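/- **Setting.** Fix a size $r$, poles numbered $j=1,\dots,k$ and integers $n_j\ge 0$. *Birkhoff data* consist of distinct points $a_j\in\mathbb C$; traceless diagonal matrices $T_{j,1},\dots,T_{j,n_j}$ and $L_j$; matrices $C_j\in SL_r(\mathbb C)$; and Stokes matrices $S_{j,1},\dots,S_{j,2n_j}$. They are generic: if $n_j\ge1$ the diagonal entries $\Lambda_1,\dots,\Lambda_r$ of $T_{j,n_j}$ are distinct, and if $n_j=0$ no two diagonal entries of $L_j$ differ by an integer. The $(a_j,T_{j,\ell})$ are the isomonodromic times; the $(L_j,C_j,S_{j,\nu})$ are the generalized monodromy data. Put $$T_j(z)=\sum_{\ell=1}^{n_j}T_{j,\ell}(z-a_j)^{-\ell},\qquad \widehat T_j(z)=T_j(z)+L_j\ln(z-a_j),\qquad Q_j=S_{j,2n_j}\cdots S_{j,2}S_{j,1}$$ (so $Q_j=\mathbf 1$ if $n_j=0$). **Contour and jumps.** Around each $a_j$ take circles centred at $a_j$: the connection circle (the closed connection discs being disjoint), inside it the formal monodromy circle and, if $n_j\ge1$, inside that the toral circle. On all of them mark the point with $\arg(z-a_j)=\theta_j$. All circles are run counterclockwise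 from the marked point; every other arc is oriented towards the pole; the $+$ side of an arc is its left. The contour $\Sigma\gamma$ and the jump matrix $M$ are as follows. * Stems: disjoint (except at their origin) simple regular $C^1$ arcs from a common point $z_0$ outside all connection discs to the marked points of the connection circles, outside the discs; on the stem to $a_j$, $M=C_j^{-1}Q_je^{2\pi iL_j}C_j$. Each continues along the ray $\arg(z-a_j)=\theta_j$ to the formal monodromy circle, with $M=Q_je^{2\pi iL_j}$. * Connection circle: $M=C_j^{-1}$. Formal monodromy circle: $M=(z-a_j)^{-L_j}$, with $\arg(z-a_j)\in(\theta_j,\theta_j+2\pi)$. * If $n_j\ge1$: on the ray $\arg(z-a_j)=\theta_j$ between the formal monodromy circle and the toral circle, $M=(z-a_j)^{L_j}Q_j(z-a_j)^{-L_j}$. Toral circle: $M=e^{-T_j(z)}$. Inside the toral circle, $2n_j$ Stokes lines from its marked point to $a_j$, given as $C^1$ graphs $\arg(z-a_j)=\alpha_\nu(|z-a_j|)$, $\nu=1,\dots,2n_j$, counterclockwise ordered, disjoint except at the ends, with $\alpha_\nu=\theta_j$ on the toral circle and with tangents at $a_j$ along directions $\varphi_\nu=\varphi_1+(\nu-1)\pi/n_j$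 on which the numbers $\Re(\Lambda_pe^{-in_j\varphi_\nu})$ are distinct; on the line $\nu$, $M=e^{\widehat T_j}S_{j,\nu}e^{-\widehat T_j}$, with $\arg(z-a_j)=\alpha_\nu$. Here $S_{j,\nu}$ has unit diagonal, and for $p\ne q$ its entry $(p,q)$ vanishes unless $\Re\big((\Lambda_p-\Lambda_q)e^{-in_j\varphi_\nu}\big)<0$. Let $\Gamma:\mathbb C\setminus\Sigma\gamma\to SL_r(\mathbb C)$ be a bounded holomorphic solution of this Riemann–Hilbert problem: it has non-tangential boundary values in the interior of every arc, $\Gamma_+=\Gamma_-M$, and $\Gamma(\infty)=\mathbf 1$. **Differentials.** For a derivative $\partial=\frac{d}{ds}\big|_{s_0}$ with respect to a parameter $s$ of the Birkhoff data, taken at fixed $z$ on the contour of the data at $s_0$ (a prime is $d/dz$), the modified Malgrange differential is $$\Omega(\partial)=-\int_{\Sigma\gamma}\mathrm{Tr}\big(\Gamma_-^{-1}\Gamma_-'\,\partial M\,M^{-1}\big)\frac{dx}{2\pi i}-\frac12\int_{\Sigma\gamma}\mathrm{Tr}\big(M'M^{-1}\,\partial M\,M^{-1}\big)\frac{dx}{2\pi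 i}.$$ Near $a_j$ let $A=\Psi'\Psi^{-1}$ with $\Psi=\Gamma e^{T_j}(z-a_j)^{L_j}$. A formal solution at $a_j$ is $\widehat Y_je^{\widehat T_j}$, where $\widehat Y_j$ is a formal power series in $z-a_j$ with invertible constant term and $\widehat Y_j'+\widehat Y_j\widehat T_j'=A\widehat Y_j$ ($A$ being expanded at $a_j$). The Jimbo–Miwa–Ueno differential is here $$\omega_{JMU}(\partial)=\sum_{j=1}^k\mathop{\mathrm{res}}_{z=a_j}\mathrm{Tr}\big(\widehat Y_j^{-1}\widehat Y_j'\,\partial\widehat T_j\big),$$ where the formal residue is the coefficient of $(z-a_j)^{-1}$ in a formal Laurent series. **Proposition.** Suppose that the Birkhoff data depend on $s$ near $s_0$ only through the isomonodromic times, which depend holomorphically on $s$, while all $L_j,C_j,S_{j,\nu}$ are frozen; and let $\Gamma$ solve the Riemann–Hilbert problem at $s_0$. Then: 1. $\Omega(\partial)$ is well defined: the boundary values $\Gamma_-$, $\Gamma_-'$ exist in the interior of the arcs wherever $\partial M\neq0$, and the integrals converge. 2. At each $a_j$ the matrix $\Gamma$ has an asymptotic expansion $\Gamma\sim\widehat Y_j$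 in powers of $z-a_j$, the same in all sectors, and $\widehat Y_je^{\widehat T_j}$ is a formal solution at $a_j$. 3. For every choice of formal solutions $\widehat Y_je^{\widehat T_j}$ at the poles, $$\Omega(\partial)=\omega_{JMU}(\partial)=\sum_{j=1}^k\mathop{\mathrm{res}}_{z=a_j}\mathrm{Tr}\big(\widehat Y_j^{-1}\widehat Y_j'\,\partial\widehat T_j\big).$$ -/

import Mathlib

open Complex Filter Topology Set

noncomputable section

/-- Square complex matrices of size `r`. -/
abbrev Mat (r : ℕ) := Matrix (Fin r) (Fin r) ℂ

/-- Entrywise complex derivative of a matrix-valued function of one complex variable. -/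
def matDeriv {r : ℕ} (F : ℂ → Mat r) (z : ℂ) : Mat r :=
  Matrix.of fun p q => deriv (fun w => F w p q) z

/-! ### Riemann--Hilbert problems on a finite system of oriented arcs

A system of arcs is `path : ι → ℝ → ℂ`, the arc `i` being traced by `path i t`, `t ∈ [0,1]`.
The jump matrix is given near every point of every arc: `J i t` is the analytic function of `z`
(defined near `z = path i t`) which is the jump matrix of the arc `i` close to that point; its
value on the arc is `J i t (path i t)`. -/

/-- The union `Σγ` of all the arcs. -/
def contourSupport {ι : Type} (path : ι → ℝ → ℂ) : Set ℂ :=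
  ⋃ i, path i '' Icc 0 1

/-- Non-tangential approach cone at `γ t`, on the left of the oriented arc `γ`. -/
def leftCone (γ : ℝ → ℂ) (t κ : ℝ) : Set ℂ :=
  {z | κ * ‖(z - γ t) / deriv γ t‖ < ((z - γ t) / deriv γ t).im}

/-- Non-tangential approach cone at `γ t`, on the right of the oriented arc `γ`. -/
def rightCone (γ : ℝ → ℂ) (t κ : ℝ) : Set ℂ :=
  {z | κ * ‖(z - γ t) / deriv γ t‖ < -((z - γ t) / deriv γ t).im}

/-- `l` is the non-tangential boundary value of `F` at `γ t` from the left (the `+` side). -/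
def HasPlusValue {r : ℕ} (F : ℂ → Mat r) (γ : ℝ → ℂ) (t : ℝ) (l : Mat r) : Prop :=
  ∀ κ ∈ Ioo (0 : ℝ) 1, Tendsto F (𝓝[leftCone γ t κ] (γ t)) (𝓝 l)

/-- `l` is the non-tangential boundary value of `F` at `γ t` from the right (the `-` side). -/
def HasMinusValue {r : ℕ} (F : ℂ → Mat r) (γ : ℝ → ℂ) (t : ℝ) (l : Mat r) : Prop :=
  ∀ κ ∈ Ioo (0 : ℝ) 1, Tendsto F (𝓝[rightCone γ t κ] (γ t)) (𝓝 l)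

/-- The boundary value `F_-` at `γ t` (meaningful when it exists, see `HasMinusValue`). -/
def minusValue {r : ℕ} (F : ℂ → Mat r) (γ : ℝ → ℂ) (t : ℝ) : Mat r :=
  limUnder (𝓝[rightCone γ t (1 / 2)] (γ t)) F

/-- `Γ : ℂ ∖ Σγ → SL_r(ℂ)` solves the Riemann--Hilbert problem: it is holomorphic and bounded off
the contour, `Γ_+ = Γ_- M` on every arc, and `Γ(∞) = 1`. -/
structure IsRHSolution {r : ℕ} {ι : Type} (path : ι → ℝ → ℂ) (J : ι → ℝ → ℂ → Mat r)
    (Γ : ℂ → Mat r) : Prop where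
  holomorphic : ∀ p q, DifferentiableOn ℂ (fun z => Γ z p q) (contourSupport path)ᶜ
  det_eq_one : ∀ z ∈ (contourSupport path)ᶜ, (Γ z).det = 1
  bounded : ∃ B : ℝ, ∀ z ∈ (contourSupport path)ᶜ, ∀ p q, ‖Γ z p q‖ ≤ B
  jump : ∀ i, ∀ t ∈ Ioo (0 : ℝ) 1, ∃ Gp Gm : Mat r,
    HasPlusValue Γ (path i) t Gp ∧ HasMinusValue Γ (path i) t Gm ∧ Gp = Gm * J i t (path i t)
  normalized : Tendsto Γ (cocompact ℂ) (𝓝 1)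

/-! ### The Malgrange differential and its modification

`J s` is a family of jump matrices depending on a complex parameter `s`, and `∂ = d/ds` at
`s = s₀`, taken at a fixed point of the arcs. -/

section Malgrange

variable {r : ℕ} {ι : Type} (path : ι → ℝ → ℂ) (J : ℂ → ι → ℝ → ℂ → Mat r) (s₀ : ℂ)

/-- The derivative `∂M` of the jump matrix at the point `path i t`. -/
def jumpVariation (i : ι) (t : ℝ) : Mat r :=
  matDeriv (fun s => J s i t (path i t)) s₀

/-- The integrand `Tr (Γ_-⁻¹ Γ_-' ∂M M⁻¹) dx`, pulled back to the parameter `t` of the arc. -/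
def malgrangeIntegrand (Γ : ℂ → Mat r) (i : ι) (t : ℝ) : ℂ :=
  ((minusValue Γ (path i) t)⁻¹ * minusValue (matDeriv Γ) (path i) t *
    (jumpVariation path J s₀ i t * (J s₀ i t (path i t))⁻¹)).trace * deriv (path i) t

/-- The integrand `Tr (M' M⁻¹ ∂M M⁻¹) dx`, pulled back to the parameter `t` of the arc. -/
def thetaIntegrand (i : ι) (t : ℝ) : ℂ :=
  (matDeriv (J s₀ i t) (path i t) * (J s₀ i t (path i t))⁻¹ *
    (jumpVariation path J s₀ i t * (J s₀ i t (path i t))⁻¹)).trace * deriv (path i) t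

/-- Malgrange's form `ω_M(∂) = - ∫ Tr (Γ_-⁻¹ Γ_-' ∂M M⁻¹) dx / 2πi`. -/
def malgrangeForm [Fintype ι] (Γ : ℂ → Mat r) : ℂ :=
  -∑ i, (∫ t in (0 : ℝ)..1, malgrangeIntegrand path J s₀ Γ i t) / (2 * Real.pi * I)

/-- The correction `ϑ(∂) = - 1/2 ∫ Tr (M' M⁻¹ ∂M M⁻¹) dx / 2πi`. -/
def thetaForm [Fintype ι] : ℂ :=
  -(1 / 2) * ∑ i, (∫ t in (0 : ℝ)..1, thetaIntegrand path J s₀ i t) / (2 * Real.pi * I)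

/-- The modified Malgrange differential `Ω = ω_M + ϑ`, evaluated on `∂`. -/
def modifiedMalgrangeForm [Fintype ι] (Γ : ℂ → Mat r) : ℂ :=
  malgrangeForm path J s₀ Γ + thetaForm path J s₀

/-- All that enters the definition of `Ω(∂)` exists: the boundary values of `Γ` and of `Γ'`
wherever `∂M ≠ 0`, and the integrals. -/
def MalgrangeConverges (Γ : ℂ → Mat r) : Prop :=
  (∀ i, ∀ t ∈ Ioo (0 : ℝ) 1, jumpVariation path J s₀ i t ≠ 0 →
    HasMinusValue Γ (path i) t (minusValue Γ (path i) t) ∧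
    HasMinusValue (matDeriv Γ) (path i) t (minusValue (matDeriv Γ) (path i) t)) ∧
  ∀ i, IntervalIntegrable (malgrangeIntegrand path J s₀ Γ i) MeasureTheory.volume 0 1 ∧
    IntervalIntegrable (thetaIntegrand path J s₀ i) MeasureTheory.volume 0 1

end Malgrange

/-! ### Birkhoff data -/

/-- Birkhoff data with `k` poles, in size `r`; the pole `j` has order `n j + 1`. The isomonodromic
times are `a` and `T`; the generalized monodromy data are `L`, `C` and `S`. -/
structure BirkhoffData (k r : ℕ) (n : Fin k → ℕ) where
  /-- Position of the poles. -/
  a : Fin k → ℂ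
  /-- Toral data: `T j l` is the diagonal of the coefficient of `(z - a j)^(-(l+1))`. -/
  T : (j : Fin k) → Fin (n j) → Fin r → ℂ
  /-- Exponents of formal monodromy (diagonal matrices). -/
  L : Fin k → Fin r → ℂ
  /-- Connection matrices. -/
  C : Fin k → Mat r
  /-- Stokes matrices: `S j ν` is the Stokes matrix number `ν + 1` at the pole `j`. -/
  S : (j : Fin k) → Fin (2 * n j) → Mat r
  a_injective : Function.Injective a
  T_traceless : ∀ j l, ∑ p, T j l p = 0
  L_traceless : ∀ j, ∑ p, L j p = 0
  C_det : ∀ j, (C j).det = 1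
  /-- Genericity at a higher pole: the eigenvalues of the leading coefficient are distinct. -/
  leading_injective : ∀ j (l : Fin (n j)), (l : ℕ) + 1 = n j → Function.Injective (T j l)
  /-- Genericity at a simple pole: no two exponents differ by an integer. -/
  nonresonant : ∀ j, n j = 0 → ∀ p q, p ≠ q → ∀ m : ℤ, L j p - L j q ≠ m

/-- The branch of `log w` with imaginary part in `(η - π, η + π]`. -/
def logBranch (η : ℝ) (w : ℂ) : ℂ := Complex.log (w * exp (-(η * I))) + η * I

namespace BirkhoffData

variable {k r : ℕ} {n : Fin k → ℕ} (D : BirkhoffData k r n)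

/-- `T_j(z) = ∑_l T_{j,l} (z - a_j)^{-l}`, as the vector of its diagonal entries. -/
def toral (j : Fin k) (z : ℂ) (p : Fin r) : ℂ :=
  ∑ l : Fin (n j), D.T j l p / (z - D.a j) ^ ((l : ℕ) + 1)

/-- The matrix `e^{T_j(z)}`. -/
def expT (j : Fin k) (z : ℂ) : Mat r := Matrix.diagonal fun p => exp (D.toral j z p)

/-- The matrix `(z - a_j)^{L_j}`, with the branch of the logarithm given by `η`. -/
def powL (j : Fin k) (η : ℝ) (z : ℂ) : Mat r :=
  Matrix.diagonal fun p => exp (D.L j p * logBranch η (z - D.a j))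

/-- The matrix `e^{T̂_j(z)} = e^{T_j(z)} (z - a_j)^{L_j}`. -/
def expThat (j : Fin k) (η : ℝ) (z : ℂ) : Mat r := D.expT j z * D.powL j η z

/-- The product `S_{2n} ⋯ S_2 S_1` of the Stokes matrices at the pole `j` (it is `1` if `n j = 0`). -/
def stokesProduct (j : Fin k) : Mat r := (List.ofFn (D.S j)).reverse.prod

/-- The monodromy `S_{2n} ⋯ S_1 e^{2πi L}` at the pole `j`, in the local basis. -/
def localMonodromy (j : Fin k) : Mat r :=
  D.stokesProduct j * Matrix.diagonal fun p => exp (2 * Real.pi * I * D.L j p)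

end BirkhoffData

/-! ### The contours -/

/-- The choices that determine the contours around the poles of given Birkhoff data. All the
circles around `a j` are centred at `a j`; on them the ray `arg (z - a j) = θ j` is marked. -/
structure ContourChoice {k r : ℕ} {n : Fin k → ℕ} (D : BirkhoffData k r n) where
  /-- The common initial point of the stems. -/
  z₀ : ℂ
  /-- Radius of the connection circles. -/
  R : Fin k → ℝ
  /-- Radius of the formal monodromy circles. -/
  ρ : Fin k → ℝ
  /-- Radius of the toral circles (they are used at the higher poles only). -/
  τ : Fin k → ℝ
  /-- Argument of the marked points on the circles. -/
  θ : Fin k → ℝ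
  /-- Argument of the first anti-Stokes direction. -/
  φ : Fin k → ℝ
  /-- The Stokes line `ν` at the pole `j` is `x ↦ a j + x e^{i α j ν x}`, for `0 ≤ x ≤ τ j`. -/
  α : (j : Fin k) → Fin (2 * n j) → ℝ → ℝ
  /-- The stem `j`, from `z₀` to the marked point of the connection circle of `a j`. -/
  stem : Fin k → ℝ → ℂ
  τ_pos : ∀ j, 0 < τ j
  τ_lt_ρ : ∀ j, τ j < ρ j
  ρ_lt_R : ∀ j, ρ j < R j
  discs_disjoint : ∀ i j, i ≠ j → R i + R j < ‖D.a i - D.a j‖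
  z₀_outside : ∀ j, R j < ‖z₀ - D.a j‖
  stem_start : ∀ j, stem j 0 = z₀
  stem_end : ∀ j, stem j 1 = D.a j + R j * exp (θ j * I)
  stem_smooth : ∀ j, ContDiffOn ℝ 1 (stem j) (Icc 0 1)
  stem_regular : ∀ j, ∀ t ∈ Ioo (0 : ℝ) 1, deriv (stem j) t ≠ 0
  stem_injOn : ∀ j, InjOn (stem j) (Icc 0 1)
  stem_outside : ∀ i j, ∀ t ∈ Ioo (0 : ℝ) 1, R i < ‖stem j t - D.a i‖
  stems_disjoint : ∀ i j, i ≠ j → ∀ t ∈ Ioc (0 : ℝ) 1, ∀ u ∈ Ioc (0 : ℝ) 1, stem i t ≠ stem j u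
  /-- The Stokes lines are smooth, they leave the pole along directions separated by `π / n`, all
  of them end at the marked point of the toral circle, and they are disjoint and in
  counterclockwise order. -/
  α_smooth : ∀ j ν, ContDiffOn ℝ 1 (α j ν) (Icc 0 (τ j))
  α_pole : ∀ j ν, α j ν 0 = φ j + ν * Real.pi / n j
  α_end : ∀ j ν, α j ν (τ j) = θ j
  α_lt : ∀ j, ∀ x ∈ Ico 0 (τ j), ∀ ν μ, ν < μ → α j ν x < α j μ x
  α_lt_add : ∀ j, ∀ x ∈ Ico 0 (τ j), ∀ ν μ, α j μ x < α j ν x + 2 * Real.pi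
  /-- On each anti-Stokes direction the real parts `Re (Λ_p / ζ^n)` of the leading terms of the
  toral data are strictly ordered. -/
  antiStokes : ∀ j (l : Fin (n j)), (l : ℕ) + 1 = n j → ∀ p q, p ≠ q → ∀ ν,
    ((D.T j l p - D.T j l q) * exp (-(n j * α j ν 0 * I))).re ≠ 0
  /-- The Stokes matrices are unipotent, and triangular with respect to that ordering, in such a
  way that `e^{T} S_ν e^{-T} → 1` at the pole along the direction `ν`. -/
  stokes_diag : ∀ j ν p, D.S j ν p p = 1
  stokes_triangular : ∀ j (l : Fin (n j)), (l : ℕ) + 1 = n j → ∀ ν p q, p ≠ q → D.S j ν p q ≠ 0 →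
    ((D.T j l p - D.T j l q) * exp (-(n j * α j ν 0 * I))).re < 0

/-- The arcs around one pole of order `m + 1`. -/
inductive LocalArc (m : ℕ) : Type
  | outerStem : LocalArc m
  | innerStem : LocalArc m
  | connectionCircle : LocalArc m
  | formalCircle : LocalArc m
  | neck (h : 0 < m) : LocalArc m
  | toralCircle (h : 0 < m) : LocalArc m
  | stokesLine (ν : Fin (2 * m)) : LocalArc m
  deriving Fintype

/-- The index set of all the arcs. -/
abbrev ContourArc {k : ℕ} (n : Fin k → ℕ) : Type := (j : Fin k) × LocalArc (n j)

namespace ContourChoice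

variable {k r : ℕ} {n : Fin k → ℕ} {D₀ : BirkhoffData k r n} (G : ContourChoice D₀)

/-- The parametrized arcs. The circles are run counterclockwise from the marked points; all the
other arcs are oriented towards the pole. -/
def path : ContourArc n → ℝ → ℂ
  | ⟨j, .outerStem⟩, t => G.stem j t
  | ⟨j, .innerStem⟩, t => D₀.a j + (G.R j - t * (G.R j - G.ρ j) : ℝ) * exp (G.θ j * I)
  | ⟨j, .connectionCircle⟩, t => D₀.a j + G.R j * exp ((G.θ j + 2 * Real.pi * t : ℝ) * I)
  | ⟨j, .formalCircle⟩, t => D₀.a j + G.ρ j * exp ((G.θ j + 2 * Real.pi * t : ℝ) * I)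
  | ⟨j, .neck _⟩, t => D₀.a j + (G.ρ j - t * (G.ρ j - G.τ j) : ℝ) * exp (G.θ j * I)
  | ⟨j, .toralCircle _⟩, t => D₀.a j + G.τ j * exp ((G.θ j + 2 * Real.pi * t : ℝ) * I)
  | ⟨j, .stokesLine ν⟩, t =>
      D₀.a j + (G.τ j * (1 - t) : ℝ) * exp (G.α j ν (G.τ j * (1 - t)) * I)

/-- The jump matrices on these arcs for Birkhoff data `D` (close to the data `D₀` for which the
contours were chosen). The argument of `z - a` is continuous along every arc: it runs from `θ` to
`θ + 2π` on the formal monodromy circle, it is `θ` on the neck, and it is `α` on a Stokes line. -/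
def jump (D : BirkhoffData k r n) : ContourArc n → ℝ → ℂ → Mat r
  | ⟨j, .outerStem⟩, _, _ => (D.C j)⁻¹ * D.localMonodromy j * D.C j
  | ⟨j, .innerStem⟩, _, _ => D.localMonodromy j
  | ⟨j, .connectionCircle⟩, _, _ => (D.C j)⁻¹
  | ⟨j, .formalCircle⟩, t, z => (D.powL j (G.θ j + 2 * Real.pi * t) z)⁻¹
  | ⟨j, .neck _⟩, _, z => D.powL j (G.θ j) z * D.stokesProduct j * (D.powL j (G.θ j) z)⁻¹
  | ⟨j, .toralCircle _⟩, _, z => (D.expT j z)⁻¹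
  | ⟨j, .stokesLine ν⟩, t, z =>
      D.expThat j (G.α j ν (G.τ j * (1 - t))) z * D.S j ν *
        (D.expThat j (G.α j ν (G.τ j * (1 - t))) z)⁻¹

end ContourChoice

/-! ### Deformations -/

/-- Near `s₀` the family `D` of Birkhoff data varies only through the isomonodromic times `a`, `T`,
which depend holomorphically on `s`; the monodromy data `L`, `C`, `S` are frozen. -/
structure IsIsomonodromicAt {k r : ℕ} {n : Fin k → ℕ} (D : ℂ → BirkhoffData k r n) (s₀ : ℂ) :
    Prop where
  a_differentiable : ∀ j, ∀ᶠ s in 𝓝 s₀, DifferentiableAt ℂ (fun u => (D u).a j) s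
  T_differentiable : ∀ j l p, ∀ᶠ s in 𝓝 s₀, DifferentiableAt ℂ (fun u => (D u).T j l p) s
  L_frozen : ∀ᶠ s in 𝓝 s₀, (D s).L = (D s₀).L
  C_frozen : ∀ᶠ s in 𝓝 s₀, (D s).C = (D s₀).C
  S_frozen : ∀ᶠ s in 𝓝 s₀, (D s).S = (D s₀).S

/-! ### Formal solutions and the Jimbo--Miwa--Ueno differential -/

/-- Matrices of formal power series in `ζ = z - a`. -/
abbrev FormalMat (r : ℕ) := Matrix (Fin r) (Fin r) (PowerSeries ℂ)

/-- `F` has the asymptotic expansion `Y` in powers of `z - a`, as `z → a` in `U`. -/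
def HasExpansion {r : ℕ} (F : ℂ → Mat r) (a : ℂ) (U : Set ℂ) (Y : FormalMat r) : Prop :=
  ∀ (N : ℕ) (p q : Fin r),
    (fun z => F z p q - ∑ m ∈ Finset.range N, PowerSeries.coeff m (Y p q) * (z - a) ^ m)
      =O[𝓝[U \ {a}] a] fun z => (z - a) ^ N

namespace BirkhoffData

variable {k r : ℕ} {n : Fin k → ℕ} (D : BirkhoffData k r n)

/-- The coefficient matrix `A = Ψ' Ψ⁻¹` of the connection near the pole `a j`, where
`Ψ = Γ e^{T} (z - a)^L` inside the smallest circle around `a j`. The branch of the logarithm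
is immaterial; at each `z` one that is analytic near `z` is used. -/
def connectionNear (Γ : ℂ → Mat r) (j : Fin k) (z : ℂ) : Mat r :=
  matDeriv (fun w => Γ w * D.expThat j (z - D.a j).arg w) z *
    (Γ z * D.expThat j (z - D.a j).arg z)⁻¹

/-- The diagonal entries of `ζ^{n+1} ∂_z T̂_j = L_j ζ^n - ∑_l l T_{j,l} ζ^{n-l}`. -/
def scaledThatDeriv (j : Fin k) (p : Fin r) : PowerSeries ℂ :=
  PowerSeries.C (D.L j p) * PowerSeries.X ^ n j -
    ∑ l : Fin (n j), PowerSeries.C (((l : ℕ) + 1) * D.T j l p) *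
      PowerSeries.X ^ (n j - ((l : ℕ) + 1))

/-- `Y e^{T̂_j}`, with `Y` a formal power series in `ζ = z - a j` with invertible leading
coefficient, is a formal solution at `a j` of `dΨ/dz = A Ψ`. Here `B` is the expansion of
`ζ^{n+1} A(z)`, and the equation is `ζ^{n+1} (Y' + Y T̂') = B Y`. -/
def IsFormalSolution (A : ℂ → Mat r) (U : Set ℂ) (j : Fin k) (Y : FormalMat r) : Prop :=
  IsUnit (Y.map PowerSeries.constantCoeff).det ∧
  ∃ B : FormalMat r,
    HasExpansion (fun z => (z - D.a j) ^ (n j + 1) • A z) (D.a j) U B ∧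
    (PowerSeries.X ^ (n j + 1) : PowerSeries ℂ) • Y.map (PowerSeries.derivative ℂ) +
      Y * Matrix.diagonal (D.scaledThatDeriv j) = B * Y

end BirkhoffData

/-- The diagonal entries of `∂T̂_j`, where `T̂_j(z) = ∑_l T_{j,l} (z-a_j)^{-l} + L_j log (z-a_j)`
and `∂ = d/ds` at `s₀` for fixed `z` and frozen `L`, as Laurent polynomials in `ζ = z - a_j`:
`∑_l (∂T_{j,l} ζ^{-l} + l T_{j,l} ∂a_j ζ^{-l-1}) - L_j ∂a_j ζ^{-1}`. -/
def thatVariation {k r : ℕ} {n : Fin k → ℕ} (D : ℂ → BirkhoffData k r n) (s₀ : ℂ) (j : Fin k)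
    (p : Fin r) : LaurentSeries ℂ :=
  ∑ l : Fin (n j),
    (HahnSeries.single (-((l : ℤ) + 1)) (deriv (fun s => (D s).T j l p) s₀) +
      HahnSeries.single (-((l : ℤ) + 2))
        (((l : ℕ) + 1) * (D s₀).T j l p * deriv (fun s => (D s).a j) s₀)) -
  HahnSeries.single (-1) ((D s₀).L j p * deriv (fun s => (D s).a j) s₀)

/-- The formal residue `res Tr (Y⁻¹ Y' ∂T̂_j)` at the pole `a j`. -/
def jmuResidue {k r : ℕ} {n : Fin k → ℕ} (D : ℂ → BirkhoffData k r n) (s₀ : ℂ) (j : Fin k)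
    (Y : FormalMat r) : ℂ :=
  HahnSeries.coeff
    ((Y⁻¹ * Y.map (PowerSeries.derivative ℂ)).map (HahnSeries.ofPowerSeries ℤ ℂ) *
      Matrix.diagonal (thatVariation D s₀ j)).trace (-1)

/-- The Jimbo--Miwa--Ueno differential on `∂ = d/ds`, from formal solutions `Y j` at the poles:
the sum over all poles of the formal residues. -/
def jmuForm {k r : ℕ} {n : Fin k → ℕ} (D : ℂ → BirkhoffData k r n) (s₀ : ℂ)
    (Y : Fin k → FormalMat r) : ℂ :=
  ∑ j, jmuResidue D s₀ j (Y j)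

end

noncomputable section

open MeasureTheory (volume IntegrableOn)
open PowerSeries (coeff derivative constantCoeff)
open scoped Real

/-! ### Holomorphic continuation across a graph -/

/-- The point at height `s` above the point of abscissa `x` of the graph of `g`. -/
def graphPoint (g : ℝ → ℝ) (x s : ℝ) : ℂ := x + (g x + s : ℝ) * I

lemma graphPoint_re (g : ℝ → ℝ) (x s : ℝ) : (graphPoint g x s).re = x := by simp [graphPoint]

lemma graphPoint_im (g : ℝ → ℝ) (x s : ℝ) : (graphPoint g x s).im = g x + s := by
  simp [graphPoint]

lemma graphPoint_self (g : ℝ → ℝ) (w : ℂ) : graphPoint g w.re (w.im - g w.re) = w := by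
  apply Complex.ext <;> simp [graphPoint]

lemma hasDerivAt_graphPoint_right (g : ℝ → ℝ) (x s : ℝ) :
    HasDerivAt (fun σ : ℝ => graphPoint g x σ) I s := by
  unfold graphPoint
  have h : HasDerivAt (fun σ : ℝ => ((g x + σ : ℝ) : ℂ)) 1 s := by
    simpa using ((hasDerivAt_id s).const_add (g x)).ofReal_comp
  simpa using (h.mul_const I).const_add (x : ℂ)

lemma hasDerivAt_graphPoint_left {g : ℝ → ℝ} {x d : ℝ} (hg : HasDerivAt g d x) (s : ℝ) :
    HasDerivAt (fun t : ℝ => graphPoint g t s) (1 + d * I) x := by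
  unfold graphPoint
  have h : HasDerivAt (fun t : ℝ => ((g t + s : ℝ) : ℂ)) d x := by
    simpa using (hg.add_const s).ofReal_comp
  exact (hasDerivAt_id x).ofReal_comp.add (h.mul_const I)

section Graph

variable {g g' : ℝ → ℝ} {a b h B : ℝ} {v : ℂ → ℂ}

/-- Cauchy's theorem for a rectangle in the coordinates straightening a graph, on one side of the
graph. -/
lemma integral_graph_rect_of_analyticAt
    (hg : ∀ x ∈ Icc a b, HasDerivAt g (g' x) x) (hg' : ContinuousOn g' (Icc a b))
    {x x' s s' : ℝ} (hx : x ∈ Icc a b) (hx' : x' ∈ Icc a b)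
    (hv : ∀ t ∈ Icc a b, ∀ σ ∈ uIcc s s', AnalyticAt ℂ v (graphPoint g t σ)) :
    ∫ t in x..x', (v (graphPoint g t s') - v (graphPoint g t s)) * (1 + g' t * I) =
      I * ∫ σ in s..s', (v (graphPoint g x' σ) - v (graphPoint g x σ)) := by
  have hsub : uIcc x x' ⊆ Icc a b := uIcc_subset_Icc hx hx'
  have hgc : ContinuousOn g (Icc a b) := fun t ht => (hg t ht).continuousAt.continuousWithinAt
  have hΦ : ContinuousOn (fun p : ℝ × ℝ => graphPoint g p.1 p.2) (uIcc x x' ×ˢ uIcc s s') := by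
    have : ContinuousOn (fun p : ℝ × ℝ => g p.1) (uIcc x x' ×ˢ uIcc s s') :=
      (hgc.mono hsub).comp continuousOn_fst (fun p hp => hp.1)
    exact (continuous_ofReal.comp_continuousOn continuousOn_fst).add
      ((continuous_ofReal.comp_continuousOn (this.add continuousOn_snd)).mul continuousOn_const)
  have hD : ContinuousOn (fun p : ℝ × ℝ => deriv v (graphPoint g p.1 p.2))
      (uIcc x x' ×ˢ uIcc s s') := by
    intro p hp
    exact ContinuousAt.comp_continuousWithinAt (g := deriv v)
      (f := fun p : ℝ × ℝ => graphPoint g p.1 p.2)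
      (hv p.1 (hsub hp.1) p.2 hp.2).deriv.continuousAt (hΦ p hp)
  have hγ : ContinuousOn (fun p : ℝ × ℝ => (1 + g' p.1 * I : ℂ)) (uIcc x x' ×ˢ uIcc s s') := by
    have : ContinuousOn (fun p : ℝ × ℝ => g' p.1) (uIcc x x' ×ˢ uIcc s s') :=
      (hg'.mono hsub).comp continuousOn_fst (fun p hp => hp.1)
    exact continuousOn_const.add ((continuous_ofReal.comp_continuousOn this).mul continuousOn_const)
  have hsec₁ : ∀ t ∈ uIcc x x', v (graphPoint g t s') - v (graphPoint g t s) =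
      ∫ σ in s..s', deriv v (graphPoint g t σ) * I := by
    intro t ht
    refine (intervalIntegral.integral_eq_sub_of_hasDerivAt
      (f := fun σ : ℝ => v (graphPoint g t σ)) (fun σ hσ => ?_) ?_).symm
    · exact (hv t (hsub ht) σ hσ).differentiableAt.hasDerivAt.comp σ
        (hasDerivAt_graphPoint_right g t σ)
    · refine ContinuousOn.intervalIntegrable ?_
      have : ContinuousOn (fun σ : ℝ => deriv v (graphPoint g t σ)) (uIcc s s') :=
        hD.comp (f := fun σ : ℝ => (t, σ)) (by fun_prop) (fun σ hσ => ⟨ht, hσ⟩)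
      fun_prop
  have hsec₂ : ∀ σ ∈ uIcc s s', v (graphPoint g x' σ) - v (graphPoint g x σ) =
      ∫ t in x..x', deriv v (graphPoint g t σ) * (1 + g' t * I) := by
    intro σ hσ
    refine (intervalIntegral.integral_eq_sub_of_hasDerivAt
      (f := fun t : ℝ => v (graphPoint g t σ)) (fun t ht => ?_) ?_).symm
    · exact (hv t (hsub ht) σ hσ).differentiableAt.hasDerivAt.comp t
        (hasDerivAt_graphPoint_left (hg t (hsub ht)) σ)
    · refine ContinuousOn.intervalIntegrable ?_
      exact (hD.mul hγ).comp (f := fun t : ℝ => (t, σ)) (by fun_prop) (fun t ht => ⟨ht, hσ⟩)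
  have e1 : ∫ t in x..x', (v (graphPoint g t s') - v (graphPoint g t s)) * (1 + g' t * I) =
      ∫ t in x..x', ∫ σ in s..s', deriv v (graphPoint g t σ) * (1 + g' t * I) * I := by
    refine intervalIntegral.integral_congr fun t ht => ?_
    rw [hsec₁ t ht, ← intervalIntegral.integral_mul_const]
    exact intervalIntegral.integral_congr fun σ _ => by ring
  have e2 : I * ∫ σ in s..s', (v (graphPoint g x' σ) - v (graphPoint g x σ)) =
      ∫ σ in s..s', ∫ t in x..x', deriv v (graphPoint g t σ) * (1 + g' t * I) * I := by
    rw [← intervalIntegral.integral_const_mul]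
    refine intervalIntegral.integral_congr fun σ hσ => ?_
    rw [hsec₂ σ hσ, mul_comm, ← intervalIntegral.integral_mul_const]
  rw [e1, e2]
  refine MeasureTheory.intervalIntegral_intervalIntegral_swap ?_
  have : ContinuousOn (Function.uncurry fun t σ : ℝ =>
      deriv v (graphPoint g t σ) * (1 + g' t * I) * I) (uIcc x x' ×ˢ uIcc s s') :=
    (hD.mul hγ).mul continuousOn_const
  exact (this.integrableOn_compact (isCompact_uIcc.prod isCompact_uIcc)).mono_set
    (prod_mono uIoc_subset_uIcc uIoc_subset_uIcc)

/-- A function near the graph of `g`: bounded, holomorphic off the graph, and continuous in the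
vertical direction at every point of the graph. -/
structure CrossesGraph (g : ℝ → ℝ) (a b h B : ℝ) (v : ℂ → ℂ) : Prop where
  analytic : ∀ t ∈ Icc a b, ∀ σ ∈ Icc (-h) h, σ ≠ 0 → AnalyticAt ℂ v (graphPoint g t σ)
  bound : ∀ t ∈ Icc a b, ∀ σ ∈ Icc (-h) h, σ ≠ 0 → ‖v (graphPoint g t σ)‖ ≤ B
  continuous : ∀ t ∈ Icc a b, ContinuousAt (fun σ : ℝ => v (graphPoint g t σ)) 0

lemma CrossesGraph.bound' (hv : CrossesGraph g a b h B v) (hh : 0 < h) {t σ : ℝ}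
    (ht : t ∈ Icc a b) (hσ : σ ∈ Icc (-h) h) : ‖v (graphPoint g t σ)‖ ≤ B := by
  by_cases h0 : σ = 0
  · subst h0
    have h1 : Tendsto (fun σ : ℝ => ‖v (graphPoint g t σ)‖) (𝓝[≠] 0) (𝓝 ‖v (graphPoint g t 0)‖) :=
      (hv.continuous t ht).norm.tendsto.mono_left nhdsWithin_le_nhds
    refine le_of_tendsto h1 ?_
    have : Icc (-h) h ∈ 𝓝 (0 : ℝ) := Icc_mem_nhds (by linarith) hh
    filter_upwards [nhdsWithin_le_nhds this, self_mem_nhdsWithin] with σ h1 h2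
    exact hv.bound t ht σ h1 h2
  · exact hv.bound t ht σ hσ h0

lemma CrossesGraph.continuousOn_vertical (hv : CrossesGraph g a b h B v) {t : ℝ}
    (ht : t ∈ Icc a b) : ContinuousOn (fun σ : ℝ => v (graphPoint g t σ)) (Icc (-h) h) := by
  intro σ hσ
  by_cases h0 : σ = 0
  · subst h0; exact (hv.continuous t ht).continuousWithinAt
  · exact ((hv.analytic t ht σ hσ h0).continuousAt.comp
      (hasDerivAt_graphPoint_right g t σ).continuousAt).continuousWithinAt

lemma CrossesGraph.continuousOn_horizontal (hg : ∀ x ∈ Icc a b, HasDerivAt g (g' x) x)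
    (hv : CrossesGraph g a b h B v) {σ : ℝ} (hσ : σ ∈ Icc (-h) h) (h0 : σ ≠ 0) :
    ContinuousOn (fun t : ℝ => v (graphPoint g t σ)) (Icc a b) := by
  intro t ht
  exact (ContinuousAt.comp (g := v) (f := fun t : ℝ => graphPoint g t σ)
    (hv.analytic t ht σ hσ h0).continuousAt
      (hasDerivAt_graphPoint_left (hg t ht) σ).continuousAt).continuousWithinAt

lemma uIoc_ae_mem_Icc {x x' : ℝ} (hx : x ∈ Icc a b) (hx' : x' ∈ Icc a b) {t : ℝ}
    (ht : t ∈ uIoc x x') : t ∈ Icc a b :=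
  uIcc_subset_Icc hx hx' (uIoc_subset_uIcc ht)

/-- Distances in the coordinates straightening the graph. -/
lemma abs_sub_le_of_graph (hg : ∀ x ∈ Icc a b, HasDerivAt g (g' x) x)
    {K : ℝ} (hK : ∀ t ∈ Icc a b, ‖(1 + g' t * I : ℂ)‖ ≤ K) {x x' : ℝ} (hx : x ∈ Icc a b)
    (hx' : x' ∈ Icc a b) : |g x' - g x| ≤ K * |x' - x| := by
  have h1 : ∀ t ∈ Icc a b, ‖g' t‖ ≤ K := fun t ht => by
    refine le_trans ?_ (hK t ht)
    have := Complex.abs_im_le_norm (1 + g' t * I : ℂ)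
    simpa using this
  simpa using (convex_Icc a b).norm_image_sub_le_of_norm_hasDerivWithin_le
    (fun t ht => (hg t ht).hasDerivWithinAt) h1 hx hx'

variable (hg : ∀ x ∈ Icc a b, HasDerivAt g (g' x) x) (hg' : ContinuousOn g' (Icc a b))
  (hh : 0 < h) (hv : CrossesGraph g a b h B v)

include hg hg' hh hv

/-- As the height tends to `0` the integrals along the translated graphs converge. -/
lemma CrossesGraph.tendsto_integral {x x' : ℝ} (hx : x ∈ Icc a b) (hx' : x' ∈ Icc a b) :
    Tendsto (fun σ : ℝ => ∫ t in x..x', v (graphPoint g t σ) * (1 + g' t * I)) (𝓝[≠] 0)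
      (𝓝 (∫ t in x..x', v (graphPoint g t 0) * (1 + g' t * I))) := by
  have hmem : ∀ᶠ σ : ℝ in 𝓝[≠] 0, σ ∈ Icc (-h) h ∧ σ ≠ 0 := by
    filter_upwards [nhdsWithin_le_nhds (Icc_mem_nhds (by linarith) hh : Icc (-h) h ∈ 𝓝 (0 : ℝ)),
      self_mem_nhdsWithin] with σ h1 h2 using ⟨h1, h2⟩
  have hsub : uIcc x x' ⊆ Icc a b := uIcc_subset_Icc hx hx'
  have hγ : ContinuousOn (fun t : ℝ => (1 + g' t * I : ℂ)) (Icc a b) := by fun_prop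
  refine intervalIntegral.tendsto_integral_filter_of_dominated_convergence
    (fun t => B * ‖(1 + g' t * I : ℂ)‖) ?_ ?_ ?_ ?_
  · filter_upwards [hmem] with σ hσ
    exact ((((hv.continuousOn_horizontal hg hσ.1 hσ.2).mul hγ).mono hsub).mono
      uIoc_subset_uIcc).aestronglyMeasurable measurableSet_uIoc
  · filter_upwards [hmem] with σ hσ
    refine .of_forall fun t ht => ?_
    rw [norm_mul]
    exact mul_le_mul_of_nonneg_right (hv.bound t (uIoc_ae_mem_Icc hx hx' ht) σ hσ.1 hσ.2)
      (norm_nonneg _)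
  · exact (((continuousOn_const.mul hγ.norm)).mono hsub).intervalIntegrable
  · refine .of_forall fun t ht => ?_
    exact ((hv.continuous t (uIoc_ae_mem_Icc hx hx' ht)).tendsto.mono_left
      nhdsWithin_le_nhds).mul_const _

lemma CrossesGraph.intervalIntegrable_horizontal {x x' σ : ℝ} (hx : x ∈ Icc a b)
    (hx' : x' ∈ Icc a b) (hσ : σ ∈ Icc (-h) h) :
    IntervalIntegrable (fun t => v (graphPoint g t σ) * (1 + g' t * I))
      volume x x' := by
  have hsub : uIcc x x' ⊆ Icc a b := uIcc_subset_Icc hx hx'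
  have hγ : ContinuousOn (fun t : ℝ => (1 + g' t * I : ℂ)) (Icc a b) := by fun_prop
  have hmeas : ∀ τ ∈ Icc (-h) h, τ ≠ 0 → MeasureTheory.AEStronglyMeasurable
      (fun t => v (graphPoint g t τ) * (1 + g' t * I))
      (volume.restrict (uIoc x x')) := fun τ hτ h0 =>
    ((((hv.continuousOn_horizontal hg hτ h0).mul hγ).mono hsub).mono
      uIoc_subset_uIcc).aestronglyMeasurable measurableSet_uIoc
  have hdom : IntervalIntegrable (fun t => B * ‖(1 + g' t * I : ℂ)‖) volume x x' :=
    ((continuousOn_const.mul hγ.norm).mono hsub).intervalIntegrable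
  refine hdom.mono_fun' ?_ ?_
  · by_cases h0 : σ = 0
    · subst h0
      obtain ⟨s, hs⟩ := exists_seq_tendsto (𝓝[≠] (0 : ℝ))
      have hmem : ∀ᶠ σ : ℝ in 𝓝[≠] 0, σ ∈ Icc (-h) h ∧ σ ≠ 0 := by
        filter_upwards [nhdsWithin_le_nhds
          (Icc_mem_nhds (by linarith) hh : Icc (-h) h ∈ 𝓝 (0 : ℝ)),
          self_mem_nhdsWithin] with σ h1 h2 using ⟨h1, h2⟩
      have hs' := hs.eventually hmem
      obtain ⟨M, hM⟩ := eventually_atTop.1 hs'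
      refine aestronglyMeasurable_of_tendsto_ae (u := atTop)
        (f := fun n t => v (graphPoint g t (s (n + M))) * (1 + g' t * I)) ?_ ?_
      · intro n
        exact hmeas _ (hM _ (by omega)).1 (hM _ (by omega)).2
      · refine (MeasureTheory.ae_restrict_iff' measurableSet_uIoc).2
          (.of_forall fun t ht => ?_)
        exact (((hv.continuous t (uIoc_ae_mem_Icc hx hx' ht)).tendsto.mono_left
          nhdsWithin_le_nhds).comp (hs.comp (tendsto_add_atTop_nat M))).mul_const _
    · exact hmeas σ hσ h0
  · refine (MeasureTheory.ae_restrict_iff' measurableSet_uIoc).2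
      (.of_forall fun t ht => ?_)
    beta_reduce
    rw [norm_mul]
    exact mul_le_mul_of_nonneg_right (hv.bound' hh (uIoc_ae_mem_Icc hx hx' ht) hσ) (norm_nonneg _)

/-- Cauchy's theorem for a rectangle in the coordinates straightening a graph. -/
lemma CrossesGraph.integral_rect {x x' s : ℝ} (hx : x ∈ Icc a b) (hx' : x' ∈ Icc a b)
    (hs : s ∈ Icc (-h) h) :
    (∫ t in x..x', v (graphPoint g t s) * (1 + g' t * I)) =
      (∫ t in x..x', v (graphPoint g t 0) * (1 + g' t * I)) +
      I * ((∫ σ in 0..s, v (graphPoint g x' σ)) - ∫ σ in 0..s, v (graphPoint g x σ)) := by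
  have h0 : (0 : ℝ) ∈ Icc (-h) h := ⟨by linarith, hh.le⟩
  have hint : ∀ y ∈ Icc a b, ∀ p ∈ Icc (-h) h, ∀ q ∈ Icc (-h) h,
      IntervalIntegrable (fun σ => v (graphPoint g y σ)) volume p q := fun y hy p hp q hq =>
    ((hv.continuousOn_vertical hy).mono (uIcc_subset_Icc hp hq)).intervalIntegrable
  have key : ∀ σ ∈ Icc (-h) h, (∀ τ ∈ uIcc σ s, τ ≠ 0) →
      (∫ t in x..x', v (graphPoint g t s) * (1 + g' t * I)) -
        (∫ t in x..x', v (graphPoint g t σ) * (1 + g' t * I)) =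
      I * (((∫ τ in 0..s, v (graphPoint g x' τ)) - ∫ τ in 0..σ, v (graphPoint g x' τ)) -
        ((∫ τ in 0..s, v (graphPoint g x τ)) - ∫ τ in 0..σ, v (graphPoint g x τ))) := by
    intro σ hσ hne
    rw [intervalIntegral.integral_interval_sub_left (hint _ hx' _ h0 _ hs) (hint _ hx' _ h0 _ hσ),
      intervalIntegral.integral_interval_sub_left (hint _ hx _ h0 _ hs) (hint _ hx _ h0 _ hσ),
      ← intervalIntegral.integral_sub (hint _ hx' _ hσ _ hs) (hint _ hx _ hσ _ hs),
      ← integral_graph_rect_of_analyticAt hg hg' hx hx'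
        (fun t ht τ hτ => hv.analytic t ht τ (uIcc_subset_Icc hσ hs hτ) (hne τ hτ)),
      ← intervalIntegral.integral_sub (hv.intervalIntegrable_horizontal hg hg' hh hx hx' hs)
        (hv.intervalIntegrable_horizontal hg hg' hh hx hx' hσ)]
    exact intervalIntegral.integral_congr fun t _ => by ring
  have hV : ∀ y ∈ Icc a b, Tendsto (fun σ : ℝ => ∫ τ in 0..σ, v (graphPoint g y τ)) (𝓝[≠] 0)
      (𝓝 0) := by
    intro y hy
    have hc : ContinuousOn (fun σ : ℝ => ∫ τ in 0..σ, v (graphPoint g y τ)) (Icc (-h) h) := by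
      have := intervalIntegral.continuousOn_primitive_interval' (a := 0)
        (hint y hy (-h) ⟨le_rfl, by linarith⟩ h ⟨by linarith, le_rfl⟩)
        (by rw [uIcc_of_le (by linarith)]; exact h0)
      rwa [uIcc_of_le (by linarith)] at this
    have h1 : ContinuousAt (fun σ : ℝ => ∫ τ in 0..σ, v (graphPoint g y τ)) 0 :=
      hc.continuousAt (Icc_mem_nhds (by linarith) hh)
    have h2 := h1.tendsto
    rw [intervalIntegral.integral_same] at h2
    exact h2.mono_left nhdsWithin_le_nhds
  rcases eq_or_ne s 0 with rfl | hs0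
  · simp
  obtain ⟨F, hFne, hF, hF'⟩ : ∃ F : Filter ℝ, F.NeBot ∧ F ≤ 𝓝[≠] 0 ∧
      ∀ᶠ σ in F, σ ∈ Icc (-h) h ∧ ∀ τ ∈ uIcc σ s, τ ≠ 0 := by
    rcases lt_or_gt_of_ne hs0 with hlt | hgt
    · refine ⟨𝓝[<] 0, inferInstance, nhdsWithin_mono _ fun x hx => ne_of_lt hx, ?_⟩
      filter_upwards [Ioo_mem_nhdsLT (show -h < 0 by linarith)] with σ hσ
      refine ⟨⟨hσ.1.le, hσ.2.le.trans hh.le⟩, fun τ hτ => ?_⟩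
      have := hτ.2
      rcases le_max_iff.1 this with h1 | h1 <;> linarith [hσ.2]
    · refine ⟨𝓝[>] 0, inferInstance, nhdsWithin_mono _ fun x hx => ne_of_gt hx, ?_⟩
      filter_upwards [Ioo_mem_nhdsGT hh] with σ hσ
      refine ⟨⟨by linarith [hσ.1], hσ.2.le⟩, fun τ hτ => ?_⟩
      have := hτ.1
      rcases min_le_iff.1 this with h1 | h1 <;> linarith [hσ.1]
  have l1 := ((hv.tendsto_integral hg hg' hh hx hx').mono_left hF).const_sub
    (∫ t in x..x', v (graphPoint g t s) * (1 + g' t * I))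
  have l2 := ((((hV x' hx').mono_left hF).const_sub (∫ τ in 0..s, v (graphPoint g x' τ))).sub
    (((hV x hx).mono_left hF).const_sub (∫ τ in 0..s, v (graphPoint g x τ)))).const_mul I
  have := tendsto_nhds_unique_of_eventuallyEq l1 l2 (hF'.mono fun σ hσ => key σ hσ.1 hσ.2)
  linear_combination this

/-- A primitive, in the coordinates straightening the graph. -/
def graphPrimitive (g g' : ℝ → ℝ) (a : ℝ) (v : ℂ → ℂ) (w : ℂ) : ℂ :=
  (∫ t in a..w.re, v (graphPoint g t 0) * (1 + g' t * I)) +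
    I * ∫ σ in 0..(w.im - g w.re), v (graphPoint g w.re σ)

lemma CrossesGraph.primitive_sub {x x' s s' : ℝ} (hx : x ∈ Icc a b) (hx' : x' ∈ Icc a b)
    (hs : s ∈ Icc (-h) h)
    (hs' : s' ∈ Icc (-h) h) :
    graphPrimitive g g' a v (graphPoint g x' s') - graphPrimitive g g' a v (graphPoint g x s) =
      (∫ t in x..x', v (graphPoint g t s) * (1 + g' t * I)) +
        I * ∫ σ in s..s', v (graphPoint g x' σ) := by
  have h0 : (0 : ℝ) ∈ Icc (-h) h := ⟨by linarith, hh.le⟩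
  have ha : a ∈ Icc a b := ⟨le_rfl, hx.1.trans hx.2⟩
  have hint : ∀ p ∈ Icc (-h) h, ∀ q ∈ Icc (-h) h,
      IntervalIntegrable (fun σ => v (graphPoint g x' σ)) volume p q := fun p hp q hq =>
    ((hv.continuousOn_vertical hx').mono (uIcc_subset_Icc hp hq)).intervalIntegrable
  rw [hv.integral_rect hg hg' hh hx hx' hs]
  simp only [graphPrimitive, graphPoint_re, graphPoint_im, add_sub_cancel_left]
  rw [← intervalIntegral.integral_add_adjacent_intervals (hint 0 h0 s hs) (hint s hs s' hs'),
    ← intervalIntegral.integral_add_adjacent_intervals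
      (hv.intervalIntegrable_horizontal hg hg' hh ha hx h0)
      (hv.intervalIntegrable_horizontal hg hg' hh hx hx' h0)]
  ring

lemma CrossesGraph.norm_primitive_sub_le {K : ℝ} (hK : ∀ t ∈ Icc a b, ‖(1 + g' t * I : ℂ)‖ ≤ K)
    {x x' s s' ε : ℝ} (hx : x ∈ Icc a b) (hx' : x' ∈ Icc a b) (hs : s ∈ Icc (-h) h)
    (hs' : s' ∈ Icc (-h) h) {c : ℂ} (h₁ : ∀ t ∈ uIcc x x', ‖v (graphPoint g t s) - c‖ ≤ ε)
    (h₂ : ∀ σ ∈ uIcc s s', ‖v (graphPoint g x' σ) - c‖ ≤ ε) :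
    ‖graphPrimitive g g' a v (graphPoint g x' s') - graphPrimitive g g' a v (graphPoint g x s) -
      c * (graphPoint g x' s' - graphPoint g x s)‖ ≤ ε * (K * |x' - x| + |s' - s|) := by
  have hsub : uIcc x x' ⊆ Icc a b := uIcc_subset_Icc hx hx'
  have hγ : ContinuousOn (fun t : ℝ => (1 + g' t * I : ℂ)) (Icc a b) := by fun_prop
  have hγi : IntervalIntegrable (fun t : ℝ => (1 + g' t * I : ℂ)) volume x x' :=
    (hγ.mono hsub).intervalIntegrable
  have e : graphPoint g x' s' - graphPoint g x s =
      (∫ t in x..x', (1 + g' t * I : ℂ)) + I * ∫ σ in s..s', (1 : ℂ) := by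
    rw [intervalIntegral.integral_eq_sub_of_hasDerivAt (f := fun t => graphPoint g t s)
      (fun t ht => hasDerivAt_graphPoint_left (hg t (hsub ht)) s) hγi]
    rw [intervalIntegral.integral_const]
    simp [graphPoint]
    ring
  have hint : IntervalIntegrable (fun σ => v (graphPoint g x' σ)) volume s s' :=
    ((hv.continuousOn_vertical hx').mono (uIcc_subset_Icc hs hs')).intervalIntegrable
  rw [hv.primitive_sub hg hg' hh hx hx' hs hs', e]
  have e2 : (∫ t in x..x', v (graphPoint g t s) * (1 + g' t * I)) +
        I * (∫ σ in s..s', v (graphPoint g x' σ)) -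
        c * ((∫ t in x..x', (1 + g' t * I : ℂ)) + I * ∫ σ in s..s', (1 : ℂ)) =
      (∫ t in x..x', (v (graphPoint g t s) - c) * (1 + g' t * I)) +
        I * ∫ σ in s..s', (v (graphPoint g x' σ) - c) := by
    rw [intervalIntegral.integral_sub hint intervalIntegrable_const]
    have : ∀ t : ℝ, (v (graphPoint g t s) - c) * (1 + g' t * I) =
        v (graphPoint g t s) * (1 + g' t * I) - c * (1 + g' t * I) := fun t => by ring
    simp only [this]
    rw [intervalIntegral.integral_sub (hv.intervalIntegrable_horizontal hg hg' hh hx hx' hs)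
      (hγi.const_mul c), intervalIntegral.integral_const_mul]
    simp only [intervalIntegral.integral_const]
    simp
    ring
  rw [e2]
  refine (norm_add_le _ _).trans ?_
  have b1 : ‖∫ t in x..x', (v (graphPoint g t s) - c) * (1 + g' t * I)‖ ≤ ε * K * |x' - x| := by
    refine intervalIntegral.norm_integral_le_of_norm_le_const fun t ht => ?_
    rw [norm_mul]
    have ht' := uIoc_subset_uIcc ht
    exact mul_le_mul (h₁ t ht') (hK t (hsub ht')) (norm_nonneg _)
      ((norm_nonneg _).trans (h₁ t ht'))
  have b2 : ‖∫ σ in s..s', (v (graphPoint g x' σ) - c)‖ ≤ ε * |s' - s| :=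
    intervalIntegral.norm_integral_le_of_norm_le_const fun σ hσ => h₂ σ (uIoc_subset_uIcc hσ)
  rw [norm_mul, norm_I, one_mul]
  linarith [b1, b2]

lemma CrossesGraph.lipschitz_primitive :
    ∃ C, ∀ w w' : ℂ, w.re ∈ Icc a b → w'.re ∈ Icc a b → w.im - g w.re ∈ Icc (-h) h →
      w'.im - g w'.re ∈ Icc (-h) h →
      ‖graphPrimitive g g' a v w' - graphPrimitive g g' a v w‖ ≤ C * ‖w' - w‖ := by
  have hγ : ContinuousOn (fun t : ℝ => (1 + g' t * I : ℂ)) (Icc a b) := by fun_prop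
  obtain ⟨K, hK⟩ := isCompact_Icc.exists_bound_of_continuousOn hγ
  refine ⟨B * (K + (1 + K)), fun w w' hw hw' hs hs' => ?_⟩
  have hB : 0 ≤ B := (norm_nonneg _).trans (hv.bound' hh hw hs)
  have hK0 : 0 ≤ K := (norm_nonneg _).trans (hK _ hw)
  have := hv.norm_primitive_sub_le hg hg' hh hK hw hw' hs hs' (c := 0) (ε := B)
    (fun t ht => by simpa using hv.bound' hh (uIcc_subset_Icc hw hw' ht) hs)
    (fun σ hσ => by simpa using hv.bound' hh hw' (uIcc_subset_Icc hs hs' hσ))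
  simp only [graphPoint_self, zero_mul, sub_zero] at this
  refine this.trans ?_
  have h1 : |w'.re - w.re| ≤ ‖w' - w‖ := by simpa using abs_re_le_norm (w' - w)
  have h2 : |w'.im - w.im| ≤ ‖w' - w‖ := by simpa using abs_im_le_norm (w' - w)
  have h3 := abs_sub_le_of_graph hg hK hw hw'
  have h4 : |w'.im - g w'.re - (w.im - g w.re)| ≤ |w'.im - w.im| + |g w'.re - g w.re| := by
    rw [sub_sub_sub_comm]; exact abs_sub _ _
  rw [mul_assoc]
  refine mul_le_mul_of_nonneg_left ?_ hB
  nlinarith [mul_le_mul_of_nonneg_left h1 hK0]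

lemma CrossesGraph.hasDerivAt_primitive {w : ℂ} (hw : w.re ∈ Ioo a b)
    (hs : w.im - g w.re ∈ Ioo (-h) h) (hc : ContinuousAt v w) :
    HasDerivAt (graphPrimitive g g' a v) (v w) w := by
  have hγ : ContinuousOn (fun t : ℝ => (1 + g' t * I : ℂ)) (Icc a b) := by fun_prop
  obtain ⟨K, hK⟩ := isCompact_Icc.exists_bound_of_continuousOn hγ
  have hK0 : 0 ≤ K := (norm_nonneg _).trans (hK _ (Ioo_subset_Icc_self hw))
  set M : ℝ := K + (1 + K)
  have hM0 : 0 < M := by positivity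
  rw [hasDerivAt_iff_isLittleO, Asymptotics.isLittleO_iff]
  intro ε hε
  have hgc : ContinuousAt g w.re := (hg _ (Ioo_subset_Icc_self hw)).continuousAt
  have ev1 : ∀ᶠ w' : ℂ in 𝓝 w, w'.re ∈ Ioo a b :=
    continuous_re.continuousAt.eventually_mem (Ioo_mem_nhds hw.1 hw.2)
  have ev2 : ∀ᶠ w' : ℂ in 𝓝 w, w'.im - g w'.re ∈ Ioo (-h) h := by
    have : ContinuousAt (fun w' : ℂ => w'.im - g w'.re) w :=
      continuous_im.continuousAt.sub (ContinuousAt.comp (g := g) hgc continuous_re.continuousAt)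
    exact this.eventually_mem (Ioo_mem_nhds hs.1 hs.2)
  obtain ⟨δ, hδ, hδc⟩ := Metric.continuousAt_iff.1 hc (ε / M) (by positivity)
  have ev3 : ∀ᶠ w' : ℂ in 𝓝 w, ‖w' - w‖ < δ / (2 * M) := by
    have : Metric.ball w (δ / (2 * M)) ∈ 𝓝 w := Metric.ball_mem_nhds _ (by positivity)
    filter_upwards [this] with w' hw'
    simpa [dist_eq_norm] using hw'
  filter_upwards [ev1, ev2, ev3] with w' hw' hs' hd
  have h1 : |w'.re - w.re| ≤ ‖w' - w‖ := by simpa using abs_re_le_norm (w' - w)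
  have h2 : |w'.im - w.im| ≤ ‖w' - w‖ := by simpa using abs_im_le_norm (w' - w)
  have hwI := Ioo_subset_Icc_self hw
  have hwI' := Ioo_subset_Icc_self hw'
  have h3 := abs_sub_le_of_graph hg hK hwI hwI'
  have h4 : |w'.im - g w'.re - (w.im - g w.re)| ≤ |w'.im - w.im| + |g w'.re - g w.re| := by
    rw [sub_sub_sub_comm]; exact abs_sub _ _
  have h5 : K * |w'.re - w.re| + |w'.im - g w'.re - (w.im - g w.re)| ≤ M * ‖w' - w‖ := by
    nlinarith [mul_le_mul_of_nonneg_left h1 hK0]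
  have hgp : ∀ t s t' s' : ℝ, ‖graphPoint g t s - graphPoint g t' s'‖ ≤
      |t - t'| + (|g t - g t'| + |s - s'|) := by
    intro t s t' s'
    refine (Complex.norm_le_abs_re_add_abs_im _).trans ?_
    simp only [sub_re, sub_im, graphPoint_re, graphPoint_im]
    gcongr
    have : g t + s - (g t' + s') = (g t - g t') + (s - s') := by ring
    rw [this]; exact abs_add_le _ _
  have hd' : M * ‖w' - w‖ < δ / 2 := by
    rw [lt_div_iff₀ (by positivity)] at hd ⊢
    linarith
  have hMw : 0 ≤ ‖w' - w‖ := norm_nonneg _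
  have := hv.norm_primitive_sub_le hg hg' hh hK hwI hwI'
    (Ioo_subset_Icc_self hs) (Ioo_subset_Icc_self hs') (c := v w) (ε := ε / M)
    (fun t ht => by
      rw [← dist_eq_norm]
      refine (hδc ?_).le
      have e := hgp t (w.im - g w.re) w.re (w.im - g w.re)
      rw [graphPoint_self] at e
      rw [dist_eq_norm]
      have ht1 : |t - w.re| ≤ |w'.re - w.re| := abs_sub_left_of_mem_uIcc ht
      have ht2 := abs_sub_le_of_graph hg hK hwI (uIcc_subset_Icc hwI hwI' ht)
      simp only [sub_self, abs_zero, add_zero] at e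
      nlinarith [mul_le_mul_of_nonneg_left (ht1.trans h1) hK0])
    (fun σ hσ => by
      rw [← dist_eq_norm]
      refine (hδc ?_).le
      have e := hgp w'.re σ w.re (w.im - g w.re)
      rw [graphPoint_self] at e
      rw [dist_eq_norm]
      have hσ1 : |σ - (w.im - g w.re)| ≤ |w'.im - g w'.re - (w.im - g w.re)| :=
        abs_sub_left_of_mem_uIcc hσ
      nlinarith [mul_le_mul_of_nonneg_left h1 hK0])
  simp only [graphPoint_self] at this
  rw [smul_eq_mul, mul_comm (w' - w)]
  refine this.trans ?_
  calc ε / M * (K * |w'.re - w.re| + |w'.im - g w'.re - (w.im - g w.re)|)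
      ≤ ε / M * (M * ‖w' - w‖) := mul_le_mul_of_nonneg_left h5 (by positivity)
    _ = ε * ‖w' - w‖ := by field_simp

/-- A bounded function which is holomorphic off a `C¹` graph and continuous in the vertical
direction across it is holomorphic. -/
theorem CrossesGraph.exists_analyticAt {x : ℝ} (hx : x ∈ Ioo a b) :
    ∃ F : ℂ → ℂ, AnalyticAt ℂ F (graphPoint g x 0) ∧
      ∀ᶠ w in 𝓝 (graphPoint g x 0), w.im ≠ g w.re → F w = v w := by
  set P := graphPrimitive g g' a v
  obtain ⟨a', ha', hax⟩ := exists_between hx.1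
  obtain ⟨b', hbx, hb'⟩ := exists_between hx.2
  have hsub : Icc a' b' ⊆ Ioo a b := fun t ht => ⟨ha'.trans_le ht.1, ht.2.trans_lt hb'⟩
  have hsub' : Icc a' b' ⊆ Icc a b := hsub.trans Ioo_subset_Icc_self
  have hsubh : Icc (-(h / 2)) (h / 2) ⊆ Ioo (-h) h := fun s hs =>
    ⟨by linarith [hs.1], by linarith [hs.2]⟩
  have hbox : ∀ w : ℂ, w.re ∈ Ioo a b → w.im - g w.re ∈ Ioo (-h) h →
      ∀ᶠ w' : ℂ in 𝓝 w, w'.re ∈ Ioo a b ∧ w'.im - g w'.re ∈ Ioo (-h) h := by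
    intro w hw hs
    have hgc : ContinuousAt g w.re := (hg _ (Ioo_subset_Icc_self hw)).continuousAt
    have : ContinuousAt (fun w' : ℂ => w'.im - g w'.re) w :=
      continuous_im.continuousAt.sub (ContinuousAt.comp (g := g) hgc continuous_re.continuousAt)
    exact (continuous_re.continuousAt.eventually_mem (Ioo_mem_nhds hw.1 hw.2)).and
      (this.eventually_mem (Ioo_mem_nhds hs.1 hs.2))
  obtain ⟨C, hC⟩ := hv.lipschitz_primitive hg hg' hh
  have hPc : ∀ w : ℂ, w.re ∈ Ioo a b → w.im - g w.re ∈ Ioo (-h) h → ContinuousAt P w := by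
    intro w hw hs
    rw [Metric.continuousAt_iff']
    have : Tendsto (fun w' : ℂ => C * ‖w' - w‖) (𝓝 w) (𝓝 0) := by
      have : Continuous fun w' : ℂ => C * ‖w' - w‖ := by fun_prop
      simpa using this.tendsto w
    intro ε hε
    filter_upwards [hbox w hw hs, this.eventually_lt_const hε] with w' hw' hlt
    rw [dist_eq_norm]
    exact (hC w w' (Ioo_subset_Icc_self hw) (Ioo_subset_Icc_self hw'.1) (Ioo_subset_Icc_self hs)
      (Ioo_subset_Icc_self hw'.2)).trans_lt hlt
  have hvan : ∀ w : ℂ, w.re ∈ Ioo a b → w.im - g w.re ∈ Ioo (-h) h → w.im ≠ g w.re →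
      AnalyticAt ℂ v w := by
    intro w hw hs hne
    have := hv.analytic w.re (Ioo_subset_Icc_self hw) _ (Ioo_subset_Icc_self hs)
      (sub_ne_zero.2 hne)
    rwa [graphPoint_self] at this
  have hPd : ∀ w : ℂ, w.re ∈ Ioo a b → w.im - g w.re ∈ Ioo (-h) h → w.im ≠ g w.re →
      HasDerivAt P (v w) w := fun w hw hs hne =>
    hv.hasDerivAt_primitive hg hg' hh hw hs (hvan w hw hs hne).continuousAt
  have hne : ∀ w : ℂ, w.re ∈ Ioo a b → w.im ≠ g w.re → ∀ᶠ w' : ℂ in 𝓝 w, w'.im ≠ g w'.re := by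
    intro w hw hne
    have hgc : ContinuousAt g w.re := (hg _ (Ioo_subset_Icc_self hw)).continuousAt
    have : ContinuousAt (fun w' : ℂ => w'.im - g w'.re) w :=
      continuous_im.continuousAt.sub (ContinuousAt.comp (g := g) hgc continuous_re.continuousAt)
    exact (this.eventually_ne (sub_ne_zero.2 hne)).mono fun w' h => sub_ne_zero.1 h
  have hPan : ∀ w : ℂ, w.re ∈ Ioo a b → w.im - g w.re ∈ Ioo (-h) h → w.im ≠ g w.re →
      AnalyticAt ℂ P w := by
    intro w hw hs hn
    rw [Complex.analyticAt_iff_eventually_differentiableAt]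
    filter_upwards [hbox w hw hs, hne w hw hn] with w' h1 h2
    exact (hPd w' h1.1 h1.2 h2).differentiableAt
  obtain ⟨B', hB'⟩ : ∃ B', ∀ t ∈ Icc a' b', ∀ s ∈ Icc (-(h / 2)) (h / 2),
      ‖P (graphPoint g t s)‖ ≤ B' := by
    have hgc : ContinuousOn g (Icc a' b') := fun t ht =>
      (hg t (hsub' ht)).continuousAt.continuousWithinAt
    have hΦ : ContinuousOn (fun p : ℝ × ℝ => graphPoint g p.1 p.2)
        (Icc a' b' ×ˢ Icc (-(h / 2)) (h / 2)) := by
      have : ContinuousOn (fun p : ℝ × ℝ => g p.1) (Icc a' b' ×ˢ Icc (-(h / 2)) (h / 2)) :=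
        hgc.comp continuousOn_fst (fun p hp => hp.1)
      exact (continuous_ofReal.comp_continuousOn continuousOn_fst).add
        ((continuous_ofReal.comp_continuousOn (this.add continuousOn_snd)).mul continuousOn_const)
    have hcP : ContinuousOn (fun p : ℝ × ℝ => P (graphPoint g p.1 p.2))
        (Icc a' b' ×ˢ Icc (-(h / 2)) (h / 2)) := by
      intro p hp
      refine ContinuousAt.comp_continuousWithinAt (g := P)
        (f := fun p : ℝ × ℝ => graphPoint g p.1 p.2) (hPc _ ?_ ?_) (hΦ p hp)
      · rw [graphPoint_re]; exact hsub hp.1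
      · rw [graphPoint_re, graphPoint_im, add_sub_cancel_left]; exact hsubh hp.2
    obtain ⟨B', hB'⟩ := (isCompact_Icc.prod isCompact_Icc).exists_bound_of_continuousOn hcP
    exact ⟨B', fun t ht s hs => hB' (t, s) ⟨ht, hs⟩⟩
  have hPcr : CrossesGraph g a' b' (h / 2) B' P := by
    refine ⟨fun t ht s hs h0 => hPan _ ?_ ?_ ?_, fun t ht s hs _ => hB' t ht s hs, fun t ht => ?_⟩
    · rw [graphPoint_re]; exact hsub ht
    · rw [graphPoint_re, graphPoint_im, add_sub_cancel_left]; exact hsubh hs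
    · rw [graphPoint_re, graphPoint_im]; simpa using h0
    · refine ContinuousAt.comp (g := P) (hPc _ ?_ ?_) (hasDerivAt_graphPoint_right g t 0).continuousAt
      · rw [graphPoint_re]; exact hsub ht
      · rw [graphPoint_re, graphPoint_im, add_sub_cancel_left]; exact ⟨by linarith, hh⟩
  set Q := graphPrimitive g g' a' P
  have hbox' : ∀ᶠ w : ℂ in 𝓝 (graphPoint g x 0),
      w.re ∈ Ioo a' b' ∧ w.im - g w.re ∈ Ioo (-(h / 2)) (h / 2) := by
    have hgc : ContinuousAt g (graphPoint g x 0).re := by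
      rw [graphPoint_re]; exact (hg _ (Ioo_subset_Icc_self hx)).continuousAt
    have : ContinuousAt (fun w' : ℂ => w'.im - g w'.re) (graphPoint g x 0) :=
      continuous_im.continuousAt.sub (ContinuousAt.comp (g := g) hgc continuous_re.continuousAt)
    refine (continuous_re.continuousAt.eventually_mem ?_).and (this.eventually_mem ?_)
    · rw [graphPoint_re]; exact Ioo_mem_nhds hax hbx
    · rw [graphPoint_re, graphPoint_im, add_sub_cancel_left]
      exact Ioo_mem_nhds (by linarith) (by linarith)
  have hQd : ∀ᶠ w : ℂ in 𝓝 (graphPoint g x 0), HasDerivAt Q (P w) w := by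
    filter_upwards [hbox'] with w hw
    refine hPcr.hasDerivAt_primitive (fun t ht => hg t (hsub' ht)) (hg'.mono hsub') (by linarith)
      hw.1 hw.2 (hPc w (hsub (Ioo_subset_Icc_self hw.1)) (hsubh (Ioo_subset_Icc_self hw.2)))
  have hQa : AnalyticAt ℂ Q (graphPoint g x 0) :=
    Complex.analyticAt_iff_eventually_differentiableAt.2 (hQd.mono fun w hw => hw.differentiableAt)
  refine ⟨deriv (deriv Q), hQa.deriv.deriv, ?_⟩
  filter_upwards [hbox', hQd.eventually_nhds] with w hw hd hn
  have e : deriv Q =ᶠ[𝓝 w] P := hd.mono fun w' h => h.deriv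
  rw [e.deriv_eq]
  exact (hPd w (hsub (Ioo_subset_Icc_self hw.1)) (hsubh (Ioo_subset_Icc_self hw.2)) hn).deriv

end Graph

/-- Off `E` and near `w`, the function `v` agrees with a function which is analytic at `w`. -/
def LocallyExtends (v : ℂ → ℂ) (E : Set ℂ) (w : ℂ) : Prop :=
  ∃ F : ℂ → ℂ, AnalyticAt ℂ F w ∧ ∀ᶠ w' in 𝓝 w, w' ∉ E → F w' = v w'

/-- Gluing of local holomorphic extensions; at isolated points boundedness is enough. -/
theorem exists_differentiableOn_of_locallyExtends {v : ℂ → ℂ} {Ω E V : Set ℂ} (hΩ : IsOpen Ω)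
    (hE : ∀ w ∈ Ω, (𝓝[Eᶜ] w).NeBot) (hVE : V ⊆ E)
    (hV : ∀ w ∈ Ω, ∀ᶠ w' in 𝓝[≠] w, w' ∉ V)
    (hbd : ∀ w ∈ Ω, ∃ B, ∀ᶠ w' in 𝓝 w, w' ∉ E → ‖v w'‖ ≤ B)
    (hext : ∀ w ∈ Ω, w ∉ V → LocallyExtends v E w) :
    ∃ F : ℂ → ℂ, DifferentiableOn ℂ F Ω ∧ ∀ w ∈ Ω, w ∉ E → F w = v w := by
  set F0 : ℂ → ℂ := fun w => limUnder (𝓝[Eᶜ] w) v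
  have hloc : ∀ w ∈ Ω, ∀ F : ℂ → ℂ, AnalyticAt ℂ F w → (∀ᶠ w' in 𝓝 w, w' ∉ E → F w' = v w') →
      F0 =ᶠ[𝓝 w] F := by
    intro w hw F hF hFv
    filter_upwards [hΩ.mem_nhds hw, hF.eventually_analyticAt, hFv.eventually_nhds] with w' h1 h2 h3
    have := hE w' h1
    refine Tendsto.limUnder_eq ?_
    refine (h2.continuousAt.tendsto.mono_left nhdsWithin_le_nhds).congr' ?_
    filter_upwards [nhdsWithin_le_nhds h3, self_mem_nhdsWithin] with z hz hzE using hz hzE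
  have hext' : ∀ w ∈ Ω, LocallyExtends v E w := by
    intro w hw
    by_cases hwV : w ∈ V
    swap
    · exact hext w hw hwV
    obtain ⟨B, hB⟩ := hbd w hw
    have hgood : ∀ᶠ w' in 𝓝[≠] w, DifferentiableAt ℂ F0 w' ∧ ‖F0 w'‖ ≤ B ∧
        (w' ∉ E → F0 w' = v w') := by
      filter_upwards [nhdsWithin_le_nhds (hΩ.mem_nhds hw), hV w hw,
        nhdsWithin_le_nhds hB.eventually_nhds] with w' h1 h2 h3
      obtain ⟨F, hF, hFv⟩ := hext w' h1 h2
      have e := hloc w' h1 F hF hFv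
      refine ⟨e.differentiableAt_iff.2 hF.differentiableAt, ?_, fun h => ?_⟩
      · rw [e.eq_of_nhds]
        have := hE w' h1
        refine le_of_tendsto (hF.continuousAt.norm.tendsto.mono_left
          (nhdsWithin_le_nhds (s := Eᶜ))) ?_
        filter_upwards [nhdsWithin_le_nhds h3, nhdsWithin_le_nhds hFv, self_mem_nhdsWithin]
          with z hz hz' hzE
        rw [hz' hzE]; exact hz hzE
      · rw [e.eq_of_nhds]; exact hFv.self_of_nhds h
    obtain ⟨s, hs, hsg⟩ : ∃ s ∈ 𝓝 w, ∀ w' ∈ s \ {w}, DifferentiableAt ℂ F0 w' ∧ ‖F0 w'‖ ≤ B ∧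
        (w' ∉ E → F0 w' = v w') := by
      rw [eventually_nhdsWithin_iff] at hgood
      exact ⟨_, hgood, fun w' h => h.1 h.2⟩
    have hd := Complex.differentiableOn_update_limUnder_of_bddAbove hs
      (fun w' h => (hsg w' h).1.differentiableWithinAt)
      ⟨B, by rintro _ ⟨w', h, rfl⟩; exact (hsg w' h).2.1⟩
    refine ⟨_, hd.analyticAt hs, ?_⟩
    filter_upwards [hs] with w' hw' hE'
    have hne : w' ≠ w := by rintro rfl; exact hE' (hVE hwV)
    rw [Function.update_of_ne hne]
    exact (hsg w' ⟨hw', hne⟩).2.2 hE'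
  refine ⟨F0, fun w hw => ?_, fun w hw hwE => ?_⟩
  · obtain ⟨F, hF, hFv⟩ := hext' w hw
    exact ((hloc w hw F hF hFv).differentiableAt_iff.2 hF.differentiableAt).differentiableWithinAt
  · obtain ⟨F, hF, hFv⟩ := hext' w hw
    rw [(hloc w hw F hF hFv).eq_of_nhds]
    exact hFv.self_of_nhds hwE

theorem locallyExtends_of_graph {v : ℂ → ℂ} {E : Set ℂ} {g g' : ℝ → ℝ} {w1 : ℂ} {B : ℝ}
    (hw1 : w1.im = g w1.re) (hg : ∀ᶠ x in 𝓝 w1.re, HasDerivAt g (g' x) x)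
    (hg' : ∀ᶠ x in 𝓝 w1.re, ContinuousAt g' x)
    (hoff : ∀ᶠ w in 𝓝 w1, w.im ≠ g w.re → AnalyticAt ℂ v w ∧ ‖v w‖ ≤ B)
    (hon : ∀ᶠ w in 𝓝 w1, w.im = g w.re →
      w ∈ E ∧ ∃ l, Tendsto (fun σ : ℝ => v (w + σ * I)) (𝓝[≠] 0) (𝓝 l)) :
    LocallyExtends v E w1 := by
  have hΦ : ContinuousAt (fun p : ℝ × ℝ => graphPoint g p.1 p.2) (w1.re, 0) := by
    have hc : ContinuousAt (fun p : ℝ × ℝ => g p.1) (w1.re, 0) :=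
      ContinuousAt.comp (g := g) (f := Prod.fst) hg.self_of_nhds.continuousAt continuousAt_fst
    exact (continuous_ofReal.continuousAt.comp continuousAt_fst).add
      ((continuous_ofReal.continuousAt.comp (hc.add continuousAt_snd)).mul continuousAt_const)
  have hΦ0 : graphPoint g w1.re 0 = w1 := by
    have := graphPoint_self g w1
    rwa [hw1, sub_self] at this
  have hΦ' : Tendsto (fun p : ℝ × ℝ => graphPoint g p.1 p.2) (𝓝 w1.re ×ˢ 𝓝 0) (𝓝 w1) := by
    have := hΦ.tendsto
    simp only [hΦ0, nhds_prod_eq] at this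
    exact this
  have hall := hΦ'.eventually (hoff.and hon)
  obtain ⟨p, hp, q, hq, hpq⟩ := eventually_prod_iff.1 hall
  obtain ⟨δ, hδ, hδp⟩ := Metric.eventually_nhds_iff.1 (hp.and (hg.and hg'))
  obtain ⟨η, hη, hηq⟩ := Metric.eventually_nhds_iff.1 hq
  have hpx : ∀ t ∈ Icc (w1.re - δ / 2) (w1.re + δ / 2),
      p t ∧ HasDerivAt g (g' t) t ∧ ContinuousAt g' t := fun t ht => hδp (by
    rw [Real.dist_eq, abs_lt]; constructor <;> linarith [ht.1, ht.2])
  have hqx : ∀ s ∈ Icc (-(η / 2)) (η / 2), q s := fun s hs => hηq (by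
    rw [Real.dist_eq, abs_lt]; constructor <;> linarith [hs.1, hs.2])
  have h0 : q 0 := hqx 0 ⟨by linarith, by linarith⟩
  set L : ℂ → ℂ := fun w => limUnder (𝓝[≠] (0 : ℝ)) fun σ : ℝ => v (w + σ * I)
  set v' : ℂ → ℂ := fun w => if w.im = g w.re then L w else v w with hv'
  have hsh : ∀ t s : ℝ, graphPoint g t 0 + s * I = graphPoint g t s := by
    intro t s; simp [graphPoint]; ring
  have hcross : CrossesGraph g (w1.re - δ / 2) (w1.re + δ / 2) (η / 2) B v' := by
    refine ⟨fun t ht s hs hs0 => ?_, fun t ht s hs hs0 => ?_, fun t ht => ?_⟩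
    · have h1 := (hpq (hpx t ht).1 (hqx s hs)).1
        (by rw [graphPoint_re, graphPoint_im]; simpa using hs0)
      have hc : ContinuousAt (fun w' : ℂ => w'.im - g w'.re) (graphPoint g t s) := by
        refine continuous_im.continuousAt.sub (ContinuousAt.comp (g := g) ?_
          continuous_re.continuousAt)
        rw [graphPoint_re]; exact (hpx t ht).2.1.continuousAt
      refine h1.1.congr ?_
      have : ∀ᶠ w' in 𝓝 (graphPoint g t s), w'.im - g w'.re ≠ 0 := hc.eventually_ne (by
        rw [graphPoint_re, graphPoint_im]; simpa using hs0)
      filter_upwards [this] with w' h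
      simp [hv', sub_ne_zero.1 h]
    · have h1 := (hpq (hpx t ht).1 (hqx s hs)).1
        (by rw [graphPoint_re, graphPoint_im]; simpa using hs0)
      have : v' (graphPoint g t s) = v (graphPoint g t s) := by
        simp [hv', graphPoint_re, graphPoint_im, hs0]
      rw [this]; exact h1.2
    · obtain ⟨-, l, hl⟩ := (hpq (hpx t ht).1 h0).2 (by rw [graphPoint_re, graphPoint_im]; simp)
      have e : L (graphPoint g t 0) = l := hl.limUnder_eq
      rw [← continuousWithinAt_compl_self]
      unfold ContinuousWithinAt
      have e0 : v' (graphPoint g t 0) = l := by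
        simp [hv', graphPoint_re, graphPoint_im, e]
      beta_reduce
      rw [e0]
      refine hl.congr' ?_
      filter_upwards [self_mem_nhdsWithin] with s hs
      rw [hsh]
      have : s ≠ 0 := hs
      simp [hv', graphPoint_re, graphPoint_im, this]
  obtain ⟨F, hF, hFv⟩ := hcross.exists_analyticAt (fun t ht => (hpx t ht).2.1)
    (fun t ht => (hpx t ht).2.2.continuousWithinAt) (by linarith) (x := w1.re)
    ⟨by linarith, by linarith⟩
  rw [hΦ0] at hF hFv
  refine ⟨F, hF, ?_⟩
  filter_upwards [hFv, hon] with w h1 h2 hE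
  have hne : w.im ≠ g w.re := fun h => hE (h2 h).1
  rw [h1 hne]; simp [hv', hne]

theorem locallyExtends_of_vertical {v : ℂ → ℂ} {E : Set ℂ} {c : ℝ} {w1 : ℂ} {B : ℝ}
    (hw1 : w1.re = c) (hoff : ∀ᶠ w in 𝓝 w1, w.re ≠ c → AnalyticAt ℂ v w ∧ ‖v w‖ ≤ B)
    (hon : ∀ᶠ w in 𝓝 w1, w.re = c →
      w ∈ E ∧ ∃ l, Tendsto (fun σ : ℝ => v (w + σ)) (𝓝[≠] 0) (𝓝 l)) :
    LocallyExtends v E w1 := by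
  set m : ℂ → ℂ := fun w => c + I * w with hm
  set m' : ℂ → ℂ := fun z => -I * (z - c) with hm'
  have hmm' : ∀ z, m (m' z) = z := fun z => by
    simp only [hm, hm']; linear_combination (-(z - c)) * I_sq
  have hmc : Continuous m := by fun_prop
  have hmc' : Continuous m' := by fun_prop
  have hmd : ∀ z, AnalyticAt ℂ m z := fun z =>
    analyticAt_const.add (analyticAt_const.mul analyticAt_id)
  have hmd' : ∀ z, AnalyticAt ℂ m' z := fun z =>
    analyticAt_const.mul (analyticAt_id.sub analyticAt_const)
  have hre : ∀ w, (m w).re = c - w.im := fun w => by simp [hm]; ring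
  have ht : Tendsto m (𝓝 (m' w1)) (𝓝 w1) := by
    have := hmc.tendsto (m' w1); rwa [hmm'] at this
  have := locallyExtends_of_graph (v := v ∘ m) (E := m ⁻¹' E) (g := fun _ => 0) (g' := fun _ => 0)
    (w1 := m' w1) (B := B) (by have := hre (m' w1); rw [hmm', hw1] at this; linarith)
    (.of_forall fun x => hasDerivAt_const x 0)
    (.of_forall fun x => continuousAt_const)
    (by
      filter_upwards [ht.eventually hoff] with w h hne
      have := h (by rw [hre]; intro h'; exact hne (by linarith))
      exact ⟨this.1.comp (hmd w), this.2⟩)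
    (by
      filter_upwards [ht.eventually hon] with w h he
      obtain ⟨h1, l, hl⟩ := h (by rw [hre, he]; ring)
      refine ⟨h1, l, ?_⟩
      have hneg : Tendsto (fun σ : ℝ => -σ) (𝓝[≠] 0) (𝓝[≠] 0) := by
        refine tendsto_nhdsWithin_iff.2 ⟨?_, ?_⟩
        · have : Tendsto (fun σ : ℝ => -σ) (𝓝 0) (𝓝 (-0)) := (continuous_neg.tendsto 0)
          rw [neg_zero] at this
          exact this.mono_left nhdsWithin_le_nhds
        · filter_upwards [self_mem_nhdsWithin] with σ hσ
          simpa using hσ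
      refine (hl.comp hneg).congr fun σ => ?_
      simp only [Function.comp, hm]
      congr 1
      push_cast
      linear_combination (-σ : ℂ) * I_sq)
  obtain ⟨F, hF, hFv⟩ := this
  refine ⟨F ∘ m', hF.comp (hmd' w1), ?_⟩
  filter_upwards [(hmc'.tendsto w1).eventually hFv] with z hz hE
  have := hz (by simpa [hmm'] using hE)
  simpa [hmm'] using this

/-- A holomorphic function on a left half-plane has a primitive. -/
theorem exists_primitive_of_halfPlane {f : ℂ → ℂ} {c : ℝ}
    (hf : DifferentiableOn ℂ f {w | w.re < c}) :
    ∃ F : ℂ → ℂ, ∀ w, w.re < c → HasDerivAt F (f w) w := by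
  set z0 : ℂ := ((c - 1 : ℝ) : ℂ) with hz0
  set b : ℕ → Set ℂ := fun k => Metric.ball ((c - (k + 1) : ℝ) : ℂ) (k + 1) with hb
  have hbsub : ∀ k, b k ⊆ {w | w.re < c} := by
    intro k w hw
    have h1 : ‖w - ((c - (k + 1) : ℝ) : ℂ)‖ < k + 1 := by simpa [hb, dist_eq_norm] using hw
    have h2 := (le_abs_self _).trans (abs_re_le_norm (w - ((c - (k + 1) : ℝ) : ℂ)))
    rw [sub_re, ofReal_re] at h2
    change w.re < c; linarith
  have hmono : Monotone b := by
    refine monotone_nat_of_le_succ fun k => Metric.ball_subset_ball' ?_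
    rw [dist_eq_norm, ← ofReal_sub, norm_real, Real.norm_eq_abs]
    push_cast
    have : c - ((k : ℝ) + 1) - (c - ((k : ℝ) + 1 + 1)) = 1 := by ring
    rw [this, abs_one]
  have hz0b : ∀ k, z0 ∈ b k := fun k => hmono (Nat.zero_le k) (by simp [hb, hz0])
  have hcover : ∀ w : ℂ, w.re < c → ∃ k, w ∈ b k := by
    intro w hw
    obtain ⟨k, hk⟩ := exists_nat_gt (((c - w.re) ^ 2 + w.im ^ 2) / (2 * (c - w.re)))
    refine ⟨k, ?_⟩
    have hd : 0 < c - w.re := by linarith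
    rw [div_lt_iff₀ (by linarith)] at hk
    simp only [hb, Metric.mem_ball, Complex.dist_eq_re_im, ofReal_re, ofReal_im, sub_zero]
    rw [Real.sqrt_lt' (by positivity)]
    nlinarith
  have hprim : ∀ k, ∃ g : ℂ → ℂ, g z0 = 0 ∧ ∀ x ∈ b k, HasDerivAt g (f x) x := fun k =>
    ((hf.mono (hbsub k)).isExactOn_ball).with_val_at z0 0
  choose P hP0 hP using hprim
  have hagree : ∀ k l, k ≤ l → ∀ w ∈ b k, P k w = P l w := by
    intro k l hkl w hw
    have hd : ∀ x ∈ b k, HasDerivAt (fun w => P k w - P l w) 0 x := fun x hx => by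
      have := (hP k x hx).fun_sub (hP l x (hmono hkl hx))
      rwa [sub_self] at this
    have := (convex_ball (((c - (k + 1) : ℝ) : ℂ)) ((k : ℝ) + 1)).norm_image_sub_le_of_norm_hasDerivWithin_le
      (f := fun w => P k w - P l w) (f' := fun _ => (0 : ℂ)) (C := 0)
      (fun x hx => (hd x hx).hasDerivWithinAt) (fun x _ => by simp) (hz0b k) hw
    simp only [hP0, sub_zero, zero_mul, norm_le_zero_iff] at this
    exact sub_eq_zero.1 this
  classical
  refine ⟨fun w => if h : ∃ k, w ∈ b k then P (Nat.find h) w else 0, fun w hw => ?_⟩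
  obtain ⟨k, hk⟩ := hcover w hw
  refine (hP k w hk).congr_of_eventuallyEq ?_
  filter_upwards [Metric.isOpen_ball.mem_nhds hk] with z hz
  have h : ∃ k, z ∈ b k := ⟨k, hz⟩
  rw [dif_pos h]
  exact hagree _ _ (Nat.find_min' h hz) z (Nat.find_spec h)


/-! ### Asymptotic expansions -/

/-- `f` has the asymptotic expansion `p` in powers of the small quantity `ζ` along `l`. -/
def Asymp {α : Type*} (l : Filter α) (ζ : α → ℂ) (f : α → ℂ) (p : PowerSeries ℂ) : Prop :=
  ∀ N : ℕ, (fun i => f i - ∑ m ∈ Finset.range N, coeff m p * ζ i ^ m)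
    =O[l] fun i => ζ i ^ N

namespace Asymp

variable {α : Type*} {l : Filter α} {ζ : α → ℂ} {f g : α → ℂ} {p q : PowerSeries ℂ}

open Asymptotics

lemma congr' (h : Asymp l ζ f p) (hfg : f =ᶠ[l] g) : Asymp l ζ g p := fun N =>
  (h N).congr' (hfg.mono fun i hi => by beta_reduce; rw [hi]) EventuallyEq.rfl

lemma zeta_isBigO_one (hζ : Tendsto ζ l (𝓝 0)) : ζ =O[l] fun _ => (1 : ℂ) :=
  hζ.isBigO_one ℂ

lemma pow_isBigO_pow (hζ : Tendsto ζ l (𝓝 0)) {M N : ℕ} (h : M ≤ N) :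
    (fun i => ζ i ^ N) =O[l] fun i => ζ i ^ M := by
  obtain ⟨k, rfl⟩ := Nat.exists_eq_add_of_le h
  simpa [pow_add] using (isBigO_refl (fun i => ζ i ^ M) l).mul
    ((zeta_isBigO_one hζ).pow k)

lemma sum_isBigO (hζ : Tendsto ζ l (𝓝 0)) (p : PowerSeries ℂ) {M N : ℕ} (h : M ≤ N) :
    (fun i => ∑ m ∈ Finset.range N, coeff m p * ζ i ^ m -
      ∑ m ∈ Finset.range M, coeff m p * ζ i ^ m) =O[l] fun i => ζ i ^ M := by
  have : ∀ i, ∑ m ∈ Finset.range N, coeff m p * ζ i ^ m -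
      ∑ m ∈ Finset.range M, coeff m p * ζ i ^ m =
      ∑ m ∈ Finset.Ico M N, coeff m p * ζ i ^ m := fun i =>
    (Finset.sum_Ico_eq_sub _ h).symm
  simp only [this]
  refine IsBigO.fun_sum fun m hm => ?_
  exact (pow_isBigO_pow hζ (Finset.mem_Ico.1 hm).1).const_mul_left _

/-- It is enough to have the expansion to arbitrarily large orders. -/
lemma of_frequently (hζ : Tendsto ζ l (𝓝 0))
    (h : ∀ M, ∃ N ≥ M, (fun i => f i - ∑ m ∈ Finset.range N, coeff m p * ζ i ^ m)
      =O[l] fun i => ζ i ^ N) : Asymp l ζ f p := fun M => by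
  obtain ⟨N, hN, hf⟩ := h M
  have := (hf.trans (pow_isBigO_pow hζ hN)).add (sum_isBigO hζ p hN)
  simpa using this

lemma isBigO_one (h : Asymp l ζ f p) : f =O[l] fun _ => (1 : ℂ) := by
  simpa using h 0

lemma const (hζ : Tendsto ζ l (𝓝 0)) (c : ℂ) : Asymp l ζ (fun _ => c) (PowerSeries.C c) := by
  refine of_frequently hζ fun M => ⟨M + 1, by omega, ?_⟩
  have : ∀ i, c - ∑ m ∈ Finset.range (M + 1), coeff m (PowerSeries.C c) * ζ i ^ m
      = 0 := by
    intro i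
    rw [Finset.sum_eq_single 0] <;> simp +contextual [PowerSeries.coeff_C]
  simp only [this]
  exact isBigO_zero _ _

lemma zeta (hζ : Tendsto ζ l (𝓝 0)) : Asymp l ζ ζ PowerSeries.X := by
  refine of_frequently hζ fun M => ⟨M + 2, by omega, ?_⟩
  have : ∀ i, ζ i - ∑ m ∈ Finset.range (M + 2), coeff m PowerSeries.X * ζ i ^ m
      = 0 := by
    intro i
    rw [Finset.sum_eq_single 1] <;> simp +contextual [PowerSeries.coeff_X]
  simp only [this]
  exact isBigO_zero _ _

lemma add (hf : Asymp l ζ f p) (hg : Asymp l ζ g q) :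
    Asymp l ζ (fun i => f i + g i) (p + q) := fun N => by
  refine ((hf N).add (hg N)).congr_left fun i => ?_
  simp only [map_add, add_mul, Finset.sum_add_distrib]; ring

lemma neg (hf : Asymp l ζ f p) : Asymp l ζ (fun i => - f i) (-p) := fun N => by
  refine (hf N).neg_left.congr_left fun i => ?_
  simp only [map_neg, neg_mul, Finset.sum_neg_distrib]; ring

lemma sub (hf : Asymp l ζ f p) (hg : Asymp l ζ g q) :
    Asymp l ζ (fun i => f i - g i) (p - q) := by
  simpa [sub_eq_add_neg] using hf.add hg.neg

lemma mul (hζ : Tendsto ζ l (𝓝 0)) (hf : Asymp l ζ f p) (hg : Asymp l ζ g q) :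
    Asymp l ζ (fun i => f i * g i) (p * q) := fun N => by
  set P : α → ℂ := fun i => ∑ m ∈ Finset.range N, coeff m p * ζ i ^ m with hP
  set Q : α → ℂ := fun i => ∑ m ∈ Finset.range N, coeff m q * ζ i ^ m with hQ
  have hQ1 : Q =O[l] fun _ => (1 : ℂ) := by
    have := sum_isBigO hζ q (Nat.zero_le N)
    simpa using this
  have h1 : (fun i => (f i - P i) * Q i) =O[l] fun i => ζ i ^ N := by
    simpa using (hf N).mul hQ1
  have h2 : (fun i => f i * (g i - Q i)) =O[l] fun i => ζ i ^ N := by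
    simpa using hf.isBigO_one.mul (hg N)
  have h3 : (fun i => P i * Q i -
      ∑ m ∈ Finset.range N, coeff m (p * q) * ζ i ^ m) =O[l] fun i => ζ i ^ N := by
    set a : Polynomial ℂ := PowerSeries.trunc N p
    set b : Polynomial ℂ := PowerSeries.trunc N q
    have ev : ∀ (r : PowerSeries ℂ) (i : α), (PowerSeries.trunc N r).eval (ζ i) =
        ∑ m ∈ Finset.range N, coeff m r * ζ i ^ m := by
      intro r i
      have := PowerSeries.eval₂_trunc_eq_sum_range (ζ i) (RingHom.id ℂ) N r
      rw [Polynomial.eval₂_id] at this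
      simpa using this
    have hdvd : Polynomial.X ^ N ∣ a * b - PowerSeries.trunc N (p * q) := by
      rw [Polynomial.X_pow_dvd_iff]
      intro d hd
      rw [Polynomial.coeff_sub, sub_eq_zero, PowerSeries.coeff_trunc, if_pos hd,
        Polynomial.coeff_mul, PowerSeries.coeff_mul]
      refine Finset.sum_congr rfl fun x hx => ?_
      have := Finset.HasAntidiagonal.mem_antidiagonal.1 hx
      simp only [a, b]
      rw [PowerSeries.coeff_trunc, PowerSeries.coeff_trunc, if_pos (by omega), if_pos (by omega)]
    obtain ⟨c, hc⟩ := hdvd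
    have hc1 : (fun i => c.eval (ζ i)) =O[l] fun _ => (1 : ℂ) :=
      ((c.continuous.tendsto 0).comp hζ).isBigO_one ℂ
    have := (isBigO_refl (fun i => ζ i ^ N) l).mul hc1
    simp only [mul_one] at this
    refine this.congr_left fun i => ?_
    have e := congrArg (Polynomial.eval (ζ i)) hc
    simp only [Polynomial.eval_sub, Polynomial.eval_mul, Polynomial.eval_pow, Polynomial.eval_X, ev,
      a, b] at e
    simp only [hP, hQ, e]
  refine ((h1.add h2).add h3).congr_left fun i => ?_
  ring

lemma sum (hζ : Tendsto ζ l (𝓝 0)) {κ : Type*} (s : Finset κ) {f : κ → α → ℂ}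
    {p : κ → PowerSeries ℂ} (h : ∀ k ∈ s, Asymp l ζ (f k) (p k)) :
    Asymp l ζ (fun i => ∑ k ∈ s, f k i) (∑ k ∈ s, p k) := by
  classical
  induction s using Finset.induction_on with
  | empty => simpa using const hζ 0
  | insert a s ha ih =>
    simp only [Finset.sum_insert ha]
    exact (h a (by simp)).add (ih fun k hk => h k (by simp [hk]))

lemma prod (hζ : Tendsto ζ l (𝓝 0)) {κ : Type*} (s : Finset κ) {f : κ → α → ℂ}
    {p : κ → PowerSeries ℂ} (h : ∀ k ∈ s, Asymp l ζ (f k) (p k)) :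
    Asymp l ζ (fun i => ∏ k ∈ s, f k i) (∏ k ∈ s, p k) := by
  classical
  induction s using Finset.induction_on with
  | empty => simpa using const hζ 1
  | insert a s ha ih =>
    simp only [Finset.prod_insert ha]
    exact (h a (by simp)).mul hζ (ih fun k hk => h k (by simp [hk]))

lemma pow (hζ : Tendsto ζ l (𝓝 0)) (hf : Asymp l ζ f p) (n : ℕ) :
    Asymp l ζ (fun i => f i ^ n) (p ^ n) := by
  induction n with
  | zero => simpa using const hζ 1
  | succ n ih => simpa [pow_succ] using ih.mul hζ hf

lemma unique [l.NeBot] (hζ : Tendsto ζ l (𝓝[≠] 0)) (hf : Asymp l ζ f p) (hg : Asymp l ζ f q) :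
    p = q := by
  have hζ0 : Tendsto ζ l (𝓝 0) := hζ.mono_right nhdsWithin_le_nhds
  ext N
  induction N using Nat.strong_induction_on with
  | _ N ih =>
  have h1 := (hf (N + 1)).sub (hg (N + 1))
  have h2 : (fun i => (coeff N q - coeff N p) * ζ i ^ N) =O[l]
      fun i => ζ i ^ (N + 1) := by
    refine h1.congr_left fun i => ?_
    rw [Finset.sum_range_succ, Finset.sum_range_succ, Finset.sum_congr rfl fun m hm => by
      rw [ih m (Finset.mem_range.1 hm)]]
    ring
  have hne : ∀ᶠ i in l, ζ i ≠ 0 := (tendsto_nhdsWithin_iff.1 hζ).2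
  have h3 : (fun _ : α => coeff N q - coeff N p) =O[l] ζ := by
    obtain ⟨C, hC⟩ := h2.bound
    refine IsBigO.of_bound C ?_
    filter_upwards [hC, hne] with i hi h0
    rw [norm_mul, norm_pow, norm_pow, pow_succ] at hi
    have : 0 < ‖ζ i‖ ^ N := by positivity
    nlinarith
  have h4 : Tendsto (fun _ : α => coeff N q - coeff N p) l (𝓝 0) :=
    h3.trans_tendsto hζ0
  have := tendsto_nhds_unique h4 tendsto_const_nhds
  exact (sub_eq_zero.1 this.symm).symm

variable {r : ℕ}

lemma det (hζ : Tendsto ζ l (𝓝 0)) {n : Type*} [DecidableEq n] [Fintype n]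
    {F : α → Matrix n n ℂ} {Y : Matrix n n (PowerSeries ℂ)}
    (h : ∀ i j, Asymp l ζ (fun x => F x i j) (Y i j)) : Asymp l ζ (fun x => (F x).det) Y.det := by
  simp only [Matrix.det_apply']
  refine sum hζ _ fun σ _ => ?_
  refine Asymp.mul hζ ?_ (prod hζ _ fun i _ => h _ _)
  have := const hζ (((Equiv.Perm.sign σ : ℤ) : ℂ))
  simpa using this

lemma adjugate (hζ : Tendsto ζ l (𝓝 0)) {n : Type*} [DecidableEq n] [Fintype n]
    {F : α → Matrix n n ℂ} {Y : Matrix n n (PowerSeries ℂ)}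
    (h : ∀ i j, Asymp l ζ (fun x => F x i j) (Y i j)) (i j : n) :
    Asymp l ζ (fun x => (F x).adjugate i j) (Y.adjugate i j) := by
  simp only [Matrix.adjugate_apply]
  refine det hζ fun i' j' => ?_
  simp only [Matrix.updateRow_apply]
  split_ifs
  · by_cases hij : j' = i
    · subst hij; simpa using const hζ 1
    · simpa [Pi.single_apply, hij] using const hζ 0
  · exact h _ _

lemma matMul (hζ : Tendsto ζ l (𝓝 0)) {n : Type*} [Fintype n]
    {F G : α → Matrix n n ℂ} {Y Z : Matrix n n (PowerSeries ℂ)}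
    (hF : ∀ i j, Asymp l ζ (fun x => F x i j) (Y i j))
    (hG : ∀ i j, Asymp l ζ (fun x => G x i j) (Z i j)) (i j : n) :
    Asymp l ζ (fun x => (F x * G x) i j) ((Y * Z) i j) := by
  simp only [Matrix.mul_apply]
  exact sum hζ _ fun k _ => (hF i k).mul hζ (hG k j)

end Asymp


/-! ### Functions on sectors with exponentially close differences

Sectors at the origin are described in the logarithmic coordinate `w`, `ζ = e^w`. -/

lemma exp_ne_exp_of_im {w w0 : ℂ} (hne : w ≠ w0) (h1 : w.im - w0.im < 2 * π)
    (h2 : w0.im - w.im < 2 * π) : exp w ≠ exp w0 := by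
  intro h
  obtain ⟨n, hn⟩ := Complex.exp_eq_exp_iff_exists_int.1 h
  have him : w.im = w0.im + n * (2 * π) := by
    have := congrArg Complex.im hn
    simpa using this
  have hpi := Real.pi_pos
  have hn0 : n = 0 := by
    have a1 : (n : ℝ) < 1 := by nlinarith
    have a2 : (-1 : ℝ) < n := by nlinarith
    have b1 : n < 1 := by exact_mod_cast a1
    have b2 : -1 < n := by exact_mod_cast a2
    omega
  rw [hn0] at hn
  exact hne (by simpa using hn)

/-- The distance from a point to a ray through the origin. -/
lemma sin_mul_exp_le_norm_sub {w w0 : ℂ} {η : ℝ} (h : Real.cos (w.im - w0.im) ≤ Real.cos η)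
    : Real.sin η * Real.exp w.re ≤ ‖exp w - exp w0‖ := by
  refine Real.le_sqrt_of_sq_le ?_ |>.trans_eq (Complex.norm_eq_sqrt_sq_add_sq _).symm
  rw [sub_re, sub_im, exp_re, exp_re, exp_im, exp_im]
  have e := Real.cos_sub w.im w0.im
  have c1 := Real.sin_sq_add_cos_sq w.im
  have c2 := Real.sin_sq_add_cos_sq w0.im
  have c3 := Real.sin_sq_add_cos_sq η
  set p := Real.exp w.re
  set q := Real.exp w0.re
  have hp : 0 < p := Real.exp_pos _
  have hq : 0 < q := Real.exp_pos _
  rw [e] at h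
  have hpq : 0 < p * q := mul_pos hp hq
  have h' := mul_le_mul_of_nonneg_left h hpq.le
  have : (p * Real.cos w.im - q * Real.cos w0.im) ^ 2 + (p * Real.sin w.im - q * Real.sin w0.im) ^ 2
      = p ^ 2 + q ^ 2 - 2 * (p * q * (Real.cos w.im * Real.cos w0.im +
        Real.sin w.im * Real.sin w0.im)) := by
    linear_combination p ^ 2 * c1 + q ^ 2 * c2
  rw [this]
  have h3 : (Real.sin η * p) ^ 2 = p ^ 2 - p ^ 2 * Real.cos η ^ 2 := by
    linear_combination p ^ 2 * c3
  rw [h3]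
  nlinarith [sq_nonneg (q - p * Real.cos η)]

lemma cos_le_cos_of_mem {δ η : ℝ} (hη : 0 ≤ η) (h1 : η ≤ |δ|) (h2 : |δ| ≤ 2 * π - η) :
    Real.cos δ ≤ Real.cos η := by
  rw [← Real.cos_abs δ]
  rcases le_or_gt |δ| π with h | h
  · exact Real.cos_le_cos_of_nonneg_of_le_pi hη h h1
  · rw [← Real.cos_two_pi_sub]
    exact Real.cos_le_cos_of_nonneg_of_le_pi hη (by linarith) (by linarith)

/-- The Cauchy kernel `dζ / (ζ - ζ₀)` in the logarithmic coordinate. -/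
def logKernel (w0 w : ℂ) : ℂ := exp w / (exp w - exp w0)

lemma logKernel_sub_one {w0 w : ℂ} (h : exp w ≠ exp w0) :
    logKernel w0 w - 1 = exp w0 / (exp w - exp w0) := by
  have : exp w - exp w0 ≠ 0 := sub_ne_zero.2 h
  unfold logKernel
  field_simp
  ring

lemma logKernel_periodic (w0 w : ℂ) : logKernel w0 (w + 2 * π * I) = logKernel w0 w := by
  simp [logKernel, Complex.exp_add]

/-- The Cauchy integral over the boundary of a rectangle, with the kernel in the logarithmic
coordinate; the pole is either inside the rectangle and cancelled, or outside. -/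
lemma integral_boundary_rect_logKernel {F : ℂ → ℂ} {w0 A : ℂ} {X x1 x0 c d : ℝ} (hX : X < w0.re)
    (hx : w0.re < x1) (hx1 : x1 < x0) (hF : DifferentiableOn ℂ F {w | w.re < x0}) (hcd : c ≤ d)
    (hcase : (F w0 = A ∧ c < w0.im ∧ w0.im < d ∧ d - c ≤ 2 * π) ∨
      ((d < w0.im ∨ w0.im < c) ∧ w0.im - c < 2 * π ∧ d - w0.im < 2 * π)) :
    (∫ x in X..x1, (F (x + c * I) - A) * logKernel w0 (x + c * I)) -
      (∫ x in X..x1, (F (x + d * I) - A) * logKernel w0 (x + d * I)) +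
      I * (∫ y in c..d, (F (x1 + y * I) - A) * logKernel w0 (x1 + y * I)) -
      I * (∫ y in c..d, (F (X + y * I) - A) * logKernel w0 (X + y * I)) = 0 := by
  have hXx : X ≤ x1 := by linarith
  set G : ℂ → ℂ := fun w => dslope F w0 w * exp w * (dslope exp w0 w)⁻¹ with hG
  have hU : {w : ℂ | w.re < x0} ∈ 𝓝 w0 :=
    (isOpen_re_lt _).mem_nhds (by change w0.re < x0; linarith)
  rcases hcase with ⟨hA, hc, hd, hlen⟩ | ⟨hout, hc, hd⟩
  · have hGe : ∀ w : ℂ, w ≠ w0 → (F w - A) * logKernel w0 w = G w := by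
      intro w hw
      simp only [hG, dslope_of_ne _ hw, slope_def_field, logKernel, hA]
      have : w - w0 ≠ 0 := sub_ne_zero.2 hw
      rw [inv_div]
      field_simp
    have hGd : DifferentiableOn ℂ G (uIcc (X + c * I : ℂ).re (x1 + d * I : ℂ).re ×ℂ
        uIcc (X + c * I : ℂ).im (x1 + d * I : ℂ).im) := by
      have h1 : DifferentiableOn ℂ (dslope F w0) {w | w.re < x0} :=
        (Complex.differentiableOn_dslope hU).2 hF
      have h2 : DifferentiableOn ℂ (dslope exp w0) univ :=
        (Complex.differentiableOn_dslope univ_mem).2 Complex.differentiable_exp.differentiableOn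
      intro w hw
      rw [mem_reProdIm] at hw
      simp [uIcc_of_le hXx, uIcc_of_le hcd] at hw
      have hne : dslope exp w0 w ≠ 0 := by
        by_cases hw0 : w = w0
        · subst hw0; simp [dslope_same, Complex.exp_ne_zero]
        · rw [dslope_of_ne _ hw0, slope_def_field]
          exact div_ne_zero (sub_ne_zero.2 (exp_ne_exp_of_im hw0 (by linarith) (by linarith)))
            (sub_ne_zero.2 hw0)
      have h1' := (h1.differentiableAt ((isOpen_re_lt _).mem_nhds
        (show w.re < x0 by linarith)))
      have h2' := h2.differentiableAt (x := w) univ_mem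
      exact ((h1'.mul Complex.differentiable_exp.differentiableAt).mul
        (h2'.inv hne)).differentiableWithinAt
    have := Complex.integral_boundary_rect_eq_zero_of_differentiableOn G (X + c * I) (x1 + d * I)
      hGd
    simp only [add_re, ofReal_re, mul_re, I_re, mul_zero, ofReal_im, I_im, mul_one, sub_self,
      add_zero, add_im, mul_im, zero_add, smul_eq_mul] at this
    rw [← this]
    have e1 : ∀ x : ℝ, (F (x + c * I) - A) * logKernel w0 (x + c * I) = G (x + c * I) := fun x =>
      hGe _ (by rintro rfl; simp at hc)
    have e2 : ∀ x : ℝ, (F (x + d * I) - A) * logKernel w0 (x + d * I) = G (x + d * I) := fun x =>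
      hGe _ (by rintro rfl; simp at hd)
    have e3 : ∀ y : ℝ, (F (x1 + y * I) - A) * logKernel w0 (x1 + y * I) = G (x1 + y * I) :=
      fun y => hGe _ (by rintro rfl; simp at hx)
    have e4 : ∀ y : ℝ, (F (X + y * I) - A) * logKernel w0 (X + y * I) = G (X + y * I) :=
      fun y => hGe _ (by rintro rfl; simp at hX)
    simp only [e1, e2, e3, e4]
  · have hGd : DifferentiableOn ℂ (fun w => (F w - A) * logKernel w0 w)
        (uIcc (X + c * I : ℂ).re (x1 + d * I : ℂ).re ×ℂ
        uIcc (X + c * I : ℂ).im (x1 + d * I : ℂ).im) := by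
      intro w hw
      rw [mem_reProdIm] at hw
      simp [uIcc_of_le hXx, uIcc_of_le hcd] at hw
      have h1 := hF.differentiableAt ((isOpen_re_lt _).mem_nhds
        (show w.re < x0 by linarith))
      have hne : exp w - exp w0 ≠ 0 := sub_ne_zero.2 (exp_ne_exp_of_im
        (by rintro rfl; rcases hout with h | h <;> linarith) (by linarith) (by linarith))
      unfold logKernel
      exact ((h1.sub_const A).mul (Complex.differentiable_exp.differentiableAt.div
        (Complex.differentiable_exp.differentiableAt.sub_const _) hne)).differentiableWithinAt
    have := Complex.integral_boundary_rect_eq_zero_of_differentiableOn _ (X + c * I) (x1 + d * I)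
      hGd
    simpa only [add_re, ofReal_re, mul_re, I_re, mul_zero, ofReal_im, I_im, mul_one, sub_self,
      add_zero, add_im, mul_im, zero_add, smul_eq_mul] using this

lemma integral_logKernel {w0 : ℂ} {x1 : ℝ} (hx : w0.re < x1) (c : ℝ) :
    ∫ y in c..(c + 2 * π), logKernel w0 (x1 + y * I) = 2 * π := by
  have hper : Function.Periodic (fun y : ℝ => logKernel w0 (x1 + y * I)) (2 * π) := by
    intro y
    beta_reduce
    rw [← logKernel_periodic w0 (x1 + y * I)]
    congr 1
    push_cast
    ring
  rw [hper.intervalIntegral_add_eq c 0, zero_add]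
  have hb : exp w0 ∈ Metric.ball (0 : ℂ) (Real.exp x1) := by
    rw [mem_ball_zero_iff, norm_exp]
    exact Real.exp_lt_exp.2 hx
  have h := circleIntegral.integral_sub_inv_of_mem_ball hb
  rw [circleIntegral] at h
  have e : ∀ y : ℝ, deriv (circleMap 0 (Real.exp x1)) y • (circleMap 0 (Real.exp x1) y - exp w0)⁻¹ =
      I * logKernel w0 (x1 + y * I) := by
    intro y
    rw [deriv_circleMap, smul_eq_mul]
    simp only [circleMap, zero_add, ofReal_exp, logKernel, Complex.exp_add]
    ring
  simp only [e, intervalIntegral.integral_const_mul] at h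
  have : I * (∫ y in (0 : ℝ)..2 * π, logKernel w0 (x1 + y * I)) = I * (2 * π) := by
    rw [h]; ring
  exact mul_left_cancel₀ I_ne_zero this


/-- Increasing sequence of angles, periodic up to full turns. -/
structure IsAngleSequence (φ : ℤ → ℝ) (N : ℕ) (σ : ℝ) : Prop where
  N_pos : 0 < N
  gap_pos : 0 < σ
  gap : ∀ m, φ m + σ ≤ φ (m + 1)
  periodic : ∀ m, φ (m + N) = φ m + 2 * π

lemma IsAngleSequence.mono {φ : ℤ → ℝ} {N : ℕ} {σ : ℝ} (h : IsAngleSequence φ N σ) :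
    Monotone φ :=
  monotone_int_of_le_succ fun m => by linarith [h.gap m, h.gap_pos]

/-- Bounded holomorphic functions on the sectors between consecutive rays (slightly enlarged),
whose differences are flat along the rays. -/
structure IsSectorFamily (φ : ℤ → ℝ) (N : ℕ) (f : ℤ → ℂ → ℂ) (ε x0 B : ℝ) : Prop where
  holomorphic : ∀ m, DifferentiableOn ℂ (f m) {w | w.re < x0}
  periodic : ∀ m w, w.re < x0 → f (m + N) (w + 2 * π * I) = f m w
  bound : ∀ m w, w.re < x0 → φ (m - 1) - ε < w.im → w.im < φ m + ε → ‖f m w‖ ≤ B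
  flat : ∀ K : ℕ, ∃ C, ∀ m w, w.re < x0 → |w.im - φ m| < ε →
    ‖f m w - f (m + 1) w‖ ≤ C * Real.exp (K * w.re)

lemma IsSectorFamily.mono {φ : ℤ → ℝ} {N : ℕ} {f : ℤ → ℂ → ℂ} {ε ε' x0 x0' B : ℝ}
    (h : IsSectorFamily φ N f ε x0 B) (hε : ε' ≤ ε) (hx : x0' ≤ x0) :
    IsSectorFamily φ N f ε' x0' B where
  holomorphic m := (h.holomorphic m).mono fun w (hw : w.re < x0') => hw.trans_le hx
  periodic m w hw := h.periodic m w (hw.trans_le hx)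
  bound m w hw h1 h2 := h.bound m w (hw.trans_le hx) (by linarith) (by linarith)
  flat K := by
    obtain ⟨C, hC⟩ := h.flat K
    exact ⟨C, fun m w hw h1 => hC m w (hw.trans_le hx) (by linarith)⟩

lemma differentiableOn_halfPlane_continuous {F : ℂ → ℂ} {x0 : ℝ}
    (hF : DifferentiableOn ℂ F {w | w.re < x0}) {w : ℂ} (hw : w.re < x0) : ContinuousAt F w :=
  (hF.differentiableAt ((isOpen_re_lt _).mem_nhds hw)).continuousAt

section Core

variable {φ : ℤ → ℝ} {N : ℕ} {σ : ℝ} {f : ℤ → ℂ → ℂ} {ε x0 B : ℝ}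

lemma continuousOn_line_re {F : ℂ → ℂ} (hF : DifferentiableOn ℂ F {w | w.re < x0}) (b : ℝ) :
    ContinuousOn (fun x : ℝ => F (x + b * I)) (Iio x0) := by
  intro x hx
  refine (ContinuousAt.comp (g := F) (f := fun x : ℝ => (x + b * I : ℂ))
    (differentiableOn_halfPlane_continuous hF (by simpa using hx)) ?_).continuousWithinAt
  fun_prop

lemma continuous_line_im {F : ℂ → ℂ} (hF : DifferentiableOn ℂ F {w | w.re < x0}) {x : ℝ}
    (hx : x < x0) : Continuous (fun y : ℝ => F (x + y * I)) := by
  rw [continuous_iff_continuousAt]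
  intro y
  refine ContinuousAt.comp (g := F) (f := fun y : ℝ => (x + y * I : ℂ))
    (differentiableOn_halfPlane_continuous hF (by simpa using hx)) ?_
  fun_prop

lemma continuousOn_logKernel_re {w0 : ℂ} {b : ℝ} (hb : ∀ x : ℝ, exp (x + b * I) ≠ exp w0) :
    Continuous (fun x : ℝ => logKernel w0 (x + b * I)) := by
  unfold logKernel
  exact Continuous.div (by fun_prop) (by fun_prop) fun x => sub_ne_zero.2 (hb x)

lemma continuous_logKernel_im {w0 : ℂ} {x : ℝ} (hx : x ≠ w0.re) :
    Continuous (fun y : ℝ => logKernel w0 (x + y * I)) := by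
  unfold logKernel
  refine Continuous.div (by fun_prop) (by fun_prop) fun y => sub_ne_zero.2 fun h => hx ?_
  have := congrArg norm h
  simpa [norm_exp] using this

lemma re_add_ofReal_mul_I (x y : ℝ) : ((x : ℂ) + y * I).re = x := by simp

lemma half_exp_le_norm_sub {z w : ℂ} (h : w.re ≤ z.re - 1) :
    Real.exp z.re / 2 ≤ ‖exp z - exp w‖ := by
  have h1 := norm_sub_norm_le (exp z) (exp w)
  rw [norm_exp, norm_exp] at h1
  have h2 := Real.exp_le_exp.2 h
  rw [Real.exp_sub] at h2
  have h3 : Real.exp z.re / Real.exp 1 ≤ Real.exp z.re / 2 := by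
    gcongr
    linarith [Real.add_one_le_exp (1 : ℝ)]
  linarith

/-- The rays bounding the sectors stay away from a point inside a sector. -/
lemma IsAngleSequence.sin_mul_exp_le (hφ : IsAngleSequence φ N σ) (hε : 0 < ε)
    {η : ℝ} {k : ℕ} (hk : k < N) {w0 : ℂ} (hl : φ k + η + ε / 4 ≤ w0.im)
    (hr : w0.im ≤ φ (k + 1) + η - ε / 4) {j : ℕ} (hj : j ≤ N) (x : ℝ) :
    Real.sin (ε / 4) * Real.exp x ≤ ‖exp (x + (φ j + η : ℝ) * I) - exp w0‖ := by
  have hbm : ∀ {m n : ℤ}, m ≤ n → φ m + η ≤ φ n + η := fun h => by linarith [hφ.mono h]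
  have hbN : φ N = φ 0 + 2 * π := by simpa using hφ.periodic 0
  have h0 : φ 0 + η ≤ φ j + η := hbm (by positivity)
  have h1 : φ j + η ≤ φ N + η := hbm (by exact_mod_cast hj)
  have h0k : φ 0 + η ≤ φ k + η := hbm (by positivity)
  have hkN : φ (k + 1) + η ≤ φ N + η := hbm (by exact_mod_cast hk)
  have hpi := Real.pi_gt_three
  have hcos : Real.cos (φ j + η - w0.im) ≤ Real.cos (ε / 4) := by
    refine cos_le_cos_of_mem (by positivity) ?_ ?_
    · rcases le_or_gt j k with h | h
      · have : φ j + η ≤ φ k + η := hbm (by exact_mod_cast h)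
        rw [abs_of_nonpos (by linarith)]; linarith
      · have : φ (k + 1) + η ≤ φ j + η := hbm (by exact_mod_cast h)
        rw [abs_of_nonneg (by linarith)]; linarith
    · rw [abs_le]; constructor <;> linarith
  simpa using sin_mul_exp_le_norm_sub (w := x + (φ j + η : ℝ) * I) (w0 := w0) (η := ε / 4)
    (by simpa using hcos)

/-- The Cauchy formula for a family of functions on sectors. -/
lemma IsSectorFamily.cauchy_formula (hφ : IsAngleSequence φ N σ) (hf : IsSectorFamily φ N f ε x0 B)
    (hε : 0 < ε) (hε1 : ε ≤ 1)
    {η : ℝ} (hη : |η| < ε) {x1 : ℝ} (hx1 : x1 < x0) {k : ℕ} (hk : k < N) {w0 : ℂ}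
    (hw : w0.re < x1) (hl : φ k + η + ε / 4 ≤ w0.im) (hr : w0.im ≤ φ (k + 1) + η - ε / 4) :
    I * (∑ j ∈ Finset.range N, ∫ y in (φ j + η)..(φ (j + 1) + η),
        f (j + 1) (x1 + y * I) * logKernel w0 (x1 + y * I)) -
      (∑ j ∈ Finset.range N, ∫ x in Iic x1, (f j (x + (φ j + η : ℝ) * I) -
        f (j + 1) (x + (φ j + η : ℝ) * I)) * logKernel w0 (x + (φ j + η : ℝ) * I)) =
      2 * π * I * f (k + 1) w0 := by
  set b : ℤ → ℝ := fun m => φ m + η with hb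
  have hbm : Monotone b := fun m n h => by simp only [hb]; linarith [hφ.mono h]
  have hbN : b N = b 0 + 2 * π := by
    have := hφ.periodic 0
    simp only [zero_add] at this
    simp only [hb, this]; ring
  set A := f (k + 1) w0 with hA
  have hb0 : b 0 ≤ b k := hbm (by positivity)
  have hbk : b (k + 1) ≤ b N := hbm (by exact_mod_cast hk)
  have hl' : b k + ε / 4 ≤ w0.im := hl
  have hr' : w0.im ≤ b (k + 1) - ε / 4 := hr
  have hpi := Real.pi_gt_three
  have hsin : 0 < Real.sin (ε / 4) := Real.sin_pos_of_pos_of_lt_pi (by positivity) (by linarith)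
  have hlow : ∀ j : ℕ, j ≤ N → ∀ x : ℝ,
      Real.sin (ε / 4) * Real.exp x ≤ ‖exp (x + b j * I) - exp w0‖ := fun j hj =>
    hφ.sin_mul_exp_le hε hk hl hr hj
  have hne : ∀ j : ℕ, j ≤ N → ∀ x : ℝ, exp (x + b j * I) ≠ exp w0 := by
    intro j hj x h
    have := hlow j hj x
    rw [h, sub_self, norm_zero] at this
    have h2 := mul_pos hsin (Real.exp_pos x)
    linarith
  -- the pieces
  set a : ℕ → ℝ → ℂ := fun j X => ∫ x in X..x1, (f (j + 1) (x + b j * I) - A) *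
    logKernel w0 (x + b j * I) with ha
  set e : ℕ → ℝ → ℂ := fun j X => ∫ x in X..x1, (f j (x + b j * I) - A) *
    logKernel w0 (x + b j * I) with he
  set R : ℕ → ℂ := fun j => ∫ y in (b j)..(b (j + 1)), (f (j + 1) (x1 + y * I) - A) *
    logKernel w0 (x1 + y * I) with hR
  set Lf : ℕ → ℝ → ℂ := fun j X => ∫ y in (b j)..(b (j + 1)), (f (j + 1) (X + y * I) - A) *
    logKernel w0 (X + y * I) with hLf
  have hrect : ∀ X < w0.re, ∀ j < N, a j X - e (j + 1) X + I * R j - I * Lf j X = 0 := by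
    intro X hX j hj
    have hlen : b (j + 1) ≤ b N := hbm (by exact_mod_cast hj)
    have hj0 : b 0 ≤ b j := hbm (by positivity)
    have hcd : b j ≤ b (j + 1) := hbm (by omega)
    have := integral_boundary_rect_logKernel (F := f (j + 1)) (A := A) (c := b j) (d := b (j + 1))
      hX hw hx1 (hf.holomorphic _) hcd (by
        rcases lt_trichotomy j k with h | h | h
        · right
          have : b (j + 1) ≤ b k := hbm (by exact_mod_cast h)
          exact ⟨Or.inl (by linarith), by linarith, by linarith⟩
        · left
          subst h
          exact ⟨rfl, by linarith, by linarith, by linarith⟩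
        · right
          have : b (k + 1) ≤ b j := hbm (by exact_mod_cast h)
          exact ⟨Or.inr (by linarith), by linarith, by linarith⟩)
    simp only [ha, he, hR, hLf]
    push_cast
    exact this
  have hper : ∀ X, X < x1 → e N X = e 0 X := by
    intro X hX
    simp only [he]
    refine intervalIntegral.integral_congr fun x hx => ?_
    rw [uIcc_of_le hX.le] at hx
    have hshift : (x + b N * I : ℂ) = x + b (0 : ℕ) * I + 2 * π * I := by
      rw [hbN]; push_cast; ring
    have hp := hf.periodic 0 (x + b (0 : ℕ) * I) (by simpa using hx.2.trans_lt hx1)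
    rw [zero_add, ← hshift] at hp
    have h0 : ((0 : ℕ) : ℤ) = 0 := rfl
    rw [hp, hshift, logKernel_periodic, h0]
  have hsumE : ∀ X, X < x1 → ∑ j ∈ Finset.range N, e (j + 1) X = ∑ j ∈ Finset.range N, e j X := by
    intro X hX
    have := Finset.sum_range_succ' (fun j => e j X) N
    rw [Finset.sum_range_succ, hper X hX] at this
    exact (add_right_cancel this).symm
  set d : ℕ → ℝ → ℂ := fun j x => (f j (x + b j * I) - f (j + 1) (x + b j * I)) *
    logKernel w0 (x + b j * I) with hd
  have hdc : ∀ j < N, ContinuousOn (d j) (Iio x0) := fun j hj =>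
    ((continuousOn_line_re (hf.holomorphic _) _).sub
      (continuousOn_line_re (hf.holomorphic _) _)).mul
        (continuousOn_logKernel_re (hne j hj.le)).continuousOn
  have hkey : ∀ X < w0.re, I * ∑ j ∈ Finset.range N, R j -
      ∑ j ∈ Finset.range N, ∫ x in X..x1, d j x = I * ∑ j ∈ Finset.range N, Lf j X := by
    intro X hX
    have h1 : ∑ j ∈ Finset.range N, (a j X - e (j + 1) X + I * R j - I * Lf j X) = 0 :=
      Finset.sum_eq_zero fun j hj => hrect X hX j (Finset.mem_range.1 hj)
    simp only [Finset.sum_sub_distrib, Finset.sum_add_distrib, ← Finset.mul_sum] at h1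
    rw [hsumE X (hX.trans hw)] at h1
    have h2 : ∑ j ∈ Finset.range N, ∫ x in X..x1, d j x =
        ∑ j ∈ Finset.range N, e j X - ∑ j ∈ Finset.range N, a j X := by
      rw [← Finset.sum_sub_distrib]
      refine Finset.sum_congr rfl fun j hj => ?_
      have hj' := Finset.mem_range.1 hj
      have hsub : uIcc X x1 ⊆ Iio x0 := by
        rw [uIcc_of_le (hX.trans hw).le]
        exact fun x hx => hx.2.trans_lt hx1
      have hi : ∀ m : ℤ, IntervalIntegrable (fun x : ℝ => (f m (x + b j * I) - A) *
          logKernel w0 (x + b j * I)) volume X x1 := fun m =>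
        ((((continuousOn_line_re (hf.holomorphic m) _).sub continuousOn_const).mul
          (continuousOn_logKernel_re (hne j hj'.le)).continuousOn).mono hsub).intervalIntegrable
      simp only [he, ha]
      rw [← intervalIntegral.integral_sub (hi _) (hi _)]
      refine intervalIntegral.integral_congr fun x _ => ?_
      simp only [hd]; ring
    linear_combination h1 - h2
  -- the limit
  have hdint : ∀ j < N, IntegrableOn (d j) (Iic x1) := by
    intro j hj
    obtain ⟨C, hC⟩ := hf.flat 1
    refine MeasureTheory.Integrable.mono' ((integrableOn_exp_Iic x1).const_mul
      (C / Real.sin (ε / 4))) (((hdc j hj).mono fun x (hx : x ≤ x1) =>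
        hx.trans_lt hx1).aestronglyMeasurable measurableSet_Iic) ?_
    refine (MeasureTheory.ae_restrict_iff' measurableSet_Iic).2 (.of_forall fun x hx => ?_)
    have h1 := hC j (x + b j * I) (by simpa using (show x ≤ x1 from hx).trans_lt hx1)
      (by simpa [hb] using hη)
    simp only [re_add_ofReal_mul_I, Nat.cast_one, one_mul] at h1
    have h2 := hlow j hj.le x
    simp only [hd, logKernel, norm_mul, norm_div]
    have h4 : ‖exp (x + b j * I)‖ = Real.exp x := by simp [norm_exp]
    rw [h4]
    have hC0 : 0 ≤ C * Real.exp x := (norm_nonneg _).trans h1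
    calc _ ≤ (C * Real.exp x) * (Real.exp x / (Real.sin (ε / 4) * Real.exp x)) := by gcongr
      _ = _ := by field_simp
  have hlimL : Tendsto (fun X => I * ∑ j ∈ Finset.range N, Lf j X) atBot (𝓝 0) := by
    rw [show (0 : ℂ) = I * ∑ j ∈ Finset.range N, (0 : ℂ) by simp]
    refine Tendsto.const_mul _ (tendsto_finsetSum _ fun j hj => ?_)
    have hcd : b j ≤ b (j + 1) := hbm (by omega)
    have hbd : ∀ᶠ X : ℝ in atBot, ‖Lf j X‖ ≤ ((B + ‖A‖) * (Real.exp X / (Real.exp w0.re / 2))) *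
        |b (j + 1) - b j| := by
      filter_upwards [eventually_lt_atBot (w0.re - 1), eventually_lt_atBot x0] with X hX hX0
      refine intervalIntegral.norm_integral_le_of_norm_le_const fun y hy => ?_
      rw [uIoc_of_le hcd] at hy
      have hη' := abs_lt.1 hη
      have h1 : ‖f (j + 1) (X + y * I)‖ ≤ B := by
        refine hf.bound _ _ (by simpa using hX0) ?_ ?_
        · have : (φ (j : ℤ)) + η < y := hy.1
          simp only [add_sub_cancel_right]
          simp; linarith
        · have : y ≤ φ (j + 1) + η := hy.2
          simp; linarith
      have h2 : Real.exp w0.re / 2 ≤ ‖exp (X + y * I) - exp w0‖ := by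
        rw [norm_sub_rev]
        exact half_exp_le_norm_sub (by rw [re_add_ofReal_mul_I]; exact hX.le)
      rw [norm_mul, logKernel, norm_div]
      have h4 : ‖exp (X + y * I : ℂ)‖ = Real.exp X := by simp [norm_exp]
      rw [h4]
      have h5 := norm_sub_le (f (j + 1) (X + y * I)) A
      have h7 : 0 ≤ B := (norm_nonneg _).trans h1
      gcongr
      linarith
    refine squeeze_zero_norm' hbd ?_
    have : Tendsto (fun X : ℝ => ((B + ‖A‖) * (Real.exp X / (Real.exp w0.re / 2))) *
        |b (j + 1) - b j|) atBot (𝓝 (((B + ‖A‖) * (0 / (Real.exp w0.re / 2))) *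
        |b (j + 1) - b j|)) :=
      ((Real.tendsto_exp_atBot.div_const _).const_mul _).mul_const _
    simpa using this
  have hlimR : Tendsto (fun X => I * ∑ j ∈ Finset.range N, R j -
      ∑ j ∈ Finset.range N, ∫ x in X..x1, d j x) atBot (𝓝 (I * ∑ j ∈ Finset.range N, R j -
      ∑ j ∈ Finset.range N, ∫ x in Iic x1, d j x)) :=
    tendsto_const_nhds.sub (tendsto_finsetSum _ fun j hj =>
      MeasureTheory.intervalIntegral_tendsto_integral_Iic _ (hdint j (Finset.mem_range.1 hj))
        tendsto_id)
  have hfin := tendsto_nhds_unique (hlimR.congr' (by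
    filter_upwards [eventually_lt_atBot w0.re] with X hX using hkey X hX)) hlimL
  have hsplit : ∑ j ∈ Finset.range N, R j = (∑ j ∈ Finset.range N,
      ∫ y in (b j)..(b (j + 1)), f (j + 1) (x1 + y * I) * logKernel w0 (x1 + y * I)) -
      A * (2 * π) := by
    have hki : ∀ c d : ℝ, IntervalIntegrable (fun y : ℝ => logKernel w0 (x1 + y * I))
        volume c d := fun c d =>
      (continuous_logKernel_im hw.ne').intervalIntegrable _ _
    have hsumk : ∑ j ∈ Finset.range N, ∫ y in (b j)..(b (j + 1)), logKernel w0 (x1 + y * I) =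
        2 * π := by
      have := intervalIntegral.sum_integral_adjacent_intervals (a := fun j : ℕ => b j) (n := N)
        (f := fun y : ℝ => logKernel w0 (x1 + y * I)) (μ := volume)
        fun k _ => hki _ _
      push_cast at this
      rw [this, hbN]
      exact integral_logKernel hw (b 0)
    rw [← hsumk, Finset.mul_sum, ← Finset.sum_sub_distrib]
    refine Finset.sum_congr rfl fun j _ => ?_
    rw [← intervalIntegral.integral_const_mul, ← intervalIntegral.integral_sub]
    · refine intervalIntegral.integral_congr fun y _ => ?_
      ring
    · exact ((continuous_line_im (hf.holomorphic _) hx1).mul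
        (continuous_logKernel_im hw.ne')).intervalIntegrable _ _
    · exact (hki _ _).const_mul _
  rw [hsplit] at hfin
  linear_combination hfin

end Core

section Core

variable {φ : ℤ → ℝ} {N : ℕ} {σ : ℝ} {f : ℤ → ℂ → ℂ} {ε x0 B : ℝ}

lemma IsSectorFamily.integrableOn_ray (hf : IsSectorFamily φ N f ε x0 B) {η : ℝ} (hη : |η| < ε)
    {x1 : ℝ} (hx1 : x1 < x0) (j : ℤ) {k : ℝ → ℂ} (hk : Continuous k) {M : ℝ}
    (hM : ∀ x, ‖k x‖ ≤ M) :
    IntegrableOn (fun x : ℝ => (f j (x + (φ j + η : ℝ) * I) -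
        f (j + 1) (x + (φ j + η : ℝ) * I)) * k x) (Iic x1) := by
  obtain ⟨C, hC⟩ := hf.flat 1
  have hc : ContinuousOn (fun x : ℝ => (f j (x + (φ j + η : ℝ) * I) -
        f (j + 1) (x + (φ j + η : ℝ) * I)) * k x) (Iio x0) :=
    ((continuousOn_line_re (hf.holomorphic _) _).sub
      (continuousOn_line_re (hf.holomorphic _) _)).mul hk.continuousOn
  refine MeasureTheory.Integrable.mono' ((integrableOn_exp_Iic x1).const_mul (C * M))
    ((hc.mono fun x (hx : x ≤ x1) => hx.trans_lt hx1).aestronglyMeasurable measurableSet_Iic) ?_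
  refine (MeasureTheory.ae_restrict_iff' measurableSet_Iic).2 (.of_forall fun x hx => ?_)
  have h1 := hC j (x + (φ j + η : ℝ) * I)
    (by simpa using (show x ≤ x1 from hx).trans_lt hx1) (by simpa using hη)
  simp only [re_add_ofReal_mul_I, Nat.cast_one, one_mul] at h1
  have hC0 : 0 ≤ C * Real.exp x := (norm_nonneg _).trans h1
  rw [norm_mul]
  calc _ ≤ (C * Real.exp x) * M := by gcongr; exact hM x
    _ = _ := by ring

/-- The functions of a sector family converge to a common constant at the rate `|ζ|`, away from
the chosen rays. -/
lemma IsSectorFamily.exists_limit_aux (hφ : IsAngleSequence φ N σ)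
    (hf : IsSectorFamily φ N f ε x0 B) (hε : 0 < ε) (hε1 : ε ≤ 1)
    {η : ℝ} (hη : |η| < ε) :
    ∃ (c : ℂ) (C : ℝ), ∀ k < N, ∀ w0 : ℂ, w0.re ≤ x0 - 2 → φ (k : ℕ) + η + ε / 4 ≤ w0.im →
      w0.im ≤ φ ((k : ℕ) + 1) + η - ε / 4 → ‖f ((k : ℕ) + 1) w0 - c‖ ≤ C * Real.exp w0.re := by
  set x1 := x0 - 1
  have hx1 : x1 < x0 := by linarith
  have hpi := Real.pi_gt_three
  set s := Real.sin (ε / 4)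
  have hsin : 0 < s := Real.sin_pos_of_pos_of_lt_pi (by positivity) (by linarith)
  obtain ⟨C2, hC2⟩ := hf.flat 2
  set P : ℂ := ∑ j ∈ Finset.range N, ∫ y in (φ j + η)..(φ (j + 1) + η), f (j + 1) (x1 + y * I)
  set Q : ℂ := ∑ j ∈ Finset.range N, ∫ x in Iic x1, (f j (x + (φ j + η : ℝ) * I) -
        f (j + 1) (x + (φ j + η : ℝ) * I)) * 1
  set C1 : ℝ := ∑ j ∈ Finset.range N, (B * (2 / Real.exp x1)) * |φ (j + 1) + η - (φ j + η)|
  set C3 : ℝ := ∑ j ∈ Finset.range N, ‖C2 / s‖ * Real.exp x1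
  refine ⟨(I * P - Q) / (2 * π * I), (C1 + C3) / (2 * π), fun k hk w0 hw hl hr => ?_⟩
  have hw1 : w0.re < x1 := by linarith
  have hcf := hf.cauchy_formula hφ hε hε1 hη hx1 hk hw1 hl hr
  have hbm : ∀ {m n : ℤ}, m ≤ n → φ m + η ≤ φ n + η := fun h => by linarith [hφ.mono h]
  have hlow : ∀ j : ℕ, j < N → ∀ x : ℝ,
      s * Real.exp x ≤ ‖exp (x + (φ j + η : ℝ) * I) - exp w0‖ := fun j hj =>
    hφ.sin_mul_exp_le hε hk hl hr hj.le
  have hne : ∀ j : ℕ, j < N → ∀ x : ℝ, exp (x + (φ j + η : ℝ) * I) ≠ exp w0 := by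
    intro j hj x h
    have := hlow j hj x
    rw [h, sub_self, norm_zero] at this
    have h2 := mul_pos hsin (Real.exp_pos x)
    linarith
  have hk1 : ∀ j : ℕ, j < N → ∀ x : ℝ, ‖logKernel w0 (x + (φ j + η : ℝ) * I) - 1‖ ≤
      Real.exp w0.re / (s * Real.exp x) := by
    intro j hj x
    have := mul_pos hsin (Real.exp_pos x)
    rw [logKernel_sub_one (hne j hj x), norm_div, norm_exp]
    exact div_le_div_of_nonneg_left (Real.exp_pos _).le this (hlow j hj x)
  have hk0 : ∀ j : ℕ, j < N → ∀ x : ℝ, ‖logKernel w0 (x + (φ j + η : ℝ) * I)‖ ≤ 1 / s := by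
    intro j hj x
    have h3 := mul_pos hsin (Real.exp_pos x)
    rw [logKernel, norm_div]
    have h4 : ‖exp (x + (φ j + η : ℝ) * I)‖ = Real.exp x := by simp [norm_exp]
    rw [h4]
    calc _ ≤ Real.exp x / (s * Real.exp x) :=
          div_le_div_of_nonneg_left (Real.exp_pos _).le h3 (hlow j hj x)
      _ = 1 / s := by field_simp
  -- first sum
  have e1 : (∑ j ∈ Finset.range N, ∫ y in (φ j + η)..(φ (j + 1) + η),
        f (j + 1) (x1 + y * I) * logKernel w0 (x1 + y * I)) - P =
      ∑ j ∈ Finset.range N, ∫ y in (φ j + η)..(φ (j + 1) + η),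
        f (j + 1) (x1 + y * I) * (logKernel w0 (x1 + y * I) - 1) := by
    rw [← Finset.sum_sub_distrib]
    refine Finset.sum_congr rfl fun j hj => ?_
    have hc := continuous_line_im (hf.holomorphic (j + 1)) hx1
    have hck : Continuous fun y : ℝ => f (j + 1) (x1 + y * I) * logKernel w0 (x1 + y * I) :=
      hc.mul (continuous_logKernel_im hw1.ne')
    rw [← intervalIntegral.integral_sub (hck.intervalIntegrable _ _) (hc.intervalIntegrable _ _)]
    exact intervalIntegral.integral_congr fun y _ => by ring
  have b1 : ‖∑ j ∈ Finset.range N, ∫ y in (φ j + η)..(φ (j + 1) + η),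
        f (j + 1) (x1 + y * I) * (logKernel w0 (x1 + y * I) - 1)‖ ≤ C1 * Real.exp w0.re := by
    rw [Finset.sum_mul]
    refine norm_sum_le_of_le _ fun j hj => ?_
    have hcd : φ j + η ≤ φ (j + 1) + η := hbm (by omega)
    calc _ ≤ (B * (Real.exp w0.re * 2 / Real.exp x1)) * |φ (j + 1) + η - (φ j + η)| := by
          refine intervalIntegral.norm_integral_le_of_norm_le_const fun y hy => ?_
          rw [uIoc_of_le hcd] at hy
          have hη' := abs_lt.1 hη
          have h1 : ‖f (j + 1) (x1 + y * I)‖ ≤ B := by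
            refine hf.bound _ _ (by simpa using hx1) ?_ ?_
            · simp only [add_sub_cancel_right]
              simp; linarith [hy.1]
            · simp; linarith [hy.2]
          have hne1 : exp (x1 + y * I) ≠ exp w0 := fun h => hw1.ne' (by
            have := congrArg norm h
            simpa [norm_exp] using this)
          have h2 : Real.exp x1 / 2 ≤ ‖exp (x1 + y * I) - exp w0‖ := by
            simpa using half_exp_le_norm_sub (z := x1 + y * I) (w := w0) (by simp; linarith)
          have hB : 0 ≤ B := (norm_nonneg _).trans h1
          rw [norm_mul, logKernel_sub_one hne1, norm_div, norm_exp]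
          refine mul_le_mul h1 ?_ (by positivity) hB
          calc Real.exp w0.re / ‖exp (x1 + y * I) - exp w0‖
              ≤ Real.exp w0.re / (Real.exp x1 / 2) :=
                div_le_div_of_nonneg_left (Real.exp_pos _).le (by positivity) h2
            _ = _ := by field_simp
      _ = _ := by ring
  -- second sum
  have e2 : (∑ j ∈ Finset.range N, ∫ x in Iic x1, (f j (x + (φ j + η : ℝ) * I) -
        f (j + 1) (x + (φ j + η : ℝ) * I)) * logKernel w0 (x + (φ j + η : ℝ) * I)) - Q =
      ∑ j ∈ Finset.range N, ∫ x in Iic x1, (f j (x + (φ j + η : ℝ) * I) -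
        f (j + 1) (x + (φ j + η : ℝ) * I)) * (logKernel w0 (x + (φ j + η : ℝ) * I) - 1) := by
    rw [← Finset.sum_sub_distrib]
    refine Finset.sum_congr rfl fun j hj => ?_
    have hj' := Finset.mem_range.1 hj
    rw [← MeasureTheory.integral_sub
      (hf.integrableOn_ray hη hx1 j (continuousOn_logKernel_re (hne j hj')) (hk0 j hj'))
      (hf.integrableOn_ray hη hx1 j continuous_const (M := 1) (by simp))]
    exact MeasureTheory.integral_congr_ae (.of_forall fun x => by ring)
  have b2 : ‖∑ j ∈ Finset.range N, ∫ x in Iic x1, (f j (x + (φ j + η : ℝ) * I) -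
        f (j + 1) (x + (φ j + η : ℝ) * I)) * (logKernel w0 (x + (φ j + η : ℝ) * I) - 1)‖ ≤
      C3 * Real.exp w0.re := by
    rw [Finset.sum_mul]
    refine norm_sum_le_of_le _ fun j hj => ?_
    have hj' := Finset.mem_range.1 hj
    have hdom : IntegrableOn (fun x => ‖C2 / s‖ * Real.exp w0.re * Real.exp x)
        (Iic x1) := (integrableOn_exp_Iic x1).const_mul _
    refine (MeasureTheory.norm_integral_le_of_norm_le hdom
      ((MeasureTheory.ae_restrict_iff' measurableSet_Iic).2
        (.of_forall fun x hx => ?_))).trans_eq ?_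
    · have h1 := hC2 j (x + (φ j + η : ℝ) * I)
        (by simpa using (show x ≤ x1 from hx).trans_lt hx1) (by simpa using hη)
      simp only [re_add_ofReal_mul_I] at h1
      have h2 := hk1 j hj' x
      have h3 : Real.exp ((2 : ℕ) * x) = Real.exp x * Real.exp x := by
        rw [← Real.exp_add]; congr 1; push_cast; ring
      rw [h3] at h1
      rw [norm_mul]
      have h4 : 0 ≤ C2 * (Real.exp x * Real.exp x) := (norm_nonneg _).trans h1
      calc _ ≤ (C2 * (Real.exp x * Real.exp x)) * (Real.exp w0.re / (s * Real.exp x)) := by gcongr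
        _ = (C2 / s) * Real.exp w0.re * Real.exp x := by field_simp
        _ ≤ _ := by gcongr; exact Real.le_norm_self _
    · rw [MeasureTheory.integral_const_mul, integral_exp_Iic]
      ring
  have hpi0 : (2 * π * I : ℂ) ≠ 0 := by simp [Real.pi_ne_zero, I_ne_zero]
  have hfin : f ((k : ℕ) + 1) w0 - (I * P - Q) / (2 * π * I) =
      (I * (∑ j ∈ Finset.range N, ∫ y in (φ j + η)..(φ (j + 1) + η),
        f (j + 1) (x1 + y * I) * (logKernel w0 (x1 + y * I) - 1)) -
      ∑ j ∈ Finset.range N, ∫ x in Iic x1, (f j (x + (φ j + η : ℝ) * I) -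
        f (j + 1) (x + (φ j + η : ℝ) * I)) * (logKernel w0 (x + (φ j + η : ℝ) * I) - 1)) /
        (2 * π * I) := by
    rw [← e1, ← e2, eq_div_iff hpi0, sub_mul, div_mul_cancel₀ _ hpi0]
    linear_combination -hcf
  rw [hfin, norm_div]
  have hn : ‖(2 * π * I : ℂ)‖ = 2 * π := by
    simp [abs_of_pos Real.pi_pos]
  rw [hn, div_mul_eq_mul_div]
  refine div_le_div_of_nonneg_right ?_ (by positivity)
  refine (norm_sub_le _ _).trans ?_
  rw [norm_mul, norm_I, one_mul, add_mul]
  exact add_le_add b1 b2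

lemma IsAngleSequence.periodic_int (hφ : IsAngleSequence φ N σ) (m q : ℤ) :
    φ (m + q * N) = φ m + q * (2 * π) := by
  induction q using Int.induction_on with
  | zero => simp
  | succ i ih =>
    have := hφ.periodic (m + i * N)
    rw [ih] at this
    rw [show m + ((i : ℤ) + 1) * N = m + i * N + N by ring, this]; push_cast; ring
  | pred i ih =>
    have := hφ.periodic (m + (-i - 1) * N)
    rw [show m + (-(i : ℤ) - 1) * N + N = m + -i * N by ring, ih] at this
    push_cast at this ⊢; linarith

lemma IsSectorFamily.periodic_int (hf : IsSectorFamily φ N f ε x0 B) (m q : ℤ) {w : ℂ}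
    (hw : w.re < x0) : f (m + q * N) (w + q * (2 * π * I)) = f m w := by
  have hre : ∀ i : ℤ, (w + i * (2 * π * I)).re < x0 := fun i => by simpa using hw
  induction q using Int.induction_on with
  | zero => simp
  | succ i ih =>
    have := hf.periodic (m + i * N) _ (hre i)
    rw [Int.cast_natCast] at this
    rw [← ih, Int.cast_natCast, ← this]; congr 1
    · ring
    · push_cast; ring
  | pred i ih =>
    have := hf.periodic (m + (-i - 1) * N) _ (hre (-i - 1))
    rw [← this, ← ih]; congr 1
    · ring
    · push_cast; ring

lemma exists_nat_add_mul (hN : 0 < N) (m : ℤ) : ∃ (k : ℕ) (q : ℤ), k < N ∧ m =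
    (k + 1 : ℤ) + q * N := by
  have hN' : (0 : ℤ) < N := by exact_mod_cast hN
  refine ⟨((m - 1) % N).toNat, (m - 1) / N, ?_, ?_⟩
  · have := Int.emod_lt_of_pos (m - 1) hN'
    have h2 := Int.emod_nonneg (m - 1) hN'.ne'
    omega
  · have h2 := Int.emod_nonneg (m - 1) hN'.ne'
    have h3 := Int.emod_add_mul_ediv (m - 1) N
    rw [Int.toNat_of_nonneg h2]
    linarith [mul_comm ((m - 1) / (N : ℤ)) (N : ℤ)]

lemma IsSectorFamily.exists_limit_of_shift (hφ : IsAngleSequence φ N σ)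
    (hf : IsSectorFamily φ N f ε x0 B) (hε : 0 < ε) (hε1 : ε ≤ 1) {η : ℝ} (hη : |η| < ε) :
    ∃ (c : ℂ) (C : ℝ), ∀ (m : ℤ) (w0 : ℂ), w0.re ≤ x0 - 2 → φ (m - 1) + η + ε / 4 ≤ w0.im →
      w0.im ≤ φ m + η - ε / 4 → ‖f m w0 - c‖ ≤ C * Real.exp w0.re := by
  obtain ⟨c, C, h⟩ := hf.exists_limit_aux hφ hε hε1 hη
  refine ⟨c, C, fun m w0 hw hl hr => ?_⟩
  obtain ⟨k, q, hk, rfl⟩ := exists_nat_add_mul hφ.N_pos m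
  have hre : (w0 - q * (2 * π * I)).re = w0.re := by simp
  have him : (w0 - q * (2 * π * I)).im = w0.im - q * (2 * π) := by simp
  have h1 := hf.periodic_int (k + 1) q (w := w0 - q * (2 * π * I)) (by rw [hre]; linarith)
  rw [sub_add_cancel] at h1
  rw [h1, ← hre]
  rw [show (k + 1 : ℤ) + q * N - 1 = k + q * N by ring, hφ.periodic_int] at hl
  rw [hφ.periodic_int] at hr
  exact h k hk _ (by rw [hre]; exact hw) (by rw [him]; linarith) (by rw [him]; linarith)

lemma tendsto_const_mul_exp_atBot (C : ℝ) :
    Tendsto (fun x : ℝ => C * Real.exp x) atBot (𝓝 0) := by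
  simpa using Real.tendsto_exp_atBot.const_mul C

/-- Dividing out the common constant term of a sector family gives a sector family. -/
lemma IsSectorFamily.exists_step (hφ : IsAngleSequence φ N σ)
    (hf : IsSectorFamily φ N f ε x0 B) (hε : 0 < ε) (hε1 : ε ≤ 1) (hεσ : 2 * ε ≤ σ) :
    ∃ (c : ℂ) (C : ℝ), IsSectorFamily φ N (fun m w => (f m w - c) * exp (-w)) (ε / 4) (x0 - 2) C := by
  obtain ⟨c, C, h⟩ := hf.exists_limit_of_shift hφ hε hε1 (η := ε / 2)
    (by rw [abs_of_pos (by positivity)]; linarith)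
  obtain ⟨c', C', h'⟩ := hf.exists_limit_of_shift hφ hε hε1 (η := -(ε / 2))
    (by rw [abs_neg, abs_of_pos (by positivity)]; linarith)
  have hcc : c' = c := by
    have hg := hφ.gap 0
    have hlim : ∀ (a : ℂ) (M : ℝ), (∀ x ≤ x0 - 2,
        ‖f 1 (x + (φ 0 + 3 * ε / 4 : ℝ) * I) - a‖ ≤ M * Real.exp x) →
        Tendsto (fun x : ℝ => f 1 (x + (φ 0 + 3 * ε / 4 : ℝ) * I)) atBot (𝓝 a) := by
      intro a M hM
      rw [tendsto_iff_norm_sub_tendsto_zero]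
      refine squeeze_zero' (.of_forall fun _ => norm_nonneg _) ?_
        (tendsto_const_mul_exp_atBot M)
      filter_upwards [eventually_le_atBot (x0 - 2)] with x hx using hM x hx
    refine tendsto_nhds_unique (hlim c' C' fun x hx => ?_) (hlim c C fun x hx => ?_)
    · have := h' 1 (x + (φ 0 + 3 * ε / 4 : ℝ) * I) (by simpa using hx) (by simp; linarith)
        (by simp at hg ⊢; linarith)
      simpa using this
    · have := h 1 (x + (φ 0 + 3 * ε / 4 : ℝ) * I) (by simpa using hx) (by simp; linarith)
        (by simp at hg ⊢; linarith)
      simpa using this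
  subst hcc
  refine ⟨c', max C C', ?_, ?_, ?_, ?_⟩
  · intro m
    have := (hf.holomorphic m).mono (t := {w : ℂ | w.re < x0}) (s := {w : ℂ | w.re < x0 - 2})
      (fun w (hw : w.re < x0 - 2) => show w.re < x0 by linarith)
    exact (this.sub_const c').mul (by fun_prop)
  · intro m w hw
    have := hf.periodic m w (by linarith)
    simp only [this, neg_add]
    rw [Complex.exp_add, Complex.exp_neg (2 * π * I), Complex.exp_two_pi_mul_I]
    simp
  · intro m w hw h1 h2
    have hg := hφ.gap (m - 1)
    rw [sub_add_cancel] at hg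
    have hb : ‖f m w - c'‖ ≤ max C C' * Real.exp w.re := by
      rcases le_total (φ (m - 1) + 3 * ε / 4) w.im with hy | hy
      · exact (h m w hw.le (by linarith) (by linarith)).trans
          (mul_le_mul_of_nonneg_right (le_max_left _ _) (Real.exp_pos _).le)
      · exact (h' m w hw.le (by linarith) (by linarith)).trans
          (mul_le_mul_of_nonneg_right (le_max_right _ _) (Real.exp_pos _).le)
    rw [norm_mul, norm_exp, neg_re]
    calc _ ≤ max C C' * Real.exp w.re * Real.exp (-w.re) := by gcongr
      _ = _ := by rw [mul_assoc, ← Real.exp_add]; simp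
  · intro K
    obtain ⟨D, hD⟩ := hf.flat (K + 1)
    refine ⟨D, fun m w hw h1 => ?_⟩
    have := hD m w (by linarith) (by linarith)
    rw [← sub_mul, norm_mul, norm_exp, neg_re]
    rw [show f m w - c' - (f (m + 1) w - c') = f m w - f (m + 1) w by ring]
    calc _ ≤ D * Real.exp ((K + 1 : ℕ) * w.re) * Real.exp (-w.re) := by gcongr
      _ = _ := by
        rw [mul_assoc, ← Real.exp_add]
        congr 2
        push_cast; ring

/-- The functions of a sector family have a common asymptotic expansion in powers of `ζ = e^w`. -/
theorem IsSectorFamily.exists_expansion (hφ : IsAngleSequence φ N σ)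
    (hf : IsSectorFamily φ N f ε x0 B) (hε : 0 < ε) :
    ∃ p : PowerSeries ℂ, ∀ K : ℕ, ∃ ε' > 0, ∃ x' C : ℝ, ∀ (m : ℤ) (w : ℂ), w.re < x' →
      φ (m - 1) - ε' < w.im → w.im < φ m + ε' →
      ‖f m w - ∑ i ∈ Finset.range K, coeff i p * exp w ^ i‖ ≤
        C * Real.exp (K * w.re) := by
  set S := {F : ℤ → ℂ → ℂ // ∃ ε > 0, ε ≤ 1 ∧ 2 * ε ≤ σ ∧ ∃ x0 B, IsSectorFamily φ N F ε x0 B}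
  have hstep : ∀ F : S, ∃ (c : ℂ) (F' : S), ∀ m w, F'.1 m w = (F.1 m w - c) * exp (-w) := by
    rintro ⟨F, ε, hε, hε1, hεσ, x0, B, hF⟩
    obtain ⟨c, C, h⟩ := hF.exists_step hφ hε hε1 hεσ
    exact ⟨c, ⟨_, ε / 4, by positivity, by linarith, by linarith, _, _, h⟩, fun _ _ => rfl⟩
  choose c nxt hnxt using hstep
  have hσ := hφ.gap_pos
  set ε1 := min ε (min 1 (σ / 2))
  have hε₁1 : ε1 ≤ 1 := (min_le_right _ _).trans (min_le_left _ _)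
  have hε₁σ : ε1 ≤ σ / 2 := (min_le_right _ _).trans (min_le_right _ _)
  set F0 : S := ⟨f, ε1, by positivity, hε₁1, by linarith, x0, B, hf.mono (min_le_left _ _) le_rfl⟩
    with hF0
  set s : ℕ → S := fun n => Nat.rec F0 (fun _ F => nxt F) n with hs
  have key : ∀ K m w, f m w - ∑ i ∈ Finset.range K, c (s i) * exp w ^ i =
      (s K).1 m w * exp w ^ K := by
    intro K
    induction K with
    | zero => intro m w; simp [hs, hF0]
    | succ K ih =>
      intro m w
      have e : (s (K + 1)).1 m w = ((s K).1 m w - c (s K)) * exp (-w) := hnxt (s K) m w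
      rw [e, Finset.sum_range_succ, ← sub_sub, ih, pow_succ, Complex.exp_neg]
      have := Complex.exp_ne_zero w
      field_simp
  refine ⟨PowerSeries.mk fun i => c (s i), fun K => ?_⟩
  obtain ⟨ε', hε', -, -, x', C, hC⟩ := (s K).2
  refine ⟨ε', hε', x', C, fun m w hw h1 h2 => ?_⟩
  simp only [PowerSeries.coeff_mk]
  rw [key, norm_mul, norm_pow, norm_exp, ← Real.exp_nat_mul]
  exact mul_le_mul_of_nonneg_right (hC.bound m w hw h1 h2) (Real.exp_pos _).le

/-- The expansion of a sector family may be differentiated. -/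
theorem IsSectorFamily.exists_expansion_deriv (hφ : IsAngleSequence φ N σ)
    (hf : IsSectorFamily φ N f ε x0 B) (hε : 0 < ε) :
    ∃ p : PowerSeries ℂ, ∀ K : ℕ, ∃ ε' > 0, ∃ x' C : ℝ, ∀ (m : ℤ) (w : ℂ), w.re < x' →
      φ (m - 1) - ε' < w.im → w.im < φ m + ε' →
      ‖f m w - ∑ i ∈ Finset.range K, coeff i p * exp w ^ i‖ ≤
        C * Real.exp (K * w.re) ∧
      ‖deriv (f m) w - ∑ i ∈ Finset.range K,
        coeff i (PowerSeries.X * derivative ℂ p) * exp w ^ i‖ ≤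
        C * Real.exp (K * w.re) := by
  obtain ⟨p, hp⟩ := hf.exists_expansion hφ hε
  refine ⟨p, fun K => ?_⟩
  obtain ⟨ε', hε', x', C, h⟩ := hp K
  set δ := min (ε' / 2) 1
  have hδ0 : 0 < δ := by positivity
  have hδε : δ ≤ ε' / 2 := min_le_left _ _
  refine ⟨ε' / 2, by positivity, min x' x0 - 1, max C (|C| * Real.exp K / δ),
    fun m w hw h1 h2 => ⟨?_, ?_⟩⟩
  · refine (h m w ?_ (by linarith) (by linarith)).trans
      (mul_le_mul_of_nonneg_right (le_max_left _ _) (Real.exp_pos _).le)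
    have := min_le_left x' x0; linarith
  · have hx' := min_le_left x' x0
    have hx0 := min_le_right x' x0
    set g : ℂ → ℂ := fun w => f m w - ∑ i ∈ Finset.range K, coeff i p * exp w ^ i
    have hball : ∀ z ∈ Metric.closedBall w δ, z.re < x' ∧ z.re < x0 ∧ z.re ≤ w.re + 1 ∧
        φ (m - 1) - ε' < z.im ∧ z.im < φ m + ε' := by
      intro z hz
      rw [Metric.mem_closedBall, dist_eq_norm] at hz
      have a1 := (le_abs_self _).trans ((abs_re_le_norm (z - w)).trans hz)
      have a2 := abs_le.1 ((abs_im_le_norm (z - w)).trans hz)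
      rw [sub_re] at a1
      rw [sub_im] at a2
      have : δ ≤ 1 := min_le_right _ _
      refine ⟨by linarith, by linarith, by linarith, by linarith, by linarith⟩
    have hsumd : ∀ z, HasDerivAt (fun w => ∑ i ∈ Finset.range K, coeff i p * exp w ^ i)
        (∑ i ∈ Finset.range K, coeff i (PowerSeries.X * derivative ℂ p) *
          exp z ^ i) z := by
      intro z
      refine HasDerivAt.fun_sum fun i _ => ?_
      have := ((Complex.hasDerivAt_exp z).pow i).const_mul (coeff i p)
      refine this.congr_deriv ?_
      rcases i with _ | i
      · simp
      · rw [PowerSeries.coeff_succ_X_mul, PowerSeries.coeff_derivative]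
        simp only [Nat.add_sub_cancel, pow_succ]
        push_cast
        ring
    have hfd : ∀ z, z.re < x0 → DifferentiableAt ℂ (f m) z := fun z hz =>
      (hf.holomorphic m).differentiableAt
        ((isOpen_re_lt _).mem_nhds hz)
    have hgd : ∀ z, z.re < x0 → DifferentiableAt ℂ g z := fun z hz =>
      (hfd z hz).sub (hsumd z).differentiableAt
    have hwx : w.re < x0 := by linarith
    have hder : deriv g w = deriv (f m) w - ∑ i ∈ Finset.range K,
        coeff i (PowerSeries.X * derivative ℂ p) * exp w ^ i :=
      ((hfd w hwx).hasDerivAt.sub (hsumd w)).deriv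
    rw [← hder]
    have hdc : DiffContOnCl ℂ g (Metric.ball w δ) := by
      refine DifferentiableOn.diffContOnCl ?_
      rw [closure_ball _ hδ0.ne']
      exact fun z hz => (hgd z (hball z hz).2.1).differentiableWithinAt
    have := Complex.norm_deriv_le_of_forall_mem_sphere_norm_le hδ0 hdc
      (C := |C| * (Real.exp K * Real.exp (K * w.re))) fun z hz => by
        have hz' := hball z (Metric.sphere_subset_closedBall hz)
        refine (h m z hz'.1 hz'.2.2.2.1 hz'.2.2.2.2).trans ?_
        rw [← Real.exp_add]
        refine mul_le_mul (le_abs_self _) (Real.exp_le_exp.2 ?_) (Real.exp_pos _).le (abs_nonneg _)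
        have := mul_le_mul_of_nonneg_left hz'.2.2.1 (Nat.cast_nonneg K (α := ℝ))
        linarith
    refine this.trans ?_
    calc _ = |C| * Real.exp K / δ * Real.exp (K * w.re) := by ring
      _ ≤ _ := mul_le_mul_of_nonneg_right (le_max_right _ _) (Real.exp_pos _).le

end Core

/-! ### Local data at one pole, in the logarithmic coordinate -/

/-- The data of the Riemann--Hilbert problem near one pole, written in the coordinate
`w = log (z - a)`. All the objects are indexed by the sheets of the logarithm: `line m` is the
`m`-th Stokes line, `line (m + N)` being its next copy. -/
structure LocalData (r : ℕ) where
  n : ℕ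
  T : Fin n → Fin r → ℂ
  L : Fin r → ℂ
  N : ℕ
  θ : ℝ
  xτ : ℝ
  xρ : ℝ
  xR : ℝ
  line : ℤ → ℝ → ℝ
  lineDeriv : ℤ → ℝ → ℝ
  φ : ℤ → ℝ
  S : ℤ → Mat r
  R : ℤ → Mat r
  M0 : Mat r
  height : ℤ → Fin r → ℝ
  N_pos : 0 < N
  xτ_lt_xρ : xτ < xρ
  xρ_lt_xR : xρ < xR
  T_traceless : ∀ l, ∑ p, T l p = 0
  L_traceless : ∑ p, L p = 0
  line_add : ∀ (m : ℤ) x, line (m + N) x = line m x + 2 * π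
  line_of_ge : ∀ m : ℤ, 0 ≤ m → m < N → ∀ x, xτ ≤ x → line m x = θ
  line_lt : ∀ (m : ℤ) x, x < xτ → line m x < line (m + 1) x
  line_continuous : ∀ m, Continuous (line m)
  line_hasDerivAt : ∀ m x, x < xτ → HasDerivAt (line m) (lineDeriv m x) x
  lineDeriv_continuousAt : ∀ m x, x < xτ → ContinuousAt (lineDeriv m) x
  line_tendsto : ∀ m, Tendsto (line m) atBot (𝓝 (φ m))
  angles : ∃ σ, IsAngleSequence φ N σ
  R_det : ∀ m, (R m).det = 1
  R_succ : ∀ m : ℤ, R m = R (m + 1) * S m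
  R_add : ∀ m : ℤ, M0 * R (m + N) = R m * Matrix.diagonal fun p => exp (2 * π * I * L p)
  R_period : R N = 1
  S_diag : ∀ m p, S m p p = 1
  S_triangular : ∀ m p q, p ≠ q → S m p q ≠ 0 → height m p < height m q
  S_flat : ∀ m p q, p ≠ q → S m p q ≠ 0 → ∃ ε > 0, ∀ K : ℕ, ∃ C, ∀ w : ℂ, w.re < xτ →
    |w.im - φ m| < ε →
    ‖exp ((∑ l, T l p * exp (-(((l : ℕ) + 1 : ℕ) * w)) + L p * w) -
      (∑ l, T l q * exp (-(((l : ℕ) + 1 : ℕ) * w)) + L q * w))‖ ≤ C * Real.exp (K * w.re)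

namespace LocalData

variable {r : ℕ} (L : LocalData r)

/-- The diagonal entries of `T`, as functions of `w`. -/
def toral (w : ℂ) (p : Fin r) : ℂ := ∑ l, L.T l p * exp (-(((l : ℕ) + 1 : ℕ) * w))

/-- The diagonal entries of `T̂`, as functions of `w`. -/
def That (w : ℂ) (p : Fin r) : ℂ := L.toral w p + L.L p * w

/-- The matrix `e^{T̂}`. -/
def expThat (w : ℂ) : Mat r := Matrix.diagonal fun p => exp (L.That w p)

/-- The matrix `e^{L w}`. -/
def expL (w : ℂ) : Mat r := Matrix.diagonal fun p => exp (L.L p * w)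

/-- The preimage of the contour. -/
def cuts : Set ℂ := {w | (∃ m, w.im = L.line m w.re) ∨ w.re = L.xτ ∨ w.re = L.xρ}

/-- The preimage of the marked points of the circles. -/
def corners : Set ℂ := {w | (∃ m, w.im = L.line m w.re) ∧ (w.re = L.xτ ∨ w.re = L.xρ)}

/-- The pullback `u` of a solution of the Riemann--Hilbert problem to the logarithmic coordinate:
the jump conditions are imposed on one sheet only. -/
structure IsJumpSolution (u : ℂ → Mat r) : Prop where
  analytic : ∀ w, w.re < L.xR → w ∉ L.cuts → ∀ p q, AnalyticAt ℂ (fun w => u w p q) w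
  bounded : ∃ B, ∀ w, w.re < L.xR → w ∉ L.cuts → ∀ p q, ‖u w p q‖ ≤ B
  det_eq_one : ∀ w, w.re < L.xR → w ∉ L.cuts → (u w).det = 1
  periodic : ∀ w, u (w + 2 * π * I) = u w
  stokes : ∀ m : ℤ, 0 ≤ m → m < L.N → ∀ w : ℂ, w.re < L.xτ → w.im = L.line m w.re → ∃ Ga Gb,
    Tendsto (fun σ : ℝ => u (w + σ * I)) (𝓝[>] 0) (𝓝 Ga) ∧
    Tendsto (fun σ : ℝ => u (w + σ * I)) (𝓝[<] 0) (𝓝 Gb) ∧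
    Gb * L.expThat w = Ga * L.expThat w * L.S m
  neck : ∀ w : ℂ, L.xτ < w.re → w.re < L.xρ → w.im = L.θ → ∃ Ga Gb,
    Tendsto (fun σ : ℝ => u (w + σ * I)) (𝓝[>] 0) (𝓝 Ga) ∧
    Tendsto (fun σ : ℝ => u (w + σ * I)) (𝓝[<] 0) (𝓝 Gb) ∧
    Gb * L.expL w = Ga * L.expL w * L.R 0
  stem : ∀ w : ℂ, L.xρ < w.re → w.re < L.xR → w.im = L.θ → ∃ Ga Gb,
    Tendsto (fun σ : ℝ => u (w + σ * I)) (𝓝[>] 0) (𝓝 Ga) ∧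
    Tendsto (fun σ : ℝ => u (w + σ * I)) (𝓝[<] 0) (𝓝 Gb) ∧
    Gb = Ga * L.M0
  toralCircle : ∀ w : ℂ, w.re = L.xτ → L.θ < w.im → w.im < L.θ + 2 * π → ∃ Gi Go,
    Tendsto (fun σ : ℝ => u (w + σ)) (𝓝[<] 0) (𝓝 Gi) ∧
    Tendsto (fun σ : ℝ => u (w + σ)) (𝓝[>] 0) (𝓝 Go) ∧
    Gi * L.expThat w = Go * L.expL w
  formalCircle : ∀ w : ℂ, w.re = L.xρ → L.θ < w.im → w.im < L.θ + 2 * π → ∃ Gi Go,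
    Tendsto (fun σ : ℝ => u (w + σ)) (𝓝[<] 0) (𝓝 Gi) ∧
    Tendsto (fun σ : ℝ => u (w + σ)) (𝓝[>] 0) (𝓝 Go) ∧
    Gi * L.expL w = Go

/-! #### The sectors between the lines -/

lemma line_add_mul (m k : ℤ) (x : ℝ) :
    L.line (m + k * L.N) x = L.line m x + 2 * π * k := by
  induction k using Int.induction_on with
  | zero => simp
  | succ k ih =>
    have := L.line_add (m + k * L.N) x
    rw [show m + ((k : ℤ) + 1) * L.N = m + k * L.N + L.N by ring, this, ih]
    push_cast; ring
  | pred k ih =>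
    have := L.line_add (m + (-(k : ℤ) - 1) * L.N) x
    rw [show m + (-(k : ℤ) - 1) * L.N + L.N = m + (-(k : ℤ)) * L.N by ring, ih] at this
    push_cast at this ⊢
    linarith

lemma line_eq (m : ℤ) {x : ℝ} (hx : L.xτ ≤ x) :
    L.line m x = L.θ + 2 * π * ((m / L.N : ℤ) : ℝ) := by
  have hN : (0 : ℤ) < L.N := by exact_mod_cast L.N_pos
  have h := L.line_add_mul (m % L.N) (m / L.N) x
  rw [show m % L.N + m / L.N * L.N = m by
    rw [mul_comm]; exact Int.emod_add_mul_ediv m L.N] at h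
  rw [h, L.line_of_ge _ (Int.emod_nonneg _ hN.ne') (Int.emod_lt_of_pos _ hN) x hx]

lemma line_monotone (x : ℝ) : Monotone fun m => L.line m x := by
  rcases lt_or_ge x L.xτ with hx | hx
  · exact monotone_int_of_le_succ fun m => (L.line_lt m x hx).le
  · intro m m' h
    have hN : (0 : ℤ) < L.N := by exact_mod_cast L.N_pos
    simp only [L.line_eq _ hx]
    have : (m / L.N : ℤ) ≤ m' / L.N := Int.ediv_le_ediv hN h
    have : ((m / L.N : ℤ) : ℝ) ≤ ((m' / L.N : ℤ) : ℝ) := by exact_mod_cast this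
    nlinarith [Real.pi_pos]

lemma line_strictMono {x : ℝ} (hx : x < L.xτ) : StrictMono fun m => L.line m x :=
  strictMono_int_of_lt_succ fun m => L.line_lt m x hx

lemma exists_sector (w : ℂ) :
    ∃ m, L.line (m - 1) w.re < w.im ∧ w.im ≤ L.line m w.re := by
  have hb : ∃ b : ℤ, ∀ z : ℤ, w.im ≤ L.line z w.re → b ≤ z := by
    obtain ⟨k, hk⟩ := exists_int_lt ((w.im - L.line 0 w.re) / (2 * π))
    refine ⟨k * L.N, fun z hz => ?_⟩
    by_contra! hlt
    have h1 := L.line_monotone w.re hlt.le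
    have h2 := L.line_add_mul 0 k w.re
    rw [zero_add] at h2
    simp only at h1
    rw [lt_div_iff₀ (by positivity)] at hk
    linarith
  have hi : ∃ z : ℤ, w.im ≤ L.line z w.re := by
    obtain ⟨k, hk⟩ := exists_int_gt ((w.im - L.line 0 w.re) / (2 * π))
    refine ⟨k * L.N, ?_⟩
    have h2 := L.line_add_mul 0 k w.re
    rw [zero_add] at h2
    rw [div_lt_iff₀ (by positivity)] at hk
    linarith
  obtain ⟨m, hm, hmin⟩ := Int.exists_least_of_bdd hb hi
  refine ⟨m, ?_, hm⟩
  by_contra! h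
  have := hmin _ h
  omega

/-- The index of the sector that contains `w`. -/
def sector (w : ℂ) : ℤ := (L.exists_sector w).choose

lemma line_sector_lt (w : ℂ) : L.line (L.sector w - 1) w.re < w.im :=
  (L.exists_sector w).choose_spec.1

lemma le_line_sector (w : ℂ) : w.im ≤ L.line (L.sector w) w.re :=
  (L.exists_sector w).choose_spec.2

lemma sector_eq {w : ℂ} {m : ℤ} (h1 : L.line (m - 1) w.re < w.im) (h2 : w.im ≤ L.line m w.re) :
    L.sector w = m := by
  have h3 := L.line_sector_lt w
  have h4 := L.le_line_sector w
  apply le_antisymm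
  · by_contra! h
    have := L.line_monotone w.re (show m ≤ L.sector w - 1 by omega)
    simp only at this
    linarith
  · by_contra! h
    have := L.line_monotone w.re (show L.sector w ≤ m - 1 by omega)
    simp only at this
    linarith

lemma add_two_pi_im (w : ℂ) : (w + 2 * π * I).im = w.im + 2 * π := by simp

lemma add_two_pi_re (w : ℂ) : (w + 2 * π * I).re = w.re := by simp

lemma sector_add (w : ℂ) : L.sector (w + 2 * π * I) = L.sector w + L.N := by
  apply L.sector_eq
  · rw [add_two_pi_im, add_two_pi_re, show L.sector w + L.N - 1 = L.sector w - 1 + L.N by ring,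
      L.line_add]
    linarith [L.line_sector_lt w]
  · rw [add_two_pi_im, add_two_pi_re, L.line_add]
    linarith [L.le_line_sector w]

lemma add_mem_cuts (w : ℂ) : w + 2 * π * I ∈ L.cuts ↔ w ∈ L.cuts := by
  unfold cuts
  simp only [mem_ofPred_eq, add_two_pi_re, add_two_pi_im]
  refine or_congr_left ⟨fun ⟨m, hm⟩ => ⟨m - L.N, ?_⟩, fun ⟨m, hm⟩ => ⟨m + L.N, ?_⟩⟩
  · have := L.line_add (m - L.N) w.re
    rw [sub_add_cancel] at this
    linarith
  · rw [L.line_add, hm]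

lemma eventually_line_lt {w : ℂ} {m : ℤ} (h : L.line m w.re < w.im) :
    ∀ᶠ w' in 𝓝 w, L.line m w'.re < w'.im :=
  (((L.line_continuous m).comp continuous_re).tendsto w).eventually_lt (continuous_im.tendsto w) h

lemma eventually_lt_line {w : ℂ} {m : ℤ} (h : w.im < L.line m w.re) :
    ∀ᶠ w' in 𝓝 w, w'.im < L.line m w'.re :=
  (continuous_im.tendsto w).eventually_lt (((L.line_continuous m).comp continuous_re).tendsto w) h

lemma eventually_sector_eq {w : ℂ} {m : ℤ} (h1 : L.line (m - 1) w.re < w.im)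
    (h2 : w.im < L.line m w.re) : ∀ᶠ w' in 𝓝 w, L.sector w' = m := by
  filter_upwards [L.eventually_line_lt h1, L.eventually_lt_line h2] with w' h3 h4
    using L.sector_eq h3 h4.le

lemma eventually_sector_mem (w : ℂ) :
    ∃ s : Finset ℤ, ∀ᶠ w' in 𝓝 w, L.sector w' ∈ s := by
  obtain ⟨k, hk⟩ := exists_int_lt ((w.im - L.line 0 w.re) / (2 * π))
  obtain ⟨l, hl⟩ := exists_int_gt ((w.im - L.line 0 w.re) / (2 * π))
  rw [lt_div_iff₀ (by positivity)] at hk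
  rw [div_lt_iff₀ (by positivity)] at hl
  have h1 := L.line_add_mul 0 k w.re
  have h2 := L.line_add_mul 0 l w.re
  rw [zero_add] at h1 h2
  refine ⟨Finset.Icc (k * L.N) (l * L.N), ?_⟩
  filter_upwards [L.eventually_line_lt (w := w) (m := k * L.N) (by linarith),
    L.eventually_lt_line (w := w) (m := l * L.N) (by linarith)] with w' h3 h4
  have h5 := L.line_sector_lt w'
  have h6 := L.le_line_sector w'
  rw [Finset.mem_Icc]
  constructor
  · by_contra! h
    have := L.line_monotone w'.re h.le
    simp only at this
    linarith
  · by_contra! h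
    have := L.line_monotone w'.re (show l * L.N ≤ L.sector w' - 1 by omega)
    simp only at this
    linarith

end LocalData

lemma eventually_notMem_of_separated {V : Set ℂ} {δ : ℝ} (hδ : 0 < δ)
    (h : ∀ v ∈ V, ∀ v' ∈ V, dist v v' < δ → v = v') (w : ℂ) : ∀ᶠ w' in 𝓝[≠] w, w' ∉ V := by
  by_cases hv : ∃ v ∈ V, v ≠ w ∧ dist v w < δ / 2
  · obtain ⟨v, hv, hne, hvw⟩ := hv
    have : ∀ᶠ w' in 𝓝 w, dist w' w < min (δ / 2) (dist v w) :=
      Metric.ball_mem_nhds w (by have := dist_pos.2 hne; positivity)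
    filter_upwards [this.filter_mono nhdsWithin_le_nhds] with w' hw' hV
    have h1 := h v hv w' hV (by
      have := dist_triangle_right v w' w
      linarith [hw'.trans_le (min_le_left _ _)])
    subst h1
    exact absurd (hw'.trans_le (min_le_right _ _)) (lt_irrefl _)
  · push Not at hv
    have : ∀ᶠ w' in 𝓝 w, dist w' w < δ / 2 := Metric.ball_mem_nhds w (by positivity)
    filter_upwards [this.filter_mono nhdsWithin_le_nhds, self_mem_nhdsWithin] with w' hw' hne hV
    linarith [hv w' hV hne]

lemma dense_re_im {A : Set ℝ} {B : ℝ → Set ℝ} (hA : A.Countable) (hB : ∀ x, (B x).Countable) :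
    Dense {w : ℂ | w.re ∉ A ∧ w.im ∉ B w.re} := by
  rw [Metric.dense_iff]
  intro w δ hδ
  obtain ⟨x, hx, hxA⟩ := Metric.dense_iff.1 (hA.dense_compl ℝ) w.re (δ / 2) (by positivity)
  obtain ⟨y, hy, hyB⟩ := Metric.dense_iff.1 ((hB x).dense_compl ℝ) w.im (δ / 2) (by positivity)
  refine ⟨⟨x, y⟩, ?_, hxA, hyB⟩
  rw [Metric.mem_ball, Complex.dist_eq] at *
  rw [Real.dist_eq] at hx hy
  refine (Complex.norm_le_abs_re_add_abs_im _).trans_lt ?_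
  simp only [sub_re, sub_im]
  linarith

lemma LocallyExtends.translate {r : ℕ} {v : ℂ → Mat r} {E : Set ℂ} {w b : ℂ} {M : Mat r}
    (hE : ∀ w, w + b ∈ E ↔ w ∈ E) (hv : ∀ w, v (w + b) = v w * M)
    (h : ∀ p q, LocallyExtends (fun w => v w p q) E w) (p q : Fin r) :
    LocallyExtends (fun w => v w p q) E (w + b) := by
  choose F hF hFv using h
  have ht : Tendsto (fun w' : ℂ => w' - b) (𝓝 (w + b)) (𝓝 w) := by
    have : Continuous fun w' : ℂ => w' - b := by fun_prop
    simpa using this.tendsto (w + b)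
  refine ⟨fun w' => ∑ k, F p k (w' - b) * M k q, ?_, ?_⟩
  · refine Finset.analyticAt_fun_sum _ fun k _ => AnalyticAt.mul ?_ analyticAt_const
    refine AnalyticAt.fun_comp (g := F p k) ?_ (analyticAt_id.sub analyticAt_const)
    simpa using hF p k
  · have : ∀ᶠ w' in 𝓝 (w + b), ∀ k, w' - b ∉ E → F p k (w' - b) = v (w' - b) p k :=
      eventually_all.2 fun k => ht.eventually (hFv p k)
    filter_upwards [this] with w' hw' hwE
    have h1 : w' - b ∉ E := fun h => hwE (by simpa using (hE (w' - b)).2 h)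
    have h2 := hv (w' - b)
    rw [sub_add_cancel] at h2
    rw [h2, Matrix.mul_apply]
    exact Finset.sum_congr rfl fun k _ => by rw [hw' k h1]


namespace LocalData

variable {r : ℕ} (L : LocalData r)

/-- The formal monodromy `e^{2πi L}`. -/
def formalMonodromy : Mat r := Matrix.diagonal fun p => exp (2 * π * I * L.L p)

open Classical in
/-- The exponent of the diagonal factor that relates `u` to the glued solution. -/
def gaugeExponent (w : ℂ) (p : Fin r) : ℂ :=
  if w.re < L.xτ then L.That w p else if w.re < L.xρ then L.L p * w else
    L.L p * (2 * π * I * ((L.sector w / L.N - 1 : ℤ) : ℂ))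

/-- The solution on the half-plane, up to its values on the cuts. -/
def glue (u : ℂ → Mat r) (w : ℂ) : Mat r :=
  u w * Matrix.diagonal (fun p => exp (L.gaugeExponent w p)) * (L.R (L.sector w))⁻¹

lemma glue_apply (u : ℂ → Mat r) (w : ℂ) (p q : Fin r) :
    L.glue u w p q =
      ∑ k, u w p k * exp (L.gaugeExponent w k) * (L.R (L.sector w))⁻¹ k q := by
  simp [glue, Matrix.mul_apply, Matrix.diagonal_apply]

lemma exp_toral_arg_add (l : ℕ) (w : ℂ) :
    exp (-((l : ℕ) * (w + 2 * π * I))) = exp (-(l * w)) := by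
  rw [show -((l : ℂ) * (w + 2 * π * I)) = -(l * w) + ((-l : ℤ) : ℂ) * (2 * π * I) by
    push_cast; ring, exp_add, exp_int_mul_two_pi_mul_I, mul_one]

lemma toral_add (w : ℂ) (p : Fin r) : L.toral (w + 2 * π * I) p = L.toral w p := by
  unfold toral
  exact Finset.sum_congr rfl fun l _ => by rw [exp_toral_arg_add]

lemma That_add (w : ℂ) (p : Fin r) :
    L.That (w + 2 * π * I) p = L.That w p + 2 * π * I * L.L p := by
  rw [That, That, toral_add]; ring

lemma expThat_add (w : ℂ) :
    L.expThat (w + 2 * π * I) = L.expThat w * L.formalMonodromy := by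
  simp [expThat, formalMonodromy, That_add, exp_add]

lemma gaugeExponent_add (w : ℂ) (p : Fin r) :
    L.gaugeExponent (w + 2 * π * I) p
      = L.gaugeExponent w p + 2 * π * I * L.L p := by
  have hN : (L.N : ℤ) ≠ 0 := by exact_mod_cast L.N_pos.ne'
  simp only [gaugeExponent, add_two_pi_re, That_add, sector_add]
  split_ifs
  · rfl
  · ring
  · rw [Int.add_ediv_of_dvd_right (dvd_refl _), Int.ediv_self hN]
    push_cast; ring

lemma R_isUnit (m : ℤ) : IsUnit (L.R m).det := by rw [L.R_det]; exact isUnit_one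

lemma formalMonodromy_mul_inv_R (m : ℤ) :
    L.formalMonodromy * (L.R (m + L.N))⁻¹ = (L.R m)⁻¹ * L.M0 := by
  have h : L.M0 * L.R (m + L.N) = L.R m * L.formalMonodromy := L.R_add m
  have h1 := congrArg (fun X => (L.R m)⁻¹ * X * (L.R (m + L.N))⁻¹) h
  rw [← Matrix.mul_assoc, Matrix.mul_nonsing_inv_cancel_right _ _ (L.R_isUnit _),
    Matrix.nonsing_inv_mul_cancel_left _ _ (L.R_isUnit _)] at h1
  exact h1.symm

lemma det_diagonal_exp (d : Fin r → ℂ) (h : ∑ p, d p = 0) :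
    (Matrix.diagonal fun p => exp (d p)).det = 1 := by
  rw [Matrix.det_diagonal, ← exp_sum, h, exp_zero]

lemma sum_toral (w : ℂ) : ∑ p, L.toral w p = 0 := by
  simp only [toral]
  rw [Finset.sum_comm]
  refine Finset.sum_eq_zero fun l _ => ?_
  rw [← Finset.sum_mul, L.T_traceless, zero_mul]

lemma sum_That (w : ℂ) : ∑ p, L.That w p = 0 := by
  simp only [That, Finset.sum_add_distrib, sum_toral, ← Finset.sum_mul, L.L_traceless]
  simp

lemma det_expThat (w : ℂ) : (L.expThat w).det = 1 := det_diagonal_exp _ (L.sum_That w)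

lemma det_expL (w : ℂ) : (L.expL w).det = 1 :=
  det_diagonal_exp _ (by rw [← Finset.sum_mul, L.L_traceless, zero_mul])

lemma det_formalMonodromy : L.formalMonodromy.det = 1 :=
  det_diagonal_exp _ (by rw [← Finset.mul_sum, L.L_traceless, mul_zero])

lemma sum_gaugeExponent (w : ℂ) : ∑ p, L.gaugeExponent w p = 0 := by
  simp only [gaugeExponent]
  split_ifs
  · exact L.sum_That w
  · rw [← Finset.sum_mul, L.L_traceless, zero_mul]
  · rw [← Finset.sum_mul, L.L_traceless, zero_mul]

lemma det_M₀ : L.M0.det = 1 := by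
  have h : L.M0 * L.R (0 + L.N) = L.R 0 * L.formalMonodromy := L.R_add 0
  have := congrArg Matrix.det h
  simpa [Matrix.det_mul, L.R_det, det_formalMonodromy] using this

lemma R_zero_mul : L.R 0 * L.formalMonodromy = L.M0 := by
  have h : L.M0 * L.R (0 + L.N) = L.R 0 * L.formalMonodromy := L.R_add 0
  rw [← h, zero_add, L.R_period, Matrix.mul_one]

lemma That_differentiable (p : Fin r) : Differentiable ℂ fun w => L.That w p := by
  unfold That toral
  fun_prop

lemma eventually_gaugeExponent_eq {w : ℂ} (m : ℤ) (h1 : w.re ≠ L.xτ) (h2 : w.re ≠ L.xρ) :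
    ∃ g : ℂ → Fin r → ℂ, (∀ p, Differentiable ℂ fun w => g w p) ∧
      ∀ᶠ w' in 𝓝 w, L.sector w' = m → ∀ p, L.gaugeExponent w' p = g w' p := by
  have hlt : ∀ {c : ℝ}, w.re < c → ∀ᶠ w' in 𝓝 w, w'.re < c := fun h =>
    continuous_re.continuousAt.eventually (gt_mem_nhds h)
  have hgt : ∀ {c : ℝ}, c < w.re → ∀ᶠ w' in 𝓝 w, c < w'.re := fun h =>
    continuous_re.continuousAt.eventually (lt_mem_nhds h)
  rcases lt_or_gt_of_ne h1 with h | h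
  · refine ⟨fun w p => L.That w p, L.That_differentiable, ?_⟩
    filter_upwards [hlt h] with w' hw' _ p
    simp [gaugeExponent, hw']
  rcases lt_or_gt_of_ne h2 with h' | h'
  · refine ⟨fun w p => L.L p * w, fun p => by fun_prop, ?_⟩
    filter_upwards [hlt h', hgt h] with w' hw' hw'' _ p
    simp [gaugeExponent, hw', hw''.not_gt]
  · refine ⟨fun _ p => L.L p * (2 * π * I * ((m / L.N - 1 : ℤ) : ℂ)),
      fun p => by fun_prop, ?_⟩
    filter_upwards [hgt h', hgt h] with w' hw' hw'' hs p
    simp [gaugeExponent, hw'.not_gt, hw''.not_gt, hs]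

lemma eventually_norm_gaugeExponent_le (w : ℂ) :
    ∃ C, ∀ᶠ w' in 𝓝 w, ∀ p, ‖L.gaugeExponent w' p‖ ≤ C := by
  obtain ⟨s, hs⟩ := L.eventually_sector_mem w
  have h1 : Continuous fun w' => ∑ p, (‖L.That w' p‖ + ‖L.L p * w'‖ +
      ∑ m ∈ s, ‖L.L p * (2 * π * I * ((m / L.N - 1 : ℤ) : ℂ))‖) := by
    refine continuous_finsetSum _ fun p _ => ?_
    have := (L.That_differentiable p).continuous
    fun_prop
  refine ⟨(∑ p, (‖L.That w p‖ + ‖L.L p * w‖ +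
      ∑ m ∈ s, ‖L.L p * (2 * π * I * ((m / L.N - 1 : ℤ) : ℂ))‖)) + 1, ?_⟩
  filter_upwards [hs, (h1.tendsto w).eventually (gt_mem_nhds (lt_add_one _))] with w' hw' h p
  refine le_trans ?_ h.le
  refine le_trans ?_ (Finset.single_le_sum (fun p _ => by positivity) (Finset.mem_univ p))
  unfold gaugeExponent
  have h2 : ‖L.L p * (2 * π * I * ((L.sector w' / L.N - 1 : ℤ) : ℂ))‖ ≤
      ∑ m ∈ s, ‖L.L p * (2 * π * I * ((m / L.N - 1 : ℤ) : ℂ))‖ :=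
    Finset.single_le_sum (f := fun m : ℤ =>
      ‖L.L p * (2 * π * I * ((m / L.N - 1 : ℤ) : ℂ))‖) (fun m _ => by positivity) hw'
  have h3 := norm_nonneg (L.That w' p)
  have h4 := norm_nonneg (L.L p * w')
  have h5 := norm_nonneg (L.L p * (2 * π * I * ((L.sector w' / L.N - 1 : ℤ) : ℂ)))
  split_ifs <;> linarith

lemma tendsto_glue {u : ℂ → Mat r} {l : Filter ℝ} {c : ℝ → ℂ} {w : ℂ} {G : Mat r} {m : ℤ}
    {g : ℂ → Fin r → ℂ} (hc : Tendsto c l (𝓝 w)) (hu : Tendsto (fun σ => u (c σ)) l (𝓝 G))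
    (hs : ∀ᶠ σ in l, L.sector (c σ) = m) (hg : ∀ p, Continuous fun w => g w p)
    (hgauge : ∀ᶠ σ in l, ∀ p, L.gaugeExponent (c σ) p = g (c σ) p) :
    Tendsto (fun σ => L.glue u (c σ)) l
      (𝓝 (G * Matrix.diagonal (fun p => exp (g w p)) * (L.R m)⁻¹)) := by
  have h1 : Tendsto (fun σ => Matrix.diagonal fun p => exp (g (c σ) p)) l
      (𝓝 (Matrix.diagonal fun p => exp (g w p))) := by
    have : Continuous fun w => Matrix.diagonal fun p => exp (g w p) :=
      Continuous.matrix_diagonal (continuous_pi fun p => continuous_exp.comp (hg p))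
    exact (this.tendsto w).comp hc
  refine ((hu.mul h1).mul_const (L.R m)⁻¹).congr' ?_
  filter_upwards [hs, hgauge] with σ h2 h3
  rw [glue, h2]
  simp only [h3]

end LocalData

namespace LocalData.IsJumpSolution

variable {r : ℕ} {L : LocalData r} {u : ℂ → Mat r} (hu : L.IsJumpSolution u)

include hu

lemma glue_add (w : ℂ) : L.glue u (w + 2 * π * I) = L.glue u w * L.M0 := by
  have h1 : (Matrix.diagonal fun p => exp (L.gaugeExponent (w + 2 * π * I) p)) =
      Matrix.diagonal (fun p => exp (L.gaugeExponent w p)) * L.formalMonodromy := by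
    simp [formalMonodromy, L.gaugeExponent_add, exp_add]
  rw [glue, hu.periodic, h1, L.sector_add, glue, Matrix.mul_assoc, Matrix.mul_assoc,
    L.formalMonodromy_mul_inv_R]
  simp only [Matrix.mul_assoc]

lemma analyticAt_glue {w : ℂ} (hw : w.re < L.xR) (hc : w ∉ L.cuts) (p q : Fin r) :
    AnalyticAt ℂ (fun w => L.glue u w p q) w := by
  have h1 : w.re ≠ L.xτ := fun h => hc (Or.inr (Or.inl h))
  have h2 : w.re ≠ L.xρ := fun h => hc (Or.inr (Or.inr h))
  have h3 : w.im ≠ L.line (L.sector w) w.re := fun h => hc (Or.inl ⟨_, h⟩)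
  obtain ⟨g, hg, hgv⟩ := L.eventually_gaugeExponent_eq (L.sector w) h1 h2
  have hs := L.eventually_sector_eq (L.line_sector_lt w) (lt_of_le_of_ne (L.le_line_sector w) h3)
  have h4 : AnalyticAt ℂ
      (fun w' => ∑ k, u w' p k * exp (g w' k) * (L.R (L.sector w))⁻¹ k q) w := by
    refine Finset.analyticAt_fun_sum _ fun k _ => ?_
    exact ((hu.analytic w hw hc p k).mul ((hg k).analyticAt w).cexp).mul analyticAt_const
  refine h4.congr ?_
  filter_upwards [hs, hgv] with w' h5 h6
  rw [glue_apply, h5]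
  simp only [h6 h5]

lemma eventually_norm_glue_le {w : ℂ} (hw : w.re < L.xR) :
    ∃ C, ∀ᶠ w' in 𝓝 w, w' ∉ L.cuts → ∀ p q, ‖L.glue u w' p q‖ ≤ C := by
  obtain ⟨B, hB⟩ := hu.bounded
  obtain ⟨C, hC⟩ := L.eventually_norm_gaugeExponent_le w
  obtain ⟨s, hs⟩ := L.eventually_sector_mem w
  set b : Fin r → ℝ := fun q => ∑ k : Fin r, |B| * Real.exp C * ∑ m ∈ s, ‖(L.R m)⁻¹ k q‖ with hb
  have hb0 : ∀ q, 0 ≤ b q := fun q => Finset.sum_nonneg fun k _ => by positivity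
  refine ⟨∑ q, b q, ?_⟩
  have hw' : ∀ᶠ w' in 𝓝 w, w'.re < L.xR :=
    continuous_re.continuousAt.eventually (gt_mem_nhds hw)
  filter_upwards [hC, hs, hw'] with w' h1 h2 h3 h4 p q
  refine le_trans ?_ (Finset.single_le_sum (fun q _ => hb0 q) (Finset.mem_univ q))
  rw [glue_apply, hb]
  refine (norm_sum_le _ _).trans (Finset.sum_le_sum fun k _ => ?_)
  rw [norm_mul, norm_mul]
  gcongr
  · exact (hB w' h3 h4 p k).trans (le_abs_self B)
  · exact (norm_exp_le_exp_norm _).trans (Real.exp_le_exp.2 (h1 k))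
  · exact Finset.single_le_sum (f := fun m => ‖(L.R m)⁻¹ k q‖) (fun m _ => norm_nonneg _) h2

end LocalData.IsJumpSolution


namespace LocalData

variable {r : ℕ} (L : LocalData r)

lemma S_mul_inv_R (m : ℤ) : L.S m * (L.R m)⁻¹ = (L.R (m + 1))⁻¹ := by
  symm
  apply Matrix.inv_eq_right_inv
  rw [← Matrix.mul_assoc, ← L.R_succ, Matrix.mul_nonsing_inv _ (L.R_isUnit m)]

lemma line_zero_of_ge {x : ℝ} (hx : L.xτ ≤ x) : L.line 0 x = L.θ :=
  L.line_of_ge 0 le_rfl (by exact_mod_cast L.N_pos) x hx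

lemma line_last_of_ge {x : ℝ} (hx : L.xτ ≤ x) : L.line (L.N - 1) x = L.θ := by
  have := L.N_pos
  exact L.line_of_ge _ (by omega) (by omega) x hx

lemma line_N_of_ge {x : ℝ} (hx : L.xτ ≤ x) : L.line L.N x = L.θ + 2 * π := by
  have := L.line_add 0 x
  rw [zero_add] at this
  rw [this, L.line_zero_of_ge hx]

lemma line_neg_one_of_ge {x : ℝ} (hx : L.xτ ≤ x) : L.line (-1) x = L.θ - 2 * π := by
  have := L.line_add (-1) x
  rw [show (-1 : ℤ) + L.N = L.N - 1 by ring, L.line_last_of_ge hx] at this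
  linarith

lemma tendsto_add_mul_I (w : ℂ) (s : Set ℝ) : Tendsto (fun σ : ℝ => w + σ * I) (𝓝[s] 0) (𝓝 w) := by
  have : Continuous fun σ : ℝ => w + σ * I := by fun_prop
  simpa using (this.tendsto 0).mono_left nhdsWithin_le_nhds

lemma tendsto_add_ofReal (w : ℂ) (s : Set ℝ) : Tendsto (fun σ : ℝ => w + σ) (𝓝[s] 0) (𝓝 w) := by
  have : Continuous fun σ : ℝ => w + (σ : ℂ) := by fun_prop
  simpa using (this.tendsto 0).mono_left nhdsWithin_le_nhds

lemma eventually_re_lt {w : ℂ} {c : ℝ} (h : w.re < c) : ∀ᶠ w' in 𝓝 w, w'.re < c :=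
  continuous_re.continuousAt.eventually (gt_mem_nhds h)

lemma eventually_lt_re {w : ℂ} {c : ℝ} (h : c < w.re) : ∀ᶠ w' in 𝓝 w, c < w'.re :=
  continuous_re.continuousAt.eventually (lt_mem_nhds h)

lemma eventually_im_lt {w : ℂ} {c : ℝ} (h : w.im < c) : ∀ᶠ w' in 𝓝 w, w'.im < c :=
  continuous_im.continuousAt.eventually (gt_mem_nhds h)

lemma eventually_lt_im {w : ℂ} {c : ℝ} (h : c < w.im) : ∀ᶠ w' in 𝓝 w, c < w'.im :=
  continuous_im.continuousAt.eventually (lt_mem_nhds h)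

lemma tendsto_punctured {E : Type*} [TopologicalSpace E] {v : ℝ → E} {A B : E}
    (ha : Tendsto v (𝓝[>] 0) (𝓝 A)) (hb : Tendsto v (𝓝[<] 0) (𝓝 B)) (h : B = A) :
    ∃ l, Tendsto v (𝓝[≠] 0) (𝓝 l) := by
  subst h
  exact ⟨B, by rw [← nhdsLT_sup_nhdsGT]; exact hb.sup ha⟩

lemma sector_add_mul_I_pos {w : ℂ} {m k : ℤ} (h : w.im = L.line m w.re)
    (hk : L.line k w.re = L.line m w.re) (h' : w.im < L.line (k + 1) w.re) :
    ∀ᶠ σ : ℝ in 𝓝[>] 0, L.sector (w + σ * I) = k + 1 := by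
  filter_upwards [(tendsto_add_mul_I w _).eventually
    (L.eventually_lt_line h'), self_mem_nhdsWithin] with σ h1 h2
  refine L.sector_eq ?_ h1.le
  have : (0 : ℝ) < σ := h2
  simp
  linarith

lemma sector_add_mul_I_neg {w : ℂ} {m : ℤ} (h : w.im = L.line m w.re)
    (h' : L.line (m - 1) w.re < w.im) :
    ∀ᶠ σ : ℝ in 𝓝[<] 0, L.sector (w + σ * I) = m := by
  filter_upwards [(tendsto_add_mul_I w _).eventually
    (L.eventually_line_lt h'), self_mem_nhdsWithin] with σ h1 h2
  refine L.sector_eq h1 ?_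
  have : σ < (0 : ℝ) := h2
  simp
  linarith

lemma eventually_sector_eq_N {w : ℂ} (hw : L.xτ ≤ w.re) (h1 : L.θ < w.im)
    (h2 : w.im < L.θ + 2 * π) :
    ∀ᶠ w' in 𝓝 w, L.sector w' = L.N :=
  L.eventually_sector_eq (by rwa [L.line_last_of_ge hw]) (by rwa [L.line_N_of_ge hw])

lemma sector_add_mul_I_eq_N {w : ℂ} (hw : L.xτ ≤ w.re) (h : w.im = L.θ) :
    ∀ᶠ σ : ℝ in 𝓝[>] 0, L.sector (w + σ * I) = L.N := by
  simpa using L.sector_add_mul_I_pos (w := w) (m := 0) (k := L.N - 1)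
    (by rw [L.line_zero_of_ge hw, h])
    (by rw [L.line_zero_of_ge hw, L.line_last_of_ge hw])
    (by rw [sub_add_cancel, L.line_N_of_ge hw, h]; linarith [Real.pi_pos])

lemma gaugeExponent_of_lt {w : ℂ} (hw : w.re < L.xτ) (p : Fin r) :
    L.gaugeExponent w p = L.That w p := by simp [gaugeExponent, hw]

lemma gaugeExponent_of_mid {w : ℂ} (hw : L.xτ ≤ w.re) (hw' : w.re < L.xρ) (p : Fin r) :
    L.gaugeExponent w p = L.L p * w := by simp [gaugeExponent, hw.not_gt, hw']

lemma gaugeExponent_of_gt {w : ℂ} (hw : L.xρ ≤ w.re) (p : Fin r) :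
    L.gaugeExponent w p =
      L.L p * (2 * π * I * ((L.sector w / L.N - 1 : ℤ) : ℂ)) := by
  rw [gaugeExponent, if_neg hw.not_gt, if_neg (L.xτ_lt_xρ.le.trans hw).not_gt]

end LocalData

namespace LocalData.IsJumpSolution

variable {r : ℕ} {L : LocalData r} {u : ℂ → Mat r} (hu : L.IsJumpSolution u)

include hu

lemma tendsto_glue_stokes {m : ℤ} (hm : 0 ≤ m) (hm' : m < L.N) {w : ℂ} (hw : w.re < L.xτ)
    (h : w.im = L.line m w.re) :
    ∃ l, Tendsto (fun σ : ℝ => L.glue u (w + σ * I)) (𝓝[≠] 0) (𝓝 l) := by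
  obtain ⟨Ga, Gb, ha, hb, hab⟩ := hu.stokes m hm hm' w hw h
  have h1 := L.tendsto_glue (tendsto_add_mul_I w _) ha
    (L.sector_add_mul_I_pos h rfl (by rw [h]; exact L.line_strictMono hw (lt_add_one m)))
    (fun p => (L.That_differentiable p).continuous)
    (.of_forall fun σ p => L.gaugeExponent_of_lt (by simpa using hw) p)
  have h2 := L.tendsto_glue (tendsto_add_mul_I w _) hb
    (L.sector_add_mul_I_neg h (by rw [h]; exact L.line_strictMono hw (sub_one_lt m)))
    (fun p => (L.That_differentiable p).continuous)
    (.of_forall fun σ p => L.gaugeExponent_of_lt (by simpa using hw) p)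
  refine tendsto_punctured h1 h2 ?_
  change Gb * L.expThat w * _ = Ga * L.expThat w * _
  rw [hab, Matrix.mul_assoc, L.S_mul_inv_R]

lemma tendsto_glue_neck {w : ℂ} (hw : L.xτ < w.re) (hw' : w.re < L.xρ) (h : w.im = L.θ) :
    ∃ l, Tendsto (fun σ : ℝ => L.glue u (w + σ * I)) (𝓝[≠] 0) (𝓝 l) := by
  obtain ⟨Ga, Gb, ha, hb, hab⟩ := hu.neck w hw hw' h
  have h0 := L.line_zero_of_ge hw.le
  have hs := L.sector_add_mul_I_eq_N hw.le h
  have h1 := L.tendsto_glue (tendsto_add_mul_I w _) ha hs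
    (g := fun w p => L.L p * w) (fun p => by fun_prop)
    (.of_forall fun σ p =>
      L.gaugeExponent_of_mid (by simpa using hw.le) (by simpa using hw') p)
  have h2 := L.tendsto_glue (tendsto_add_mul_I w _) hb
    (L.sector_add_mul_I_neg (m := 0) (by rw [h0, h])
      (by rw [zero_sub, L.line_neg_one_of_ge hw.le, h]; linarith [Real.pi_pos]))
    (g := fun w p => L.L p * w) (fun p => by fun_prop)
    (.of_forall fun σ p =>
      L.gaugeExponent_of_mid (by simpa using hw.le) (by simpa using hw') p)
  refine tendsto_punctured h1 h2 ?_
  change Gb * L.expL w * _ = Ga * L.expL w * _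
  rw [hab, Matrix.mul_nonsing_inv_cancel_right _ _ (L.R_isUnit 0), L.R_period, inv_one,
    Matrix.mul_one]

lemma tendsto_glue_stem {w : ℂ} (hw : L.xρ < w.re) (hw' : w.re < L.xR) (h : w.im = L.θ) :
    ∃ l, Tendsto (fun σ : ℝ => L.glue u (w + σ * I)) (𝓝[≠] 0) (𝓝 l) := by
  obtain ⟨Ga, Gb, ha, hb, hab⟩ := hu.stem w hw hw' h
  have hτ : L.xτ ≤ w.re := (L.xτ_lt_xρ.trans hw).le
  have hN : (L.N : ℤ) ≠ 0 := by exact_mod_cast L.N_pos.ne'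
  have h0 := L.line_zero_of_ge hτ
  have hs := L.sector_add_mul_I_eq_N hτ h
  have hs' : ∀ᶠ σ : ℝ in 𝓝[<] 0, L.sector (w + σ * I) = 0 :=
    L.sector_add_mul_I_neg (m := 0) (by rw [h0, h])
      (by rw [zero_sub, L.line_neg_one_of_ge hτ, h]; linarith [Real.pi_pos])
  have h1 := L.tendsto_glue (tendsto_add_mul_I w _) ha hs
    (g := fun _ _ => 0) (fun p => continuous_const) (by
      filter_upwards [hs] with σ hσ p
      rw [L.gaugeExponent_of_gt (by simpa using hw.le), hσ, Int.ediv_self hN]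
      simp)
  have h2 := L.tendsto_glue (tendsto_add_mul_I w _) hb hs'
    (g := fun _ p => -(2 * π * I * L.L p)) (fun p => continuous_const) (by
      filter_upwards [hs'] with σ hσ p
      rw [L.gaugeExponent_of_gt (by simpa using hw.le), hσ]
      simp
      ring)
  refine tendsto_punctured h1 h2 ?_
  have h3 : L.formalMonodromy * (Matrix.diagonal fun p => exp (-(2 * π * I * L.L p))) = 1 := by
    simp [formalMonodromy, ← exp_add]
  rw [L.R_period, inv_one, Matrix.mul_one, hab, ← L.R_zero_mul, ← Matrix.mul_assoc,
    Matrix.mul_assoc _ L.formalMonodromy, h3, Matrix.mul_one,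
    Matrix.mul_nonsing_inv_cancel_right _ _ (L.R_isUnit 0)]
  simp

lemma tendsto_glue_toral {w : ℂ} (hw : w.re = L.xτ) (h1 : L.θ < w.im)
    (h2 : w.im < L.θ + 2 * π) :
    ∃ l, Tendsto (fun σ : ℝ => L.glue u (w + σ)) (𝓝[≠] 0) (𝓝 l) := by
  obtain ⟨Gi, Go, hi, ho, hio⟩ := hu.toralCircle w hw h1 h2
  have hs := L.eventually_sector_eq_N hw.ge h1 h2
  have h3 := L.tendsto_glue (tendsto_add_ofReal w _) ho
    ((tendsto_add_ofReal w _).eventually hs)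
    (g := fun w p => L.L p * w) (fun p => by fun_prop) (by
      have h4 : ∀ᶠ σ : ℝ in 𝓝[>] 0, σ < L.xρ - L.xτ :=
        nhdsWithin_le_nhds (gt_mem_nhds (by linarith [L.xτ_lt_xρ]))
      filter_upwards [h4, self_mem_nhdsWithin] with σ h4 (h5 : 0 < σ) p
      refine L.gaugeExponent_of_mid ?_ ?_ p <;> simp <;> linarith)
  have h4 := L.tendsto_glue (tendsto_add_ofReal w _) hi
    ((tendsto_add_ofReal w _).eventually hs)
    (fun p => (L.That_differentiable p).continuous) (by
      filter_upwards [self_mem_nhdsWithin] with σ (h5 : σ < 0) p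
      refine L.gaugeExponent_of_lt ?_ p
      simp
      linarith)
  refine tendsto_punctured h3 h4 ?_
  change Gi * L.expThat w * _ = Go * L.expL w * _
  rw [hio]

lemma tendsto_glue_formal {w : ℂ} (hw : w.re = L.xρ) (h1 : L.θ < w.im)
    (h2 : w.im < L.θ + 2 * π) :
    ∃ l, Tendsto (fun σ : ℝ => L.glue u (w + σ)) (𝓝[≠] 0) (𝓝 l) := by
  obtain ⟨Gi, Go, hi, ho, hio⟩ := hu.formalCircle w hw h1 h2
  have hN : (L.N : ℤ) ≠ 0 := by exact_mod_cast L.N_pos.ne'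
  have hs := L.eventually_sector_eq_N (L.xτ_lt_xρ.le.trans hw.ge) h1 h2
  have hs1 := (tendsto_add_ofReal w (Ioi 0)).eventually hs
  have h3 := L.tendsto_glue (tendsto_add_ofReal w _) ho hs1
    (g := fun _ _ => 0) (fun p => by fun_prop) (by
      filter_upwards [hs1, self_mem_nhdsWithin] with σ hσ (h5 : 0 < σ) p
      rw [L.gaugeExponent_of_gt (by simp; linarith), hσ, Int.ediv_self hN]
      simp)
  have h4 := L.tendsto_glue (tendsto_add_ofReal w _) hi
    ((tendsto_add_ofReal w _).eventually hs)
    (g := fun w p => L.L p * w) (fun p => by fun_prop) (by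
      have h4 : ∀ᶠ σ : ℝ in 𝓝[<] 0, L.xτ - L.xρ < σ :=
        nhdsWithin_le_nhds (lt_mem_nhds (by linarith [L.xτ_lt_xρ]))
      filter_upwards [h4, self_mem_nhdsWithin] with σ h4 (h5 : σ < 0) p
      refine L.gaugeExponent_of_mid ?_ ?_ p <;> simp <;> linarith)
  refine tendsto_punctured h3 h4 ?_
  change Gi * L.expL w * _ = _
  rw [hio]
  simp

end LocalData.IsJumpSolution


namespace LocalData

variable {r : ℕ} (L : LocalData r)

lemma im_ne_line {w : ℂ} {m : ℤ} (h1 : L.line (m - 1) w.re < w.im) (h2 : w.im < L.line m w.re)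
    (k : ℤ) : w.im ≠ L.line k w.re := by
  intro h
  rcases le_or_gt k (m - 1) with hk | hk
  · have := L.line_monotone w.re hk
    simp only at this
    linarith
  · have := L.line_monotone w.re (show m ≤ k by omega)
    simp only at this
    linarith

lemma dense_compl_cuts : Dense L.cutsᶜ := by
  refine (dense_re_im (A := {L.xτ, L.xρ}) (B := fun x => range fun m => L.line m x)
    (Set.toFinite _).countable (fun x => countable_range _)).mono ?_
  rintro w ⟨h1, h2⟩ (⟨m, hm⟩ | h | h)
  · exact h2 ⟨m, hm.symm⟩
  · exact h1 (by simp [h])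
  · exact h1 (by simp [h])

lemma eventually_notMem_corners (w : ℂ) : ∀ᶠ w' in 𝓝[≠] w, w' ∉ L.corners := by
  have hlt := L.xτ_lt_xρ
  refine eventually_notMem_of_separated (δ := min (L.xρ - L.xτ) (2 * π))
    (lt_min (by linarith) (by positivity)) ?_ w
  rintro v ⟨⟨m, hm⟩, hv⟩ v' ⟨⟨m', hm'⟩, hv'⟩ hd
  rw [Complex.dist_eq] at hd
  have hre := (Complex.abs_re_le_norm (v - v')).trans_lt (hd.trans_le (min_le_left _ _))
  have him := (Complex.abs_im_le_norm (v - v')).trans_lt (hd.trans_le (min_le_right _ _))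
  rw [sub_re, abs_lt] at hre
  have hτ : L.xτ ≤ v.re := by rcases hv with h | h <;> linarith
  have hτ' : L.xτ ≤ v'.re := by rcases hv' with h | h <;> linarith
  rw [L.line_eq _ hτ] at hm
  rw [L.line_eq _ hτ'] at hm'
  apply Complex.ext
  · rcases hv with h | h <;> rcases hv' with h' | h' <;> rw [h, h'] at hre ⊢ <;> linarith
  · rw [sub_im, hm, hm', show L.θ + 2 * π * ((m / L.N : ℤ) : ℝ) -
      (L.θ + 2 * π * ((m' / L.N : ℤ) : ℝ)) =
      2 * π * ((m / L.N - m' / L.N : ℤ) : ℝ) by push_cast; ring, abs_mul,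
      abs_of_pos (by positivity)] at him
    have h1 : |((m / L.N - m' / L.N : ℤ) : ℝ)| < 1 := by
      by_contra! h
      nlinarith [Real.pi_pos]
    have h2 : |(m / L.N - m' / L.N : ℤ)| < 1 := by exact_mod_cast h1
    rw [Int.abs_lt_one_iff, sub_eq_zero] at h2
    rw [hm, hm', h2]

lemma add_int_mem_cuts (k : ℤ) (w : ℂ) : w + 2 * π * I * k ∈ L.cuts ↔ w ∈ L.cuts := by
  induction k using Int.induction_on with
  | zero => simp
  | succ k ih =>
    rw [← ih, ← L.add_mem_cuts (w + 2 * π * I * (k : ℤ))]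
    push_cast; ring_nf
  | pred k ih =>
    rw [← ih, ← L.add_mem_cuts]
    push_cast; ring_nf

end LocalData

namespace LocalData.IsJumpSolution

variable {r : ℕ} {L : LocalData r} {u : ℂ → Mat r} (hu : L.IsJumpSolution u)

include hu

lemma exists_glue_add_int (k : ℤ) :
    ∃ M : Mat r, ∀ w, L.glue u (w + 2 * π * I * k) = L.glue u w * M := by
  induction k using Int.induction_on with
  | zero => exact ⟨1, by simp⟩
  | succ k ih =>
    obtain ⟨M, hM⟩ := ih
    refine ⟨M * L.M0, fun w => ?_⟩
    rw [← Matrix.mul_assoc, ← hM, ← hu.glue_add]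
    congr 1; push_cast; ring
  | pred k ih =>
    obtain ⟨M, hM⟩ := ih
    refine ⟨M * L.M0⁻¹, fun w => ?_⟩
    rw [← Matrix.mul_assoc, ← hM, show w + 2 * π * I * ((-(k : ℤ) : ℤ) : ℂ) =
      w + 2 * π * I * ((-(k : ℤ) - 1 : ℤ) : ℂ) + 2 * π * I by push_cast; ring,
      hu.glue_add, Matrix.mul_nonsing_inv_cancel_right]
    rw [L.det_M₀]; exact isUnit_one

lemma locallyExtends_add_int {w : ℂ}
    (h : ∀ p q, LocallyExtends (fun w => L.glue u w p q) L.cuts w) (k : ℤ) (p q : Fin r) :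
    LocallyExtends (fun w => L.glue u w p q) L.cuts (w + 2 * π * I * k) := by
  obtain ⟨M, hM⟩ := hu.exists_glue_add_int k
  exact LocallyExtends.translate (L.add_int_mem_cuts k) hM h p q

lemma locallyExtends_stokes {m : ℤ} (hm : 0 ≤ m) (hm' : m < L.N) {w : ℂ} (hw : w.re < L.xτ)
    (h : w.im = L.line m w.re) (p q : Fin r) :
    LocallyExtends (fun w => L.glue u w p q) L.cuts w := by
  have hlt := L.xτ_lt_xρ
  have hlt' := L.xρ_lt_xR
  obtain ⟨B, hB⟩ := hu.eventually_norm_glue_le (hw.trans (hlt.trans hlt'))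
  have hx := eventually_re_lt hw
  refine locallyExtends_of_graph (g := L.line m) (g' := L.lineDeriv m) (B := B) h
    ((gt_mem_nhds hw).mono fun x hx => L.line_hasDerivAt m x hx)
    ((gt_mem_nhds hw).mono fun x hx => L.lineDeriv_continuousAt m x hx) ?_ ?_
  · filter_upwards [hx, hB, L.eventually_line_lt (w := w) (m := m - 1)
      (by rw [h]; exact L.line_strictMono hw (sub_one_lt m)),
      L.eventually_lt_line (w := w) (m := m + 1)
      (by rw [h]; exact L.line_strictMono hw (lt_add_one m))] with w' h1 h2 h3 h4 hne
    have hc : w' ∉ L.cuts := by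
      rintro (⟨k, hk⟩ | h | h)
      · rcases lt_or_gt_of_ne hne with h5 | h5
        · exact L.im_ne_line h3 h5 k hk
        · exact L.im_ne_line (m := m + 1) (by simpa using h5) h4 k hk
      · linarith
      · linarith
    exact ⟨hu.analyticAt_glue (by linarith) hc p q, h2 hc p q⟩
  · filter_upwards [hx] with w' h1 h2
    obtain ⟨l, hl⟩ := hu.tendsto_glue_stokes hm hm' h1 h2
    exact ⟨Or.inl ⟨m, h2⟩, l p q, ((continuous_apply_apply p q).tendsto l).comp hl⟩

lemma locallyExtends_ray {w : ℂ} (hw : L.xτ < w.re) (hw' : w.re < L.xR) (hρ : w.re ≠ L.xρ)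
    (h : w.im = L.θ) (p q : Fin r) :
    LocallyExtends (fun w => L.glue u w p q) L.cuts w := by
  obtain ⟨B, hB⟩ := hu.eventually_norm_glue_le hw'
  have hx := eventually_re_lt hw'
  have hx' := eventually_lt_re hw
  have hx'' : ∀ᶠ w' in 𝓝 w, w'.re ≠ L.xρ := continuous_re.continuousAt.eventually_ne hρ
  have h1 : ∀ᶠ w' in 𝓝 w, w'.im < L.θ + 2 * π :=
    (eventually_im_lt (by rw [h]; linarith [Real.pi_pos]))
  have h2 : ∀ᶠ w' in 𝓝 w, L.θ - 2 * π < w'.im :=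
    (eventually_lt_im (by rw [h]; linarith [Real.pi_pos]))
  refine locallyExtends_of_graph (g := fun _ => L.θ) (g' := fun _ => 0) (B := B) h
    (.of_forall fun x => hasDerivAt_const x _)
    (.of_forall fun x => continuousAt_const) ?_ ?_
  · filter_upwards [hx, hx', hx'', h1, h2, hB] with w' h3 h4 h5 h6 h7 h8 hne
    have hc : w' ∉ L.cuts := by
      rintro (⟨k, hk⟩ | h | h)
      · rcases lt_or_gt_of_ne hne with h9 | h9
        · exact L.im_ne_line (m := 0) (by rwa [zero_sub, L.line_neg_one_of_ge h4.le])
            (by rwa [L.line_zero_of_ge h4.le]) k hk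
        · exact L.im_ne_line (m := L.N) (by rwa [L.line_last_of_ge h4.le])
            (by rwa [L.line_N_of_ge h4.le]) k hk
      · linarith
      · exact h5 h
    exact ⟨hu.analyticAt_glue h3 hc p q, h8 hc p q⟩
  · filter_upwards [hx, hx', hx''] with w' h3 h4 h5 h6
    have : ∃ l, Tendsto (fun σ : ℝ => L.glue u (w' + σ * I)) (𝓝[≠] 0) (𝓝 l) := by
      rcases lt_or_gt_of_ne h5 with h7 | h7
      · exact hu.tendsto_glue_neck h4 h7 h6
      · exact hu.tendsto_glue_stem h7 h3 h6
    obtain ⟨l, hl⟩ := this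
    exact ⟨Or.inl ⟨0, by rw [L.line_zero_of_ge h4.le, h6]⟩, l p q,
      ((continuous_apply_apply p q).tendsto l).comp hl⟩

lemma locallyExtends_circle {w : ℂ} (hw : w.re = L.xτ ∨ w.re = L.xρ) (h1 : L.θ < w.im)
    (h2 : w.im < L.θ + 2 * π) (p q : Fin r) :
    LocallyExtends (fun w => L.glue u w p q) L.cuts w := by
  have hlt := L.xτ_lt_xρ
  have hlt' := L.xρ_lt_xR
  have hwR : w.re < L.xR := by rcases hw with h | h <;> linarith
  have hwτ : L.xτ ≤ w.re := by rcases hw with h | h <;> linarith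
  obtain ⟨B, hB⟩ := hu.eventually_norm_glue_le hwR
  have hx := eventually_re_lt hwR
  have h3 := eventually_im_lt h2
  have h4 := eventually_lt_im h1
  have h5 : ∀ᶠ w' in 𝓝 w, L.line (L.N - 1) w'.re < w'.im :=
    L.eventually_line_lt (by rwa [L.line_last_of_ge hwτ])
  have h6 : ∀ᶠ w' in 𝓝 w, w'.im < L.line L.N w'.re :=
    L.eventually_lt_line (by rwa [L.line_N_of_ge hwτ])
  have h7 : ∀ᶠ w' in 𝓝 w, w'.re ≠ w.re → w'.re ≠ L.xτ ∧ w'.re ≠ L.xρ := by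
    rcases hw with h | h
    · filter_upwards [continuous_re.continuousAt.eventually_ne (show w.re ≠ L.xρ by linarith)]
        with w' h8 h9
      exact ⟨by rwa [← h], h8⟩
    · filter_upwards [continuous_re.continuousAt.eventually_ne (show w.re ≠ L.xτ by linarith)]
        with w' h8 h9
      exact ⟨h8, by rwa [← h]⟩
  refine locallyExtends_of_vertical (c := w.re) (B := B) rfl ?_ ?_
  · filter_upwards [hx, hB, h5, h6, h7] with w' hx hB h5 h6 h7 hne
    have hc : w' ∉ L.cuts := by
      rintro (⟨k, hk⟩ | h | h)
      · exact L.im_ne_line h5 h6 k hk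
      · exact (h7 hne).1 h
      · exact (h7 hne).2 h
    exact ⟨hu.analyticAt_glue hx hc p q, hB hc p q⟩
  · filter_upwards [h3, h4] with w' h3 h4 he
    rw [← he] at hw
    refine ⟨Or.inr hw, ?_⟩
    rcases hw with h | h
    · obtain ⟨l, hl⟩ := hu.tendsto_glue_toral h h4 h3
      exact ⟨l p q, ((continuous_apply_apply p q).tendsto l).comp hl⟩
    · obtain ⟨l, hl⟩ := hu.tendsto_glue_formal h h4 h3
      exact ⟨l p q, ((continuous_apply_apply p q).tendsto l).comp hl⟩

lemma locallyExtends {w : ℂ} (hw : w.re < L.xR) (hc : w ∉ L.corners) (p q : Fin r) :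
    LocallyExtends (fun w => L.glue u w p q) L.cuts w := by
  have hN : (0 : ℤ) < L.N := by exact_mod_cast L.N_pos
  by_cases hcut : w ∈ L.cuts
  swap
  · exact ⟨_, hu.analyticAt_glue hw hcut p q, .of_forall fun _ _ => rfl⟩
  have key : ∀ k : ℤ, (∀ p q, LocallyExtends (fun w => L.glue u w p q) L.cuts
      (w - 2 * π * I * k)) → LocallyExtends (fun w => L.glue u w p q) L.cuts w := by
    intro k hk
    simpa using hu.locallyExtends_add_int hk k p q
  have hre : ∀ k : ℤ, (w - 2 * π * I * k).re = w.re := fun k => by simp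
  have him : ∀ k : ℤ, (w - 2 * π * I * k).im = w.im - 2 * π * k := fun k => by simp
  by_cases hl : ∃ m, w.im = L.line m w.re
  · obtain ⟨m, hm⟩ := hl
    have hm1 : L.line m w.re = L.line (m % L.N) w.re + 2 * π * ((m / L.N : ℤ) : ℝ) := by
      rw [← L.line_add_mul, mul_comm, Int.emod_add_mul_ediv]
    refine key (m / L.N) fun p q => ?_
    rcases lt_trichotomy w.re L.xτ with h | h | h
    · refine hu.locallyExtends_stokes (Int.emod_nonneg m hN.ne') (Int.emod_lt_of_pos m hN)
        (by rwa [hre]) ?_ p q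
      rw [hre, him]
      linarith
    · exact absurd ⟨⟨m, hm⟩, Or.inl h⟩ hc
    · refine hu.locallyExtends_ray (by rwa [hre]) (by rwa [hre]) ?_ ?_ p q
      · rw [hre]; exact fun h' => hc ⟨⟨m, hm⟩, Or.inr h'⟩
      · rw [him, hm, L.line_eq _ h.le]; ring
  · have hcirc : w.re = L.xτ ∨ w.re = L.xρ := hcut.resolve_left hl
    have hτ : L.xτ ≤ w.re := by rcases hcirc with h | h <;> linarith [L.xτ_lt_xρ]
    set k : ℤ := ⌊(w.im - L.θ) / (2 * π)⌋ with hk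
    have h1 := Int.floor_le ((w.im - L.θ) / (2 * π))
    have h2 := Int.lt_floor_add_one ((w.im - L.θ) / (2 * π))
    rw [← hk, le_div_iff₀ (by positivity)] at h1
    rw [← hk, div_lt_iff₀ (by positivity)] at h2
    have h3 : w.im - 2 * π * k ≠ L.θ := by
      intro h
      refine hl ⟨k * L.N, ?_⟩
      rw [L.line_eq _ hτ, Int.mul_ediv_cancel _ hN.ne']
      linarith
    refine key k fun p q => hu.locallyExtends_circle (by rwa [hre]) ?_ ?_ p q
    · rw [him]; exact lt_of_le_of_ne (by linarith) (Ne.symm h3)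
    · rw [him]; linarith

end LocalData.IsJumpSolution

/-- `Ψ` is the holomorphic matrix on the half-plane that is obtained from `u` by gluing. -/
structure LocalData.IsGlued {r : ℕ} (L : LocalData r) (u Ψ : ℂ → Mat r) : Prop where
  differentiableOn : ∀ p q, DifferentiableOn ℂ (fun w => Ψ w p q) {w | w.re < L.xR}
  eq_glue : ∀ w, w.re < L.xR → w ∉ L.cuts → Ψ w = L.glue u w
  add_period : ∀ w, w.re < L.xR → Ψ (w + 2 * π * I) = Ψ w * L.M0
  det_eq_one : ∀ w, w.re < L.xR → (Ψ w).det = 1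

theorem LocalData.IsJumpSolution.exists_isGlued {r : ℕ} {L : LocalData r} {u : ℂ → Mat r}
    (hu : L.IsJumpSolution u) : ∃ Ψ, L.IsGlued u Ψ := by
  have hΩ : IsOpen {w : ℂ | w.re < L.xR} := isOpen_re_lt _
  have hd := L.dense_compl_cuts
  have hF : ∀ p q, ∃ F : ℂ → ℂ, DifferentiableOn ℂ F {w | w.re < L.xR} ∧
      ∀ w ∈ {w : ℂ | w.re < L.xR}, w ∉ L.cuts → F w = L.glue u w p q := by
    intro p q
    refine exists_differentiableOn_of_locallyExtends (V := L.corners) hΩ (fun w _ => ?_) ?_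
      (fun w _ => L.eventually_notMem_corners w) ?_ ?_
    · exact mem_closure_iff_nhdsWithin_neBot.1 (hd w)
    · rintro w ⟨h, _⟩; exact Or.inl h
    · intro w hw
      obtain ⟨B, hB⟩ := hu.eventually_norm_glue_le hw
      exact ⟨B, hB.mono fun w' h hc => h hc p q⟩
    · exact fun w hw hc => hu.locallyExtends hw hc p q
  choose F hFd hFv using hF
  have heq : ∀ w : ℂ, w.re < L.xR → w ∉ L.cuts → Matrix.of (fun p q => F p q w) = L.glue u w := by
    intro w hw hc
    ext p q
    exact hFv p q w hw hc
  have hcont : ContinuousOn (fun w => (Matrix.of (fun p q => F p q w) : Mat r))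
      {w | w.re < L.xR} :=
    continuousOn_pi.2 fun p => continuousOn_pi.2 fun q => (hFd p q).continuousOn
  have hcl : {w : ℂ | w.re < L.xR} ⊆ closure ({w : ℂ | w.re < L.xR} ∩ L.cutsᶜ) :=
    hd.open_subset_closure_inter hΩ
  refine ⟨fun w => Matrix.of fun p q => F p q w, hFd, heq, ?_, ?_⟩
  · have hmap : MapsTo (fun w : ℂ => w + 2 * π * I) {w | w.re < L.xR} {w | w.re < L.xR} :=
      fun w (hw : w.re < L.xR) => by
        change (w + 2 * π * I).re < _
        rwa [LocalData.add_two_pi_re]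
    refine Set.EqOn.of_subset_closure (s := {w : ℂ | w.re < L.xR} ∩ L.cutsᶜ) ?_
      (hcont.comp (by fun_prop) hmap) (hcont.mul continuousOn_const) inter_subset_left hcl
    rintro w ⟨hw, hc⟩
    beta_reduce
    rw [heq w hw hc, heq _ (hmap hw) (by rwa [L.add_mem_cuts]), hu.glue_add]
  · refine Set.EqOn.of_subset_closure (s := {w : ℂ | w.re < L.xR} ∩ L.cutsᶜ) (g := fun _ => 1) ?_
      (continuous_id.matrix_det.comp_continuousOn hcont) continuousOn_const inter_subset_left hcl
    rintro w ⟨hw, hc⟩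
    beta_reduce
    rw [heq w hw hc, LocalData.glue, Matrix.det_mul, Matrix.det_mul, hu.det_eq_one w hw hc,
      LocalData.det_diagonal_exp _ (L.sum_gaugeExponent w), Matrix.det_nonsing_inv, L.R_det]
    simp


lemma int_periodic {α : Type*} {f : ℤ → ℂ → α} {N : ℕ} {x0 : ℝ}
    (h : ∀ m w, w.re < x0 → f (m + N) (w + 2 * π * I) = f m w) (m k : ℤ) {w : ℂ}
    (hw : w.re < x0) : f (m + k * N) (w + k * (2 * π * I)) = f m w := by
  have hre : ∀ i : ℤ, (w + i * (2 * π * I)).re < x0 := fun i => by simpa using hw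
  induction k using Int.induction_on with
  | zero => simp
  | succ i ih =>
    rw [← ih, ← h (m + i * N) _ (hre i)]
    congr 1
    · ring
    · push_cast; ring
  | pred i ih =>
    rw [← ih, ← h (m + (-(i : ℤ) - 1) * N) _ (hre _)]
    congr 1
    · ring
    · push_cast; ring

lemma norm_adjugate_apply_le {r : ℕ} {A : Mat r} {c : ℝ} (hc : 1 ≤ c)
    (hA : ∀ p q, ‖A p q‖ ≤ c) (p q : Fin r) : ‖A.adjugate p q‖ ≤ r.factorial * c ^ r := by
  have := Matrix.det_le (A := A.updateRow q (Pi.single p 1))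
    (abv := (IsAbsoluteValue.toAbsoluteValue (norm : ℂ → ℝ))) (x := c) (fun i j => by
      change ‖A.updateRow q (Pi.single p 1) i j‖ ≤ c
      rw [Matrix.updateRow_apply]
      split_ifs
      · rw [Pi.single_apply]; split_ifs <;> simp <;> linarith
      · exact hA i j)
  rw [Matrix.adjugate_apply]
  simpa using this

lemma norm_mul_apply_le {r : ℕ} {A B : Mat r} {a b : ℝ} (hA : ∀ p q, ‖A p q‖ ≤ a)
    (hB : ∀ p q, ‖B p q‖ ≤ b) (p q : Fin r) : ‖(A * B) p q‖ ≤ r * (a * b) := by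
  rw [Matrix.mul_apply]
  refine (norm_sum_le _ _).trans ?_
  calc ∑ k, ‖A p k * B k q‖ ≤ ∑ _k : Fin r, a * b := by
        refine Finset.sum_le_sum fun k _ => ?_
        rw [norm_mul]
        exact mul_le_mul (hA p k) (hB k q) (norm_nonneg _) ((norm_nonneg _).trans (hA p k))
    _ = r * (a * b) := by simp

namespace LocalData

variable {r : ℕ} (L : LocalData r)

/-- The inverse of `e^{T̂}`. -/
def expNegThat (w : ℂ) : Mat r := Matrix.diagonal fun p => exp (-L.That w p)

lemma expThat_mul_expNegThat (w : ℂ) : L.expThat w * L.expNegThat w = 1 := by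
  simp [expThat, expNegThat, ← exp_add]

lemma expNegThat_mul_expThat (w : ℂ) : L.expNegThat w * L.expThat w = 1 := by
  simp [expThat, expNegThat, ← exp_add]

/-- The jump `e^{T̂} S e^{-T̂}` on the Stokes line `m`. -/
def stokesJump (m : ℤ) (w : ℂ) : Mat r := L.expThat w * L.S m * L.expNegThat w

/-- The holomorphic continuation of `u` from the sector `m`. -/
def sectorial (Ψ : ℂ → Mat r) (m : ℤ) (w : ℂ) : Mat r := Ψ w * L.R m * L.expNegThat w

lemma sectorial_apply (Ψ : ℂ → Mat r) (m : ℤ) (w : ℂ) (p q : Fin r) :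
    L.sectorial Ψ m w p q = (∑ k, Ψ w p k * L.R m k q) * exp (-L.That w q) := by
  rw [sectorial, expNegThat, Matrix.mul_diagonal, Matrix.mul_apply]

lemma stokesJump_apply (m : ℤ) (w : ℂ) (p q : Fin r) :
    L.stokesJump m w p q = L.S m p q * exp (L.That w p - L.That w q) := by
  simp only [stokesJump, expThat, expNegThat, Matrix.mul_diagonal, Matrix.diagonal_mul, sub_eq_add_neg,
    exp_add]
  ring

lemma det_S (m : ℤ) : (L.S m).det = 1 := by
  have := congrArg Matrix.det (L.R_succ m)
  simpa [L.R_det] using this.symm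

lemma det_expNegThat (w : ℂ) : (L.expNegThat w).det = 1 :=
  det_diagonal_exp _ (by rw [Finset.sum_neg_distrib, L.sum_That, neg_zero])

lemma det_stokesJump (m : ℤ) (w : ℂ) : (L.stokesJump m w).det = 1 := by
  simp [stokesJump, L.det_S, L.det_expThat, L.det_expNegThat]

lemma sectorial_succ_mul (Ψ : ℂ → Mat r) (m : ℤ) (w : ℂ) :
    L.sectorial Ψ (m + 1) w * L.stokesJump m w = L.sectorial Ψ m w := by
  rw [sectorial, stokesJump, sectorial, L.R_succ m]
  simp only [Matrix.mul_assoc]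
  rw [← Matrix.mul_assoc (L.expNegThat w) (L.expThat w), expNegThat_mul_expThat, Matrix.one_mul]

lemma sectorial_eq_succ_mul_adjugate (Ψ : ℂ → Mat r) (m : ℤ) (w : ℂ) :
    L.sectorial Ψ (m + 1) w = L.sectorial Ψ m w * (L.stokesJump m w).adjugate := by
  rw [← L.sectorial_succ_mul Ψ m, Matrix.mul_assoc, Matrix.mul_adjugate, det_stokesJump, one_smul,
    Matrix.mul_one]

lemma formalMonodromy_mul_expNegThat_add (w : ℂ) :
    L.formalMonodromy * L.expNegThat (w + 2 * π * I) = L.expNegThat w := by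
  simp only [formalMonodromy, expNegThat, That_add, Matrix.diagonal_mul_diagonal, ← exp_add]
  congr 1
  funext p
  congr 1
  ring

lemma S_add (m : ℤ) :
    L.formalMonodromy * L.S (m + L.N) = L.S m * L.formalMonodromy := by
  have h1 : L.M0 * L.R (m + L.N) = L.R m * L.formalMonodromy := L.R_add m
  have h2 : L.M0 * L.R (m + 1 + L.N) = L.R (m + 1) * L.formalMonodromy := L.R_add (m + 1)
  have h3 := L.R_succ (m + L.N)
  rw [show m + (L.N : ℤ) + 1 = m + 1 + L.N by ring] at h3
  rw [h3, ← Matrix.mul_assoc, h2, L.R_succ m, Matrix.mul_assoc, Matrix.mul_assoc] at h1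
  have h4 := congrArg (fun X => (L.R (m + 1))⁻¹ * X) h1
  simpa only [Matrix.nonsing_inv_mul_cancel_left _ _ (L.R_isUnit _)] using h4

lemma stokesJump_add (m : ℤ) (w : ℂ) :
    L.stokesJump (m + L.N) (w + 2 * π * I) = L.stokesJump m w := by
  rw [stokesJump, stokesJump, expThat_add, Matrix.mul_assoc (L.expThat w), S_add,
    Matrix.mul_assoc, Matrix.mul_assoc (L.S m), formalMonodromy_mul_expNegThat_add,
    ← Matrix.mul_assoc]

/-- The Stokes jumps are flat near their lines, uniformly on all the sheets. -/
lemma exists_stokesJump_flat : ∃ ε > 0, ∀ K : ℕ, ∃ C, 0 ≤ C ∧ ∀ m (w : ℂ), w.re < L.xτ →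
    |w.im - L.φ m| < ε → ∀ p q, ‖(L.stokesJump m w - 1) p q‖ ≤ C * Real.exp (K * w.re) := by
  obtain ⟨σ, hσ⟩ := L.angles
  have hN : (0 : ℤ) < L.N := by exact_mod_cast L.N_pos
  have h0 : ∀ (m : ℤ) (p q : Fin r), ∃ ε > 0, ∀ K : ℕ, ∃ C, ∀ w : ℂ, w.re < L.xτ →
      |w.im - L.φ m| < ε → ‖(L.stokesJump m w - 1) p q‖ ≤ C * Real.exp (K * w.re) := by
    intro m p q
    have hz : (∀ w, (L.stokesJump m w - 1) p q = 0) → ∃ ε > 0, ∀ K : ℕ, ∃ C, ∀ w : ℂ,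
        w.re < L.xτ → |w.im - L.φ m| < ε →
        ‖(L.stokesJump m w - 1) p q‖ ≤ C * Real.exp (K * w.re) := fun h =>
      ⟨1, one_pos, fun K => ⟨0, fun w _ _ => by simp [h]⟩⟩
    by_cases hpq : p = q
    · subst hpq
      refine hz fun w => ?_
      rw [Matrix.sub_apply, stokesJump_apply, L.S_diag]
      simp
    by_cases hS : L.S m p q = 0
    · refine hz fun w => ?_
      rw [Matrix.sub_apply, stokesJump_apply, hS]
      simp [hpq]
    · obtain ⟨ε, hε, h⟩ := L.S_flat m p q hpq hS
      refine ⟨ε, hε, fun K => ?_⟩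
      obtain ⟨C, hC⟩ := h K
      refine ⟨‖L.S m p q‖ * C, fun w hw hwi => ?_⟩
      rw [Matrix.sub_apply, stokesJump_apply, Matrix.one_apply_ne hpq, sub_zero, norm_mul,
        mul_assoc]
      gcongr
      exact hC w hw hwi
  choose ε hε hflat using h0
  choose C hC using hflat
  obtain ⟨ε0, hε0, hle⟩ : ∃ ε0 > 0, ∀ m ∈ Finset.Ico (0 : ℤ) L.N, ∀ p q, ε0 ≤ ε m p q := by
    have : ∀ s : Finset (ℤ × Fin r × Fin r), ∃ ε0 > 0, ∀ x ∈ s, ε0 ≤ ε x.1 x.2.1 x.2.2 := by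
      intro s
      induction s using Finset.induction_on with
      | empty => exact ⟨1, one_pos, by simp⟩
      | insert a s _ ih =>
        obtain ⟨e, he, h⟩ := ih
        refine ⟨min e (ε a.1 a.2.1 a.2.2), lt_min he (hε _ _ _), fun x hx => ?_⟩
        rcases Finset.mem_insert.1 hx with rfl | hx
        · exact min_le_right _ _
        · exact (min_le_left _ _).trans (h x hx)
    obtain ⟨e, he, h⟩ := this (Finset.Ico (0 : ℤ) L.N ×ˢ Finset.univ)
    exact ⟨e, he, fun m hm p q => h (m, p, q) (by simp only [Finset.mem_product]; exact ⟨hm, Finset.mem_univ _⟩)⟩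
  refine ⟨ε0, hε0, fun K => ⟨∑ m ∈ Finset.Ico (0 : ℤ) L.N, ∑ p, ∑ q, |C m p q K|,
    by positivity, fun m w hw hwi p q => ?_⟩⟩
  have hm1 : m = m % L.N + m / L.N * L.N := by rw [mul_comm, Int.emod_add_mul_ediv]
  set w' : ℂ := w - ((m / L.N : ℤ) : ℂ) * (2 * π * I) with hw'
  have hre : w'.re = w.re := by simp [hw']
  have him : w'.im = w.im - (m / L.N : ℤ) * (2 * π) := by simp [hw']
  have hmem : m % L.N ∈ Finset.Ico (0 : ℤ) L.N :=
    Finset.mem_Ico.2 ⟨Int.emod_nonneg _ hN.ne', Int.emod_lt_of_pos _ hN⟩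
  have hJ : L.stokesJump m w = L.stokesJump (m % L.N) w' := by
    have := int_periodic (f := L.stokesJump) (x0 := L.xτ) (fun m w _ => L.stokesJump_add m w)
      (m % L.N) (m / L.N) (w := w') (by rwa [hre])
    rw [← this, ← hm1, hw', sub_add_cancel]
  have hφ := hσ.periodic_int (m % L.N) (m / L.N)
  rw [← hm1] at hφ
  rw [hJ, ← hre]
  refine (hC (m % L.N) p q K w' (by rwa [hre]) ?_).trans ?_
  · rw [him, show w.im - ((m / L.N : ℤ) : ℝ) * (2 * π) - L.φ (m % L.N) = w.im - L.φ m by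
      rw [hφ]; ring]
    exact hwi.trans_le (hle _ hmem p q)
  · gcongr
    refine (le_abs_self _).trans ?_
    refine le_trans ?_ (Finset.single_le_sum (f := fun m => ∑ p, ∑ q, |C m p q K|)
      (fun m _ => by positivity) hmem)
    refine le_trans ?_ (Finset.single_le_sum (f := fun p => ∑ q, |C (m % L.N) p q K|)
      (fun p _ => by positivity) (Finset.mem_univ p))
    exact Finset.single_le_sum (f := fun q => |C (m % L.N) p q K|)
      (fun p _ => by positivity) (Finset.mem_univ q)

lemma exists_abs_line_sub_lt {ε : ℝ} (hε : 0 < ε) :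
    ∃ x0 ≤ L.xτ, ∀ m x, x < x0 → |L.line m x - L.φ m| < ε := by
  obtain ⟨σ, hσ⟩ := L.angles
  have hN : (0 : ℤ) < L.N := by exact_mod_cast L.N_pos
  have h1 : ∀ᶠ x in atBot, ∀ m ∈ Finset.Ico (0 : ℤ) L.N, |L.line m x - L.φ m| < ε := by
    rw [Filter.eventually_all_finset]
    intro m _
    have := (L.line_tendsto m).eventually (Metric.ball_mem_nhds _ hε)
    simpa [Real.dist_eq] using this
  obtain ⟨a, ha⟩ := eventually_atBot.1 h1
  refine ⟨min a L.xτ, min_le_right _ _, fun m x hx => ?_⟩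
  have hm1 : m = m % L.N + m / L.N * L.N := by rw [mul_comm, Int.emod_add_mul_ediv]
  have h2 := ha x (hx.le.trans (min_le_left _ _)) (m % L.N)
    (Finset.mem_Ico.2 ⟨Int.emod_nonneg _ hN.ne', Int.emod_lt_of_pos _ hN⟩)
  have h3 := L.line_add_mul (m % L.N) (m / L.N) x
  have h4 := hσ.periodic_int (m % L.N) (m / L.N)
  rw [← hm1] at h3 h4
  rwa [h3, h4, show L.line (m % L.N) x + 2 * π * ((m / L.N : ℤ) : ℝ) -
    (L.φ (m % L.N) + ((m / L.N : ℤ) : ℝ) * (2 * π)) =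
    L.line (m % L.N) x - L.φ (m % L.N) by ring]

end LocalData

namespace LocalData.IsGlued

variable {r : ℕ} {L : LocalData r} {u Ψ : ℂ → Mat r} (hΨ : L.IsGlued u Ψ)

include hΨ

lemma sectorial_add (m : ℤ) (w : ℂ) (hw : w.re < L.xR) :
    L.sectorial Ψ (m + L.N) (w + 2 * π * I) = L.sectorial Ψ m w := by
  have h1 : L.M0 * L.R (m + L.N) = L.R m * L.formalMonodromy := L.R_add m
  rw [sectorial, sectorial, hΨ.add_period w hw, Matrix.mul_assoc (Ψ w), h1, Matrix.mul_assoc,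
    Matrix.mul_assoc (L.R m), L.formalMonodromy_mul_expNegThat_add, Matrix.mul_assoc]

lemma det_sectorial (m : ℤ) {w : ℂ} (hw : w.re < L.xR) : (L.sectorial Ψ m w).det = 1 := by
  rw [sectorial, Matrix.det_mul, Matrix.det_mul, hΨ.det_eq_one w hw, L.R_det, L.det_expNegThat]
  simp

lemma sectorial_differentiableOn (m : ℤ) (p q : Fin r) :
    DifferentiableOn ℂ (fun w => L.sectorial Ψ m w p q) {w | w.re < L.xR} := by
  simp only [sectorial_apply]
  refine DifferentiableOn.mul (DifferentiableOn.fun_sum fun k _ =>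
    (hΨ.differentiableOn p k).mul_const _) ?_
  exact (L.That_differentiable q).neg.cexp.differentiableOn

lemma sectorial_eq {w : ℂ} {m : ℤ} (hw : w.re < L.xτ) (h1 : L.line (m - 1) w.re < w.im)
    (h2 : w.im < L.line m w.re) : L.sectorial Ψ m w = u w := by
  have hR : w.re < L.xR := hw.trans (L.xτ_lt_xρ.trans L.xρ_lt_xR)
  have hc : w ∉ L.cuts := by
    rintro (⟨k, hk⟩ | h | h)
    · exact L.im_ne_line h1 h2 k hk
    · linarith
    · linarith [L.xτ_lt_xρ]
  rw [sectorial, hΨ.eq_glue w hR hc, glue, L.sector_eq h1 h2.le,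
    Matrix.nonsing_inv_mul_cancel_right _ _ (L.R_isUnit m)]
  have : (Matrix.diagonal fun p => exp (L.gaugeExponent w p)) = L.expThat w := by
    unfold expThat
    congr 1
    funext p
    rw [L.gaugeExponent_of_lt hw]
  rw [this, Matrix.mul_assoc, L.expThat_mul_expNegThat, Matrix.mul_one]

lemma norm_sectorial_le {B : ℝ} (hB : ∀ w, w.re < L.xR → w ∉ L.cuts → ∀ p q, ‖u w p q‖ ≤ B)
    {w : ℂ} {m : ℤ} (hw : w.re < L.xτ) (h1 : L.line (m - 1) w.re ≤ w.im)
    (h2 : w.im ≤ L.line m w.re) (p q : Fin r) : ‖L.sectorial Ψ m w p q‖ ≤ B := by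
  have hR : w.re < L.xR := hw.trans (L.xτ_lt_xρ.trans L.xρ_lt_xR)
  have hlt : L.line (m - 1) w.re < L.line m w.re := L.line_strictMono hw (sub_one_lt m)
  set b : ℝ := (L.line (m - 1) w.re + L.line m w.re) / 2 with hb
  set c : ℝ → ℂ := fun t => w + (t * (b - w.im) : ℝ) * I with hc
  have hcc : Continuous c := by fun_prop
  have hc0 : c 0 = w := by simp [hc]
  have hcont : ContinuousAt (fun w => L.sectorial Ψ m w p q) w :=
    differentiableOn_halfPlane_continuous (hΨ.sectorial_differentiableOn m p q) hR
  have ht : Tendsto (fun t => ‖L.sectorial Ψ m (c t) p q‖) (𝓝[>] 0)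
      (𝓝 ‖L.sectorial Ψ m w p q‖) := by
    refine (hcont.norm.tendsto.comp ?_).mono_left nhdsWithin_le_nhds
    simpa [hc0] using hcc.tendsto 0
  refine le_of_tendsto ht ?_
  filter_upwards [Ioo_mem_nhdsGT (zero_lt_one (α := ℝ))] with t ht
  have hre : (c t).re = w.re := by simp [hc]
  have him : (c t).im = w.im + t * (b - w.im) := by simp [hc]
  have h3 : L.line (m - 1) (c t).re < (c t).im := by
    rw [hre, him]
    nlinarith [mul_nonneg (sub_nonneg.2 ht.2.le) (sub_nonneg.2 h1), mul_pos ht.1 (sub_pos.2 hlt)]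
  have h4 : (c t).im < L.line m (c t).re := by
    rw [hre, him]
    nlinarith [mul_nonneg (sub_nonneg.2 ht.2.le) (sub_nonneg.2 h2), mul_pos ht.1 (sub_pos.2 hlt)]
  rw [hΨ.sectorial_eq (by rwa [hre]) h3 h4]
  refine hB _ (by rwa [hre]) ?_ p q
  rintro (⟨k, hk⟩ | h | h)
  · exact L.im_ne_line h3 h4 k hk
  · rw [hre] at h; linarith
  · rw [hre] at h; linarith [L.xτ_lt_xρ]

/-- The entries of the sectorial matrices form sector families. -/
theorem exists_isSectorFamily {B : ℝ}
    (hB : ∀ w, w.re < L.xR → w ∉ L.cuts → ∀ p q, ‖u w p q‖ ≤ B) :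
    ∃ ε > 0, ∃ x0 B', ∀ p q,
      IsSectorFamily L.φ L.N (fun m w => L.sectorial Ψ m w p q) ε x0 B' := by
  obtain ⟨σ, hσ⟩ := L.angles
  have hσ0 := hσ.gap_pos
  obtain ⟨ε1, hε1, hflat⟩ := L.exists_stokesJump_flat
  obtain ⟨ε, hε, hεε, hεσ⟩ : ∃ ε > 0, ε ≤ ε1 ∧ 4 * ε ≤ σ :=
    ⟨min ε1 (σ / 4), by positivity, min_le_left _ _, by linarith [min_le_right ε1 (σ / 4)]⟩
  obtain ⟨x1, hx1, hline⟩ := L.exists_abs_line_sub_lt hε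
  have hτR : L.xτ < L.xR := L.xτ_lt_xρ.trans L.xρ_lt_xR
  obtain ⟨C0, hC0, hJ0⟩ := hflat 0
  have hJ : ∀ m (w : ℂ), w.re < L.xτ → |w.im - L.φ m| < ε → ∀ p q,
      ‖L.stokesJump m w p q‖ ≤ C0 + 1 := by
    intro m w hw hwi p q
    have h1 := hJ0 m w hw (hwi.trans_le hεε) p q
    rw [Matrix.sub_apply] at h1
    have h2 : ‖(1 : Mat r) p q‖ ≤ 1 := by
      rw [Matrix.one_apply]; split_ifs <;> simp
    have h3 := norm_sub_norm_le (L.stokesJump m w p q) ((1 : Mat r) p q)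
    simp only [Nat.cast_zero, zero_mul, Real.exp_zero, mul_one] at h1
    linarith
  set c : ℝ := r.factorial * (C0 + 1) ^ r
  set B' : ℝ := B + |r * (B * (C0 + 1))| + |r * (B * c)|
  have hbound : ∀ m (w : ℂ), w.re < x1 → L.φ (m - 1) - ε < w.im → w.im < L.φ m + ε → ∀ p q,
      ‖L.sectorial Ψ m w p q‖ ≤ B' := by
    intro m w hw h1 h2 p q
    have hwτ : w.re < L.xτ := hw.trans_le hx1
    have l0 := abs_lt.1 (hline m w.re hw)
    have l1 := abs_lt.1 (hline (m + 1) w.re hw)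
    have l2 := abs_lt.1 (hline (m - 1) w.re hw)
    have l3 := abs_lt.1 (hline (m - 2) w.re hw)
    have g0 := hσ.gap m
    have g1 := hσ.gap (m - 2)
    rw [show m - 2 + 1 = m - 1 by ring] at g1
    rcases lt_or_ge (L.line m w.re) w.im with h3 | h3
    · have h5 := norm_mul_apply_le (hΨ.norm_sectorial_le hB hwτ (m := m + 1)
        (by rw [add_sub_cancel_right]; exact h3.le) (by linarith))
        (hJ m w hwτ (by rw [abs_lt]; constructor <;> linarith)) p q
      rw [L.sectorial_succ_mul] at h5
      have hB0 : 0 ≤ B := (norm_nonneg _).trans (hΨ.norm_sectorial_le hB hwτ (m := m + 1)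
        (by rw [add_sub_cancel_right]; exact h3.le) (by linarith) p q)
      linarith [le_abs_self (r * (B * (C0 + 1))), abs_nonneg (r * (B * c))]
    rcases lt_or_ge w.im (L.line (m - 1) w.re) with h4 | h4
    · have hs := hΨ.norm_sectorial_le hB hwτ (m := m - 1)
        (by rw [show m - 1 - 1 = m - 2 by ring]; linarith) h4.le
      have h5 := norm_mul_apply_le hs (norm_adjugate_apply_le (by linarith)
        (hJ (m - 1) w hwτ (by rw [abs_lt]; constructor <;> linarith))) p q
      rw [← L.sectorial_eq_succ_mul_adjugate, sub_add_cancel] at h5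
      have hB0 : 0 ≤ B := (norm_nonneg _).trans (hs p q)
      linarith [abs_nonneg (r * (B * (C0 + 1))), le_abs_self (r * (B * c))]
    · have := hΨ.norm_sectorial_le hB hwτ h4 h3 p q
      linarith [abs_nonneg (r * (B * (C0 + 1))), abs_nonneg (r * (B * c))]
  refine ⟨ε, hε, x1, B', fun p q => ⟨fun m => ?_, fun m w hw => ?_, fun m w hw h1 h2 =>
    hbound m w hw h1 h2 p q, fun K => ?_⟩⟩
  · exact (hΨ.sectorial_differentiableOn m p q).mono fun w (hw : w.re < x1) =>
      show w.re < L.xR by linarith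
  · simp only [hΨ.sectorial_add m w (by linarith)]
  · obtain ⟨C, hC, h⟩ := hflat K
    refine ⟨r * (B' * C), fun m w hw hwi => ?_⟩
    have hw2 := abs_lt.1 hwi
    have h1 := norm_mul_apply_le (hbound (m + 1) w hw (by rw [add_sub_cancel_right]; linarith)
      (by linarith [hσ.gap m])) (h m w (hw.trans_le hx1) (hwi.trans_le hεε)) p q
    rw [mul_sub, L.sectorial_succ_mul, mul_one, Matrix.sub_apply] at h1
    refine h1.trans (le_of_eq ?_)
    ring

end LocalData.IsGlued


namespace LocalData

variable {r : ℕ} (L : LocalData r)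

/-- Points of the closed sectors, going to the pole: the filter on pairs (sector, point). -/
def sectorFilter : Filter (ℤ × ℂ) :=
  comap (fun x => x.2.re) atBot ⊓
    𝓟 {x | L.line (x.1 - 1) x.2.re ≤ x.2.im ∧ x.2.im ≤ L.line x.1 x.2.re}

lemma tendsto_re_sectorFilter : Tendsto (fun x : ℤ × ℂ => x.2.re) L.sectorFilter atBot :=
  tendsto_comap.mono_left inf_le_left

lemma eventually_mem_sectorFilter :
    ∀ᶠ x in L.sectorFilter,
      L.line (x.1 - 1) x.2.re ≤ x.2.im ∧ x.2.im ≤ L.line x.1 x.2.re :=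
  mem_inf_of_right (mem_principal_self _)

lemma tendsto_sectorFilter {α : Type*} {l : Filter α} {f : α → ℤ × ℂ}
    (h1 : Tendsto (fun i => (f i).2.re) l atBot)
    (h2 : ∀ᶠ i in l, L.line ((f i).1 - 1) (f i).2.re ≤ (f i).2.im ∧
      (f i).2.im ≤ L.line (f i).1 (f i).2.re) : Tendsto f l L.sectorFilter :=
  tendsto_inf.2 ⟨tendsto_comap_iff.2 h1, tendsto_principal.2 h2⟩

instance neBot_sectorFilter : L.sectorFilter.NeBot := by
  have : Tendsto (fun x : ℝ => ((0 : ℤ), (⟨x, L.line 0 x⟩ : ℂ))) atBot L.sectorFilter :=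
    L.tendsto_sectorFilter tendsto_id
      (.of_forall fun x => ⟨L.line_monotone x (by norm_num), le_rfl⟩)
  exact this.neBot

lemma tendsto_exp_sectorFilter :
    Tendsto (fun x : ℤ × ℂ => exp x.2) L.sectorFilter (𝓝[≠] 0) := by
  refine tendsto_nhdsWithin_iff.2 ⟨?_, .of_forall fun x => exp_ne_zero _⟩
  rw [tendsto_zero_iff_norm_tendsto_zero]
  simp only [norm_exp]
  exact Real.tendsto_exp_atBot.comp L.tendsto_re_sectorFilter

lemma tendsto_exp_sectorFilter_zero :
    Tendsto (fun x : ℤ × ℂ => exp x.2) L.sectorFilter (𝓝 0) :=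
  L.tendsto_exp_sectorFilter.mono_right nhdsWithin_le_nhds

end LocalData

/-- The Euler derivative `ζ dY/dζ` of a matrix of formal power series. -/
def formalEuler {r : ℕ} (Y : FormalMat r) : FormalMat r :=
  Matrix.of fun p q => PowerSeries.X * derivative ℂ (Y p q)

/-- `Y` is the common asymptotic expansion of the sectorial matrices, which may be differentiated
term by term. -/
structure LocalData.IsExpansion {r : ℕ} (L : LocalData r) (Ψ : ℂ → Mat r) (Y : FormalMat r) :
    Prop where
  asymp : ∀ p q, Asymp L.sectorFilter (fun x => exp x.2)
    (fun x => L.sectorial Ψ x.1 x.2 p q) (Y p q)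
  asymp_deriv : ∀ p q, Asymp L.sectorFilter (fun x => exp x.2)
    (fun x => matDeriv (L.sectorial Ψ x.1) x.2 p q)
    (PowerSeries.X * derivative ℂ (Y p q))

theorem LocalData.IsGlued.exists_isExpansion {r : ℕ} {L : LocalData r} {u Ψ : ℂ → Mat r}
    (hu : L.IsJumpSolution u) (hΨ : L.IsGlued u Ψ) : ∃ Y, L.IsExpansion Ψ Y := by
  obtain ⟨B, hB⟩ := hu.bounded
  obtain ⟨ε, hε, x0, B', hf⟩ := hΨ.exists_isSectorFamily hB
  obtain ⟨σ, hσ⟩ := L.angles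
  choose Y hY using fun p q => (hf p q).exists_expansion_deriv hσ hε
  have key : ∀ p q (K : ℕ), ∃ C : ℝ, ∀ᶠ x in L.sectorFilter,
      ‖L.sectorial Ψ x.1 x.2 p q -
        ∑ i ∈ Finset.range K, coeff i (Y p q) * exp x.2 ^ i‖ ≤ C * ‖exp x.2 ^ K‖ ∧
      ‖matDeriv (L.sectorial Ψ x.1) x.2 p q - ∑ i ∈ Finset.range K,
        coeff i (PowerSeries.X * derivative ℂ (Y p q)) * exp x.2 ^ i‖
        ≤ C * ‖exp x.2 ^ K‖ := by
    intro p q K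
    obtain ⟨ε', hε', x', C, h⟩ := hY p q K
    obtain ⟨x1, _, hline⟩ := L.exists_abs_line_sub_lt hε'
    refine ⟨C, ?_⟩
    filter_upwards [L.eventually_mem_sectorFilter,
      L.tendsto_re_sectorFilter.eventually (eventually_lt_atBot (min x' x1))] with x hx hx'
    have h1 := abs_lt.1 (hline (x.1 - 1) x.2.re (hx'.trans_le (min_le_right _ _)))
    have h2 := abs_lt.1 (hline x.1 x.2.re (hx'.trans_le (min_le_right _ _)))
    have := h x.1 x.2 (hx'.trans_le (min_le_left _ _)) (by linarith) (by linarith)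
    rw [norm_pow, norm_exp, ← Real.exp_nat_mul]
    exact this
  refine ⟨Matrix.of Y, fun p q K => ?_, fun p q K => ?_⟩
  · obtain ⟨C, hC⟩ := key p q K
    exact Asymptotics.IsBigO.of_bound C (hC.mono fun x hx => hx.1)
  · obtain ⟨C, hC⟩ := key p q K
    exact Asymptotics.IsBigO.of_bound C (hC.mono fun x hx => hx.2)

namespace LocalData.IsExpansion

variable {r : ℕ} {L : LocalData r} {u Ψ : ℂ → Mat r} {Y : FormalMat r}

lemma det_eq_one (hΨ : L.IsGlued u Ψ) (hY : L.IsExpansion Ψ Y) : Y.det = 1 := by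
  have h1 := Asymp.det L.tendsto_exp_sectorFilter_zero hY.asymp
  have h2 : Asymp L.sectorFilter (fun x => exp x.2)
      (fun x => (L.sectorial Ψ x.1 x.2).det) 1 := by
    have := Asymp.const L.tendsto_exp_sectorFilter_zero 1
    rw [map_one] at this
    refine this.congr' ?_
    filter_upwards [L.tendsto_re_sectorFilter.eventually (eventually_lt_atBot L.xR)] with x hx
    exact (hΨ.det_sectorial x.1 hx).symm
  exact h1.unique L.tendsto_exp_sectorFilter h2

/-- The formal logarithmic derivative `Y⁻¹ ζ Y'`. -/
lemma asymp_adjugate_mul_deriv (hY : L.IsExpansion Ψ Y) (p q : Fin r) :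
    Asymp L.sectorFilter (fun x => exp x.2)
      (fun x => ((L.sectorial Ψ x.1 x.2).adjugate * matDeriv (L.sectorial Ψ x.1) x.2) p q)
      ((Y.adjugate * formalEuler Y) p q) :=
  Asymp.matMul L.tendsto_exp_sectorFilter_zero
    (fun p q => Asymp.adjugate L.tendsto_exp_sectorFilter_zero hY.asymp p q)
    (fun p q => hY.asymp_deriv p q) p q

end LocalData.IsExpansion


/-! ### Matrix algebra of the integrands -/

section Algebra

variable {r : ℕ}

/-- Conjugating a diagonal matrix by a triangular one does not change the diagonal. -/
lemma conj_diagonal_apply_self {S : Mat r} {h : Fin r → ℝ} (hdet : S.det = 1)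
    (hS : ∀ p q, p ≠ q → S p q ≠ 0 → h p < h q) (d : Fin r → ℂ) (p : Fin r) :
    (S * Matrix.diagonal d * S⁻¹) p p = d p := by
  have hu : IsUnit S.det := by rw [hdet]; exact isUnit_one
  have : Invertible S := Matrix.invertibleOfIsUnitDet S hu
  have hbt : S.BlockTriangular h := by
    intro i j hij
    by_contra hne
    exact absurd (hS i j (by rintro rfl; exact lt_irrefl _ hij) hne) (not_lt.2 hij.le)
  have hinv := Matrix.blockTriangular_inv_of_blockTriangular hbt
  have hz : ∀ k, k ≠ p → S p k * S⁻¹ k p = 0 := by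
    intro k hk
    by_cases h0 : S p k = 0
    · rw [h0, zero_mul]
    · rw [hinv (hS p k hk.symm h0), mul_zero]
  have h1 : S p p * S⁻¹ p p = 1 := by
    have := congrFun (congrFun (Matrix.mul_nonsing_inv S hu) p) p
    rwa [Matrix.mul_apply, Finset.sum_eq_single p (fun k _ hk => hz k hk) (by simp),
      Matrix.one_apply_eq] at this
  rw [Matrix.mul_apply, Finset.sum_eq_single p]
  · rw [Matrix.mul_diagonal]
    linear_combination d p * h1
  · intro k _ hk
    rw [Matrix.mul_diagonal]
    linear_combination d k * hz k hk
  · simp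

lemma trace_diagonal_mul (d : Fin r → ℂ) (A : Mat r) :
    (Matrix.diagonal d * A).trace = ∑ p, d p * A p p := by
  simp [Matrix.trace]

lemma trace_mul_diagonal (d : Fin r → ℂ) (A : Mat r) :
    (A * Matrix.diagonal d).trace = ∑ p, A p p * d p := by
  simp [Matrix.trace]

/-- Traces in a frame that is conjugated by an invertible diagonal matrix. -/
lemma trace_conj_mul_conj {D D' : Mat r} (h : D' * D = 1) (A B : Mat r) :
    (D * A * D' * (D * B * D')).trace = (A * B).trace := by
  have : D * A * D' * (D * B * D') = D * (A * B * D') := by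
    simp only [Matrix.mul_assoc]
    rw [← Matrix.mul_assoc D' D, h, Matrix.one_mul]
  rw [this, Matrix.trace_mul_comm, Matrix.mul_assoc, h, Matrix.mul_one]

variable {S D D' J : Mat r} {d ℓ θ : Fin r → ℂ}

lemma inv_of_eq_conj (hJ : J = D * S * D') (h : D' * D = 1)
    (hS : S.det = 1) : J⁻¹ = D * S⁻¹ * D' := by
  have h' : D * D' = 1 := mul_eq_one_comm.1 h
  apply Matrix.inv_eq_right_inv
  rw [hJ]
  have : D * S * D' * (D * S⁻¹ * D') = D * (S * S⁻¹) * D' := by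
    simp only [Matrix.mul_assoc]
    rw [← Matrix.mul_assoc D' D, h, Matrix.one_mul]
  rw [this, Matrix.mul_nonsing_inv _ (by rw [hS]; exact isUnit_one), Matrix.mul_one, h']

lemma sub_conj_diagonal (hJ : J = D * S * D') (h : D' * D = 1) (hS : S.det = 1)
    (hD : D = Matrix.diagonal d) (θ : Fin r → ℂ) :
    Matrix.diagonal θ - J * Matrix.diagonal θ * J⁻¹ =
      D * (Matrix.diagonal θ - S * Matrix.diagonal θ * S⁻¹) * D' := by
  have h' : D * D' = 1 := mul_eq_one_comm.1 h
  have hc : D * Matrix.diagonal θ = Matrix.diagonal θ * D := by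
    rw [hD]; simp [mul_comm]
  have hc' : D' * Matrix.diagonal θ * D = Matrix.diagonal θ := by
    rw [Matrix.mul_assoc, ← hc, ← Matrix.mul_assoc, h, Matrix.one_mul]
  rw [inv_of_eq_conj hJ h hS, hJ, Matrix.mul_sub, Matrix.sub_mul, hc, Matrix.mul_assoc _ D D', h',
    Matrix.mul_one]
  congr 1
  have : D * S * D' * Matrix.diagonal θ * (D * S⁻¹ * D') =
      D * S * (D' * Matrix.diagonal θ * D) * S⁻¹ * D' := by
    simp only [Matrix.mul_assoc]
  rw [this, hc']
  simp only [Matrix.mul_assoc]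

/-- The integrand of Malgrange's form on a Stokes line or a neck, in the frame of `Ψ`. -/
lemma trace_malgrange (hJ : J = D * S * D') (h : D' * D = 1) (hS : S.det = 1)
    (hD : D = Matrix.diagonal d) (A : Mat r) :
    ((D * A * D' - Matrix.diagonal ℓ) *
      (Matrix.diagonal θ - J * Matrix.diagonal θ * J⁻¹)).trace =
    (A * (Matrix.diagonal θ - S * Matrix.diagonal θ * S⁻¹)).trace -
      (∑ p, ℓ p * θ p - ∑ p, ℓ p * (S * Matrix.diagonal θ * S⁻¹) p p) := by
  have h' : D * D' = 1 := mul_eq_one_comm.1 h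
  have hc : D * Matrix.diagonal ℓ = Matrix.diagonal ℓ * D := by
    rw [hD]; simp [mul_comm]
  have hl : Matrix.diagonal ℓ = D * Matrix.diagonal ℓ * D' := by
    rw [hc, Matrix.mul_assoc, h', Matrix.mul_one]
  rw [sub_conj_diagonal hJ h hS hD, Matrix.sub_mul, Matrix.trace_sub, trace_conj_mul_conj h]
  congr 1
  nth_rewrite 1 [hl]
  rw [trace_conj_mul_conj h, trace_diagonal_mul, ← Finset.sum_sub_distrib]
  refine Finset.sum_congr rfl fun p _ => ?_
  rw [Matrix.sub_apply, Matrix.diagonal_apply_eq]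
  ring

/-- The integrand of the correction on a Stokes line or a neck. -/
lemma trace_theta (hJ : J = D * S * D') (h : D' * D = 1) (hS : S.det = 1)
    (hD : D = Matrix.diagonal d) :
    ((Matrix.diagonal ℓ - J * Matrix.diagonal ℓ * J⁻¹) *
      (Matrix.diagonal θ - J * Matrix.diagonal θ * J⁻¹)).trace =
    2 * ∑ p, ℓ p * θ p - ∑ p, ℓ p * (S * Matrix.diagonal θ * S⁻¹) p p -
      ∑ p, (S * Matrix.diagonal ℓ * S⁻¹) p p * θ p := by
  have hSS : S⁻¹ * S = 1 := Matrix.nonsing_inv_mul _ (by rw [hS]; exact isUnit_one)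
  rw [sub_conj_diagonal hJ h hS hD, sub_conj_diagonal hJ h hS hD, trace_conj_mul_conj h,
    Matrix.sub_mul, Matrix.mul_sub, Matrix.mul_sub, Matrix.trace_sub, Matrix.trace_sub,
    Matrix.trace_sub, trace_conj_mul_conj hSS, trace_diagonal_mul, trace_diagonal_mul,
    trace_mul_diagonal]
  simp only [Matrix.diagonal_apply_eq]
  ring

end Algebra

/-! ### Entrywise derivatives -/

section Derivatives

variable {r : ℕ} {A B : ℂ → Mat r} {w : ℂ}

lemma matDeriv_mul (hA : ∀ p q, DifferentiableAt ℂ (fun w => A w p q) w)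
    (hB : ∀ p q, DifferentiableAt ℂ (fun w => B w p q) w) :
    matDeriv (fun w => A w * B w) w = matDeriv A w * B w + A w * matDeriv B w := by
  ext p q
  simp only [matDeriv, Matrix.of_apply, Matrix.add_apply, Matrix.mul_apply]
  rw [deriv_fun_sum (A := fun k w => A w p k * B w k q) fun k _ => (hA p k).fun_mul (hB k q), ← Finset.sum_add_distrib]
  exact Finset.sum_congr rfl fun k _ => deriv_fun_mul (hA p k) (hB k q)

lemma matDeriv_const (M : Mat r) (w : ℂ) : matDeriv (fun _ => M) w = 0 := by
  ext p q
  simp [matDeriv]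

lemma matDeriv_mul_const (hA : ∀ p q, DifferentiableAt ℂ (fun w => A w p q) w) (M : Mat r) :
    matDeriv (fun w => A w * M) w = matDeriv A w * M := by
  rw [matDeriv_mul (B := fun _ => M) hA fun p q => differentiableAt_const _, matDeriv_const]
  simp

lemma differentiableAt_mul_apply (hA : ∀ p q, DifferentiableAt ℂ (fun w => A w p q) w)
    (hB : ∀ p q, DifferentiableAt ℂ (fun w => B w p q) w) (p q : Fin r) :
    DifferentiableAt ℂ (fun w => (A w * B w) p q) w := by
  simp only [Matrix.mul_apply]
  exact DifferentiableAt.fun_sum fun k _ => (hA p k).mul (hB k q)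

lemma differentiableAt_diagonal_apply {f : ℂ → Fin r → ℂ}
    (hf : ∀ p, DifferentiableAt ℂ (fun w => f w p) w) (p q : Fin r) :
    DifferentiableAt ℂ (fun w => Matrix.diagonal (f w) p q) w := by
  by_cases h : p = q
  · subst h; simpa using hf p
  · simp [h]

lemma matDeriv_diagonal {f : ℂ → Fin r → ℂ} {f' : Fin r → ℂ}
    (hf : ∀ p, HasDerivAt (fun w => f w p) (f' p) w) :
    matDeriv (fun w => Matrix.diagonal (f w)) w = Matrix.diagonal f' := by
  ext p q
  by_cases h : p = q
  · subst h; simpa [matDeriv] using (hf p).deriv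
  · simp [matDeriv, h]

lemma differentiableOn_adjugate_apply {s : Set ℂ}
    (hA : ∀ p q, DifferentiableOn ℂ (fun w => A w p q) s) (p q : Fin r) :
    DifferentiableOn ℂ (fun w => (A w).adjugate p q) s := by
  simp only [Matrix.adjugate_apply, Matrix.det_apply']
  refine DifferentiableOn.fun_sum fun σ _ => DifferentiableOn.const_mul ?_ _
  refine DifferentiableOn.fun_finsetProd fun i _ => ?_
  simp only [Matrix.updateRow_apply]
  split_ifs
  · exact differentiableOn_const _
  · exact hA _ _

end Derivatives


lemma adjugate_eq_inv {r : ℕ} {A : Mat r} (h : A.det = 1) : A.adjugate = A⁻¹ := by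
  rw [Matrix.inv_def, h]; simp

/-- Laurent polynomials in `e^{w}` with negative exponents, as diagonals of matrices. -/
def laurent {r : ℕ} {ι : Type*} [Fintype ι] (e : ι → ℕ) (t : ι → Fin r → ℂ) (w : ℂ)
    (p : Fin r) : ℂ := ∑ i, t i p * exp (-(e i * w))

lemma laurent_add {r : ℕ} {ι : Type*} [Fintype ι] (e : ι → ℕ) (t : ι → Fin r → ℂ) (w : ℂ)
    (p : Fin r) : laurent e t (w + 2 * π * I) p = laurent e t w p := by
  simp only [laurent, LocalData.exp_toral_arg_add]

lemma laurent_differentiable {r : ℕ} {ι : Type*} [Fintype ι] (e : ι → ℕ) (t : ι → Fin r → ℂ)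
    (p : Fin r) : Differentiable ℂ fun w => laurent e t w p := by
  unfold laurent
  fun_prop

/-- `f` has an entire primitive that is `2πi`-periodic. -/
def HasPeriodicPrimitive (f : ℂ → ℂ) : Prop :=
  ∃ K : ℂ → ℂ, (∀ w, HasDerivAt K (f w) w) ∧ ∀ w, K (w + 2 * π * I) = K w

namespace HasPeriodicPrimitive

variable {f g : ℂ → ℂ}

lemma const_mul (hf : HasPeriodicPrimitive f) (c : ℂ) :
    HasPeriodicPrimitive fun w => c * f w := by
  obtain ⟨K, h1, h2⟩ := hf
  exact ⟨fun w => c * K w, fun w => (h1 w).const_mul c, fun w => by beta_reduce; rw [h2]⟩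

lemma zero : HasPeriodicPrimitive fun _ => 0 :=
  ⟨fun _ => 0, fun w => hasDerivAt_const w _, fun _ => rfl⟩

lemma add (hf : HasPeriodicPrimitive f) (hg : HasPeriodicPrimitive g) :
    HasPeriodicPrimitive fun w => f w + g w := by
  obtain ⟨K, h1, h2⟩ := hf
  obtain ⟨K', h3, h4⟩ := hg
  exact ⟨fun w => K w + K' w, fun w => (h1 w).add (h3 w), fun w => by beta_reduce; rw [h2, h4]⟩

lemma sum {κ : Type*} (s : Finset κ) {f : κ → ℂ → ℂ} (h : ∀ k ∈ s, HasPeriodicPrimitive (f k)) :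
    HasPeriodicPrimitive fun w => ∑ k ∈ s, f k w := by
  classical
  induction s using Finset.induction_on with
  | empty => simpa using zero
  | insert a s ha ih =>
    simp only [Finset.sum_insert ha]
    exact (h a (Finset.mem_insert_self a s)).add
      (ih fun k hk => h k (Finset.mem_insert_of_mem hk))

lemma exp_int_mul {j : ℤ} (hj : j ≠ 0) : HasPeriodicPrimitive fun w => exp (j * w) := by
  have hj' : (j : ℂ) ≠ 0 := by exact_mod_cast hj
  refine ⟨fun w => exp (j * w) / j, fun w => ?_, fun w => ?_⟩
  · have := (((hasDerivAt_id w).const_mul (j : ℂ)).cexp).div_const (j : ℂ)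
    refine this.congr_deriv ?_
    simp only [id]
    field_simp
  · beta_reduce
    rw [mul_add, exp_add, exp_int_mul_two_pi_mul_I, mul_one]

lemma exp_neg_natCast_mul {k : ℕ} (hk : 1 ≤ k) : HasPeriodicPrimitive fun w => exp (-(k * w)) := by
  have := exp_int_mul (j := -(k : ℤ)) (by omega)
  simpa using this

end HasPeriodicPrimitive

namespace LocalData

variable {r : ℕ} (L : LocalData r)

/-- The derivative of `T̂`. -/
def ThatDeriv (w : ℂ) (p : Fin r) : ℂ :=
  ∑ l, L.T l p * (-(((l : ℕ) + 1 : ℕ) : ℂ) * exp (-(((l : ℕ) + 1 : ℕ) * w))) + L.L p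

lemma hasDerivAt_toral (w : ℂ) (p : Fin r) :
    HasDerivAt (fun w => L.toral w p)
      (∑ l, L.T l p * (-(((l : ℕ) + 1 : ℕ) : ℂ) * exp (-(((l : ℕ) + 1 : ℕ) * w)))) w := by
  refine HasDerivAt.fun_sum fun l _ => HasDerivAt.const_mul _ ?_
  have := (((hasDerivAt_id w).const_mul (((l : ℕ) + 1 : ℕ) : ℂ)).fun_neg).cexp
  refine this.congr_deriv ?_
  simp only [id]
  ring

lemma hasDerivAt_That (w : ℂ) (p : Fin r) :
    HasDerivAt (fun w => L.That w p) (L.ThatDeriv w p) w := by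
  have := (L.hasDerivAt_toral w p).fun_add ((hasDerivAt_id w).const_mul (L.L p))
  simp only [mul_one] at this
  exact this

lemma expNegThat_inv (w : ℂ) : (L.expNegThat w)⁻¹ = L.expThat w :=
  Matrix.inv_eq_left_inv (L.expThat_mul_expNegThat w)

/-- The matrix `Ψ⁻¹ Ψ'`. -/
def logDeriv (Ψ : ℂ → Mat r) (w : ℂ) : Mat r := (Ψ w).adjugate * matDeriv Ψ w

/-- The trace `Tr (R⁻¹ Ψ⁻¹ Ψ' R θ)` in the frame of the sector `m`. -/
def density (Ψ : ℂ → Mat r) (θ : ℂ → Fin r → ℂ) (m : ℤ) (w : ℂ) : ℂ :=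
  ((L.R m)⁻¹ * logDeriv Ψ w * L.R m * Matrix.diagonal (θ w)).trace

end LocalData

lemma trace_conj_diagonal_mul_diagonal {r : ℕ} {D D' : Mat r} {d : Fin r → ℂ} (h : D' * D = 1)
    (hD : D = Matrix.diagonal d) (A : Mat r) (θ : Fin r → ℂ) :
    (D * A * D' * Matrix.diagonal θ).trace = (A * Matrix.diagonal θ).trace := by
  have hc : Matrix.diagonal θ * D = D * Matrix.diagonal θ := by
    rw [hD]; simp [mul_comm]
  rw [Matrix.mul_assoc, Matrix.mul_assoc, Matrix.trace_mul_comm, Matrix.mul_assoc, Matrix.mul_assoc,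
    hc, ← Matrix.mul_assoc D', h, Matrix.one_mul]

namespace LocalData.IsGlued

variable {r : ℕ} {L : LocalData r} {u Ψ : ℂ → Mat r} (hΨ : L.IsGlued u Ψ)

include hΨ

lemma differentiableAt {w : ℂ} (hw : w.re < L.xR) (p q : Fin r) :
    DifferentiableAt ℂ (fun w => Ψ w p q) w :=
  (hΨ.differentiableOn p q).differentiableAt
    ((isOpen_re_lt _).mem_nhds hw)

lemma differentiableOn_logDeriv (p q : Fin r) :
    DifferentiableOn ℂ (fun w => logDeriv Ψ w p q) {w | w.re < L.xR} := by
  simp only [logDeriv, Matrix.mul_apply]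
  refine DifferentiableOn.fun_sum fun k _ => DifferentiableOn.mul
    (differentiableOn_adjugate_apply hΨ.differentiableOn p k) ?_
  exact (hΨ.differentiableOn k q).deriv (isOpen_re_lt _)

lemma logDeriv_add {w : ℂ} (hw : w.re < L.xR) :
    logDeriv Ψ (w + 2 * π * I) = L.M0⁻¹ * logDeriv Ψ w * L.M0 := by
  have h1 : matDeriv Ψ (w + 2 * π * I) = matDeriv Ψ w * L.M0 := by
    rw [← matDeriv_mul_const (hΨ.differentiableAt hw)]
    ext p q
    simp only [matDeriv, Matrix.of_apply]
    rw [← deriv_comp_add_const (fun w => Ψ w p q)]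
    refine EventuallyEq.deriv_eq ?_
    filter_upwards [(isOpen_re_lt _).mem_nhds hw] with w' hw'
    rw [hΨ.add_period w' hw']
  rw [logDeriv, h1, hΨ.add_period w hw, Matrix.adjugate_mul_distrib, adjugate_eq_inv L.det_M₀,
    logDeriv]
  simp only [Matrix.mul_assoc]

lemma differentiableOn_density {θ : ℂ → Fin r → ℂ} (hθ : ∀ p, Differentiable ℂ fun w => θ w p)
    (m : ℤ) : DifferentiableOn ℂ (L.density Ψ θ m) {w | w.re < L.xR} := by
  have : L.density Ψ θ m = fun w =>
      ∑ p, (∑ j, (∑ i, (L.R m)⁻¹ p i * logDeriv Ψ w i j) * L.R m j p) * θ w p := by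
    funext w
    simp [density, trace_mul_diagonal, Matrix.mul_apply]
  rw [this]
  refine DifferentiableOn.fun_sum fun p _ => DifferentiableOn.mul ?_ (hθ p).differentiableOn
  refine DifferentiableOn.fun_sum fun j _ => DifferentiableOn.mul_const ?_ _
  refine DifferentiableOn.fun_sum fun i _ => DifferentiableOn.const_mul ?_ _
  exact hΨ.differentiableOn_logDeriv i j

lemma density_add {θ : ℂ → Fin r → ℂ} (hθ : ∀ w p, θ (w + 2 * π * I) p = θ w p) (m : ℤ)
    {w : ℂ} (hw : w.re < L.xR) :
    L.density Ψ θ (m + L.N) (w + 2 * π * I) = L.density Ψ θ m w := by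
  have hM : IsUnit L.M0.det := by rw [L.det_M₀]; exact isUnit_one
  have hE : IsUnit L.formalMonodromy.det := by rw [L.det_formalMonodromy]; exact isUnit_one
  have h1 : L.R (m + L.N) = L.M0⁻¹ * (L.R m * L.formalMonodromy) := by
    have : L.M0 * L.R (m + L.N) = L.R m * L.formalMonodromy := L.R_add m
    rw [← this, Matrix.nonsing_inv_mul_cancel_left _ _ hM]
  have h2 : θ (w + 2 * π * I) = θ w := funext (hθ w)
  have h3 : (L.R (m + L.N))⁻¹ * logDeriv Ψ (w + 2 * π * I) * L.R (m + L.N) =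
      L.formalMonodromy⁻¹ * ((L.R m)⁻¹ * logDeriv Ψ w * L.R m) * L.formalMonodromy := by
    rw [h1, hΨ.logDeriv_add hw, Matrix.mul_inv_rev, Matrix.mul_inv_rev,
      Matrix.nonsing_inv_nonsing_inv _ hM]
    simp only [Matrix.mul_assoc]
    rw [← Matrix.mul_assoc L.M0 L.M0⁻¹, Matrix.mul_nonsing_inv _ hM, Matrix.one_mul,
      ← Matrix.mul_assoc L.M0 L.M0⁻¹, Matrix.mul_nonsing_inv _ hM, Matrix.one_mul]
  have h4 : L.formalMonodromy⁻¹ =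
      Matrix.diagonal fun p => exp (-(2 * π * I * L.L p)) := by
    apply Matrix.inv_eq_right_inv
    simp [formalMonodromy, ← exp_add]
  rw [density, h3, h2, density]
  exact trace_conj_diagonal_mul_diagonal (Matrix.mul_nonsing_inv _ hE) h4 _ _

lemma adjugate_mul_matDeriv_sectorial (m : ℤ) {w : ℂ} (hw : w.re < L.xR) :
    (L.sectorial Ψ m w).adjugate * matDeriv (L.sectorial Ψ m) w =
      L.expThat w * ((L.R m)⁻¹ * logDeriv Ψ w * L.R m) * L.expNegThat w -
        Matrix.diagonal (L.ThatDeriv w) := by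
  have hd := hΨ.differentiableAt hw
  have hc : ∀ p q, DifferentiableAt ℂ (fun _ : ℂ => L.R m p q) w := fun p q =>
    differentiableAt_const _
  have hN : ∀ p, HasDerivAt (fun w => exp (-L.That w p))
      (exp (-L.That w p) * -L.ThatDeriv w p) w := fun p => (L.hasDerivAt_That w p).neg.cexp
  have hN' : ∀ p q, DifferentiableAt ℂ (fun w => L.expNegThat w p q) w := fun p q =>
    differentiableAt_diagonal_apply (f := fun w p => exp (-L.That w p))
      (fun p => (hN p).differentiableAt) p q
  have h1 : matDeriv (L.sectorial Ψ m) w =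
      matDeriv Ψ w * L.R m * L.expNegThat w -
        Ψ w * L.R m * (L.expNegThat w * Matrix.diagonal (L.ThatDeriv w)) := by
    change matDeriv (fun w => Ψ w * L.R m * L.expNegThat w) w = _
    rw [matDeriv_mul (A := fun w => Ψ w * L.R m) (differentiableAt_mul_apply hd hc) hN',
      matDeriv_mul_const hd]
    have : matDeriv L.expNegThat w = -(L.expNegThat w * Matrix.diagonal (L.ThatDeriv w)) := by
      change matDeriv (fun w => Matrix.diagonal fun p => exp (-L.That w p)) w = _
      rw [matDeriv_diagonal hN]
      simp [expNegThat, ← Matrix.diagonal_neg]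
    rw [this, Matrix.mul_neg, sub_eq_add_neg]
  have h2 : (L.sectorial Ψ m w).adjugate * (Ψ w * L.R m * L.expNegThat w) = 1 := by
    change (L.sectorial Ψ m w).adjugate * L.sectorial Ψ m w = 1
    rw [Matrix.adjugate_mul, hΨ.det_sectorial m hw, one_smul]
  have h3 : (L.sectorial Ψ m w).adjugate = L.expThat w * (L.R m)⁻¹ * (Ψ w).adjugate := by
    rw [sectorial, Matrix.adjugate_mul_distrib, Matrix.adjugate_mul_distrib,
      adjugate_eq_inv (L.R_det m), adjugate_eq_inv (L.det_expNegThat w), expNegThat_inv,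
      Matrix.mul_assoc]
  rw [h1, Matrix.mul_sub, ← Matrix.mul_assoc (Ψ w * L.R m), ← Matrix.mul_assoc _ _
    (Matrix.diagonal (L.ThatDeriv w)), h2, Matrix.one_mul, h3]
  simp only [logDeriv, Matrix.mul_assoc]

lemma density_eq {θ : ℂ → Fin r → ℂ} (m : ℤ) {w : ℂ} (hw : w.re < L.xR) :
    L.density Ψ θ m w =
      ∑ p, ((L.sectorial Ψ m w).adjugate * matDeriv (L.sectorial Ψ m) w) p p * θ w p +
        ∑ p, L.ThatDeriv w p * θ w p := by
  rw [hΨ.adjugate_mul_matDeriv_sectorial m hw, ← trace_mul_diagonal, Matrix.sub_mul,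
    Matrix.trace_sub, trace_conj_diagonal_mul_diagonal (L.expNegThat_mul_expThat w) rfl,
    trace_diagonal_mul]
  simp [density]

lemma exists_primitive_density {θ : ℂ → Fin r → ℂ} (hθ : ∀ p, Differentiable ℂ fun w => θ w p) :
    ∃ G : ℤ → ℂ → ℂ, ∀ m w, w.re < L.xR → HasDerivAt (G m) (L.density Ψ θ m w) w := by
  choose G hG using fun m => exists_primitive_of_halfPlane (hΨ.differentiableOn_density hθ m)
  exact ⟨G, hG⟩

end LocalData.IsGlued


open Asymptotics

namespace HasPeriodicPrimitive

lemma mul_laurent {ι κ : Type*} [Fintype ι] [Fintype κ] {e : ι → ℕ} (he : ∀ i, 1 ≤ e i)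
    (t : ι → ℂ) (e' : κ → ℕ) (t' : κ → ℂ) :
    HasPeriodicPrimitive fun w => (∑ j, t' j * exp (-(e' j * w))) * ∑ i, t i * exp (-(e i * w)) := by
  have : (fun w : ℂ => (∑ j, t' j * exp (-(e' j * w))) * ∑ i, t i * exp (-(e i * w))) =
      fun w => ∑ j, ∑ i, (t' j * t i) * exp (-((e' j + e i : ℕ) * w)) := by
    funext w
    rw [Finset.sum_mul_sum]
    refine Finset.sum_congr rfl fun j _ => Finset.sum_congr rfl fun i _ => ?_
    rw [show -(((e' j + e i : ℕ) : ℂ) * w) = -(e' j * w) + -(e i * w) by push_cast; ring, exp_add]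
    ring
  rw [this]
  exact sum _ fun j _ => sum _ fun i _ =>
    (exp_neg_natCast_mul ((he i).trans (Nat.le_add_left _ _))).const_mul _

lemma polynomial_mul {D e : ℕ} (h : e < D) (v : ℕ → ℂ) (t : ℂ) :
    HasPeriodicPrimitive fun w =>
      (∑ k ∈ Finset.range D, v k * exp w ^ k) * (t * exp (-(e * w))) - t * v e := by
  have : (fun w : ℂ => (∑ k ∈ Finset.range D, v k * exp w ^ k) * (t * exp (-(e * w))) - t * v e) =
      fun w => ∑ k ∈ Finset.range D,
        (v k * t) * (if k = e then 0 else exp (((k : ℤ) - e : ℤ) * w)) := by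
    funext w
    rw [Finset.sum_mul, ← Finset.add_sum_erase _ _ (Finset.mem_range.2 h),
      ← Finset.add_sum_erase (Finset.range D) (fun k => (v k * t) *
        (if k = e then 0 else exp (((k : ℤ) - e : ℤ) * w))) (Finset.mem_range.2 h)]
    have h1 : v e * exp w ^ e * (t * exp (-(e * w))) = t * v e := by
      rw [← exp_nat_mul, show v e * exp (e * w) * (t * exp (-(e * w))) =
        t * v e * (exp (e * w) * exp (-(e * w))) by ring, ← exp_add, add_neg_cancel, exp_zero,
        mul_one]
    rw [h1, if_pos rfl, mul_zero, zero_add, add_sub_cancel_left]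
    refine Finset.sum_congr rfl fun k hk => ?_
    rw [if_neg (Finset.ne_of_mem_erase hk), ← exp_nat_mul,
      show (((k : ℤ) - e : ℤ) : ℂ) * w = k * w + -(e * w) by push_cast; ring, exp_add]
    ring
  rw [this]
  refine sum _ fun k _ => ?_
  by_cases hk : k = e
  · simpa [hk] using zero
  · simp only [hk, if_false]
    exact (exp_int_mul (by omega)).const_mul _

end HasPeriodicPrimitive

namespace LocalData

variable {r : ℕ} (L : LocalData r)

lemma hasPeriodicPrimitive_ThatDeriv_mul {ι : Type*} [Fintype ι] {e : ι → ℕ} (he : ∀ i, 1 ≤ e i)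
    (t : ι → Fin r → ℂ) (p : Fin r) :
    HasPeriodicPrimitive fun w => L.ThatDeriv w p * laurent e t w p := by
  have : (fun w => L.ThatDeriv w p * laurent e t w p) = fun w =>
      (∑ l : Fin L.n, L.T l p * -(((l : ℕ) + 1 : ℕ) : ℂ) * exp (-(((l : ℕ) + 1 : ℕ) * w))) *
        (∑ i, t i p * exp (-(e i * w))) + L.L p * ∑ i, t i p * exp (-(e i * w)) := by
    funext w
    simp only [ThatDeriv, laurent, add_mul, mul_assoc]
  rw [this]
  refine (HasPeriodicPrimitive.mul_laurent he _ _ _).add (HasPeriodicPrimitive.const_mul ?_ _)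
  exact HasPeriodicPrimitive.sum _ fun i _ =>
    (HasPeriodicPrimitive.exp_neg_natCast_mul (he i)).const_mul _

/-- The point of abscissa `x` on the line `m`. -/
def linePoint (m : ℤ) (x : ℝ) : ℂ := ⟨x, L.line m x⟩

lemma linePoint_add (m : ℤ) (x : ℝ) :
    L.linePoint (m + L.N) x = L.linePoint m x + 2 * π * I := by
  apply Complex.ext <;> simp [linePoint, L.line_add]

lemma exists_forall_of_eventually_sectorFilter {P : ℤ × ℂ → Prop}
    (h : ∀ᶠ x in L.sectorFilter, P x) : ∃ X : ℝ, ∀ m (w : ℂ), w.re < X →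
      L.line (m - 1) w.re ≤ w.im → w.im ≤ L.line m w.re → P (m, w) := by
  rw [sectorFilter, eventually_inf_principal, eventually_comap] at h
  obtain ⟨X, hX⟩ := eventually_atBot.1 h
  exact ⟨X, fun m w hw h1 h2 => hX w.re hw.le (m, w) rfl ⟨h1, h2⟩⟩

/-- The constant term of `Tr (V θ)` as a Laurent series in `e^w`. -/
def constantTerm {ι : Type*} [Fintype ι] (e : ι → ℕ) (t : ι → Fin r → ℂ) (V : FormalMat r) : ℂ :=
  ∑ p, ∑ i, t i p * coeff (e i) (V p p)

lemma exists_comparison_primitive {ι : Type*} [Fintype ι] {e : ι → ℕ} (he : ∀ i, 1 ≤ e i)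
    (t : ι → Fin r → ℂ) (V : FormalMat r) {D : ℕ} (hD : ∀ i, e i < D) :
    ∃ K : ℂ → ℂ, (∀ w, HasDerivAt K
      (∑ p, (∑ k ∈ Finset.range D, coeff k (V p p) * exp w ^ k) * laurent e t w p +
        ∑ p, L.ThatDeriv w p * laurent e t w p) w) ∧
      ∀ w, K (w + 2 * π * I) = K w + 2 * π * I * constantTerm e t V := by
  have h1 : HasPeriodicPrimitive fun w => (∑ p, ∑ i,
      ((∑ k ∈ Finset.range D, coeff k (V p p) * exp w ^ k) *
        (t i p * exp (-(e i * w))) - t i p * coeff (e i) (V p p))) +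
        ∑ p, L.ThatDeriv w p * laurent e t w p :=
    (HasPeriodicPrimitive.sum _ fun p _ => HasPeriodicPrimitive.sum _ fun i _ =>
      HasPeriodicPrimitive.polynomial_mul (hD i) (fun k => coeff k (V p p)) _).add
      (HasPeriodicPrimitive.sum _ fun p _ => L.hasPeriodicPrimitive_ThatDeriv_mul he t p)
  obtain ⟨K, h2, h3⟩ := h1
  refine ⟨fun w => K w + constantTerm e t V * w, fun w => ?_, fun w => ?_⟩
  · refine ((h2 w).add ((hasDerivAt_id w).const_mul _)).congr_deriv ?_
    simp only [constantTerm, laurent, Finset.sum_sub_distrib, Finset.mul_sum]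
    ring
  · beta_reduce
    rw [h3]; ring

end LocalData

namespace LocalData.IsGlued

variable {r : ℕ} {L : LocalData r} {u Ψ : ℂ → Mat r}

theorem tendsto_sum_primitives (hΨ : L.IsGlued u Ψ) {Y : FormalMat r} (hY : L.IsExpansion Ψ Y)
    {ι : Type*} [Fintype ι] {e : ι → ℕ} (he : ∀ i, 1 ≤ e i) (t : ι → Fin r → ℂ) {G : ℤ → ℂ → ℂ}
    (hG : ∀ m w, w.re < L.xR → HasDerivAt (G m) (L.density Ψ (laurent e t) m w) w) :
    Tendsto (fun x => ∑ m ∈ Finset.range L.N,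
        (G (m + 1) (L.linePoint (m + 1) x) - G (m + 1) (L.linePoint m x))) atBot
      (𝓝 (2 * π * I * constantTerm e t (Y.adjugate * formalEuler Y))) := by
  set V := Y.adjugate * formalEuler Y
  set D := Finset.univ.sup e + 1 with hDdef
  have hD : ∀ i, e i < D := fun i => Nat.lt_succ_of_le (Finset.le_sup (Finset.mem_univ i))
  obtain ⟨K, hK, hKp⟩ := L.exists_comparison_primitive he t V hD
  set d : ℤ × ℂ → ℂ := fun x => ∑ p,
    (((L.sectorial Ψ x.1 x.2).adjugate * matDeriv (L.sectorial Ψ x.1) x.2) p p -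
      ∑ k ∈ Finset.range D, coeff k (V p p) * exp x.2 ^ k) * laurent e t x.2 p with hd
  have hdO : d =O[L.sectorFilter] fun x => exp x.2 := by
    refine IsBigO.fun_sum fun p _ => ?_
    simp only [laurent, Finset.mul_sum]
    refine IsBigO.fun_sum fun i _ => ?_
    refine ((hY.asymp_adjugate_mul_deriv p p D).mul
      (isBigO_refl (fun x : ℤ × ℂ => t i p * exp (-(e i * x.2))) _)).trans ?_
    have h1 : (fun x : ℤ × ℂ => exp x.2 ^ D * (t i p * exp (-(e i * x.2)))) =
        fun x => t i p * exp x.2 ^ (D - e i) := by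
      funext x
      rw [← exp_nat_mul, ← exp_nat_mul, Nat.cast_sub (hD i).le,
        show ((D : ℂ) - e i) * x.2 = D * x.2 + -(e i * x.2) by ring, exp_add]
      ring
    rw [h1]
    refine IsBigO.const_mul_left ?_ _
    simpa using Asymp.pow_isBigO_pow L.tendsto_exp_sectorFilter_zero
      (show 1 ≤ D - e i by have := hD i; omega)
  obtain ⟨C, hC0, hC⟩ := hdO.exists_nonneg
  obtain ⟨X, hX⟩ := L.exists_forall_of_eventually_sectorFilter hC.bound
  have hdiff : ∀ m : ℤ, Tendsto (fun x => (G m (L.linePoint m x) - G m (L.linePoint (m - 1) x)) -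
      (K (L.linePoint m x) - K (L.linePoint (m - 1) x))) atBot (𝓝 0) := by
    intro m
    refine squeeze_zero_norm' (a := fun x => C * Real.exp x * (2 * π)) ?_ ?_
    · filter_upwards [eventually_lt_atBot X, eventually_lt_atBot L.xR] with x hx hxR
      have hle : L.line (m - 1) x ≤ L.line m x := L.line_monotone x (by omega)
      have hle2 : L.line m x ≤ L.line (m - 1) x + 2 * π := by
        rw [← L.line_add]
        have := L.N_pos
        exact L.line_monotone x (by omega)
      set s : Set ℂ := segment ℝ (L.linePoint (m - 1) x) (L.linePoint m x)
      have hmem : ∀ w ∈ s, w.re = x ∧ L.line (m - 1) x ≤ w.im ∧ w.im ≤ L.line m x := by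
        rintro w ⟨a, b, ha, hb, hab, rfl⟩
        simp only [linePoint, add_re, real_smul, mul_re, ofReal_re, ofReal_im, zero_mul, sub_zero,
          add_im, mul_im, add_zero]
        refine ⟨by linear_combination x * hab, ?_, ?_⟩
        · nlinarith [mul_le_mul_of_nonneg_left hle hb, congrArg (· * L.line (m - 1) x) hab]
        · nlinarith [mul_le_mul_of_nonneg_left hle ha, congrArg (· * L.line m x) hab]
      have hder : ∀ w ∈ s, HasDerivWithinAt (fun w => G m w - K w) (d (m, w)) s w := by
        intro w hw
        obtain ⟨h1, -, -⟩ := hmem w hw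
        have hwR : w.re < L.xR := by rwa [h1]
        refine (((hG m w hwR).sub (hK w)).hasDerivWithinAt).congr_deriv ?_
        rw [hΨ.density_eq m hwR]
        simp only [hd, sub_mul, Finset.sum_sub_distrib]
        ring
      have hbound : ∀ w ∈ s, ‖d (m, w)‖ ≤ C * Real.exp x := by
        intro w hw
        obtain ⟨h1, h2, h3⟩ := hmem w hw
        have := hX m w (by rwa [h1]) (by rwa [h1]) (by rwa [h1])
        rwa [norm_exp, h1] at this
      have := (convex_segment _ _).norm_image_sub_le_of_norm_hasDerivWithin_le hder hbound
        (left_mem_segment ℝ _ _) (right_mem_segment ℝ _ _)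
      rw [show G m (L.linePoint m x) - G m (L.linePoint (m - 1) x) -
        (K (L.linePoint m x) - K (L.linePoint (m - 1) x)) =
        (G m (L.linePoint m x) - K (L.linePoint m x)) -
        (G m (L.linePoint (m - 1) x) - K (L.linePoint (m - 1) x)) by ring]
      refine this.trans (mul_le_mul_of_nonneg_left ?_ (by positivity))
      have h4 : L.linePoint m x - L.linePoint (m - 1) x =
          ((L.line m x - L.line (m - 1) x : ℝ) : ℂ) * I := by
        apply Complex.ext <;> simp [linePoint]
      rw [h4, norm_mul, norm_I, mul_one, Complex.norm_real, Real.norm_eq_abs, abs_of_nonneg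
        (by linarith)]
      linarith
    · simpa using (Real.tendsto_exp_atBot.const_mul C).mul_const (2 * π)
  have hsum := tendsto_finsetSum (Finset.range L.N) fun m _ => hdiff (m + 1)
  simp only [add_sub_cancel_right, Finset.sum_const_zero] at hsum
  have htel : ∀ x, ∑ m ∈ Finset.range L.N,
      (K (L.linePoint (m + 1) x) - K (L.linePoint m x)) =
      2 * π * I * constantTerm e t V := by
    intro x
    have h1 := Finset.sum_range_sub (fun m : ℕ => K (L.linePoint m x)) L.N
    push_cast at h1
    have h2 := L.linePoint_add 0 x
    rw [zero_add] at h2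
    rw [h1, h2, hKp]; ring
  have := hsum.add_const (2 * π * I * constantTerm e t V)
  rw [zero_add] at this
  refine this.congr fun x => ?_
  rw [← htel x, ← Finset.sum_add_distrib]
  exact Finset.sum_congr rfl fun m _ => by ring

end LocalData.IsGlued


lemma sub_eq_sub_of_hasDerivAt {f g f' : ℂ → ℂ} {c : ℝ}
    (hf : ∀ w, w.re < c → HasDerivAt f (f' w) w) (hg : ∀ w, w.re < c → HasDerivAt g (f' w) w)
    {w w' : ℂ} (hw : w.re < c) (hw' : w'.re < c) : f w - f w' = g w - g w' := by
  have h := (convex_halfSpace_re_lt c).norm_image_sub_le_of_norm_hasDerivWithin_le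
    (f := fun w => f w - g w) (f' := fun _ => 0) (C := 0)
    (fun w hw => (((hf w hw).sub (hg w hw)).congr_deriv (sub_self _)).hasDerivWithinAt)
    (fun w _ => by simp) hw' hw
  rw [zero_mul, norm_le_zero_iff, sub_eq_zero] at h
  linear_combination h

namespace LocalData.IsGlued

variable {r : ℕ} {L : LocalData r} {u Ψ : ℂ → Mat r}

lemma density_N (θ : ℂ → Fin r → ℂ) (w : ℂ) :
    L.density Ψ θ L.N w = (logDeriv Ψ w * Matrix.diagonal (θ w)).trace := by
  rw [density, L.R_period, inv_one, Matrix.one_mul, Matrix.mul_one]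

/-- The sum of the contributions of all the arcs around the pole. -/
theorem sum_contributions (hΨ : L.IsGlued u Ψ) {Y : FormalMat r} (hY : L.IsExpansion Ψ Y)
    {ι : Type*} [Fintype ι] {e : ι → ℕ} (he : ∀ i, 1 ≤ e i) (t : ι → Fin r → ℂ) {G : ℤ → ℂ → ℂ}
    (hG : ∀ m w, w.re < L.xR → HasDerivAt (G m) (L.density Ψ (laurent e t) m w) w)
    {θL θT : ℂ → Fin r → ℂ} (hθ : ∀ w p, laurent e t w p = θL w p + θT w p) {H F : ℂ → ℂ}
    (hH : ∀ w, w.re < L.xR → HasDerivAt H (logDeriv Ψ w * Matrix.diagonal (θL w)).trace w)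
    (hF : ∀ w, w.re < L.xR → HasDerivAt F (logDeriv Ψ w * Matrix.diagonal (θT w)).trace w)
    {w0 : ℂ} (hw0 : w0.re < L.xR) {c : ℕ → ℂ}
    (hc : ∀ m : ℕ, m < L.N → Tendsto (fun x => (G (m + 1) w0 - G m w0) -
      (G (m + 1) (L.linePoint m x) - G m (L.linePoint m x))) atBot (𝓝 (c m))) :
    (H (w0 + 2 * π * I) - H w0) + (F (w0 + 2 * π * I) - F w0) +
      ∑ m ∈ Finset.range L.N, c m =
      2 * π * I * constantTerm e t (Y.adjugate * formalEuler Y) := by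
  have hP := hΨ.tendsto_sum_primitives hY he t hG
  have hQ := tendsto_finsetSum (Finset.range L.N) fun m hm => hc m (Finset.mem_range.1 hm)
  have hshift : ∀ w : ℂ, w.re < L.xR → (w + 2 * π * I).re < L.xR := fun w hw => by
    rwa [add_two_pi_re]
  have h1 : G L.N (w0 + 2 * π * I) - G L.N w0 =
      (H (w0 + 2 * π * I) - H w0) + (F (w0 + 2 * π * I) - F w0) := by
    rw [sub_eq_sub_of_hasDerivAt (g := fun w => H w + F w) (hG L.N) (fun w hw => ?_)
      (hshift _ hw0) hw0]
    · ring
    · refine ((hH w hw).add (hF w hw)).congr_deriv ?_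
      rw [density_N, trace_mul_diagonal, trace_mul_diagonal, trace_mul_diagonal,
        ← Finset.sum_add_distrib]
      exact Finset.sum_congr rfl fun p _ => by rw [hθ]; ring
  have h2 : ∀ x, x < L.xR → ∑ m ∈ Finset.range L.N,
        (G (m + 1) (L.linePoint (m + 1) x) - G (m + 1) (L.linePoint m x)) =
      ∑ m ∈ Finset.range L.N, ((G (m + 1) w0 - G m w0) -
        (G (m + 1) (L.linePoint m x) - G m (L.linePoint m x))) +
      (G L.N (w0 + 2 * π * I) - G L.N w0) := by
    intro x hx
    have h3 := Finset.sum_range_sub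
      (fun m : ℕ => G m (L.linePoint m x) - G m w0) L.N
    push_cast at h3
    have h4 := L.linePoint_add 0 x
    rw [zero_add] at h4
    have h5 : G L.N (L.linePoint 0 x + 2 * π * I) - G L.N (w0 + 2 * π * I) =
        G 0 (L.linePoint 0 x) - G 0 w0 := by
      refine sub_eq_sub_of_hasDerivAt (f := fun w => G L.N (w + 2 * π * I)) (c := L.xR)
        (fun w hw => ?_) (hG 0) hx hw0
      have h6 := (hG L.N _ (hshift w hw)).comp_add_const w (2 * π * I)
      have h7 := hΨ.density_add (laurent_add e t) 0 hw
      rw [zero_add] at h7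
      rwa [h7] at h6
    rw [h4] at h3
    have h8 : G L.N (w0 + 2 * π * I) - G L.N w0 = ∑ m ∈ Finset.range L.N,
        (G (m + 1) (L.linePoint (m + 1) x) - G (m + 1) w0 -
          (G m (L.linePoint m x) - G m w0)) := by
      rw [h3]
      linear_combination -h5
    rw [h8, ← Finset.sum_add_distrib]
    exact Finset.sum_congr rfl fun m _ => by ring
  rw [← h1, add_comm]
  refine tendsto_nhds_unique (hQ.add_const _) (hP.congr' ?_)
  filter_upwards [eventually_lt_atBot L.xR] with x hx using h2 x hx

/-- The primitive that computes the contribution of the neck. -/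
lemma hasDerivAt_neck (hΨ : L.IsGlued u Ψ) {θ : ℂ → Fin r → ℂ}
    (hθ : ∀ w p, θ (w + 2 * π * I) p = θ w p) {H : ℂ → ℂ}
    (hH : ∀ w, w.re < L.xR → HasDerivAt H (logDeriv Ψ w * Matrix.diagonal (θ w)).trace w)
    {w : ℂ} (hw : w.re < L.xR) :
    HasDerivAt (fun w => H (w + 2 * π * I) - H w)
      (-(logDeriv Ψ w * (Matrix.diagonal (θ w) -
        L.R 0 * Matrix.diagonal (θ w) * (L.R 0)⁻¹)).trace) w := by
  have h1 := (hH (w + 2 * π * I) (by rwa [add_two_pi_re])).comp_add_const w (2 * π * I)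
  refine (h1.sub (hH w hw)).congr_deriv ?_
  have h2 := hΨ.density_add hθ 0 hw
  rw [zero_add, density_N] at h2
  rw [h2, density, Matrix.mul_sub, Matrix.trace_sub]
  have : (logDeriv Ψ w * (L.R 0 * Matrix.diagonal (θ w) * (L.R 0)⁻¹)).trace =
      ((L.R 0)⁻¹ * logDeriv Ψ w * L.R 0 * Matrix.diagonal (θ w)).trace := by
    rw [← Matrix.mul_assoc, Matrix.trace_mul_comm]
    simp only [Matrix.mul_assoc]
  rw [this]
  ring

end LocalData.IsGlued


/-! ### Uniqueness of formal solutions -/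

namespace PowerSeries

lemma eq_zero_of_forall_X_pow_dvd {f : PowerSeries ℂ} (h : ∀ k : ℕ, (X : PowerSeries ℂ) ^ k ∣ f) :
    f = 0 := by
  ext m
  rw [map_zero]
  exact X_pow_dvd_iff.1 (h (m + 1)) m (Nat.lt_succ_self m)

/-- An irregular scalar equation has no formal solution. -/
lemma eq_zero_of_irregular {n : ℕ} (hn : 0 < n) {f δ : PowerSeries ℂ}
    (hδ : constantCoeff δ ≠ 0) (h : X ^ (n + 1) * derivative ℂ f + f * δ = 0) : f = 0 := by
  have hu : IsUnit δ := isUnit_iff_constantCoeff.2 (isUnit_iff_ne_zero.2 hδ)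
  refine eq_zero_of_forall_X_pow_dvd fun k => ?_
  induction k with
  | zero => simp
  | succ k ih =>
    obtain ⟨g, rfl⟩ := ih
    have h1 : (X : PowerSeries ℂ) ^ (k + 1) ∣ X ^ (n + 1) * derivative ℂ (X ^ k * g) := by
      rw [Derivation.leibniz, Derivation.leibniz_pow, derivative_X]
      rcases k with _ | k
      · simp only [zero_add, pow_one, pow_zero]
        exact (dvd_pow_self _ (by omega)).mul_right _
      · simp only [add_tsub_cancel_right, smul_eq_mul, mul_one, nsmul_eq_mul]
        obtain ⟨n, rfl⟩ := Nat.exists_eq_add_of_lt hn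
        refine ⟨X ^ n * (X * derivative ℂ g + g * ((k + 1 : ℕ) : PowerSeries ℂ)), ?_⟩
        ring
    have h2 : (X : PowerSeries ℂ) ^ (k + 1) ∣ X ^ k * g * δ := by
      rw [show X ^ k * g * δ = -(X ^ (n + 1) * derivative ℂ (X ^ k * g)) by
        linear_combination h]
      exact (dvd_neg).2 h1
    exact (hu.dvd_mul_right).1 h2

/-- A nonresonant regular singular scalar equation has no formal solution. -/
lemma eq_zero_of_nonresonant {f : PowerSeries ℂ} {c : ℂ} (hc : ∀ m : ℕ, (m : ℂ) + c ≠ 0)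
    (h : X * derivative ℂ f + f * C c = 0) : f = 0 := by
  ext m
  have h1 := congrArg (coeff m) h
  rw [map_add, map_zero, coeff_mul_C] at h1
  have h2 : coeff m (X * derivative ℂ f) = m * coeff m f := by
    rcases m with _ | m
    · simp
    · rw [coeff_succ_X_mul, coeff_derivative]
      push_cast; ring
  rw [h2] at h1
  have h3 : ((m : ℂ) + c) * coeff m f = 0 := by linear_combination h1
  rw [map_zero]
  exact (mul_eq_zero.1 h3).resolve_left (hc m)

lemma eq_C_of_derivative_eq_zero {f : PowerSeries ℂ} (h : derivative ℂ f = 0) :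
    f = C (constantCoeff f) := by
  ext m
  rcases m with _ | m
  · simp
  · have h1 := congrArg (coeff m) h
    rw [coeff_derivative, map_zero] at h1
    have h2 : (m : ℂ) + 1 ≠ 0 := by exact_mod_cast Nat.succ_ne_zero m
    rw [(mul_eq_zero.1 h1).resolve_right h2, coeff_C, if_neg (Nat.succ_ne_zero m)]

end PowerSeries

lemma FormalMat.derivative_mul {r : ℕ} (A B : FormalMat r) :
    (A * B).map (derivative ℂ) =
      A.map (derivative ℂ) * B + A * B.map (derivative ℂ) := by
  ext1 p q
  simp only [Matrix.map_apply, Matrix.mul_apply, Matrix.add_apply, map_sum, Derivation.leibniz,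
    smul_eq_mul, ← Finset.sum_add_distrib]
  exact Finset.sum_congr rfl fun k _ => by ring

lemma FormalMat.isUnit_det {r : ℕ} {Y : FormalMat r}
    (h : IsUnit (Y.map constantCoeff).det) : IsUnit Y.det := by
  rw [PowerSeries.isUnit_iff_constantCoeff]
  rwa [RingHom.map_det]

lemma mul_gauge_eq_zero {S A : Type*} [CommRing S] [Ring A] [Algebra S A] (x : S)
    {Y Y' K K' Δ B : A} (e1 : x • Y' + Y * Δ = B * Y)
    (e2 : x • (Y' * K + Y * K') + Y * K * Δ = B * (Y * K)) :
    Y * (x • K' + K * Δ - Δ * K) = 0 := by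
  rw [← mul_assoc, ← e1, add_mul, smul_add, smul_mul_assoc, add_assoc] at e2
  rw [mul_sub, mul_add, mul_smul_comm, ← mul_assoc, ← mul_assoc, sub_eq_zero]
  exact add_left_cancel e2

namespace BirkhoffData

variable {k r : ℕ} {n : Fin k → ℕ} (D : BirkhoffData k r n)

lemma constantCoeff_scaledThatDeriv (j : Fin k) (l : Fin (n j)) (hl : (l : ℕ) + 1 = n j)
    (p : Fin r) : constantCoeff (D.scaledThatDeriv j p) = -(n j * D.T j l p) := by
  have hn : n j ≠ 0 := by omega
  rw [scaledThatDeriv, map_sub, map_mul, map_pow, PowerSeries.constantCoeff_X, zero_pow hn,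
    mul_zero, zero_sub, map_sum, Finset.sum_eq_single l]
  · have h : ((l : ℕ) : ℂ) + 1 = n j := by exact_mod_cast hl
    rw [map_mul, hl, Nat.sub_self, pow_zero, map_one, mul_one, PowerSeries.constantCoeff_C, h]
  · intro l' _ hne
    have h1 : (l' : ℕ) ≠ l := fun h => hne (Fin.ext h)
    have h2 := l'.2
    rw [map_mul, map_pow, PowerSeries.constantCoeff_X, zero_pow (by omega), mul_zero]
  · simp

/-- The transition matrix between two formal solutions is constant and diagonal. -/
lemma exists_eq_mul_diagonal (j : Fin k) {Y1 Y2 B : FormalMat r}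
    (h₁ : IsUnit (Y1.map constantCoeff).det)
    (e1 : (PowerSeries.X ^ (n j + 1) : PowerSeries ℂ) • Y1.map (derivative ℂ) +
      Y1 * Matrix.diagonal (D.scaledThatDeriv j) = B * Y1)
    (e2 : (PowerSeries.X ^ (n j + 1) : PowerSeries ℂ) • Y2.map (derivative ℂ) +
      Y2 * Matrix.diagonal (D.scaledThatDeriv j) = B * Y2) :
    ∃ c : Fin r → ℂ, Y2 = Y1 * Matrix.diagonal fun p => PowerSeries.C (c p) := by
  have hu := FormalMat.isUnit_det h₁
  set K := Y1⁻¹ * Y2 with hK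
  have hY2 : Y2 = Y1 * K := by rw [hK, Matrix.mul_nonsing_inv_cancel_left _ _ hu]
  have h2 : (PowerSeries.X ^ (n j + 1) : PowerSeries ℂ) • K.map (derivative ℂ) +
      K * Matrix.diagonal (D.scaledThatDeriv j) -
      Matrix.diagonal (D.scaledThatDeriv j) * K = 0 := by
    rw [hY2, FormalMat.derivative_mul] at e2
    have h3 := mul_gauge_eq_zero _ e1 e2
    have h4 := congrArg (fun Z => Y1⁻¹ * Z) h3
    simpa only [Matrix.nonsing_inv_mul_cancel_left _ _ hu, Matrix.mul_zero] using h4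
  have h5 : ∀ p q, PowerSeries.X ^ (n j + 1) * derivative ℂ (K p q) +
      K p q * (D.scaledThatDeriv j q - D.scaledThatDeriv j p) = 0 := by
    intro p q
    have := congrFun (congrFun h2 p) q
    simp only [Matrix.sub_apply, Matrix.add_apply, Matrix.smul_apply, Matrix.map_apply,
      Matrix.mul_diagonal, Matrix.diagonal_mul, smul_eq_mul, Matrix.zero_apply] at this
    linear_combination this
  have hoff : ∀ p q, p ≠ q → K p q = 0 := by
    intro p q hpq
    rcases Nat.eq_zero_or_pos (n j) with hn | hn
    · refine PowerSeries.eq_zero_of_nonresonant (c := D.L j q - D.L j p) (fun m hm => ?_) ?_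
      · refine D.nonresonant j hn p q hpq m ?_
        push_cast
        linear_combination -hm
      · have h6 : ∀ p, D.scaledThatDeriv j p = PowerSeries.C (D.L j p) := by
          intro p
          have : IsEmpty (Fin (n j)) := by rw [hn]; infer_instance
          rw [scaledThatDeriv, Finset.univ_eq_empty, Finset.sum_empty, hn]
          simp
        have := h5 p q
        rw [h6, h6, hn, zero_add, pow_one] at this
        rwa [map_sub]
    · refine PowerSeries.eq_zero_of_irregular hn ?_ (h5 p q)
      have hl : n j - 1 < n j := by omega
      have hl' : ((⟨n j - 1, hl⟩ : Fin (n j)) : ℕ) + 1 = n j := by simp; omega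
      rw [map_sub, D.constantCoeff_scaledThatDeriv j _ hl', D.constantCoeff_scaledThatDeriv j _ hl']
      intro h
      have hnj : (n j : ℂ) ≠ 0 := by exact_mod_cast hn.ne'
      have h7 : D.T j ⟨n j - 1, hl⟩ p = D.T j ⟨n j - 1, hl⟩ q := by
        have : (n j : ℂ) * (D.T j ⟨n j - 1, hl⟩ p - D.T j ⟨n j - 1, hl⟩ q) = 0 := by
          linear_combination h
        exact sub_eq_zero.1 ((mul_eq_zero.1 this).resolve_left hnj)
      exact hpq (D.leading_injective j _ hl' h7)
  have hdiag : ∀ p, K p p = PowerSeries.C (constantCoeff (K p p)) := by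
    intro p
    refine PowerSeries.eq_C_of_derivative_eq_zero ?_
    have := h5 p p
    rw [sub_self, mul_zero, add_zero] at this
    exact (mul_eq_zero.1 this).resolve_left (pow_ne_zero _ PowerSeries.X_ne_zero)
  refine ⟨fun p => constantCoeff (K p p), ?_⟩
  rw [hY2]
  congr 1
  ext1 p q
  by_cases h : p = q
  · subst h; rw [Matrix.diagonal_apply_eq, ← hdiag]
  · rw [hoff p q h, Matrix.diagonal_apply_ne _ h]

end BirkhoffData

lemma trace_map_mul_diagonal_eq {r : ℕ} {A B : FormalMat r} (h : ∀ p, A p p = B p p)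
    (d : Fin r → LaurentSeries ℂ) :
    (A.map (HahnSeries.ofPowerSeries ℤ ℂ) * Matrix.diagonal d).trace =
      (B.map (HahnSeries.ofPowerSeries ℤ ℂ) * Matrix.diagonal d).trace := by
  simp [Matrix.trace, h]

/-- The Jimbo--Miwa--Ueno residue does not depend on the formal solution. -/
lemma jmuResidue_eq_of_isFormalSolution {k r : ℕ} {n : Fin k → ℕ} (D : ℂ → BirkhoffData k r n)
    (s0 : ℂ) (j : Fin k) {A : ℂ → Mat r} {U : Set ℂ}
    (hU : (𝓝[U \ {(D s0).a j}] (D s0).a j).NeBot) {Y1 Y2 : FormalMat r}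
    (h₁ : (D s0).IsFormalSolution A U j Y1) (h₂ : (D s0).IsFormalSolution A U j Y2) :
    jmuResidue D s0 j Y2 = jmuResidue D s0 j Y1 := by
  obtain ⟨hu1, B1, hB1, e1⟩ := h₁
  obtain ⟨hu2, B2, hB2, e2⟩ := h₂
  have hζ : Tendsto (fun z => z - (D s0).a j) (𝓝[U \ {(D s0).a j}] (D s0).a j) (𝓝[≠] 0) := by
    refine tendsto_nhdsWithin_iff.2 ⟨?_, ?_⟩
    · have : Continuous fun z => z - (D s0).a j := by fun_prop
      simpa using (this.tendsto ((D s0).a j)).mono_left nhdsWithin_le_nhds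
    · filter_upwards [self_mem_nhdsWithin] with z hz
      exact sub_ne_zero.2 hz.2
  have hB : B1 = B2 := by
    ext1 p q
    exact Asymp.unique hζ (fun N => hB1 N p q) (fun N => hB2 N p q)
  subst hB
  obtain ⟨c, hc⟩ := (D s0).exists_eq_mul_diagonal j hu1 e1 e2
  set K : FormalMat r := Matrix.diagonal fun p => PowerSeries.C (c p) with hK
  have hU2 := FormalMat.isUnit_det hu2
  have hKu : IsUnit K.det := by
    rw [hc, Matrix.det_mul] at hU2
    exact isUnit_of_mul_isUnit_right hU2
  have hKd : K.map (derivative ℂ) = 0 := by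
    ext1 p q
    by_cases h : p = q
    · subst h
      rw [Matrix.map_apply, hK, Matrix.diagonal_apply_eq, PowerSeries.derivative_C,
        Matrix.zero_apply]
    · rw [Matrix.map_apply, hK, Matrix.diagonal_apply_ne _ h, map_zero, Matrix.zero_apply]
  refine congrArg (fun x => HahnSeries.coeff x (-1)) (trace_map_mul_diagonal_eq (fun p => ?_) _)
  rw [hc, FormalMat.derivative_mul, hKd, Matrix.mul_zero, add_zero, Matrix.mul_inv_rev,
    Matrix.mul_assoc, ← Matrix.mul_assoc Y1⁻¹]
  set Z := Y1⁻¹ * Y1.map (derivative ℂ)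
  have hdet := hKu
  rw [hK, Matrix.det_diagonal, IsUnit.prod_univ_iff] at hdet
  have hinv : K⁻¹ = Matrix.diagonal fun p => PowerSeries.C ((c p)⁻¹) := by
    apply Matrix.inv_eq_right_inv
    rw [hK, Matrix.diagonal_mul_diagonal, ← Matrix.diagonal_one]
    congr 1
    funext p
    have h0 : c p ≠ 0 := by
      intro h
      have := hdet p
      rw [h, map_zero] at this
      exact not_isUnit_zero this
    rw [← map_mul, mul_inv_cancel₀ h0, map_one]
  have h0 : c p ≠ 0 := by
    intro h
    have := hdet p
    rw [h, map_zero] at this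
    exact not_isUnit_zero this
  rw [hinv, hK, Matrix.diagonal_mul, Matrix.mul_diagonal, mul_comm (Z p p), ← mul_assoc, ← map_mul,
    inv_mul_cancel₀ h0, map_one, one_mul]

/-- The residue of `Tr (Y⁻¹ Y' θ)` for a diagonal matrix `θ` of Laurent polynomials. -/
lemma coeff_trace_mul_diagonal {r : ℕ} {ι : Type*} [Fintype ι] {e : ι → ℕ} (he : ∀ i, 1 ≤ e i)
    (t : ι → Fin r → ℂ) {Y : FormalMat r} (hY : Y.det = 1) :
    HahnSeries.coeff ((Y⁻¹ * Y.map (derivative ℂ)).map (HahnSeries.ofPowerSeries ℤ ℂ) *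
      Matrix.diagonal fun p => ∑ i, HahnSeries.single (-(e i : ℤ)) (t i p)).trace (-1) =
      LocalData.constantTerm e t (Y.adjugate * formalEuler Y) := by
  have hinv : Y⁻¹ = Y.adjugate := by rw [Matrix.inv_def, hY]; simp
  have hfe : Y.adjugate * formalEuler Y =
      (PowerSeries.X : PowerSeries ℂ) • (Y.adjugate * Y.map (derivative ℂ)) := by
    rw [← Matrix.mul_smul]
    rfl
  rw [hinv, hfe]
  set Z := Y.adjugate * Y.map (derivative ℂ)
  simp only [Matrix.trace, Matrix.diag_apply, Matrix.mul_diagonal, Matrix.map_apply,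
    HahnSeries.coeff_sum, Finset.mul_sum, LocalData.constantTerm, Matrix.smul_apply, smul_eq_mul]
  refine Finset.sum_congr rfl fun p _ => Finset.sum_congr rfl fun i _ => ?_
  obtain ⟨m, hm⟩ := Nat.exists_eq_add_of_le' (he i)
  rw [hm, PowerSeries.coeff_succ_X_mul, show (-1 : ℤ) = (m : ℤ) + -((m + 1 : ℕ) : ℤ) by
    push_cast; ring, HahnSeries.coeff_mul_single_add, HahnSeries.ofPowerSeries_apply_coeff, mul_comm]


/-! ### The local data at a pole of given Birkhoff data -/

/-- The remainder of `m` modulo `N`, as a natural number. -/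
def residue (N : ℕ) (m : ℤ) : ℕ := (m % N).toNat

section Residue

variable {N : ℕ} (hN : 0 < N) (m : ℤ)

lemma residue_add_mul (i : ℕ) (hi : i < N) (q : ℤ) : residue N (i + q * N) = i := by
  rw [residue, Int.add_mul_emod_self_right, Int.emod_eq_of_lt (by omega) (by omega)]
  simp

lemma residue_add : residue N (m + N) = residue N m := by
  simp [residue]

include hN

lemma residue_lt : residue N m < N := by
  have h1 := Int.emod_nonneg m (show (N : ℤ) ≠ 0 by omega)
  have h2 := Int.emod_lt_of_pos m (show (0 : ℤ) < N by omega)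
  unfold residue
  omega

lemma add_mul_ediv (i : ℕ) (hi : i < N) (q : ℤ) : ((i : ℤ) + q * N) / N = q := by
  rw [Int.add_mul_ediv_right _ _ (by omega), Int.ediv_eq_zero_of_lt (by omega) (by omega), zero_add]

lemma eq_residue_add : m = residue N m + m / N * N := by
  have h1 := Int.emod_nonneg m (show (N : ℤ) ≠ 0 by omega)
  rw [residue, Int.toNat_of_nonneg h1, mul_comm, Int.emod_add_mul_ediv]

lemma add_ediv : (m + N) / N = m / N + 1 := by
  rw [Int.add_ediv_of_dvd_right (dvd_refl _), Int.ediv_self (by omega)]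

lemma residue_succ : (residue N m + 1 < N ∧ residue N (m + 1) = residue N m + 1 ∧
      (m + 1) / N = m / N) ∨
    (residue N m + 1 = N ∧ residue N (m + 1) = 0 ∧ (m + 1) / N = m / N + 1) := by
  have h := eq_residue_add hN m
  have hlt := residue_lt hN m
  rcases lt_or_ge (residue N m + 1) N with h1 | h1
  · left
    have h2 : m + 1 = ((residue N m + 1 : ℕ) : ℤ) + m / N * N := by push_cast; linarith
    exact ⟨h1, by rw [h2, residue_add_mul _ h1],
      by rw [h2, add_mul_ediv hN _ h1]⟩
  · right
    have h3 : residue N m + 1 = N := by omega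
    have h2 : m + 1 = ((0 : ℕ) : ℤ) + (m / N + 1) * N := by
      have : ((residue N m : ℕ) : ℤ) + 1 = N := by exact_mod_cast h3
      push_cast; linarith
    refine ⟨h3, ?_, ?_⟩
    · rw [h2, residue_add_mul _ hN]
    · rw [h2, add_mul_ediv hN _ hN]

end Residue

/-- Products `g (a + k - 1) ⋯ g (a + 1) g a`. -/
def reverseProd {M : Type*} [Monoid M] (g : ℕ → M) : ℕ → ℕ → M
  | _, 0 => 1
  | a, k + 1 => reverseProd g (a + 1) k * g a

lemma reverseProd_eq_ofFn {M : Type*} [Monoid M] (g : ℕ → M) (a k : ℕ) :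
    reverseProd g a k = (List.ofFn fun i : Fin k => g (a + i)).reverse.prod := by
  induction k generalizing a with
  | zero => simp [reverseProd]
  | succ k ih =>
    rw [reverseProd, ih, List.ofFn_succ, List.reverse_cons, List.prod_append]
    simp [add_assoc, add_comm 1]

lemma det_reverseProd {r : ℕ} {g : ℕ → Mat r} (hg : ∀ i, (g i).det = 1) (a k : ℕ) :
    (reverseProd g a k).det = 1 := by
  induction k generalizing a with
  | zero => simp [reverseProd]
  | succ k ih => rw [reverseProd, Matrix.det_mul, ih, hg, one_mul]

namespace ContourChoice

variable {k r : ℕ} {n : Fin k → ℕ} {D0 : BirkhoffData k r n} (G : ContourChoice D0) (j : Fin k)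

/-- The number of sectors; at a simple pole there is one, bounded by a fictitious line. -/
def sectorCount (m : ℕ) : ℕ := if m = 0 then 1 else 2 * m

lemma sectorCount_pos (m : ℕ) : 0 < sectorCount m := by
  unfold sectorCount; split_ifs <;> omega

/-- The Stokes lines in the logarithmic coordinate, on the base sheet. -/
def lineBase (i : ℕ) (x : ℝ) : ℝ :=
  if h : i < 2 * n j then G.α j ⟨i, h⟩ (min (Real.exp x) (G.τ j)) else G.θ j

/-- The directions of the Stokes lines on the base sheet. -/
def angleBase (i : ℕ) : ℝ := if h : i < 2 * n j then G.α j ⟨i, h⟩ 0 else G.θ j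

/-- The derivatives of the Stokes lines on the base sheet. -/
def slopeBase (i : ℕ) (x : ℝ) : ℝ :=
  if h : i < 2 * n j then deriv (G.α j ⟨i, h⟩) (Real.exp x) * Real.exp x else 0

lemma log_τ_lt_log_ρ : Real.log (G.τ j) < Real.log (G.ρ j) :=
  Real.log_lt_log (G.τ_pos j) (G.τ_lt_ρ j)

lemma ρ_pos : 0 < G.ρ j := (G.τ_pos j).trans (G.τ_lt_ρ j)

lemma R_pos : 0 < G.R j := (G.ρ_pos j).trans (G.ρ_lt_R j)

lemma exp_mem_Ioo {x : ℝ} (hx : x < Real.log (G.τ j)) : Real.exp x ∈ Ioo 0 (G.τ j) :=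
  ⟨Real.exp_pos x, (Real.lt_log_iff_exp_lt (G.τ_pos j)).1 hx⟩

lemma lineBase_of_lt {i : ℕ} (h : i < 2 * n j) {x : ℝ} (hx : x < Real.log (G.τ j)) :
    G.lineBase j i x = G.α j ⟨i, h⟩ (Real.exp x) := by
  rw [lineBase, dif_pos h, min_eq_left (G.exp_mem_Ioo j hx).2.le]

lemma lineBase_of_ge (i : ℕ) {x : ℝ} (hx : Real.log (G.τ j) ≤ x) : G.lineBase j i x = G.θ j := by
  unfold lineBase
  split_ifs with h
  · rw [min_eq_right ((Real.log_le_iff_le_exp (G.τ_pos j)).1 hx), G.α_end]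
  · rfl

lemma lineBase_continuous (i : ℕ) : Continuous (G.lineBase j i) := by
  unfold lineBase
  split_ifs with h
  · refine (G.α_smooth j ⟨i, h⟩).continuousOn.comp_continuous (by fun_prop) fun x => ?_
    exact ⟨le_min (Real.exp_pos x).le (G.τ_pos j).le, min_le_right _ _⟩
  · exact continuous_const

lemma lineBase_tendsto (i : ℕ) : Tendsto (G.lineBase j i) atBot (𝓝 (G.angleBase j i)) := by
  unfold lineBase angleBase
  split_ifs with h
  · have h1 := (G.α_smooth j ⟨i, h⟩).continuousOn 0 ⟨le_rfl, (G.τ_pos j).le⟩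
    refine h1.tendsto.comp (tendsto_nhdsWithin_iff.2 ⟨?_, .of_forall fun x =>
      ⟨le_min (Real.exp_pos x).le (G.τ_pos j).le, min_le_right _ _⟩⟩)
    simpa [(G.τ_pos j).le] using Real.tendsto_exp_atBot.min (tendsto_const_nhds (x := G.τ j))
  · exact tendsto_const_nhds

lemma hasDerivAt_α (ν : Fin (2 * n j)) {x : ℝ} (hx : x ∈ Ioo 0 (G.τ j)) :
    HasDerivAt (G.α j ν) (deriv (G.α j ν) x) x :=
  ((((G.α_smooth j ν).differentiableOn (by norm_num)) x (Ioo_subset_Icc_self hx)).differentiableAt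
    (Icc_mem_nhds hx.1 hx.2)).hasDerivAt

lemma continuousAt_deriv_α (ν : Fin (2 * n j)) {x : ℝ} (hx : x ∈ Ioo 0 (G.τ j)) :
    ContinuousAt (deriv (G.α j ν)) x :=
  (((G.α_smooth j ν).mono Ioo_subset_Icc_self).continuousOn_deriv_of_isOpen isOpen_Ioo
    (by norm_num)).continuousAt (Ioo_mem_nhds hx.1 hx.2)

lemma hasDerivAt_lineBase (i : ℕ) {x : ℝ} (hx : x < Real.log (G.τ j)) :
    HasDerivAt (G.lineBase j i) (G.slopeBase j i x) x := by
  by_cases h : i < 2 * n j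
  · have h1 := (G.hasDerivAt_α j ⟨i, h⟩ (G.exp_mem_Ioo j hx)).comp x (Real.hasDerivAt_exp x)
    rw [slopeBase, dif_pos h]
    refine h1.congr_of_eventuallyEq ?_
    filter_upwards [gt_mem_nhds hx] with y hy using G.lineBase_of_lt j h hy
  · have : G.lineBase j i = fun _ => G.θ j := by
      funext x
      rw [lineBase, dif_neg h]
    rw [this, slopeBase, dif_neg h]
    exact hasDerivAt_const x _

lemma slopeBase_continuousAt (i : ℕ) {x : ℝ} (hx : x < Real.log (G.τ j)) :
    ContinuousAt (G.slopeBase j i) x := by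
  unfold slopeBase
  split_ifs with h
  · refine ContinuousAt.mul ?_ Real.continuous_exp.continuousAt
    exact ContinuousAt.comp (f := Real.exp) (g := deriv (G.α j ⟨i, h⟩))
      (G.continuousAt_deriv_α j ⟨i, h⟩ (G.exp_mem_Ioo j hx)) Real.continuous_exp.continuousAt
  · exact continuousAt_const

lemma lineBase_lt {i : ℕ} (hi : i + 1 < sectorCount (n j)) {x : ℝ} (hx : x < Real.log (G.τ j)) :
    G.lineBase j i x < G.lineBase j (i + 1) x := by
  have hn : n j ≠ 0 := by
    intro h
    rw [sectorCount, if_pos h] at hi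
    omega
  rw [sectorCount, if_neg hn] at hi
  rw [G.lineBase_of_lt j hi hx, G.lineBase_of_lt j (by omega) hx]
  exact G.α_lt j _ (Ioo_subset_Ico_self (G.exp_mem_Ioo j hx)) _ _ (by simp [Fin.lt_def])

lemma lineBase_lt_add {i : ℕ} (hi : i < sectorCount (n j)) {x : ℝ}
    (hx : x < Real.log (G.τ j)) : G.lineBase j i x < G.lineBase j 0 x + 2 * π := by
  unfold sectorCount at hi
  split_ifs at hi with hn
  · obtain rfl : i = 0 := by omega
    linarith [Real.pi_pos]
  · rw [G.lineBase_of_lt j hi hx, G.lineBase_of_lt j (show 0 < 2 * n j by omega) hx]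
    exact G.α_lt_add j _ (Ioo_subset_Ico_self (G.exp_mem_Ioo j hx)) _ _

/-- The Stokes matrices on the base sheet. -/
def stokesBase (D0 : BirkhoffData k r n) (j : Fin k) (i : ℕ) : Mat r :=
  if h : i < 2 * n j then D0.S j ⟨i, h⟩ else 1

/-- The powers of the formal monodromy. -/
def formalPower (D0 : BirkhoffData k r n) (j : Fin k) (q : ℤ) : Mat r :=
  Matrix.diagonal fun p => exp (2 * π * I * q * D0.L j p)

lemma formalPower_add (q q' : ℤ) :
    formalPower D0 j (q + q') = formalPower D0 j q * formalPower D0 j q' := by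
  rw [formalPower, formalPower, formalPower, Matrix.diagonal_mul_diagonal]
  congr 1
  funext p
  rw [← exp_add]
  push_cast
  ring_nf

lemma formalPower_zero : formalPower D0 j 0 = 1 := by simp [formalPower]

lemma det_formalPower (q : ℤ) : (formalPower D0 j q).det = 1 := by
  rw [formalPower, LocalData.det_diagonal_exp]
  rw [← Finset.mul_sum, D0.L_traceless, mul_zero]

/-- The products of Stokes matrices on the base sheet. -/
def partialProd (D0 : BirkhoffData k r n) (j : Fin k) (i : ℕ) : Mat r :=
  reverseProd (stokesBase D0 j) i (sectorCount (n j) - i)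

lemma partialProd_eq {i : ℕ} (hi : i < sectorCount (n j)) :
    partialProd D0 j i = partialProd D0 j (i + 1) * stokesBase D0 j i := by
  rw [partialProd, partialProd, show sectorCount (n j) - i = sectorCount (n j) - (i + 1) + 1 by
    omega, reverseProd]

lemma partialProd_sectorCount : partialProd D0 j (sectorCount (n j)) = 1 := by
  rw [partialProd, Nat.sub_self, reverseProd]

lemma partialProd_zero : partialProd D0 j 0 = D0.stokesProduct j := by
  rw [partialProd, Nat.sub_zero, BirkhoffData.stokesProduct]
  rcases Nat.eq_zero_or_pos (n j) with hn | hn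
  · have h1 : List.ofFn (D0.S j) = [] := by
      rw [List.ofFn_eq_nil_iff]; omega
    rw [h1, sectorCount, if_pos hn]
    simp [reverseProd, stokesBase, hn]
  · rw [sectorCount, if_neg hn.ne', reverseProd_eq_ofFn]
    congr 3
    funext i
    simp [stokesBase]

lemma stokesBase_diag (G : ContourChoice D0) (i : ℕ) (p : Fin r) : stokesBase D0 j i p p = 1 := by
  unfold stokesBase
  split_ifs with h
  · exact G.stokes_diag j _ p
  · simp

/-- The numbers that order the basis vectors on the Stokes line. -/
def heightBase (G : ContourChoice D0) (j : Fin k) (i : ℕ) (p : Fin r) : ℝ :=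
  if h : i < 2 * n j then
    (D0.T j ⟨n j - 1, by omega⟩ p * exp (-(n j * G.α j ⟨i, h⟩ 0 * I))).re
  else 0

lemma heightBase_lt {i : ℕ} {p q : Fin r} (hpq : p ≠ q) (h : stokesBase D0 j i p q ≠ 0) :
    G.heightBase j i p < G.heightBase j i q := by
  unfold stokesBase at h
  split_ifs at h with hi
  · have := G.stokes_triangular j ⟨n j - 1, by omega⟩ (by simp; omega) ⟨i, hi⟩ p q hpq h
    rw [sub_mul, sub_re] at this
    rw [heightBase, heightBase, dif_pos hi, dif_pos hi]
    linarith
  · exact absurd (Matrix.one_apply_ne hpq) h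

lemma det_stokesBase (G : ContourChoice D0) (i : ℕ) : (stokesBase D0 j i).det = 1 := by
  have hbt : (stokesBase D0 j i).BlockTriangular (G.heightBase j i) := by
    intro p q hpq
    by_contra hne
    exact absurd (G.heightBase_lt j (by rintro rfl; exact lt_irrefl _ hpq) hne) (not_lt.2 hpq.le)
  rw [hbt.det]
  refine Finset.prod_eq_one fun a _ => ?_
  have : (stokesBase D0 j i).toSquareBlock (G.heightBase j i) a = 1 := by
    ext p q
    rw [Matrix.toSquareBlock_def, Matrix.of_apply]
    by_cases h : p = q
    · subst h; rw [stokesBase_diag j G, Matrix.one_apply_eq]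
    · rw [Matrix.one_apply_ne h]
      by_contra hne
      have := G.heightBase_lt j (fun h' => h (Subtype.ext h')) hne
      rw [p.2, q.2] at this
      exact lt_irrefl _ this
  rw [this, Matrix.det_one]

lemma det_partialProd (G : ContourChoice D0) (i : ℕ) : (partialProd D0 j i).det = 1 :=
  det_reverseProd (det_stokesBase j G) _ _

lemma localMonodromy_eq : D0.localMonodromy j = D0.stokesProduct j * formalPower D0 j 1 := by
  rw [BirkhoffData.localMonodromy, formalPower]
  simp

lemma det_localMonodromy (G : ContourChoice D0) : (D0.localMonodromy j).det = 1 := by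
  rw [localMonodromy_eq, Matrix.det_mul, det_formalPower, ← partialProd_zero, det_partialProd j G,
    one_mul]

/-- The connection matrices from the sectors to the base sheet. -/
def sectorMatrix (D0 : BirkhoffData k r n) (j : Fin k) (m : ℤ) : Mat r :=
  (D0.localMonodromy j) ^ (-(m / sectorCount (n j))) *
    partialProd D0 j (residue (sectorCount (n j)) m) * formalPower D0 j (m / sectorCount (n j))

/-- The Stokes matrices on all the sheets. -/
def sheetStokes (D0 : BirkhoffData k r n) (j : Fin k) (m : ℤ) : Mat r :=
  formalPower D0 j (-(m / sectorCount (n j))) *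
    stokesBase D0 j (residue (sectorCount (n j)) m) * formalPower D0 j (m / sectorCount (n j))

lemma sheetStokes_apply (m : ℤ) (p q : Fin r) : sheetStokes D0 j m p q =
    exp (2 * π * I * (-(m / sectorCount (n j)) : ℤ) * D0.L j p) *
      stokesBase D0 j (residue (sectorCount (n j)) m) p q *
      exp (2 * π * I * (m / sectorCount (n j) : ℤ) * D0.L j q) := by
  simp only [sheetStokes, formalPower, Matrix.mul_diagonal, Matrix.diagonal_mul]

lemma formalPower_mul_neg (q : ℤ) : formalPower D0 j q * formalPower D0 j (-q) = 1 := by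
  rw [← formalPower_add, add_neg_cancel, formalPower_zero]

lemma det_sectorMatrix (G : ContourChoice D0) (m : ℤ) : (sectorMatrix D0 j m).det = 1 := by
  have : ∀ q : ℤ, ((D0.localMonodromy j) ^ q).det = 1 := by
    intro q
    obtain ⟨q, rfl | rfl⟩ := q.eq_nat_or_neg
    · simp [det_localMonodromy j G]
    · rw [Matrix.zpow_neg (by rw [det_localMonodromy j G]; exact isUnit_one), Matrix.det_nonsing_inv]
      simp [det_localMonodromy j G]
  rw [sectorMatrix, Matrix.det_mul, Matrix.det_mul, this, det_partialProd j G, det_formalPower]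
  simp

lemma sectorMatrix_succ (G : ContourChoice D0) (m : ℤ) :
    sectorMatrix D0 j m = sectorMatrix D0 j (m + 1) * sheetStokes D0 j m := by
  have hN := sectorCount_pos (n j)
  have hM : IsUnit (D0.localMonodromy j).det := by rw [det_localMonodromy j G]; exact isUnit_one
  have hp := partialProd_eq (D0 := D0) j (residue_lt hN m)
  rcases residue_succ hN m with ⟨h1, h2, h3⟩ | ⟨h1, h2, h3⟩
  · rw [sectorMatrix, sectorMatrix, sheetStokes, h2, h3, hp]
    simp only [Matrix.mul_assoc]
    rw [← Matrix.mul_assoc (formalPower D0 j _) (formalPower D0 j _), formalPower_mul_neg,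
      Matrix.one_mul]
  · rw [h1, partialProd_sectorCount, Matrix.one_mul] at hp
    rw [sectorMatrix, sectorMatrix, sheetStokes, h2, h3, hp, partialProd_zero]
    simp only [Matrix.mul_assoc]
    rw [← Matrix.mul_assoc (formalPower D0 j _) (formalPower D0 j _), ← formalPower_add,
      add_neg_cancel_comm, ← Matrix.mul_assoc (D0.stokesProduct j), ← localMonodromy_eq,
      ← Matrix.mul_assoc _ (D0.localMonodromy j), ← Matrix.zpow_add_one hM]
    congr 2
    ring

lemma localMonodromy_mul_sectorMatrix_add (G : ContourChoice D0) (m : ℤ) :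
    D0.localMonodromy j * sectorMatrix D0 j (m + sectorCount (n j)) =
      sectorMatrix D0 j m * Matrix.diagonal fun p => exp (2 * π * I * D0.L j p) := by
  have hN := sectorCount_pos (n j)
  have hM : IsUnit (D0.localMonodromy j).det := by rw [det_localMonodromy j G]; exact isUnit_one
  have h1 : (Matrix.diagonal fun p => exp (2 * π * I * D0.L j p)) = formalPower D0 j 1 := by
    simp [formalPower]
  rw [sectorMatrix, sectorMatrix, residue_add, add_ediv hN, h1, formalPower_add]
  simp only [← Matrix.mul_assoc]
  rw [← Matrix.zpow_one_add hM]
  congr 4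
  ring

lemma sectorMatrix_sectorCount (G : ContourChoice D0) :
    sectorMatrix D0 j (sectorCount (n j)) = 1 := by
  have hN := sectorCount_pos (n j)
  have h1 := residue_add (N := sectorCount (n j)) 0
  have h2 := add_ediv hN 0
  rw [zero_add] at h1 h2
  have hM : IsUnit (D0.localMonodromy j).det := by rw [det_localMonodromy j G]; exact isUnit_one
  rw [sectorMatrix, h1, h2, show residue (sectorCount (n j)) 0 = 0 by simp [residue],
    partialProd_zero, Matrix.mul_assoc]
  simp only [Int.zero_ediv, zero_add]
  rw [← localMonodromy_eq, Matrix.zpow_neg_one, Matrix.nonsing_inv_mul _ hM]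

end ContourChoice


lemma exists_le_mul_pow_add {g : ℝ → ℝ} {X0 κ : ℝ} {n : ℕ} (hκ : 0 < κ)
    (hc : ContinuousOn g (Ici X0)) (ho : g =o[atTop] fun X : ℝ => X ^ n) (h0 : 0 < X0) :
    ∃ C, ∀ X ≥ X0, g X ≤ κ * X ^ n + C := by
  obtain ⟨X1, hX1⟩ := eventually_atTop.1 (ho.bound hκ)
  obtain ⟨C, hC⟩ := (isCompact_Icc.bddAbove_image
    (hc.mono (fun _ h => h.1 : Icc X0 X1 ⊆ Ici X0)) : BddAbove (g '' Icc X0 X1))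
  refine ⟨max C 0, fun X hX => ?_⟩
  have hp : 0 < X ^ n := pow_pos (h0.trans_le hX) n
  rcases le_total X X1 with h | h
  · have := hC ⟨X, ⟨hX, h⟩, rfl⟩
    have := le_max_left C 0
    nlinarith
  · have := hX1 X h
    rw [Real.norm_eq_abs, Real.norm_eq_abs, abs_of_pos hp] at this
    linarith [le_abs_self (g X), le_max_right C 0]

lemma exists_norm_exp_laurent_le {n : ℕ} (c : Fin n → ℂ) (b : ℂ) (l₀ : Fin n)
    (hl0 : (l₀ : ℕ) + 1 = n) {φ : ℝ} (h : (c l₀ * exp (-(n * φ * I))).re < 0) (x0 : ℝ) :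
    ∃ ε > 0, ∀ K : ℕ, ∃ C, ∀ w : ℂ, w.re < x0 → |w.im - φ| < ε →
      ‖exp (∑ l, c l * exp (-(((l : ℕ) + 1 : ℕ) * w)) + b * w)‖ ≤ C * Real.exp (K * w.re) := by
  set κ := -(c l₀ * exp (-(n * φ * I))).re / 2 with hκ
  have hcont : Continuous fun y : ℝ => (c l₀ * exp (-(n * y * I))).re := by fun_prop
  obtain ⟨ε, hε, hball⟩ := Metric.eventually_nhds_iff.1
    (hcont.continuousAt.eventually_lt (continuousAt_const (y := -κ)) (x₀ := φ) (by linarith))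
  refine ⟨ε, hε, fun K => ?_⟩
  let g : ℝ → ℝ := fun X => ∑ l ∈ Finset.univ.erase l₀, ‖c l‖ * X ^ ((l : ℕ) + 1) +
    (‖b‖ + K) * |Real.log X| + ‖b‖ * (|φ| + ε)
  have hn : n ≠ 0 := by omega
  obtain ⟨C, hC⟩ := exists_le_mul_pow_add (g := g) (n := n) (X0 := Real.exp (-x0))
    (show 0 < κ by linarith) (by
      refine ContinuousOn.add (ContinuousOn.add (by fun_prop) ?_) continuousOn_const
      refine continuousOn_const.mul (ContinuousOn.abs (ContinuousOn.log continuousOn_id ?_))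
      exact fun X hX => ((Real.exp_pos _).trans_le hX).ne') (by
      refine Asymptotics.IsLittleO.add (Asymptotics.IsLittleO.add ?_ ?_) ?_
      · refine Asymptotics.IsLittleO.fun_sum
          (A := fun (l : Fin n) (X : ℝ) => ‖c l‖ * X ^ ((l : ℕ) + 1)) fun l hl =>
          Asymptotics.IsLittleO.const_mul_left (Asymptotics.isLittleO_pow_pow_atTop_of_lt ?_) _
        have h1 : (l : ℕ) ≠ l₀ := fun h => (Finset.mem_erase.1 hl).1 (Fin.ext h)
        have := l.2
        omega
      · refine Asymptotics.IsLittleO.const_mul_left ?_ _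
        refine (Real.isLittleO_log_id_atTop.abs_left).trans_isBigO ?_
        refine Asymptotics.IsBigO.of_bound 1 ?_
        filter_upwards [eventually_ge_atTop 1] with X hX
        rw [one_mul, id, Real.norm_of_nonneg (by linarith), Real.norm_of_nonneg (by positivity)]
        exact le_self_pow₀ hX hn
      · exact Asymptotics.isLittleO_const_left.2 (Or.inr
          (tendsto_norm_atTop_atTop.comp (tendsto_pow_atTop hn)))) (Real.exp_pos _)
  refine ⟨Real.exp C, fun w hw hφ => ?_⟩
  rw [norm_exp, ← Real.exp_add, Real.exp_le_exp]
  set X := Real.exp (-w.re) with hX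
  have hXpos : 0 < X := Real.exp_pos _
  have h1 := hC X (Real.exp_le_exp.2 (by linarith))
  have hexp : ∀ l : ℕ, exp (-(l * w)) = ((X ^ l : ℝ) : ℂ) * exp (-(l * w.im * I)) := by
    intro l
    rw [hX, ← Real.exp_nat_mul, ofReal_exp, ← exp_add]
    congr 1
    conv_lhs => rw [← re_add_im w]
    push_cast; ring
  have hnorm : ∀ l : ℕ, ‖exp (-(l * w))‖ = X ^ l := by
    intro l
    rw [norm_exp, hX, ← Real.exp_nat_mul]
    simp
  have h2 : (c l₀ * exp (-((n : ℕ) * w))).re ≤ -κ * X ^ n := by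
    rw [hexp, mul_left_comm, re_ofReal_mul, mul_comm]
    exact mul_le_mul_of_nonneg_right (hball (y := w.im) hφ).le (pow_pos hXpos n).le
  have h3 : (∑ l ∈ Finset.univ.erase l₀, c l * exp (-(((l : ℕ) + 1 : ℕ) * w))).re ≤
      ∑ l ∈ Finset.univ.erase l₀, ‖c l‖ * X ^ ((l : ℕ) + 1) := by
    rw [re_sum]
    refine Finset.sum_le_sum fun l _ => (re_le_norm _).trans ?_
    rw [norm_mul, hnorm]
  have h4 : (b * w).re ≤ ‖b‖ * (|w.re| + (|φ| + ε)) := by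
    refine (re_le_norm _).trans ?_
    rw [norm_mul]
    refine mul_le_mul_of_nonneg_left ((norm_le_abs_re_add_abs_im w).trans ?_) (norm_nonneg _)
    have := abs_add_le (w.im - φ) φ
    rw [sub_add_cancel] at this
    linarith
  rw [← Finset.add_sum_erase Finset.univ _ (Finset.mem_univ l₀), hl0, add_re, add_re]
  have h5 : |Real.log X| = |w.re| := by rw [hX, Real.log_exp, abs_neg]
  simp only [g, h5] at h1
  have h6 : -(K * |w.re|) ≤ (K : ℝ) * w.re := by
    rw [← mul_neg]
    exact mul_le_mul_of_nonneg_left (neg_abs_le _) (Nat.cast_nonneg K)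
  linarith [h1, h2, h3, h4]

namespace ContourChoice

variable {k r : ℕ} {n : Fin k → ℕ} {D0 : BirkhoffData k r n} (G : ContourChoice D0) (j : Fin k)

lemma angleBase_eq {i : ℕ} (hi : i < sectorCount (n j)) :
    G.angleBase j i = G.angleBase j 0 + i * (2 * π / sectorCount (n j)) := by
  unfold sectorCount at *
  split_ifs at * with hn
  · obtain rfl : i = 0 := by omega
    simp
  · have : (n j : ℝ) ≠ 0 := by exact_mod_cast hn
    rw [angleBase, angleBase, dif_pos hi, dif_pos (by omega), G.α_pole, G.α_pole]
    push_cast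
    field_simp
    ring

/-- The directions of the Stokes lines on all the sheets. -/
def sheetAngle (m : ℤ) : ℝ :=
  G.angleBase j (residue (sectorCount (n j)) m) + 2 * π * (m / sectorCount (n j) : ℤ)

lemma sheetAngle_eq (m : ℤ) :
    G.sheetAngle j m = G.angleBase j 0 + m * (2 * π / sectorCount (n j)) := by
  have hN := sectorCount_pos (n j)
  have h := eq_residue_add hN m
  have hN' : (sectorCount (n j) : ℝ) ≠ 0 := by exact_mod_cast hN.ne'
  rw [sheetAngle, G.angleBase_eq j (residue_lt hN m)]
  have h' : (m : ℝ) = residue (sectorCount (n j)) m +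
      (m / sectorCount (n j) : ℤ) * sectorCount (n j) := by exact_mod_cast h
  conv_rhs => rw [h']
  field_simp
  ring

lemma exists_sheetStokes_flat {m : ℤ} {p q : Fin r} (hpq : p ≠ q)
    (h : sheetStokes D0 j m p q ≠ 0) :
    ∃ ε > 0, ∀ K : ℕ, ∃ C, ∀ w : ℂ, w.re < Real.log (G.τ j) → |w.im - G.sheetAngle j m| < ε →
    ‖exp ((∑ l, D0.T j l p * exp (-(((l : ℕ) + 1 : ℕ) * w)) + D0.L j p * w) -
      (∑ l, D0.T j l q * exp (-(((l : ℕ) + 1 : ℕ) * w)) + D0.L j q * w))‖ ≤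
        C * Real.exp (K * w.re) := by
  rw [sheetStokes_apply] at h
  replace h := right_ne_zero_of_mul (left_ne_zero_of_mul h)
  unfold stokesBase at h
  split_ifs at h with hi
  · set i := residue (sectorCount (n j)) m with hidef
    have hn : n j - 1 + 1 = n j := by omega
    have h1 := G.stokes_triangular j ⟨n j - 1, by omega⟩ hn ⟨i, hi⟩ p q hpq h
    obtain ⟨ε, hε, hK⟩ := exists_norm_exp_laurent_le (fun l => D0.T j l p - D0.T j l q)
      (D0.L j p - D0.L j q) ⟨n j - 1, by omega⟩ hn (φ := G.sheetAngle j m) (by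
        rw [sheetAngle, ← hidef, angleBase, dif_pos hi]
        convert h1 using 3
        rw [exp_eq_exp_iff_exists_int]
        refine ⟨-(n j * (m / sectorCount (n j))), ?_⟩
        push_cast
        ring) (Real.log (G.τ j))
    refine ⟨ε, hε, fun K => (hK K).imp fun C hC w hw hφ => ?_⟩
    convert hC w hw hφ using 3
    simp only [sub_mul, Finset.sum_sub_distrib]
    ring
  · exact absurd (Matrix.one_apply_ne hpq) h

/-- The local data at the pole `a j`. -/
def localData : LocalData r where
  n := n j
  T := D0.T j
  L := D0.L j
  N := sectorCount (n j)
  θ := G.θ j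
  xτ := Real.log (G.τ j)
  xρ := Real.log (G.ρ j)
  xR := Real.log (G.R j)
  line m x := G.lineBase j (residue (sectorCount (n j)) m) x +
    2 * π * (m / sectorCount (n j) : ℤ)
  lineDeriv m := G.slopeBase j (residue (sectorCount (n j)) m)
  φ := G.sheetAngle j
  S := sheetStokes D0 j
  R := sectorMatrix D0 j
  M0 := D0.localMonodromy j
  height m := G.heightBase j (residue (sectorCount (n j)) m)
  N_pos := sectorCount_pos _
  xτ_lt_xρ := G.log_τ_lt_log_ρ j
  xρ_lt_xR := Real.log_lt_log (G.ρ_pos j) (G.ρ_lt_R j)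
  T_traceless := D0.T_traceless j
  L_traceless := D0.L_traceless j
  line_add m x := by
    rw [residue_add, add_ediv (sectorCount_pos _)]
    push_cast; ring
  line_of_ge m h0 hm x hx := by
    rw [G.lineBase_of_ge j _ hx, Int.ediv_eq_zero_of_lt h0 hm]
    simp
  line_lt m x hx := by
    rcases residue_succ (sectorCount_pos (n j)) m with ⟨h1, h2, h3⟩ | ⟨h1, h2, h3⟩
    · rw [h2, h3]
      linarith [G.lineBase_lt j h1 hx]
    · rw [h2, h3]
      push_cast
      linarith [G.lineBase_lt_add j (residue_lt (sectorCount_pos (n j)) m) hx]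
  line_continuous m := (G.lineBase_continuous j _).add continuous_const
  line_hasDerivAt m x hx := (G.hasDerivAt_lineBase j _ hx).add_const _
  lineDeriv_continuousAt m x hx := G.slopeBase_continuousAt j _ hx
  line_tendsto m := (G.lineBase_tendsto j _).add_const _
  angles := by
    have hN : (0 : ℝ) < sectorCount (n j) := by exact_mod_cast sectorCount_pos (n j)
    refine ⟨2 * π / sectorCount (n j), sectorCount_pos _, by positivity, fun m => ?_,
      fun m => ?_⟩
    · rw [sheetAngle_eq, sheetAngle_eq]
      push_cast
      linarith
    · rw [sheetAngle_eq, sheetAngle_eq]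
      push_cast
      field_simp
      ring
  R_det := det_sectorMatrix j G
  R_succ := sectorMatrix_succ j G
  R_add := localMonodromy_mul_sectorMatrix_add j G
  R_period := sectorMatrix_sectorCount j G
  S_diag m p := by
    rw [sheetStokes_apply, stokesBase_diag j G, mul_one, ← exp_add]
    push_cast
    rw [← exp_zero]
    congr 1
    ring
  S_triangular m p q hpq h := by
    rw [sheetStokes_apply] at h
    exact G.heightBase_lt j hpq (right_ne_zero_of_mul (left_ne_zero_of_mul h))
  S_flat m p q hpq h := G.exists_sheetStokes_flat j hpq h

end ContourChoice


lemma logBranch_exp {η : ℝ} {w : ℂ} (h : |w.im - η| < π) : logBranch η (exp w) = w := by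
  rw [abs_lt] at h
  rw [logBranch, ← exp_add, Complex.log_exp]
  · ring
  · simp; linarith
  · simp; linarith

lemma ofReal_mul_exp {x : ℝ} (hx : 0 < x) (θ : ℝ) :
    (x : ℂ) * exp (θ * I) = exp (Real.log x + θ * I) := by
  rw [exp_add, ← ofReal_exp, Real.exp_log hx]

lemma exists_eq_add_of_exp_eq {w : ℂ} {x θ : ℝ} (hx : 0 < x)
    (h : exp w = (x : ℂ) * exp (θ * I)) :
    w.re = Real.log x ∧ ∃ q : ℤ, w.im = θ + 2 * π * q := by
  rw [ofReal_mul_exp hx, exp_eq_exp_iff_exists_int] at h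
  obtain ⟨q, rfl⟩ := h
  refine ⟨by simp, q, ?_⟩
  simp
  ring

lemma norm_ofReal_mul_exp (x θ : ℝ) : ‖(x : ℂ) * exp (θ * I)‖ = |x| := by
  rw [norm_mul, norm_exp_ofReal_mul_I, mul_one, norm_real, Real.norm_eq_abs]

/-- A curve that crosses an arc transversally approaches it inside non-tangential cones. -/
lemma exists_tendsto_cones {c γ : ℝ → ℂ} {t : ℝ} {v : ℂ} (hc : HasDerivAt c v 0) (h0 : c 0 = γ t)
    (hv : (v / deriv γ t).im < 0) : ∃ κ ∈ Ioo (0 : ℝ) 1,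
      Tendsto c (𝓝[>] 0) (𝓝[rightCone γ t κ] (γ t)) ∧
      Tendsto c (𝓝[<] 0) (𝓝[leftCone γ t κ] (γ t)) := by
  set q := v / deriv γ t
  have hqn : -q.im ≤ ‖q‖ := (neg_le_abs _).trans (abs_im_le_norm q)
  have hqpos : 0 < ‖q‖ := by linarith
  have hlt : -q.im / (2 * ‖q‖) * ‖q‖ < -q.im := by
    rw [div_mul_eq_mul_div, div_lt_iff₀ (by positivity)]
    nlinarith
  have hs : Tendsto (fun σ : ℝ => (c σ - γ t) / deriv γ t / σ) (𝓝[≠] 0) (𝓝 q) := by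
    have h1 := (hasDerivAt_iff_tendsto_slope.1 hc).div_const (deriv γ t)
    refine h1.congr fun σ => ?_
    rw [slope_def_module, h0, sub_zero, real_smul]
    push_cast
    ring
  have hev : ∀ᶠ σ : ℝ in 𝓝[≠] 0, -q.im / (2 * ‖q‖) * ‖(c σ - γ t) / deriv γ t / σ‖ <
      -((c σ - γ t) / deriv γ t / σ).im :=
    (tendsto_const_nhds.mul hs.norm).eventually_lt ((continuous_im.tendsto q).comp hs).neg hlt
  have hcont : Tendsto c (𝓝 0) (𝓝 (γ t)) := h0 ▸ hc.continuousAt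
  refine ⟨-q.im / (2 * ‖q‖), ⟨by apply div_pos <;> linarith, ?_⟩,
    tendsto_nhdsWithin_iff.2 ⟨hcont.mono_left nhdsWithin_le_nhds, ?_⟩,
    tendsto_nhdsWithin_iff.2 ⟨hcont.mono_left nhdsWithin_le_nhds, ?_⟩⟩
  · rw [div_lt_one (by positivity)]
    linarith
  · filter_upwards [hev.filter_mono (nhdsWithin_mono 0 fun x (hx : 0 < x) => hx.ne'),
      self_mem_nhdsWithin] with σ hσ hpos
    have hpos : 0 < σ := hpos
    rw [norm_div (_ / _), div_ofReal_im, norm_real, Real.norm_of_nonneg hpos.le, ← neg_div, ← mul_div_assoc,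
      div_lt_div_iff_of_pos_right hpos] at hσ
    exact hσ
  · filter_upwards [hev.filter_mono (nhdsWithin_mono 0 fun x (hx : x < 0) => hx.ne),
      self_mem_nhdsWithin] with σ hσ hneg
    have hneg : σ < 0 := hneg
    rw [norm_div (_ / _), div_ofReal_im, norm_real, Real.norm_eq_abs, abs_of_neg hneg, ← div_neg,
      ← mul_div_assoc, div_lt_div_iff_of_pos_right (by linarith)] at hσ
    exact hσ

lemma IsRHSolution.exists_limits {r : ℕ} {ι : Type} {path : ι → ℝ → ℂ} {J : ι → ℝ → ℂ → Mat r}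
    {Γ : ℂ → Mat r} (hΓ : IsRHSolution path J Γ) {i : ι} {t : ℝ} (ht : t ∈ Ioo (0 : ℝ) 1)
    {a w ω v : ℂ} (hw : path i t = a + exp w) (hd : HasDerivAt (path i) (exp w * ω) t)
    (hv : (v / ω).im < 0) : ∃ Ga Gb, Tendsto (fun σ : ℝ => Γ (a + exp (w + σ * v))) (𝓝[>] 0) (𝓝 Ga) ∧
      Tendsto (fun σ : ℝ => Γ (a + exp (w + σ * v))) (𝓝[<] 0) (𝓝 Gb) ∧
      Gb = Ga * J i t (a + exp w) := by
  have hc : HasDerivAt (fun σ : ℝ => a + exp (w + σ * v)) (exp w * v) 0 := by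
    have h1 : HasDerivAt (fun σ : ℝ => w + σ * v) v 0 := by
      simpa using ((hasDerivAt_id (0 : ℝ)).ofReal_comp.mul_const v).const_add w
    have := h1.cexp.const_add a
    simpa using this
  obtain ⟨κ, hκ, h1, h2⟩ := exists_tendsto_cones (γ := path i) (t := t) hc (by simp [hw]) (by
    rwa [hd.deriv, mul_div_mul_left _ _ (exp_ne_zero w)])
  obtain ⟨Gp, Gm, h3, h4, h5⟩ := hΓ.jump i t ht
  rw [hw] at h5
  exact ⟨Gm, Gp, (h4 κ hκ).comp h1, (h3 κ hκ).comp h2, h5⟩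

lemma BirkhoffData.powL_exp {k r : ℕ} {n : Fin k → ℕ} {D0 : BirkhoffData k r n}
    (G : ContourChoice D0) (j : Fin k) {η : ℝ} {w : ℂ} (h : |w.im - η| < π) :
    D0.powL j η (D0.a j + exp w) = (G.localData j).expL w := by
  rw [powL, add_sub_cancel_left, logBranch_exp h]
  rfl

lemma BirkhoffData.toral_exp {k r : ℕ} {n : Fin k → ℕ} {D0 : BirkhoffData k r n}
    (G : ContourChoice D0) (j : Fin k) (w : ℂ) :
    D0.toral j (D0.a j + exp w) = (G.localData j).toral w := by
  funext p
  refine Finset.sum_congr rfl fun l _ => ?_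
  rw [add_sub_cancel_left, ← exp_nat_mul, div_eq_mul_inv, ← exp_neg]
  rfl

lemma BirkhoffData.expThat_exp {k r : ℕ} {n : Fin k → ℕ} {D0 : BirkhoffData k r n}
    (G : ContourChoice D0) (j : Fin k) {η : ℝ} {w : ℂ} (h : |w.im - η| < π) :
    D0.expThat j η (D0.a j + exp w) = (G.localData j).expThat w := by
  rw [expThat, expT, powL_exp G j h, toral_exp G j, LocalData.expL, LocalData.expThat,
    Matrix.diagonal_mul_diagonal]
  simp only [← exp_add]
  rfl

namespace ContourChoice

variable {k r : ℕ} {n : Fin k → ℕ} {D0 : BirkhoffData k r n} (G : ContourChoice D0) (j : Fin k)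

/-- The arcs in the coordinate `log (z - a j)`. -/
def logPath : LocalArc (n j) → ℝ → ℂ
  | .outerStem, _ => 0
  | .innerStem, t => Real.log (G.R j - t * (G.R j - G.ρ j)) + G.θ j * I
  | .connectionCircle, t => Real.log (G.R j) + (G.θ j + 2 * π * t : ℝ) * I
  | .formalCircle, t => Real.log (G.ρ j) + (G.θ j + 2 * π * t : ℝ) * I
  | .neck _, t => Real.log (G.ρ j - t * (G.ρ j - G.τ j)) + G.θ j * I
  | .toralCircle _, t => Real.log (G.τ j) + (G.θ j + 2 * π * t : ℝ) * I
  | .stokesLine ν, t =>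
      Real.log (G.τ j * (1 - t)) + G.α j ν (G.τ j * (1 - t)) * I

/-- The derivative of `logPath`. -/
def logPathDeriv : LocalArc (n j) → ℝ → ℂ
  | .outerStem, _ => 0
  | .innerStem, t => (-(G.R j - G.ρ j) / (G.R j - t * (G.R j - G.ρ j)) : ℝ)
  | .connectionCircle, _ => 2 * π * I
  | .formalCircle, _ => 2 * π * I
  | .neck _, t => (-(G.ρ j - G.τ j) / (G.ρ j - t * (G.ρ j - G.τ j)) : ℝ)
  | .toralCircle _, _ => 2 * π * I
  | .stokesLine ν, t =>
      (-(1 - t)⁻¹ : ℝ) * (1 + (G.localData j).lineDeriv (ν : ℕ) (Real.log (G.τ j * (1 - t))) * I)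

lemma radius_pos {x y t : ℝ} (hx : 0 < x) (hxy : x < y) (ht : t ∈ Icc (0 : ℝ) 1) :
    0 < y - t * (y - x) := by
  nlinarith [ht.1, ht.2]

lemma line_eq_α (ν : Fin (2 * n j)) {x : ℝ} (hx : x < Real.log (G.τ j)) :
    (G.localData j).line (ν : ℕ) x = G.α j ν (Real.exp x) ∧
    (G.localData j).lineDeriv (ν : ℕ) x = deriv (G.α j ν) (Real.exp x) * Real.exp x := by
  have hν := ν.2
  have hN : sectorCount (n j) = 2 * n j := by rw [sectorCount, if_neg (by omega)]
  have h1 : residue (sectorCount (n j)) (ν : ℕ) = ν := by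
    simpa using residue_add_mul (N := sectorCount (n j)) (ν : ℕ) (by omega) 0
  have h2 : (((ν : ℕ) : ℤ) / sectorCount (n j) : ℤ) = 0 :=
    Int.ediv_eq_zero_of_lt (by omega) (by omega)
  simp only [localData, h1, h2, slopeBase, dif_pos hν]
  rw [G.lineBase_of_lt j hν hx]
  simp

lemma path_eq {c : LocalArc (n j)} (hc : c ≠ .outerStem) {t : ℝ} (ht : t ∈ Ico (0 : ℝ) 1) :
    G.path ⟨j, c⟩ t = D0.a j + exp (G.logPath j c t) := by
  have ht' := Ico_subset_Icc_self ht
  cases c with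
  | outerStem => exact absurd rfl hc
  | innerStem =>
    rw [path, ofReal_mul_exp (radius_pos (G.ρ_pos j) (G.ρ_lt_R j) ht')]; rfl
  | connectionCircle => rw [path, ofReal_mul_exp (G.R_pos j)]; rfl
  | formalCircle => rw [path, ofReal_mul_exp (G.ρ_pos j)]; rfl
  | neck h => rw [path, ofReal_mul_exp (radius_pos (G.τ_pos j) (G.τ_lt_ρ j) ht')]; rfl
  | toralCircle h => rw [path, ofReal_mul_exp (G.τ_pos j)]; rfl
  | stokesLine ν =>
    rw [path, ofReal_mul_exp (mul_pos (G.τ_pos j) (by linarith [ht.2]))]; rfl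

lemma hasDerivAt_log_radius {x y t : ℝ} (θ : ℝ) (h : 0 < y - t * (y - x)) :
    HasDerivAt (fun t : ℝ => (Real.log (y - t * (y - x)) : ℂ) + θ * I)
      ((-(y - x) / (y - t * (y - x)) : ℝ) : ℂ) t := by
  have h1 : HasDerivAt (fun t : ℝ => y - t * (y - x)) (-(y - x)) t := by
    simpa using ((hasDerivAt_id t).mul_const (y - x)).const_sub y
  exact ((h1.log h.ne').ofReal_comp).add_const _

lemma hasDerivAt_log_circle (x θ t : ℝ) :
    HasDerivAt (fun t : ℝ => (Real.log x : ℂ) + (θ + 2 * π * t : ℝ) * I)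
      (2 * π * I) t := by
  have h1 : HasDerivAt (fun t : ℝ => θ + 2 * π * t) (2 * π) t := by
    simpa using ((hasDerivAt_id t).const_mul (2 * π)).const_add θ
  have := (h1.ofReal_comp.mul_const I).const_add (Real.log x : ℂ)
  simpa using this

lemma hasDerivAt_logPath (c : LocalArc (n j)) {t : ℝ} (ht : t ∈ Ioo (0 : ℝ) 1) :
    HasDerivAt (G.logPath j c) (G.logPathDeriv j c t) t := by
  have ht' := Ioo_subset_Icc_self ht
  cases c with
  | outerStem => exact hasDerivAt_const t _
  | innerStem => exact hasDerivAt_log_radius _ (radius_pos (G.ρ_pos j) (G.ρ_lt_R j) ht')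
  | connectionCircle => exact hasDerivAt_log_circle _ _ t
  | formalCircle => exact hasDerivAt_log_circle _ _ t
  | neck h => exact hasDerivAt_log_radius _ (radius_pos (G.τ_pos j) (G.τ_lt_ρ j) ht')
  | toralCircle h => exact hasDerivAt_log_circle _ _ t
  | stokesLine ν =>
    have hτ := G.τ_pos j
    have h0 : (0 : ℝ) < 1 - t := by linarith [ht.2]
    have hx : G.τ j * (1 - t) ∈ Ioo 0 (G.τ j) := ⟨mul_pos hτ h0, by nlinarith [ht.1]⟩
    have h1 : HasDerivAt (fun t : ℝ => G.τ j * (1 - t)) (-G.τ j) t := by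
      simpa using ((hasDerivAt_id t).const_sub 1).const_mul (G.τ j)
    have h2 := (h1.log hx.1.ne').ofReal_comp
    have h3 := ((G.hasDerivAt_α j ν hx).comp t h1).ofReal_comp.mul_const I
    refine (h2.add h3).congr_deriv ?_
    rw [logPathDeriv, (G.line_eq_α j ν (Real.log_lt_log hx.1 hx.2)).2, Real.exp_log hx.1]
    have h4 : (G.τ j : ℂ) ≠ 0 := by exact_mod_cast hτ.ne'
    have h5 : (1 - t : ℂ) ≠ 0 := by exact_mod_cast h0.ne'
    push_cast
    field_simp
    ring

lemma hasDerivAt_path {c : LocalArc (n j)} (hc : c ≠ .outerStem) {t : ℝ}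
    (ht : t ∈ Ioo (0 : ℝ) 1) :
    HasDerivAt (G.path ⟨j, c⟩) (exp (G.logPath j c t) * G.logPathDeriv j c t) t := by
  refine ((G.hasDerivAt_logPath j c ht).cexp.const_add (D0.a j)).congr_of_eventuallyEq ?_
  filter_upwards [Ioo_mem_nhds ht.1 ht.2] with s hs
    using G.path_eq j hc (Ioo_subset_Ico_self hs)

lemma path_continuousOn (i : ContourArc n) : ContinuousOn (G.path i) (Icc 0 1) := by
  obtain ⟨j, c⟩ := i
  cases c with
  | outerStem => exact (G.stem_smooth j).continuousOn
  | stokesLine ν =>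
    have h : ContinuousOn (fun t => G.α j ν (G.τ j * (1 - t))) (Icc 0 1) := by
      refine (G.α_smooth j ν).continuousOn.comp (by fun_prop) fun t ht => ?_
      have := G.τ_pos j
      exact ⟨mul_nonneg this.le (by linarith [ht.2]), by nlinarith [ht.1]⟩
    unfold path
    have h' : ContinuousOn (fun t => ((G.α j ν (G.τ j * (1 - t)) : ℝ) : ℂ)) (Icc 0 1) :=
      continuous_ofReal.comp_continuousOn h
    fun_prop
  | _ => unfold path; fun_prop

lemma isClosed_contourSupport : IsClosed (contourSupport G.path) :=
  (isCompact_iUnion fun i => isCompact_Icc.image_of_continuousOn (G.path_continuousOn i)).isClosed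

lemma le_norm_stem (i j : Fin k) {t : ℝ} (ht : t ∈ Icc (0 : ℝ) 1) :
    G.R j ≤ ‖G.stem i t - D0.a j‖ := by
  rcases ht.1.eq_or_lt with rfl | h0
  · rw [G.stem_start]; exact (G.z₀_outside j).le
  rcases ht.2.eq_or_lt with rfl | h1
  · rw [G.stem_end]
    have hn := norm_ofReal_mul_exp (G.R i) (G.θ i)
    rw [abs_of_pos (G.R_pos i)] at hn
    by_cases hij : i = j
    · subst hij; rw [add_sub_cancel_left, hn]
    · have h1 := norm_sub_norm_le (D0.a i - D0.a j) (-(G.R i * exp (G.θ i * I)))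
      rw [norm_neg, hn, show D0.a i - D0.a j - -(G.R i * exp (G.θ i * I)) =
        D0.a i + G.R i * exp (G.θ i * I) - D0.a j by ring] at h1
      linarith [G.discs_disjoint i j hij]
  · exact (G.stem_outside j i t ⟨h0, h1⟩).le

lemma norm_path_le {c : LocalArc (n j)} (hc : c ≠ .outerStem) {t : ℝ} (ht : t ∈ Icc (0 : ℝ) 1) :
    ‖G.path ⟨j, c⟩ t - D0.a j‖ ≤ G.R j := by
  have h1 := G.τ_pos j
  have h2 := G.τ_lt_ρ j
  have h3 := G.ρ_lt_R j
  obtain ⟨ht0, ht1⟩ := ht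
  cases c with
  | outerStem => exact absurd rfl hc
  | _ =>
    rw [path, add_sub_cancel_left, norm_ofReal_mul_exp, abs_le]
    constructor <;> nlinarith

lemma line_mul_sectorCount (q : ℤ) {x : ℝ} (hx : Real.log (G.τ j) ≤ x) :
    (G.localData j).line (q * sectorCount (n j)) x = G.θ j + 2 * π * q := by
  rw [(G.localData j).line_eq _ hx]
  change _ + _ * (((q * (sectorCount (n j) : ℕ)) / (sectorCount (n j) : ℕ) : ℤ) : ℝ) = _
  rw [Int.mul_ediv_cancel _ (by exact_mod_cast (sectorCount_pos (n j)).ne')]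
  rfl

/-- Inside the connection circle the contour is contained in the image of the cuts. -/
lemma mem_cuts_of_mem_contourSupport {w : ℂ} (hw : w.re < Real.log (G.R j))
    (h : D0.a j + exp w ∈ contourSupport G.path) :
    w ∈ (G.localData j).cuts ∧ (0 < n j ∨ Real.log (G.ρ j) ≤ w.re) := by
  have hτ := G.τ_pos j
  have hτρ := G.τ_lt_ρ j
  have hρR := G.ρ_lt_R j
  have hlt : ‖D0.a j + exp w - D0.a j‖ < G.R j := by
    rw [add_sub_cancel_left, norm_exp]
    exact (Real.lt_log_iff_exp_lt (G.R_pos j)).1 hw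
  obtain ⟨⟨i, c⟩, t, ht, hz⟩ := mem_iUnion.1 h
  by_cases hc : c = .outerStem
  · subst hc
    rw [← hz] at hlt
    exact absurd hlt (not_lt.2 (G.le_norm_stem i j ht))
  by_cases hij : i = j
  swap
  · have h1 := G.norm_path_le i hc ht
    rw [hz] at h1
    have h2 := norm_sub_le (D0.a j + exp w - D0.a j) (D0.a j + exp w - D0.a i)
    rw [show D0.a j + exp w - D0.a j - (D0.a j + exp w - D0.a i) = D0.a i - D0.a j by ring] at h2
    linarith [G.discs_disjoint i j hij]
  subst hij
  have hradial : ∀ {x : ℝ}, 0 < x → Real.log (G.τ i) ≤ Real.log x →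
      exp w = (x : ℂ) * exp (G.θ i * I) →
      w.re = Real.log x ∧ w ∈ (G.localData i).cuts := fun {x} hx0 hx h => by
    obtain ⟨h1, q, h2⟩ := exists_eq_add_of_exp_eq hx0 h
    refine ⟨h1, Or.inl ⟨q * sectorCount (n i), ?_⟩⟩
    rw [h2, G.line_mul_sectorCount i q (h1 ▸ hx)]
  have hlog := (G.log_τ_lt_log_ρ i)
  cases c with
  | outerStem => exact absurd rfl hc
  | innerStem =>
    have hx : G.ρ i ≤ G.R i - t * (G.R i - G.ρ i) := by nlinarith [ht.2]
    have h2 := Real.log_le_log (G.ρ_pos i) hx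
    have h1 := hradial ((G.ρ_pos i).trans_le hx) (hlog.le.trans h2) (add_left_cancel hz).symm
    exact ⟨h1.2, Or.inr (h1.1 ▸ h2)⟩
  | connectionCircle =>
    rw [← hz, path, add_sub_cancel_left, norm_ofReal_mul_exp, abs_of_pos (G.R_pos i)] at hlt
    exact absurd hlt (lt_irrefl _)
  | formalCircle =>
    have h1 := (exists_eq_add_of_exp_eq (G.ρ_pos i) (add_left_cancel hz).symm).1
    exact ⟨Or.inr (Or.inr h1), Or.inr h1.ge⟩
  | neck hn =>
    have hx : G.τ i ≤ G.ρ i - t * (G.ρ i - G.τ i) := by nlinarith [ht.2]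
    exact ⟨(hradial (hτ.trans_le hx) (Real.log_le_log hτ hx) (add_left_cancel hz).symm).2,
      Or.inl hn⟩
  | toralCircle hn =>
    have h1 := (exists_eq_add_of_exp_eq hτ (add_left_cancel hz).symm).1
    exact ⟨Or.inr (Or.inl h1), Or.inl hn⟩
  | stokesLine ν =>
    refine ⟨?_, Or.inl (by have := ν.2; omega)⟩
    have hz := (add_left_cancel hz).symm
    rcases ht.2.eq_or_lt with rfl | h1
    · exact absurd hz (by simp)
    obtain ⟨h2, q, h3⟩ := exists_eq_add_of_exp_eq (mul_pos hτ (by linarith)) hz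
    rcases ht.1.eq_or_lt with rfl | h0
    · exact Or.inr (Or.inl (by rw [h2]; simp [localData]))
    refine Or.inl ⟨(ν : ℕ) + q * (G.localData i).N, ?_⟩
    rw [(G.localData i).line_add_mul, h3, h2, (G.line_eq_α i ν (Real.log_lt_log
      (mul_pos hτ (by linarith)) (by nlinarith))).1, Real.exp_log (mul_pos hτ (by linarith))]

end ContourChoice


namespace ContourChoice

variable {k r : ℕ} {n : Fin k → ℕ} {D0 : BirkhoffData k r n} (G : ContourChoice D0) (j : Fin k)

lemma I_div_im_neg {z : ℂ} (hz : z.re < 0) : (I / z).im < 0 := by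
  have h0 : 0 < normSq z := normSq_pos.2 fun h => by simp [h] at hz
  rw [div_im, I_im, I_re, zero_mul, zero_div, sub_zero, one_mul]
  exact div_neg_of_neg_of_pos hz h0

lemma one_div_two_pi_I_im_neg : (1 / (2 * π * I)).im < 0 := by
  have h : 1 / (2 * π * I) = ((-(2 * π)⁻¹ : ℝ) : ℂ) * I := by
    have := Real.pi_pos.ne'
    push_cast
    field_simp
    rw [I_sq, neg_neg]
  rw [h, im_ofReal_mul]
  simp [Real.pi_pos]

lemma logPathDeriv_re_neg {c : LocalArc (n j)} {t : ℝ} (ht : t ∈ Ioo (0 : ℝ) 1)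
    (hc : c = .innerStem ∨ (∃ h, c = .neck h) ∨ ∃ ν, c = .stokesLine ν) :
    (G.logPathDeriv j c t).re < 0 := by
  have ht' := Ioo_subset_Icc_self ht
  rcases hc with rfl | ⟨h, rfl⟩ | ⟨ν, rfl⟩
  · exact div_neg_of_neg_of_pos (by linarith [G.ρ_lt_R j])
      (radius_pos (G.ρ_pos j) (G.ρ_lt_R j) ht')
  · exact div_neg_of_neg_of_pos (by linarith [G.τ_lt_ρ j])
      (radius_pos (G.τ_pos j) (G.τ_lt_ρ j) ht')
  · rw [logPathDeriv, re_ofReal_mul]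
    have : 0 < (1 - t)⁻¹ := inv_pos.2 (by linarith [ht.2])
    simp [ht.2]

lemma sheetStokes_of_lt {m : ℤ} (h0 : 0 ≤ m) (h1 : m < sectorCount (n j)) :
    sheetStokes D0 j m = stokesBase D0 j m.toNat := by
  have h2 : m / (sectorCount (n j) : ℤ) = 0 := Int.ediv_eq_zero_of_lt h0 h1
  rw [sheetStokes, h2, neg_zero, formalPower_zero, Matrix.one_mul, Matrix.mul_one, residue,
    Int.emod_eq_of_lt h0 h1]

lemma sectorMatrix_zero : sectorMatrix D0 j 0 = D0.stokesProduct j := by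
  rw [sectorMatrix, Int.zero_ediv, neg_zero, zpow_zero, formalPower_zero, Matrix.one_mul,
    Matrix.mul_one, show residue (sectorCount (n j)) 0 = 0 by simp [residue], partialProd_zero]

lemma stokesProduct_of_simple_pole (hn : n j = 0) : D0.stokesProduct j = 1 := by
  have h1 : List.ofFn (D0.S j) = [] := by
    rw [List.ofFn_eq_nil_iff]; omega
  rw [BirkhoffData.stokesProduct, h1]
  simp

lemma toral_of_simple_pole (hn : n j = 0) (w : ℂ) (p : Fin r) :
    (G.localData j).toral w p = 0 := by
  have : IsEmpty (Fin (n j)) := by rw [hn]; infer_instance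
  exact Finset.sum_eq_zero fun l _ => this.elim l

lemma expThat_eq (w : ℂ) : (G.localData j).expThat w =
    (Matrix.diagonal fun p => exp ((G.localData j).toral w p)) * (G.localData j).expL w := by
  rw [LocalData.expL, LocalData.expThat, Matrix.diagonal_mul_diagonal]
  simp only [← exp_add]
  rfl

lemma exists_neck_param {x y s : ℝ} (hx : 0 < x) (hy : 0 < y) (h1 : Real.log x < s)
    (h2 : s < Real.log y) :
    ∃ t ∈ Ioo (0 : ℝ) 1, Real.log (y - t * (y - x)) = s := by
  have h3 := (Real.log_lt_iff_lt_exp hx).1 h1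
  have h4 := (Real.lt_log_iff_exp_lt hy).1 h2
  refine ⟨(y - Real.exp s) / (y - x), ⟨by apply div_pos <;> linarith, ?_⟩, ?_⟩
  · rw [div_lt_one] <;> linarith
  · rw [div_mul_cancel₀ _ (by linarith), sub_sub_cancel, Real.log_exp]

lemma exists_circle_param {x θ : ℝ} {w : ℂ} (h : w.re = x) (h1 : θ < w.im)
    (h2 : w.im < θ + 2 * π) : ∃ t ∈ Ioo (0 : ℝ) 1, (x : ℂ) + (θ + 2 * π * t : ℝ) * I = w := by
  have hπ := Real.pi_pos
  refine ⟨(w.im - θ) / (2 * π), ⟨by apply div_pos <;> linarith, ?_⟩, ?_⟩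
  · rw [div_lt_one] <;> linarith
  · rw [mul_div_cancel₀ _ (by positivity), add_sub_cancel, ← h, re_add_im]

lemma conj_jump {Ga Gb J E S : Mat r} (hE : E.det = 1) (h : Gb = Ga * J) (hJ : J = E * S * E⁻¹) :
    Gb * E = Ga * E * S := by
  rw [h, hJ]
  simp only [Matrix.mul_assoc]
  rw [Matrix.nonsing_inv_mul _ (by rw [hE]; exact isUnit_one), Matrix.mul_one]

lemma notMem_of_simple_pole (hn : n j = 0) {w : ℂ} (hw : w.re < Real.log (G.ρ j)) :
    D0.a j + exp w ∉ contourSupport G.path := fun h => by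
  have hR := Real.log_lt_log (G.ρ_pos j) (G.ρ_lt_R j)
  rcases (G.mem_cuts_of_mem_contourSupport j (hw.trans hR) h).2 with h | h
  · omega
  · linarith

end ContourChoice

namespace IsRHSolution

variable {k r : ℕ} {n : Fin k → ℕ} {D0 : BirkhoffData k r n} {G : ContourChoice D0}
  {Γ : ℂ → Mat r} (hΓ : IsRHSolution G.path (G.jump D0) Γ) (j : Fin k)

include hΓ

lemma analyticAt {z : ℂ} (hz : z ∉ contourSupport G.path) (p q : Fin r) :
    AnalyticAt ℂ (fun z => Γ z p q) z :=
  (hΓ.holomorphic p q).analyticAt (G.isClosed_contourSupport.isOpen_compl.mem_nhds hz)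

lemma analyticAt_pullback {w : ℂ} (hw : D0.a j + exp w ∉ contourSupport G.path) (p q : Fin r) :
    AnalyticAt ℂ (fun w => Γ (D0.a j + exp w) p q) w :=
  AnalyticAt.fun_comp (g := fun z => Γ z p q) (f := fun w => D0.a j + exp w)
    (hΓ.analyticAt hw p q) (by fun_prop)

lemma continuousAt_pullback {w : ℂ} (hw : D0.a j + exp w ∉ contourSupport G.path) :
    ContinuousAt (fun w => Γ (D0.a j + exp w)) w :=
  continuousAt_pi.2 fun p => continuousAt_pi.2 fun q =>
    (hΓ.analyticAt_pullback j hw p q).continuousAt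

lemma exists_limits_of_notMem {w : ℂ} (hw : D0.a j + exp w ∉ contourSupport G.path) (v : ℂ) :
    Tendsto (fun σ : ℝ => Γ (D0.a j + exp (w + σ * v))) (𝓝[>] 0) (𝓝 (Γ (D0.a j + exp w))) ∧
    Tendsto (fun σ : ℝ => Γ (D0.a j + exp (w + σ * v))) (𝓝[<] 0) (𝓝 (Γ (D0.a j + exp w))) := by
  have h : Tendsto (fun σ : ℝ => w + σ * v) (𝓝 0) (𝓝 w) := by
    have : Continuous fun σ : ℝ => w + σ * v := by fun_prop
    simpa using this.tendsto 0
  have h1 := (hΓ.continuousAt_pullback j hw).tendsto.comp h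
  exact ⟨h1.mono_left nhdsWithin_le_nhds, h1.mono_left nhdsWithin_le_nhds⟩

/-- The jump across an arc, in the coordinate `log (z - a j)`. -/
lemma exists_limits_logPath {c : LocalArc (n j)} (hc : c ≠ .outerStem) {t : ℝ}
    (ht : t ∈ Ioo (0 : ℝ) 1) {w v : ℂ} (hw : G.logPath j c t = w)
    (hv : (v / G.logPathDeriv j c t).im < 0) :
    ∃ Ga Gb, Tendsto (fun σ : ℝ => Γ (D0.a j + exp (w + σ * v))) (𝓝[>] 0) (𝓝 Ga) ∧
      Tendsto (fun σ : ℝ => Γ (D0.a j + exp (w + σ * v))) (𝓝[<] 0) (𝓝 Gb) ∧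
      Gb = Ga * G.jump D0 ⟨j, c⟩ t (D0.a j + exp w) := by
  subst hw
  exact hΓ.exists_limits ht (G.path_eq j hc (Ioo_subset_Ico_self ht)) (G.hasDerivAt_path j hc ht) hv

/-- The pullback of a solution is a solution of the local problem. -/
lemma isJumpSolution :
    (G.localData j).IsJumpSolution fun w => Γ (D0.a j + exp w) where
  analytic w hw hc := hΓ.analyticAt_pullback j fun h => hc
    (G.mem_cuts_of_mem_contourSupport j hw h).1
  bounded := hΓ.bounded.imp fun B hB w hw hc => hB _ fun h => hc
    (G.mem_cuts_of_mem_contourSupport j hw h).1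
  det_eq_one w hw hc := hΓ.det_eq_one _ fun h => hc (G.mem_cuts_of_mem_contourSupport j hw h).1
  periodic w := by
    rw [exp_add, exp_two_pi_mul_I, mul_one]
  stokes m h0 hm w hw hwm := by
    have hE := (G.localData j).det_expThat w
    change ∃ Ga Gb, _ ∧ _ ∧ _ = _ * ContourChoice.sheetStokes D0 j m
    rw [ContourChoice.sheetStokes_of_lt j h0 hm, ContourChoice.stokesBase]
    change m < (ContourChoice.sectorCount (n j) : ℕ) at hm
    have hNpos := ContourChoice.sectorCount_pos (n j)
    split_ifs with h
    · have hwm' := (G.line_eq_α j ⟨m.toNat, h⟩ hw).1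
      have hx := G.exp_mem_Ioo j hw
      have hτ := G.τ_pos j
      simp only [Int.toNat_of_nonneg h0] at hwm'
      have ht : 1 - Real.exp w.re / G.τ j ∈ Ioo (0 : ℝ) 1 := by
        constructor
        · have := (div_lt_one hτ).2 hx.2
          linarith
        · have := div_pos hx.1 hτ
          linarith
      have h1 : G.τ j * (1 - (1 - Real.exp w.re / G.τ j)) = Real.exp w.re := by
        field_simp
        ring
      obtain ⟨Ga, Gb, h2, h3, h4⟩ := hΓ.exists_limits_logPath j (c := .stokesLine ⟨m.toNat, h⟩)
        (by simp) ht (w := w) (v := I) (by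
          rw [ContourChoice.logPath, h1, Real.log_exp, ← hwm', ← hwm, re_add_im])
        (ContourChoice.I_div_im_neg (G.logPathDeriv_re_neg j ht (Or.inr (Or.inr ⟨_, rfl⟩))))
      refine ⟨Ga, Gb, h2, h3, ContourChoice.conj_jump hE h4 ?_⟩
      rw [ContourChoice.jump, h1, BirkhoffData.expThat_exp G j]
      rw [← hwm', ← hwm, sub_self, abs_zero]
      exact Real.pi_pos
    · have hn : n j = 0 := by
        by_contra hn
        rw [ContourChoice.sectorCount, if_neg hn] at hm
        omega
      obtain ⟨h1, h2⟩ := hΓ.exists_limits_of_notMem j (G.notMem_of_simple_pole j hn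
        (hw.trans (G.log_τ_lt_log_ρ j))) I
      exact ⟨_, _, h1, h2, by rw [Matrix.mul_one]⟩
  neck w h1 h2 h3 := by
    change Real.log (G.τ j) < _ at h1
    change _ < Real.log (G.ρ j) at h2
    change _ = G.θ j at h3
    change ∃ Ga Gb, _ ∧ _ ∧ _ = _ * ContourChoice.sectorMatrix D0 j 0
    rw [ContourChoice.sectorMatrix_zero]
    rcases Nat.eq_zero_or_pos (n j) with hn | hn
    · obtain ⟨h4, h5⟩ := hΓ.exists_limits_of_notMem j (G.notMem_of_simple_pole j hn h2) I
      exact ⟨_, _, h4, h5, by rw [ContourChoice.stokesProduct_of_simple_pole j hn, Matrix.mul_one]⟩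
    · obtain ⟨t, ht, h4⟩ := ContourChoice.exists_neck_param (G.τ_pos j) (G.ρ_pos j) h1 h2
      obtain ⟨Ga, Gb, h5, h6, h7⟩ := hΓ.exists_limits_logPath j (c := .neck hn) (by simp) ht
        (w := w) (v := I) (by rw [ContourChoice.logPath, h4, ← h3, re_add_im])
        (ContourChoice.I_div_im_neg (G.logPathDeriv_re_neg j ht (Or.inr (Or.inl ⟨_, rfl⟩))))
      refine ⟨Ga, Gb, h5, h6, ContourChoice.conj_jump ((G.localData j).det_expL w) h7 ?_⟩
      rw [ContourChoice.jump, BirkhoffData.powL_exp G j]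
      rw [h3, sub_self, abs_zero]
      exact Real.pi_pos
  stem w h1 h2 h3 := by
    obtain ⟨t, ht, h4⟩ := ContourChoice.exists_neck_param (G.ρ_pos j) (G.R_pos j) h1 h2
    change _ = G.θ j at h3
    exact hΓ.exists_limits_logPath j (c := .innerStem) (by simp) ht
      (by rw [ContourChoice.logPath, h4, ← h3, re_add_im])
      (ContourChoice.I_div_im_neg (G.logPathDeriv_re_neg j ht (Or.inl rfl)))
  toralCircle w h1 h2 h3 := by
    change w.re = Real.log (G.τ j) at h1
    rw [G.expThat_eq]
    rcases Nat.eq_zero_or_pos (n j) with hn | hn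
    · obtain ⟨h4, h5⟩ := hΓ.exists_limits_of_notMem j (G.notMem_of_simple_pole j hn
        (h1.trans_lt (G.log_τ_lt_log_ρ j))) 1
      simp only [mul_one] at h4 h5
      refine ⟨_, _, h5, h4, ?_⟩
      simp [G.toral_of_simple_pole j hn]
    · obtain ⟨t, ht, h4⟩ := ContourChoice.exists_circle_param h1 h2 h3
      obtain ⟨Ga, Gb, h5, h6, h7⟩ := hΓ.exists_limits_logPath j (c := .toralCircle hn) (by simp) ht
        (w := w) (v := 1) h4 ContourChoice.one_div_two_pi_I_im_neg
      simp only [mul_one] at h5 h6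
      refine ⟨Gb, Ga, h6, h5, ?_⟩
      rw [h7, ContourChoice.jump, BirkhoffData.expT, BirkhoffData.toral_exp G j, Matrix.mul_assoc,
        ← Matrix.mul_assoc _ _ ((G.localData j).expL w), Matrix.nonsing_inv_mul, Matrix.one_mul]
      rw [LocalData.det_diagonal_exp _ ((G.localData j).sum_toral w)]
      exact isUnit_one
  formalCircle w h1 h2 h3 := by
    obtain ⟨t, ht, h4⟩ := ContourChoice.exists_circle_param h1 h2 h3
    obtain ⟨Ga, Gb, h5, h6, h7⟩ := hΓ.exists_limits_logPath j (c := .formalCircle) (by simp) ht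
      (w := w) (v := 1) h4 ContourChoice.one_div_two_pi_I_im_neg
    simp only [mul_one] at h5 h6
    refine ⟨Gb, Ga, h6, h5, ?_⟩
    rw [h7, ContourChoice.jump, BirkhoffData.powL_exp G j, Matrix.mul_assoc, Matrix.nonsing_inv_mul,
      Matrix.mul_one]
    · rw [(G.localData j).det_expL]
      exact isUnit_one
    · rw [← h4]
      simp [ContourChoice.localData, Real.pi_pos]

end IsRHSolution


/-- The local inverse of `w ↦ a + exp w` that takes the value `w0` at `a + exp w0`. -/
def localLog (a w0 z : ℂ) : ℂ := w0 + log ((z - a) / exp w0)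

section LocalLog

variable {a w0 z : ℂ}

lemma add_exp_localLog (hz : z ≠ a) : a + exp (localLog a w0 z) = z := by
  rw [localLog, exp_add, exp_log (div_ne_zero (sub_ne_zero.2 hz) (exp_ne_zero _)),
    mul_div_cancel₀ _ (exp_ne_zero _), add_sub_cancel]

lemma localLog_self : localLog a w0 (a + exp w0) = w0 := by
  rw [localLog, add_sub_cancel_left, div_self (exp_ne_zero _), log_one, add_zero]

lemma hasDerivAt_localLog : HasDerivAt (localLog a w0) (exp (-w0)) (a + exp w0) := by
  have h1 : HasDerivAt (fun z : ℂ => (z - a) / exp w0) (1 / exp w0) (a + exp w0) :=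
    ((hasDerivAt_id _).sub_const a).div_const _
  have h2 := (h1.clog (by
    rw [add_sub_cancel_left, div_self (exp_ne_zero _)]; exact one_mem_slitPlane)).const_add w0
  refine h2.congr_deriv ?_
  rw [add_sub_cancel_left, div_self (exp_ne_zero _), div_one, one_div, exp_neg]

lemma tendsto_localLog : Tendsto (localLog a w0) (𝓝 (a + exp w0)) (𝓝 w0) := by
  have := hasDerivAt_localLog.continuousAt (x := a + exp w0) (f := localLog a w0)
  rwa [ContinuousAt, localLog_self] at this

lemma add_exp_ne : a + exp w0 ≠ a := by simp [exp_ne_zero]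

/-- Derivatives in the coordinate `log (z - a)`. -/
lemma hasDerivAt_of_pullback {f F : ℂ → ℂ} (h : ∀ᶠ w in 𝓝 w0, f (a + exp w) = F w) {F' : ℂ}
    (hF : HasDerivAt F F' w0) : HasDerivAt f (exp (-w0) * F') (a + exp w0) := by
  have h1 := HasDerivAt.comp (a + exp w0) (h₂ := F) (h₂' := F')
    (by rwa [localLog_self]) (hasDerivAt_localLog (a := a) (w0 := w0))
  rw [mul_comm]
  refine h1.congr_of_eventuallyEq ?_
  filter_upwards [tendsto_localLog.eventually h, eventually_ne_nhds (add_exp_ne (a := a))]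
    with z hz hne
  rw [Function.comp_apply, ← hz, add_exp_localLog hne]

lemma matDeriv_of_pullback {r : ℕ} {f F : ℂ → Mat r} (h : ∀ᶠ w in 𝓝 w0, f (a + exp w) = F w)
    (hF : ∀ p q, DifferentiableAt ℂ (fun w => F w p q) w0) :
    matDeriv f (a + exp w0) = exp (-w0) • matDeriv F w0 := by
  ext p q
  exact (hasDerivAt_of_pullback (f := fun z => f z p q)
    (h.mono fun w hw => by rw [hw]) (hF p q).hasDerivAt).deriv

end LocalLog

lemma matDeriv_congr {r : ℕ} {F G : ℂ → Mat r} {w : ℂ} (h : F =ᶠ[𝓝 w] G) :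
    matDeriv F w = matDeriv G w := by
  ext p q
  exact Filter.EventuallyEq.deriv_eq (h.mono fun _ hx => congrFun (congrFun hx p) q)

namespace LocalData

variable {r : ℕ} {L : LocalData r}

lemma differentiableAt_expThat (w : ℂ) (p q : Fin r) :
    DifferentiableAt ℂ (fun w => L.expThat w p q) w :=
  differentiableAt_diagonal_apply
    (fun p => ((L.hasDerivAt_That w p).differentiableAt).cexp) p q

lemma matDeriv_expThat (w : ℂ) :
    matDeriv L.expThat w = Matrix.diagonal (L.ThatDeriv w) * L.expThat w := by
  rw [expThat, Matrix.diagonal_mul_diagonal]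
  exact matDeriv_diagonal fun p => by
    simpa only [mul_comm] using (L.hasDerivAt_That w p).cexp

namespace IsGlued

variable {u Ψ : ℂ → Mat r} (hΨ : L.IsGlued u Ψ)

include hΨ

lemma analyticAt_sectorial (m : ℤ) {w : ℂ} (hw : w.re < L.xR) (p q : Fin r) :
    AnalyticAt ℂ (fun w => L.sectorial Ψ m w p q) w :=
  (hΨ.sectorial_differentiableOn m p q).analyticAt
    ((isOpen_re_lt _).mem_nhds hw)

/-- A point on the upper side of a sector, at which `u` is analytic. -/
lemma eventually_eq_sectorial {w : ℂ} (hw : w.re < L.xτ)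
    (hu : ∀ p q, AnalyticAt ℂ (fun w => u w p q) w) :
    u =ᶠ[𝓝 w] L.sectorial Ψ (L.sector w) := by
  set m := L.sector w
  have hR : w.re < L.xR := hw.trans (L.xτ_lt_xρ.trans L.xρ_lt_xR)
  have h : ∀ p q, ∀ᶠ z in 𝓝 w, u z p q = L.sectorial Ψ m z p q := by
    intro p q
    refine ((hu p q).frequently_eq_iff_eventually_eq (hΨ.analyticAt_sectorial m hR p q)).1 ?_
    have ht : Tendsto (fun σ : ℝ => w - σ * I) (𝓝[>] 0) (𝓝[≠] w) := by
      refine tendsto_nhdsWithin_iff.2 ⟨?_, ?_⟩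
      · have : Continuous fun σ : ℝ => w - σ * I := by fun_prop
        simpa using (this.tendsto 0).mono_left nhdsWithin_le_nhds
      · filter_upwards [self_mem_nhdsWithin] with σ hσ h
        have hσ : 0 < σ := hσ
        have := congrArg im h
        simp at this
        exact hσ.ne' this
    refine ht.frequently (Eventually.frequently ?_)
    filter_upwards [self_mem_nhdsWithin, (ht.mono_right nhdsWithin_le_nhds).eventually
      (L.eventually_line_lt (L.line_sector_lt w))] with σ hσ h1
    have hσ : 0 < σ := hσ
    have h2 := L.le_line_sector w
    rw [hΨ.sectorial_eq (by simpa using hw) h1 (by simp; linarith)]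
  have := eventually_all.2 fun p => eventually_all.2 (h p)
  filter_upwards [this] with z hz
  ext p q
  exact hz p q

end IsGlued

end LocalData

namespace IsRHSolution

variable {k r : ℕ} {n : Fin k → ℕ} {D0 : BirkhoffData k r n} {G : ContourChoice D0}
  {Γ : ℂ → Mat r} (hΓ : IsRHSolution G.path (G.jump D0) Γ) (j : Fin k)
  {Ψ : ℂ → Mat r} (hΨ : (G.localData j).IsGlued (fun w => Γ (D0.a j + exp w)) Ψ)
  {Y : FormalMat r} (hY : (G.localData j).IsExpansion Ψ Y)

lemma tendsto_log_atBot (a : ℂ) (U : Set ℂ) :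
    Tendsto (fun z => (log (z - a)).re) (𝓝[U \ {a}] a) atBot := by
  simp only [log_re]
  refine Real.tendsto_log_nhdsGT_zero.comp (tendsto_nhdsWithin_iff.2 ⟨?_, ?_⟩)
  · have : Continuous fun z : ℂ => ‖z - a‖ := by fun_prop
    simpa using (this.tendsto a).mono_left (nhdsWithin_le_nhds (s := U \ {a}))
  · filter_upwards [self_mem_nhdsWithin] with z hz
    exact norm_pos_iff.2 (sub_ne_zero.2 hz.2)

lemma tendsto_sectorFilter (L : LocalData r) (a : ℂ) (U : Set ℂ) :
    Tendsto (fun z => (L.sector (log (z - a)), log (z - a))) (𝓝[U \ {a}] a) L.sectorFilter :=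
  L.tendsto_sectorFilter (tendsto_log_atBot a U) (.of_forall fun _ =>
    ⟨(L.line_sector_lt _).le, L.le_line_sector _⟩)

lemma neBot_nhdsWithin_compl (G : ContourChoice D0) (j : Fin k) :
    (𝓝[(contourSupport G.path)ᶜ \ {D0.a j}] (D0.a j)).NeBot := by
  choose w hw using fun N : ℕ => Metric.dense_iff.1 (G.localData j).dense_compl_cuts (-(N : ℂ)) 1
    one_pos
  have hre : ∀ N, (w N).re < -N + 1 := fun N => by
    have h := (hw N).1
    rw [Metric.mem_ball, Complex.dist_eq] at h
    have := (re_le_norm _).trans_lt h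
    simp at this
    linarith
  have ht : Tendsto (fun N => (w N).re) atTop atBot := by
    refine tendsto_atBot_mono (fun N => (hre N).le) ?_
    exact tendsto_atBot_add_const_right _ _
      (tendsto_neg_atTop_atBot.comp tendsto_natCast_atTop_atTop)
  have h : Tendsto (fun N => D0.a j + exp (w N)) atTop
      (𝓝[(contourSupport G.path)ᶜ \ {D0.a j}] (D0.a j)) := by
    refine tendsto_nhdsWithin_iff.2 ⟨?_, ?_⟩
    · have : Tendsto (fun N => exp (w N)) atTop (𝓝 0) := by
        rw [tendsto_zero_iff_norm_tendsto_zero]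
        simp only [norm_exp]
        exact Real.tendsto_exp_atBot.comp ht
      simpa using this.const_add (D0.a j)
    · filter_upwards [ht.eventually (eventually_lt_atBot (Real.log (G.R j)))] with N hN
      exact ⟨fun h => (hw N).2 (G.mem_cuts_of_mem_contourSupport j hN h).1, add_exp_ne⟩
  exact h.neBot

include hΓ hΨ

lemma eventually_eq_sectorial : ∀ᶠ z in 𝓝[(contourSupport G.path)ᶜ \ {D0.a j}] (D0.a j),
    D0.a j + exp (log (z - D0.a j)) = z ∧ (log (z - D0.a j)).re < (G.localData j).xR ∧
    (fun w => Γ (D0.a j + exp w)) =ᶠ[𝓝 (log (z - D0.a j))]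
      (G.localData j).sectorial Ψ ((G.localData j).sector (log (z - D0.a j))) := by
  filter_upwards [self_mem_nhdsWithin, (tendsto_log_atBot (D0.a j) _).eventually
    (eventually_lt_atBot (G.localData j).xτ)] with z hz hre
  have h : D0.a j + exp (log (z - D0.a j)) = z := by
    rw [exp_log (sub_ne_zero.2 hz.2), add_sub_cancel]
  refine ⟨h, hre.trans ((G.localData j).xτ_lt_xρ.trans (G.localData j).xρ_lt_xR),
    hΨ.eventually_eq_sectorial hre fun p q => hΓ.analyticAt_pullback j (h.symm ▸ hz.1) p q⟩

include hY

lemma hasExpansion : HasExpansion Γ (D0.a j) (contourSupport G.path)ᶜ Y := by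
  intro N p q
  have h := (hY.asymp p q N).comp_tendsto
    (tendsto_sectorFilter (G.localData j) (D0.a j) (contourSupport G.path)ᶜ)
  have h1 := hΓ.eventually_eq_sectorial j hΨ
  refine h.congr' ?_ ?_
  · filter_upwards [h1] with z hz
    have h2 := hz.2.2.self_of_nhds
    simp only [hz.1] at h2
    simp only [Function.comp_apply]
    rw [← h2, show exp (log (z - D0.a j)) = z - D0.a j by rw [eq_sub_iff_add_eq', hz.1]]
  · filter_upwards [h1] with z hz
    simp only [Function.comp_apply]
    rw [show exp (log (z - D0.a j)) = z - D0.a j by rw [eq_sub_iff_add_eq', hz.1]]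

omit hΓ hΨ hY in
lemma asymp_scaledThatDeriv (p : Fin r) : Asymp (G.localData j).sectorFilter (fun x => exp x.2)
    (fun x => exp x.2 ^ n j * (G.localData j).ThatDeriv x.2 p) (D0.scaledThatDeriv j p) := by
  set L := G.localData j
  have hζ := L.tendsto_exp_sectorFilter_zero
  have h1 : ∀ l : Fin (n j), Asymp L.sectorFilter (fun x => exp x.2)
      (fun x => (((l : ℕ) + 1) * D0.T j l p) * exp x.2 ^ (n j - ((l : ℕ) + 1)))
      (PowerSeries.C (((l : ℕ) + 1) * D0.T j l p) * PowerSeries.X ^ (n j - ((l : ℕ) + 1))) :=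
    fun l => (Asymp.const hζ _).mul hζ ((Asymp.zeta hζ).pow hζ _)
  have h2 := (((Asymp.const hζ (D0.L j p)).mul hζ ((Asymp.zeta hζ).pow hζ (n j))).sub
    (Asymp.sum hζ Finset.univ fun l _ => h1 l))
  refine h2.congr' (.of_forall fun x => ?_)
  change D0.L j p * exp x.2 ^ n j -
      ∑ l : Fin (n j), (((l : ℕ) + 1) * D0.T j l p) * exp x.2 ^ (n j - ((l : ℕ) + 1)) =
    exp x.2 ^ n j * (∑ l : Fin (n j), D0.T j l p *
      (-(((l : ℕ) + 1 : ℕ) : ℂ) * exp (-(((l : ℕ) + 1 : ℕ) * x.2))) + D0.L j p)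
  rw [mul_add, Finset.mul_sum, add_comm, mul_comm (D0.L j p), sub_eq_add_neg,
    ← Finset.sum_neg_distrib]
  congr 1
  refine Finset.sum_congr rfl fun l _ => ?_
  rw [exp_neg, exp_nat_mul, pow_sub₀ _ (exp_ne_zero _) (by have := l.2; omega)]
  push_cast
  ring

lemma isFormalSolution :
    D0.IsFormalSolution (D0.connectionNear Γ j) (contourSupport G.path)ᶜ j Y := by
  set L := G.localData j
  have hdet := hY.det_eq_one hΨ
  have hE : (PowerSeries.X ^ n j : PowerSeries ℂ) • formalEuler Y =
      (PowerSeries.X ^ (n j + 1) : PowerSeries ℂ) • Y.map (derivative ℂ) := by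
    ext1 p q
    simp only [formalEuler, Matrix.smul_apply, Matrix.of_apply, Matrix.map_apply, smul_eq_mul,
      pow_succ, mul_assoc]
  refine ⟨?_, ((PowerSeries.X ^ n j : PowerSeries ℂ) • formalEuler Y +
    Y * Matrix.diagonal (D0.scaledThatDeriv j)) * Y.adjugate, ?_, ?_⟩
  · rw [show (Y.map constantCoeff).det = constantCoeff Y.det from
      (RingHom.map_det _ _).symm, hdet, map_one]
    exact isUnit_one
  · have hζ := L.tendsto_exp_sectorFilter_zero
    have h1 : ∀ p q, Asymp L.sectorFilter (fun x => exp x.2)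
        (fun x => (exp x.2 ^ n j • matDeriv (L.sectorial Ψ x.1) x.2 + L.sectorial Ψ x.1 x.2 *
          Matrix.diagonal fun p => exp x.2 ^ n j * L.ThatDeriv x.2 p) p q)
        (((PowerSeries.X ^ n j : PowerSeries ℂ) • formalEuler Y +
          Y * Matrix.diagonal (D0.scaledThatDeriv j)) p q) := fun p q => by
      simp only [Matrix.add_apply, Matrix.smul_apply, Matrix.mul_diagonal, smul_eq_mul]
      exact (((Asymp.zeta hζ).pow hζ _).mul hζ (hY.asymp_deriv p q)).add
        ((hY.asymp p q).mul hζ (asymp_scaledThatDeriv j q))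
    intro N p q
    have h2 := (Asymp.matMul hζ h1 (fun p q => Asymp.adjugate hζ hY.asymp p q) p q N).comp_tendsto
      (tendsto_sectorFilter L (D0.a j) (contourSupport G.path)ᶜ)
    have h3 := hΓ.eventually_eq_sectorial j hΨ
    refine h2.congr' ?_ ?_
    · filter_upwards [h3] with z ⟨hz, hR, hu⟩
      simp only [Function.comp_apply]
      set w := log (z - D0.a j) with hw
      set m := L.sector w
      have hexp : exp w = z - D0.a j := by rw [eq_sub_iff_add_eq', hz]
      rw [hexp]
      congr 2
      have him : ∀ᶠ w' in 𝓝 w, |w'.im - (z - D0.a j).arg| < π := by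
        have hc : Continuous fun w' : ℂ => |w'.im - (z - D0.a j).arg| := by fun_prop
        exact hc.continuousAt.eventually_lt continuousAt_const
          (by rw [hw, log_im, sub_self, abs_zero]; exact Real.pi_pos)
      have h4 : ∀ᶠ w' in 𝓝 w, (fun z' => Γ z' * D0.expThat j (z - D0.a j).arg z')
          (D0.a j + exp w') = L.sectorial Ψ m w' * L.expThat w' := by
        filter_upwards [him, hu] with w' h5 h6
        rw [BirkhoffData.expThat_exp G j h5, h6]
      have hX : ∀ p q, DifferentiableAt ℂ (fun w => L.sectorial Ψ m w p q) w := fun p q =>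
        (hΨ.analyticAt_sectorial m hR p q).differentiableAt
      have hE' := fun p q => L.differentiableAt_expThat w p q
      have h7 := matDeriv_of_pullback
        (f := fun z' => Γ z' * D0.expThat j (z - D0.a j).arg z') h4 (differentiableAt_mul_apply hX hE')
      have h8 := h4.self_of_nhds
      simp only [hz] at h7 h8
      rw [BirkhoffData.connectionNear, h7, h8, matDeriv_mul hX hE', L.matDeriv_expThat,
        Matrix.mul_inv_rev, ← adjugate_eq_inv (hΨ.det_sectorial m hR)]
      have hEE : L.expThat w * (L.expThat w)⁻¹ = 1 :=
        Matrix.mul_nonsing_inv _ (by rw [L.det_expThat]; exact isUnit_one)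
      rw [Matrix.smul_mul, ← Matrix.mul_assoc,
        ← Matrix.mul_assoc (L.sectorial Ψ m w), ← Matrix.add_mul,
        Matrix.mul_assoc _ (L.expThat w), hEE, Matrix.mul_one, smul_smul, exp_neg, hexp, pow_succ,
        mul_assoc, mul_inv_cancel₀ (hexp ▸ exp_ne_zero _), mul_one, ← Matrix.smul_mul, smul_add,
        show (Matrix.diagonal fun p => (z - D0.a j) ^ n j * L.ThatDeriv w p) =
          (z - D0.a j) ^ n j • Matrix.diagonal (L.ThatDeriv w) by
          rw [← Matrix.diagonal_smul]; rfl, Matrix.mul_smul]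
    · filter_upwards [h3] with z hz
      simp only [Function.comp_apply]
      rw [show exp (log (z - D0.a j)) = z - D0.a j by rw [eq_sub_iff_add_eq', hz.1]]
  · rw [Matrix.mul_assoc, Matrix.adjugate_mul, hdet, one_smul, Matrix.mul_one, hE]

end IsRHSolution


/-! ### Boundary values -/

lemma neBot_rightCone {γ : ℝ → ℂ} {t : ℝ} (hd : deriv γ t ≠ 0) :
    (𝓝[rightCone γ t (1 / 2)] (γ t)).NeBot := by
  have h : Tendsto (fun ε : ℝ => γ t - ε * (I * deriv γ t)) (𝓝[>] 0)
      (𝓝[rightCone γ t (1 / 2)] (γ t)) := by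
    refine tendsto_nhdsWithin_iff.2 ⟨?_, ?_⟩
    · have : Continuous fun ε : ℝ => γ t - ε * (I * deriv γ t) := by fun_prop
      simpa using (this.tendsto 0).mono_left nhdsWithin_le_nhds
    · filter_upwards [self_mem_nhdsWithin] with ε hε
      have hε : 0 < ε := hε
      have h1 : (γ t - ε * (I * deriv γ t) - γ t) / deriv γ t = ((-ε : ℝ) : ℂ) * I := by
        field_simp
        push_cast
        ring
      rw [rightCone, mem_ofPred_eq, h1, norm_mul, norm_I, norm_real, Real.norm_eq_abs, abs_neg,
        abs_of_pos hε, im_ofReal_mul, I_im]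
      linarith
  exact h.neBot

lemma HasMinusValue.minusValue_eq {r : ℕ} {F : ℂ → Mat r} {γ : ℝ → ℂ} {t : ℝ} {l : Mat r}
    (h : HasMinusValue F γ t l) (hd : deriv γ t ≠ 0) : minusValue F γ t = l :=
  haveI := neBot_rightCone hd
  (h (1 / 2) (by norm_num)).limUnder_eq

/-- Points of the right cones lie on the side `0 < h`, in the coordinate `log (z - a)`. -/
lemma eventually_pos_rightCone {γ : ℝ → ℂ} {t : ℝ} {a w ω : ℂ} (hw : γ t = a + exp w)
    (hd : HasDerivAt γ (exp w * ω) t) (hω : ω ≠ 0) {h : ℂ → ℝ} {h' : ℂ →L[ℝ] ℝ} (h0 : h w = 0)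
    (hh : HasFDerivAt h h' w) {c : ℝ} (hc : 0 < c) (hh' : ∀ ξ, h' (ω * ξ) = -(c * ξ.im)) {κ : ℝ}
    (hκ : 0 < κ) : ∀ᶠ z in 𝓝[rightCone γ t κ] (γ t), 0 < h (localLog a w z) := by
  have h1 : HasFDerivAt (fun z => h (localLog a w z))
      (h'.comp ((ContinuousLinearMap.toSpanSingleton ℂ (exp (-w))).restrictScalars ℝ)) (γ t) := by
    rw [hw]
    exact HasFDerivAt.comp (g := h) (g' := h') _ (by rwa [localLog_self])
      ((hasDerivAt_localLog (a := a) (w0 := w)).hasFDerivAt.restrictScalars ℝ)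
  have hne : exp w * ω ≠ 0 := mul_ne_zero (exp_ne_zero w) hω
  have hn := norm_pos_iff.2 hne
  have h2 := (hasFDerivAt_iff_isLittleO.1 h1).bound (c := c * κ / ‖exp w * ω‖) (by positivity)
  filter_upwards [h2.filter_mono nhdsWithin_le_nhds, self_mem_nhdsWithin] with z hz hcone
  have hcone : κ * ‖(z - γ t) / deriv γ t‖ < -((z - γ t) / deriv γ t).im := hcone
  rw [hd.deriv] at hcone
  rw [show c * κ / ‖exp w * ω‖ * ‖z - γ t‖ = c * κ * ‖(z - γ t) / (exp w * ω)‖ by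
    rw [norm_div]; ring] at hz
  set ξ := (z - γ t) / (exp w * ω)
  have h3 : z - γ t = exp w * ω * ξ := (mul_div_cancel₀ _ hne).symm
  have h4 : h' ((z - γ t) * exp (-w)) = -(c * ξ.im) := by
    rw [← hh', h3, exp_neg]
    congr 1
    field_simp [exp_ne_zero]
  have h5 : h (localLog a w (γ t)) = 0 := by rw [hw, localLog_self, h0]
  simp only [h5, sub_zero, ContinuousLinearMap.comp_apply,
    ContinuousLinearMap.coe_restrictScalars', ContinuousLinearMap.toSpanSingleton_apply,
    smul_eq_mul, h4] at hz
  rw [Real.norm_eq_abs, abs_le] at hz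
  nlinarith [hz.1]

/-- Boundary values of a function that extends analytically from the right side. -/
lemma hasMinusValue_of_side {r : ℕ} {Γ f : ℂ → Mat r} {γ : ℝ → ℂ} {t : ℝ} {a w ω : ℂ}
    (hw : γ t = a + exp w)
    (hd : HasDerivAt γ (exp w * ω) t) (hω : ω ≠ 0) {h : ℂ → ℝ} {h' : ℂ →L[ℝ] ℝ} (h0 : h w = 0)
    (hh : HasFDerivAt h h' w) {c : ℝ} (hc : 0 < c) (hh' : ∀ ξ, h' (ω * ξ) = -(c * ξ.im))
    (hf : ∀ p q, AnalyticAt ℂ (fun w => f w p q) w)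
    (hside : ∀ᶠ v in 𝓝 w, 0 < h v → (fun v => Γ (a + exp v)) =ᶠ[𝓝 v] f) :
    HasMinusValue Γ γ t (f w) ∧ HasMinusValue (matDeriv Γ) γ t (exp (-w) • matDeriv f w) := by
  have hlog : Tendsto (localLog a w) (𝓝 (γ t)) (𝓝 w) := hw ▸ tendsto_localLog
  have hne : ∀ᶠ z in 𝓝 (γ t), z ≠ a := eventually_ne_nhds (hw ▸ add_exp_ne)
  have key : ∀ κ ∈ Ioo (0 : ℝ) 1, ∀ᶠ z in 𝓝[rightCone γ t κ] (γ t),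
      z ≠ a ∧ (fun v => Γ (a + exp v)) =ᶠ[𝓝 (localLog a w z)] f := by
    intro κ hκ
    filter_upwards [eventually_pos_rightCone hw hd hω h0 hh hc hh' hκ.1,
      (hlog.eventually hside).filter_mono nhdsWithin_le_nhds,
      hne.filter_mono nhdsWithin_le_nhds] with z h1 h2 h3 using ⟨h3, h2 h1⟩
  have hcf : Tendsto f (𝓝 w) (𝓝 (f w)) :=
    tendsto_pi_nhds.2 fun p => tendsto_pi_nhds.2 fun q => (hf p q).continuousAt
  have hcd : Tendsto (fun v => exp (-v) • matDeriv f v) (𝓝 w) (𝓝 (exp (-w) • matDeriv f w)) := by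
    refine Tendsto.smul (by fun_prop : Continuous fun v : ℂ => exp (-v)).continuousAt ?_
    exact tendsto_pi_nhds.2 fun p => tendsto_pi_nhds.2 fun q => (hf p q).deriv.continuousAt
  have hdiff : ∀ᶠ v in 𝓝 w, ∀ p q, DifferentiableAt ℂ (fun w => f w p q) v :=
    eventually_all.2 fun p => eventually_all.2 fun q =>
      (hf p q).eventually_analyticAt.mono fun v hv => hv.differentiableAt
  refine ⟨fun κ hκ => ?_, fun κ hκ => ?_⟩
  · refine ((hcf.comp hlog).mono_left nhdsWithin_le_nhds).congr' ?_
    filter_upwards [key κ hκ] with z hz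
    rw [Function.comp_apply, ← hz.2.self_of_nhds]
    simp only
    rw [add_exp_localLog hz.1]
  · refine ((hcd.comp hlog).mono_left nhdsWithin_le_nhds).congr' ?_
    filter_upwards [key κ hκ, (hlog.eventually hdiff).filter_mono nhdsWithin_le_nhds]
      with z hz hz'
    rw [Function.comp_apply, ← matDeriv_of_pullback hz.2 hz', add_exp_localLog hz.1]

/-! ### Logarithmic variations of jump matrices -/

section Variation

variable {r : ℕ} {d : ℂ → Fin r → ℂ} {d' : Fin r → ℂ} {s : ℂ}

/-- The diagonal matrix with entries `exp (d p)`. -/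
def expDiag (d : Fin r → ℂ) : Mat r := Matrix.diagonal fun p => exp (d p)

lemma expDiag_inv (d : Fin r → ℂ) : (expDiag d)⁻¹ = Matrix.diagonal fun p => exp (-d p) :=
  Matrix.inv_eq_left_inv (by simp [expDiag, ← exp_add])

lemma expDiag_inv_mul (d : Fin r → ℂ) : (expDiag d)⁻¹ * expDiag d = 1 := by
  rw [expDiag_inv]; simp [expDiag, ← exp_add]

lemma expDiag_mul_inv (d : Fin r → ℂ) : expDiag d * (expDiag d)⁻¹ = 1 := by
  rw [expDiag_inv]; simp [expDiag, ← exp_add]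

lemma isUnit_det_expDiag (d : Fin r → ℂ) : IsUnit (expDiag d).det := by
  rw [expDiag, Matrix.det_diagonal, ← exp_sum]
  exact (exp_ne_zero _).isUnit

lemma matDeriv_expDiag (hd : ∀ p, HasDerivAt (fun s => d s p) (d' p) s) :
    matDeriv (fun s => expDiag (d s)) s = Matrix.diagonal d' * expDiag (d s) := by
  rw [expDiag, Matrix.diagonal_mul_diagonal]
  exact matDeriv_diagonal fun p => by simpa only [mul_comm] using (hd p).cexp

lemma matDeriv_expDiag_inv (hd : ∀ p, HasDerivAt (fun s => d s p) (d' p) s) :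
    matDeriv (fun s => (expDiag (d s))⁻¹) s = -((expDiag (d s))⁻¹ * Matrix.diagonal d') := by
  simp only [expDiag_inv, Matrix.diagonal_mul_diagonal, Matrix.diagonal_neg]
  exact matDeriv_diagonal fun p => by
    have := (hd p).fun_neg.cexp
    rwa [mul_neg] at this

lemma differentiableAt_expDiag (hd : ∀ p, HasDerivAt (fun s => d s p) (d' p) s) (p q : Fin r) :
    DifferentiableAt ℂ (fun s => expDiag (d s) p q) s :=
  differentiableAt_diagonal_apply (fun p => (hd p).differentiableAt.cexp) p q

lemma differentiableAt_expDiag_inv (hd : ∀ p, HasDerivAt (fun s => d s p) (d' p) s)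
    (p q : Fin r) : DifferentiableAt ℂ (fun s => (expDiag (d s))⁻¹ p q) s := by
  simp only [expDiag_inv]
  exact differentiableAt_diagonal_apply (fun p => (hd p).fun_neg.differentiableAt.cexp) p q

lemma matDeriv_expDiag_inv_mul_inv (hd : ∀ p, HasDerivAt (fun s => d s p) (d' p) s) :
    matDeriv (fun s => (expDiag (d s))⁻¹) s * ((expDiag (d s))⁻¹)⁻¹ = -Matrix.diagonal d' := by
  rw [matDeriv_expDiag_inv hd, Matrix.nonsing_inv_nonsing_inv _ (isUnit_det_expDiag _),
    Matrix.neg_mul, expDiag_inv, expDiag, Matrix.diagonal_mul_diagonal,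
    Matrix.diagonal_mul_diagonal]
  congr 2
  funext p
  rw [mul_right_comm, ← exp_add, neg_add_cancel, exp_zero, one_mul]

lemma matDeriv_conj_mul_inv (hd : ∀ p, HasDerivAt (fun s => d s p) (d' p) s) {S : Mat r}
    (hS : S.det = 1) :
    matDeriv (fun s => expDiag (d s) * S * (expDiag (d s))⁻¹) s *
        (expDiag (d s) * S * (expDiag (d s))⁻¹)⁻¹ =
      Matrix.diagonal d' - expDiag (d s) * S * (expDiag (d s))⁻¹ * Matrix.diagonal d' *
        (expDiag (d s) * S * (expDiag (d s))⁻¹)⁻¹ := by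
  have h1 := differentiableAt_expDiag hd
  have hu := isUnit_det_expDiag (d s)
  have hdet : IsUnit (expDiag (d s) * S * (expDiag (d s))⁻¹).det := by
    rw [Matrix.det_mul, Matrix.det_mul, hS, Matrix.det_nonsing_inv, mul_one]
    exact hu.mul hu.ringInverse
  have h2 : matDeriv (fun s => expDiag (d s) * S * (expDiag (d s))⁻¹) s =
      Matrix.diagonal d' * (expDiag (d s) * S * (expDiag (d s))⁻¹) -
        expDiag (d s) * S * (expDiag (d s))⁻¹ * Matrix.diagonal d' := by
    rw [matDeriv_mul (differentiableAt_mul_apply (B := fun _ => S) h1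
      fun p q => differentiableAt_const _) (differentiableAt_expDiag_inv hd),
      matDeriv_mul_const h1, matDeriv_expDiag hd, matDeriv_expDiag_inv hd]
    simp only [Matrix.mul_assoc, Matrix.mul_neg, sub_eq_add_neg]
  rw [h2, Matrix.sub_mul, Matrix.mul_assoc (Matrix.diagonal d'), Matrix.mul_nonsing_inv _ hdet,
    Matrix.mul_one]

end Variation


namespace LocalData

variable {r : ℕ} {L : LocalData r} {u Ψ : ℂ → Mat r}

/-- The exponents of `e^{L w}`. -/
def levelExponent (L : LocalData r) (w : ℂ) (p : Fin r) : ℂ := L.L p * w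

lemma hasDerivAt_levelExponent (w : ℂ) (p : Fin r) :
    HasDerivAt (fun w => L.levelExponent w p) (L.L p) w := by
  simpa [levelExponent] using (hasDerivAt_id w).const_mul (L.L p)

namespace IsGlued

variable (hΨ : L.IsGlued u Ψ)

include hΨ

lemma glue_eq {w : ℂ} (h1 : L.xτ < w.re) (h2 : w.re < L.xR) (h3 : w.re ≠ L.xρ)
    (h4 : L.θ < w.im) (h5 : w.im < L.θ + 2 * π) :
    Ψ w = u w * Matrix.diagonal (fun p => exp (L.gaugeExponent w p)) ∧ L.sector w = L.N := by
  have h6 : L.line (L.N - 1) w.re < w.im := by rwa [L.line_last_of_ge h1.le]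
  have h7 : w.im < L.line L.N w.re := by rwa [L.line_N_of_ge h1.le]
  have hs := L.sector_eq h6 h7.le
  refine ⟨?_, hs⟩
  rw [hΨ.eq_glue w h2, glue, hs, L.R_period, inv_one, Matrix.mul_one]
  rintro (⟨m, hm⟩ | h | h)
  · exact L.im_ne_line h6 h7 m hm
  · exact h1.ne' h
  · exact h3 h

/-- Outside the formal monodromy circle. -/
lemma eventually_eq_outer {w : ℂ} (h1 : L.xρ < w.re) (h2 : w.re < L.xR) (h4 : L.θ < w.im)
    (h5 : w.im < L.θ + 2 * π) : u =ᶠ[𝓝 w] Ψ := by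
  filter_upwards [(continuous_re.tendsto w).eventually (lt_mem_nhds h1),
    (continuous_re.tendsto w).eventually (gt_mem_nhds h2),
    (continuous_im.tendsto w).eventually (lt_mem_nhds h4),
    (continuous_im.tendsto w).eventually (gt_mem_nhds h5)] with v h6 h7 h8 h9
  obtain ⟨h10, h11⟩ := hΨ.glue_eq (L.xτ_lt_xρ.trans h6) h7 h6.ne' h8 h9
  have hN : (L.N : ℤ) ≠ 0 := by exact_mod_cast L.N_pos.ne'
  rw [h10]
  simp only [L.gaugeExponent_of_gt h6.le, h11, Int.ediv_self hN]
  simp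

/-- Between the formal monodromy circle and the toral circle. -/
lemma eventually_eq_mid {w : ℂ} (h1 : L.xτ < w.re) (h2 : w.re < L.xρ) (h4 : L.θ < w.im)
    (h5 : w.im < L.θ + 2 * π) :
    u =ᶠ[𝓝 w] fun w => Ψ w * (expDiag (L.levelExponent w))⁻¹ := by
  filter_upwards [(continuous_re.tendsto w).eventually (lt_mem_nhds h1),
    (continuous_re.tendsto w).eventually (gt_mem_nhds h2),
    (continuous_im.tendsto w).eventually (lt_mem_nhds h4),
    (continuous_im.tendsto w).eventually (gt_mem_nhds h5)] with v h6 h7 h8 h9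
  rw [(hΨ.glue_eq h6 (h7.trans L.xρ_lt_xR) h7.ne h8 h9).1]
  simp only [L.gaugeExponent_of_mid h6.le h7]
  rw [Matrix.mul_assoc, show (Matrix.diagonal fun p => exp (L.L p * v)) =
    expDiag (L.levelExponent v) from rfl, expDiag_mul_inv, Matrix.mul_one]

/-- In a sector. -/
lemma eventually_eq_sector {w : ℂ} {m : ℤ} (h1 : w.re < L.xτ) (h2 : L.line m w.re < w.im)
    (h3 : w.im < L.line (m + 1) w.re) : u =ᶠ[𝓝 w] L.sectorial Ψ (m + 1) := by
  filter_upwards [(continuous_re.tendsto w).eventually (gt_mem_nhds h1), L.eventually_line_lt h2,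
    L.eventually_lt_line h3] with v h4 h5 h6
  exact (hΨ.sectorial_eq h4 (by rwa [add_sub_cancel_right]) h6).symm

lemma analyticAt {w : ℂ} (hw : w.re < L.xR) (p q : Fin r) :
    AnalyticAt ℂ (fun w => Ψ w p q) w :=
  (hΨ.differentiableOn p q).analyticAt ((isOpen_re_lt _).mem_nhds hw)

lemma analyticAt_mid {w : ℂ} (hw : w.re < L.xR) (p q : Fin r) :
    AnalyticAt ℂ (fun w => (Ψ w * (expDiag (L.levelExponent w))⁻¹) p q) w := by
  simp only [expDiag_inv, Matrix.mul_diagonal, levelExponent]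
  exact (hΨ.analyticAt hw p q).mul (by fun_prop)

lemma inv_mul_matDeriv_mid {w : ℂ} (hw : w.re < L.xR) :
    (Ψ w * (expDiag (L.levelExponent w))⁻¹)⁻¹ *
      matDeriv (fun w => Ψ w * (expDiag (L.levelExponent w))⁻¹) w =
    expDiag (L.levelExponent w) * logDeriv Ψ w * (expDiag (L.levelExponent w))⁻¹ -
      Matrix.diagonal L.L := by
  have hd := fun p => L.hasDerivAt_levelExponent w p
  have hu := isUnit_det_expDiag (L.levelExponent w)
  have hΨu : IsUnit (Ψ w).det := by rw [hΨ.det_eq_one w hw]; exact isUnit_one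
  rw [matDeriv_mul (hΨ.differentiableAt hw) (differentiableAt_expDiag_inv hd),
    matDeriv_expDiag_inv hd, Matrix.mul_inv_rev, Matrix.nonsing_inv_nonsing_inv _ hu, logDeriv,
    adjugate_eq_inv (hΨ.det_eq_one w hw), Matrix.mul_add]
  have h1 : expDiag (L.levelExponent w) * (Ψ w)⁻¹ *
      (Ψ w * -((expDiag (L.levelExponent w))⁻¹ * Matrix.diagonal L.L)) = -Matrix.diagonal L.L := by
    rw [Matrix.mul_assoc, ← Matrix.mul_assoc _ (Ψ w), Matrix.nonsing_inv_mul _ hΨu, Matrix.one_mul,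
      Matrix.mul_neg, ← Matrix.mul_assoc, expDiag_mul_inv, Matrix.one_mul]
  rw [h1, sub_eq_add_neg]
  simp only [Matrix.mul_assoc]

end IsGlued

end LocalData

/-! ### Variations of the jump matrices -/

section TimeVariation

variable {k r : ℕ} {n : Fin k → ℕ} (D : ℂ → BirkhoffData k r n) (s0 : ℂ) (j : Fin k)

/-- The pole orders of the terms of `∂T̂`. -/
def timeExponent {m : ℕ} : Fin m ⊕ Fin m ⊕ Unit → ℕ
  | .inl l => l + 1
  | .inr (.inl l) => l + 2
  | .inr (.inr _) => 1

/-- The coefficients of the terms of `∂T̂`. -/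
def timeCoeff : Fin (n j) ⊕ Fin (n j) ⊕ Unit → Fin r → ℂ
  | .inl l, p => deriv (fun s => (D s).T j l p) s0
  | .inr (.inl l), p => ((l : ℕ) + 1) * (D s0).T j l p * deriv (fun s => (D s).a j) s0
  | .inr (.inr _), p => -((D s0).L j p * deriv (fun s => (D s).a j) s0)

/-- The variation of `L log (z - a)`, in the coordinate `w = log (z - a)`. -/
def levelVariation (w : ℂ) (p : Fin r) : ℂ :=
  -((D s0).L j p * deriv (fun s => (D s).a j) s0) * exp (-w)

/-- The variation of `T`, in the coordinate `w = log (z - a)`. -/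
def toralVariation (w : ℂ) (p : Fin r) : ℂ :=
  ∑ l : Fin (n j), (deriv (fun s => (D s).T j l p) s0 * exp (-(((l : ℕ) + 1 : ℕ) * w)) +
    ((l : ℕ) + 1) * (D s0).T j l p * deriv (fun s => (D s).a j) s0 *
      exp (-(((l : ℕ) + 2 : ℕ) * w)))

lemma one_le_timeExponent {m : ℕ} (i : Fin m ⊕ Fin m ⊕ Unit) : 1 ≤ timeExponent i := by
  rcases i with l | l | l <;> simp [timeExponent]

lemma laurent_time (w : ℂ) (p : Fin r) : laurent timeExponent (timeCoeff D s0 j) w p =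
    levelVariation D s0 j w p + toralVariation D s0 j w p := by
  simp only [laurent, Fintype.sum_sum_type, timeCoeff, timeExponent, levelVariation,
    toralVariation, Finset.sum_add_distrib, Finset.univ_unique, Finset.sum_singleton,
    Nat.cast_one, one_mul]
  ring

lemma thatVariation_eq (p : Fin r) : thatVariation D s0 j p =
    ∑ i, HahnSeries.single (-(timeExponent i : ℤ)) (timeCoeff D s0 j i p) := by
  simp only [thatVariation, Fintype.sum_sum_type, timeCoeff, timeExponent,
    Finset.sum_add_distrib, Finset.univ_unique, Finset.sum_singleton, Nat.cast_add, Nat.cast_one,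
    Nat.cast_ofNat]
  rw [sub_eq_add_neg, ← HahnSeries.single_neg, add_assoc]

variable {D s0} (hD : IsIsomonodromicAt D s0)

include hD

lemma hasDerivAt_logBranch_variation {η : ℝ} {w : ℂ} (h : |w.im - η| < π) (p : Fin r) :
    HasDerivAt (fun s => (D s0).L j p * logBranch η ((D s0).a j + exp w - (D s).a j))
      (levelVariation D s0 j w p) s0 := by
  have ha := (hD.a_differentiable j).self_of_nhds.hasDerivAt
  have h1 : HasDerivAt (fun s => ((D s0).a j + exp w - (D s).a j) * exp (-(η * I)))
      (-deriv (fun s => (D s).a j) s0 * exp (-(η * I))) s0 := (ha.const_sub _).mul_const _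
  have h2 : ((D s0).a j + exp w - (D s0).a j) * exp (-(η * I)) = exp (w - η * I) := by
    rw [add_sub_cancel_left, ← exp_add, sub_eq_add_neg]
  have h3 := ((h1.clog (by
    rw [h2]
    rw [abs_lt] at h
    exact (mem_slitPlane_iff_arg.2 ⟨by
      rw [← log_im, Complex.log_exp (by simp; linarith) (by simp; linarith)]
      simp
      linarith, exp_ne_zero _⟩))).add_const (η * I)).const_mul ((D s0).L j p)
  refine h3.congr_deriv ?_
  rw [h2, levelVariation, sub_eq_add_neg, exp_add, exp_neg w]
  field_simp [exp_ne_zero]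

lemma hasDerivAt_toral_variation (w : ℂ) (p : Fin r) :
    HasDerivAt (fun s => (D s).toral j ((D s0).a j + exp w) p) (toralVariation D s0 j w p) s0 := by
  have ha := (hD.a_differentiable j).self_of_nhds.hasDerivAt
  refine HasDerivAt.fun_sum fun l _ => ?_
  have hT := (hD.T_differentiable j l p).self_of_nhds.hasDerivAt
  have hne : (D s0).a j + exp w - (D s0).a j ≠ 0 := by simp [exp_ne_zero]
  have h1 := hT.div ((ha.const_sub ((D s0).a j + exp w)).pow ((l : ℕ) + 1)) (pow_ne_zero _ hne)
  refine h1.congr_deriv ?_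
  simp only [Pi.pow_apply, add_sub_cancel_left, exp_neg, exp_nat_mul, Nat.add_sub_cancel]
  have := exp_ne_zero w
  field_simp
  push_cast
  ring

end TimeVariation


lemma LocalData.density_succ_sub {r : ℕ} {L : LocalData r} (Ψ : ℂ → Mat r)
    (θ : ℂ → Fin r → ℂ) (m : ℤ) (w : ℂ) : L.density Ψ θ (m + 1) w - L.density Ψ θ m w =
      ((L.R (m + 1))⁻¹ * logDeriv Ψ w * L.R (m + 1) * (Matrix.diagonal (θ w) -
        L.S m * Matrix.diagonal (θ w) * (L.S m)⁻¹)).trace := by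
  rw [density, density, L.R_succ m, Matrix.mul_inv_rev, Matrix.mul_sub, Matrix.trace_sub,
    sub_right_inj]
  simp only [← Matrix.mul_assoc]
  rw [Matrix.trace_mul_comm _ (L.S m)⁻¹]
  simp only [← Matrix.mul_assoc]

/-- The boundary values at a point of an arc exist, and `μ`, `ϑ` are the values there of the
integrands of the modified Malgrange differential. -/
structure HasIntegrands {k r : ℕ} {n : Fin k → ℕ} (D : ℂ → BirkhoffData k r n) (s0 : ℂ)
    (G : ContourChoice (D s0)) (Γ : ℂ → Mat r) (i : ContourArc n) (t : ℝ) (μ ϑ : ℂ) : Prop where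
  minus : HasMinusValue Γ (G.path i) t (minusValue Γ (G.path i) t)
  minus_deriv : HasMinusValue (matDeriv Γ) (G.path i) t (minusValue (matDeriv Γ) (G.path i) t)
  malgrange : malgrangeIntegrand G.path (fun s => G.jump (D s)) s0 Γ i t = μ
  theta : thetaIntegrand G.path (fun s => G.jump (D s)) s0 i t = ϑ

namespace ContourChoice

variable {k r : ℕ} {n : Fin k → ℕ} {D : ℂ → BirkhoffData k r n} {s0 : ℂ}
  (hD : IsIsomonodromicAt D s0) (G : ContourChoice (D s0)) {Γ : ℂ → Mat r} (j : Fin k)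

lemma hasIntegrands_of {c : LocalArc (n j)} (hc : c ≠ .outerStem) {t : ℝ}
    (ht : t ∈ Ioo (0 : ℝ) 1) {w ω : ℂ} (hw : G.logPath j c t = w)
    (hω : G.logPathDeriv j c t = ω) (hω0 : ω ≠ 0) {h : ℂ → ℝ} {h' : ℂ →L[ℝ] ℝ} (h0 : h w = 0)
    (hh : HasFDerivAt h h' w) {b : ℝ} (hb : 0 < b) (hh' : ∀ ξ, h' (ω * ξ) = -(b * ξ.im))
    {f : ℂ → Mat r} (hf : ∀ p q, AnalyticAt ℂ (fun w => f w p q) w)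
    (hside : ∀ᶠ v in 𝓝 w, 0 < h v → (fun v => Γ ((D s0).a j + exp v)) =ᶠ[𝓝 v] f)
    {F : ℂ → Mat r}
    (hF : ∀ᶠ v in 𝓝 w, G.jump (D s0) ⟨j, c⟩ t ((D s0).a j + exp v) = F v)
    (hFd : ∀ p q, DifferentiableAt ℂ (fun v => F v p q) w) {X V W : Mat r}
    (hX : (f w)⁻¹ * matDeriv f w = X)
    (hV : matDeriv (fun s => G.jump (D s) ⟨j, c⟩ t ((D s0).a j + exp w)) s0 * (F w)⁻¹ = V)
    (hW : matDeriv F w * (F w)⁻¹ = W) :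
    HasIntegrands D s0 G Γ ⟨j, c⟩ t ((X * V).trace * ω) ((W * V).trace * ω) := by
  have hp : G.path ⟨j, c⟩ t = (D s0).a j + exp w := by
    rw [G.path_eq j hc (Ioo_subset_Ico_self ht), hw]
  have hd : HasDerivAt (G.path ⟨j, c⟩) (exp w * ω) t := by
    rw [← hw, ← hω]; exact G.hasDerivAt_path j hc ht
  have hd0 : deriv (G.path ⟨j, c⟩) t ≠ 0 := by
    rw [hd.deriv]; exact mul_ne_zero (exp_ne_zero _) hω0
  obtain ⟨h1, h2⟩ := hasMinusValue_of_side hp hd hω0 h0 hh hb hh' hf hside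
  have e1 := h1.minusValue_eq hd0
  have e2 := h2.minusValue_eq hd0
  have e3 : G.jump (D s0) ⟨j, c⟩ t ((D s0).a j + exp w) = F w := hF.self_of_nhds
  have e4 := matDeriv_of_pullback hF hFd
  have hexp : exp (-w) * exp w = 1 := by rw [← exp_add, neg_add_cancel, exp_zero]
  refine ⟨by rwa [e1], by rwa [e2], ?_, ?_⟩
  · rw [malgrangeIntegrand, e1, e2, jumpVariation, hp, e3, hV, hd.deriv, Matrix.mul_smul, hX,
      Matrix.smul_mul, Matrix.trace_smul, smul_eq_mul]
    linear_combination (X * V).trace * ω * hexp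
  · rw [thetaIntegrand, jumpVariation, hp, e3, e4, hV, hd.deriv, Matrix.smul_mul, hW,
      Matrix.smul_mul, Matrix.trace_smul, smul_eq_mul]
    linear_combination (W * V).trace * ω * hexp

lemma abs_im_sub_lt {w : ℂ} {η : ℝ} (h : w.im = η) : ∀ᶠ v in 𝓝 w, |v.im - η| < π := by
  have hc : Continuous fun v : ℂ => |v.im - η| := by fun_prop
  exact hc.continuousAt.eventually_lt continuousAt_const
    (by rw [h, sub_self, abs_zero]; exact Real.pi_pos)

lemma level_self {η : ℝ} {w : ℂ} (h : |w.im - η| < π) :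
    (fun p => (D s0).L j p * logBranch η ((D s0).a j + exp w - (D s0).a j)) =
      (G.localData j).levelExponent w := by
  rw [add_sub_cancel_left, logBranch_exp h]
  rfl

lemma two_pi_I_mul_re (ξ : ℂ) : (2 * π * I * ξ).re = -(2 * π * ξ.im) := by
  rw [mul_assoc, show (2 * π : ℂ) = ((2 * π : ℝ) : ℂ) by push_cast; rfl, re_ofReal_mul]
  simp

lemma hasFDerivAt_re_sub (x : ℝ) (w : ℂ) : HasFDerivAt (fun v : ℂ => v.re - x) reCLM w :=
  reCLM.hasFDerivAt.sub_const x

lemma hasFDerivAt_im_sub (x : ℝ) (w : ℂ) : HasFDerivAt (fun v : ℂ => v.im - x) imCLM w :=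
  imCLM.hasFDerivAt.sub_const x

variable {Ψ : ℂ → Mat r}
  (hΨ : (G.localData j).IsGlued (fun w => Γ ((D s0).a j + exp w)) Ψ)

include hD hΨ

lemma hasIntegrands_formalCircle {t : ℝ} (ht : t ∈ Ioo (0 : ℝ) 1) {w : ℂ}
    (hw : G.logPath j .formalCircle t = w) :
    HasIntegrands D s0 G Γ ⟨j, .formalCircle⟩ t
      (-(LocalData.logDeriv Ψ w * Matrix.diagonal (levelVariation D s0 j w)).trace *
        (2 * π * I))
      ((∑ p, (D s0).L j p * levelVariation D s0 j w p) * (2 * π * I)) := by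
  set L := G.localData j with hLd
  have hre : w.re = L.xρ := by rw [← hw]; simp [logPath, hLd, localData]
  have him : w.im = G.θ j + 2 * π * t := by rw [← hw]; simp [logPath]
  have hR : w.re < L.xR := hre ▸ L.xρ_lt_xR
  have h1 : L.θ < w.im := by
    rw [him]; exact lt_add_of_pos_right _ (mul_pos (by positivity) ht.1)
  have h2 : w.im < L.θ + 2 * π := by
    rw [him]
    exact add_lt_add_right (mul_lt_of_lt_one_right (by positivity) ht.2) _
  have h3 := (abs_im_sub_lt him).self_of_nhds
  have hlev := G.level_self j h3
  have hvar := fun p => hasDerivAt_logBranch_variation j hD h3 p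
  have hlevd := fun p => L.hasDerivAt_levelExponent w p
  convert G.hasIntegrands_of j (by simp) ht hw
    (ω := 2 * π * I) rfl Complex.two_pi_I_ne_zero
    (h := fun v => v.re - L.xρ) (by simp [hre]) (hasFDerivAt_re_sub _ w)
    (b := 2 * π) (by positivity) (fun ξ => two_pi_I_mul_re ξ) (f := Ψ) (hΨ.analyticAt hR)
    (F := fun v => (expDiag (L.levelExponent v))⁻¹) (X := LocalData.logDeriv Ψ w)
    (V := -Matrix.diagonal (levelVariation D s0 j w)) (W := -Matrix.diagonal (D s0 |>.L j))
    ?_ ?_ ?_ ?_ ?_ ?_ using 1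
  · rw [Matrix.mul_neg, Matrix.trace_neg]
  · rw [Matrix.neg_mul, Matrix.mul_neg, neg_neg, trace_diagonal_mul]
    simp
  · filter_upwards [(continuous_re.tendsto w).eventually (gt_mem_nhds hR),
      (continuous_im.tendsto w).eventually (lt_mem_nhds h1),
      (continuous_im.tendsto w).eventually (gt_mem_nhds h2)] with v h4 h5 h6 h7
    exact hΨ.eventually_eq_outer (by linarith) h4 h5 h6
  · filter_upwards [abs_im_sub_lt him] with v hv
    rw [jump, BirkhoffData.powL_exp G j hv]
    rfl
  · exact differentiableAt_expDiag_inv hlevd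
  · rw [← adjugate_eq_inv (hΨ.det_eq_one w hR)]; rfl
  · rw [← hlev, ← matDeriv_expDiag_inv_mul_inv hvar]
    congr 1
    refine matDeriv_congr ?_
    filter_upwards [hD.L_frozen] with s hs
    rw [jump, BirkhoffData.powL, hs]
    rfl
  · exact matDeriv_expDiag_inv_mul_inv hlevd

lemma hasIntegrands_toralCircle (hn : 0 < n j) {t : ℝ} (ht : t ∈ Ioo (0 : ℝ) 1) {w : ℂ}
    (hw : G.logPath j (.toralCircle hn) t = w) :
    HasIntegrands D s0 G Γ ⟨j, .toralCircle hn⟩ t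
      ((-(LocalData.logDeriv Ψ w * Matrix.diagonal (toralVariation D s0 j w)).trace +
        ∑ p, (D s0).L j p * toralVariation D s0 j w p) * (2 * π * I))
      ((∑ p, ((G.localData j).ThatDeriv w p - (D s0).L j p) * toralVariation D s0 j w p) *
        (2 * π * I)) := by
  set L := G.localData j with hLd
  have hre : w.re = L.xτ := by rw [← hw]; simp [logPath, hLd, localData]
  have him : w.im = G.θ j + 2 * π * t := by rw [← hw]; simp [logPath]
  have hρ : w.re < L.xρ := hre ▸ L.xτ_lt_xρ
  have hR : w.re < L.xR := hρ.trans L.xρ_lt_xR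
  have h1 : L.θ < w.im := by
    rw [him]; exact lt_add_of_pos_right _ (mul_pos (by positivity) ht.1)
  have h2 : w.im < L.θ + 2 * π := by
    rw [him]
    exact add_lt_add_right (mul_lt_of_lt_one_right (by positivity) ht.2) _
  have hvar := fun p => hasDerivAt_toral_variation j hD w p
  have htor : ∀ p, HasDerivAt (fun w => L.toral w p) (L.ThatDeriv w p - (D s0).L j p) w :=
    fun p => (L.hasDerivAt_toral w p).congr_deriv (add_sub_cancel_right _ _).symm
  convert G.hasIntegrands_of j (by simp) ht hw
    (ω := 2 * π * I) rfl Complex.two_pi_I_ne_zero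
    (h := fun v => v.re - L.xτ) (by simp [hre]) (hasFDerivAt_re_sub _ w)
    (b := 2 * π) (by positivity) (fun ξ => two_pi_I_mul_re ξ) (hΨ.analyticAt_mid hR)
    (F := fun v => (expDiag (L.toral v))⁻¹)
    (V := -Matrix.diagonal (toralVariation D s0 j w))
    (W := -Matrix.diagonal fun p => L.ThatDeriv w p - (D s0).L j p)
    ?_ ?_ ?_ (hΨ.inv_mul_matDeriv_mid hR) ?_ ?_ using 1
  · rw [Matrix.mul_neg, Matrix.trace_neg, Matrix.sub_mul, Matrix.trace_sub,
      trace_conj_diagonal_mul_diagonal (expDiag_inv_mul _) rfl, trace_diagonal_mul]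
    simp only [Matrix.diagonal_apply_eq]
    rw [neg_sub, sub_eq_neg_add]
    rfl
  · rw [Matrix.neg_mul, Matrix.mul_neg, neg_neg, trace_diagonal_mul]
    simp
  · filter_upwards [(continuous_re.tendsto w).eventually (gt_mem_nhds hρ),
      (continuous_im.tendsto w).eventually (lt_mem_nhds h1),
      (continuous_im.tendsto w).eventually (gt_mem_nhds h2)] with v h4 h5 h6 h7
    exact hΨ.eventually_eq_mid (by linarith) h4 h5 h6
  · refine .of_forall fun v => ?_
    rw [jump, BirkhoffData.expT, BirkhoffData.toral_exp G j]
    rfl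
  · exact differentiableAt_expDiag_inv htor
  · have hself : (D s0).toral j ((D s0).a j + exp w) = L.toral w := BirkhoffData.toral_exp G j w
    rw [← hself]
    exact matDeriv_expDiag_inv_mul_inv hvar
  · exact matDeriv_expDiag_inv_mul_inv htor

/-- The part of the integrands on the neck that cancels. -/
def neckDefect (D : ℂ → BirkhoffData k r n) (s0 : ℂ) (G : ContourChoice (D s0)) (j : Fin k)
    (w : ℂ) : ℂ :=
  ∑ p, (D s0).L j p * levelVariation D s0 j w p - ∑ p, (D s0).L j p * ((G.localData j).R 0 *
    Matrix.diagonal (levelVariation D s0 j w) * ((G.localData j).R 0)⁻¹) p p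

lemma hasIntegrands_neck (hn : 0 < n j) {t : ℝ} (ht : t ∈ Ioo (0 : ℝ) 1) {w ω : ℂ}
    (hw : G.logPath j (.neck hn) t = w) (hω : G.logPathDeriv j (.neck hn) t = ω) :
    HasIntegrands D s0 G Γ ⟨j, .neck hn⟩ t
      (((LocalData.logDeriv Ψ w * (Matrix.diagonal (levelVariation D s0 j w) -
        (G.localData j).R 0 * Matrix.diagonal (levelVariation D s0 j w) *
          ((G.localData j).R 0)⁻¹)).trace - neckDefect D s0 G j w) * ω)
      ((2 * neckDefect D s0 G j w) * ω) := by
  set L := G.localData j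
  have hτ := G.τ_pos j
  have hτρ := G.τ_lt_ρ j
  have hre : w.re = Real.log (G.ρ j - t * (G.ρ j - G.τ j)) := by rw [← hw]; simp [logPath]
  have him : w.im = G.θ j := by rw [← hw]; simp [logPath]
  have hρ : w.re < L.xρ := by
    rw [hre]
    exact Real.log_lt_log (radius_pos hτ hτρ (Ioo_subset_Icc_self ht)) (by nlinarith [ht.1])
  have hτw : L.xτ < w.re := by
    rw [hre]
    exact Real.log_lt_log hτ (by nlinarith [ht.2])
  have hR : w.re < L.xR := hρ.trans L.xρ_lt_xR
  have h3 := (abs_im_sub_lt him).self_of_nhds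
  have hlev := G.level_self j h3
  have hvar := fun p => hasDerivAt_logBranch_variation j hD h3 p
  have hlevd := fun p => L.hasDerivAt_levelExponent w p
  have hR0 : L.R 0 = (D s0).stokesProduct j := sectorMatrix_zero j
  have hdet := L.R_det 0
  set x := -(G.ρ j - G.τ j) / (G.ρ j - t * (G.ρ j - G.τ j))
  have hx0 : x < 0 := div_neg_of_neg_of_pos (by linarith)
    (radius_pos hτ hτρ (Ioo_subset_Icc_self ht))
  have hωx : ω = (x : ℂ) := hω.symm
  have hlt : w.im < L.θ + 2 * π := by
    rw [him]; exact lt_add_of_pos_right _ (by positivity)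
  have hL : ∀ p, (L.R 0 * Matrix.diagonal (L.L) * (L.R 0)⁻¹) p p * levelVariation D s0 j w p =
      L.L p * (L.R 0 * Matrix.diagonal (levelVariation D s0 j w) * (L.R 0)⁻¹) p p := by
    intro p
    have : levelVariation D s0 j w = (-deriv (fun s => (D s).a j) s0 * exp (-w)) • L.L := by
      funext q
      simp only [levelVariation, Pi.smul_apply, smul_eq_mul]
      change _ = _ * (D s0).L j q
      ring
    rw [this, Matrix.diagonal_smul, Matrix.mul_smul, Matrix.smul_mul, Matrix.smul_apply,
      Pi.smul_apply, smul_eq_mul, smul_eq_mul]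
    ring
  convert G.hasIntegrands_of j (by simp) ht hw hω (by rw [hωx]; exact_mod_cast hx0.ne)
    (h := fun v => v.im - G.θ j) (by simp [him]) (hasFDerivAt_im_sub _ w)
    (b := -x) (by linarith) (fun ξ => by rw [hωx, imCLM_apply, im_ofReal_mul]; ring)
    (hΨ.analyticAt_mid hR)
    (F := fun v => expDiag (L.levelExponent v) * L.R 0 * (expDiag (L.levelExponent v))⁻¹)
    ?_ ?_ ?_ (hΨ.inv_mul_matDeriv_mid hR)
    (V := Matrix.diagonal (levelVariation D s0 j w) - expDiag (L.levelExponent w) * L.R 0 *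
      (expDiag (L.levelExponent w))⁻¹ * Matrix.diagonal (levelVariation D s0 j w) *
      (expDiag (L.levelExponent w) * L.R 0 * (expDiag (L.levelExponent w))⁻¹)⁻¹) ?_
    (matDeriv_conj_mul_inv hlevd hdet) using 1
  · rw [trace_malgrange rfl (expDiag_inv_mul _) hdet rfl]
    rfl
  · rw [trace_theta rfl (expDiag_inv_mul _) hdet rfl, Finset.sum_congr rfl fun p _ => hL p,
      neckDefect]
    change _ = (2 * ∑ p, (D s0).L j p * _ - ∑ p, (D s0).L j p * _ - ∑ p, (D s0).L j p * _) * _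
    ring
  · filter_upwards [(continuous_re.tendsto w).eventually (gt_mem_nhds hρ),
      (continuous_re.tendsto w).eventually (lt_mem_nhds hτw),
      (continuous_im.tendsto w).eventually (gt_mem_nhds hlt)] with v h4 h5 h6 h7
    exact hΨ.eventually_eq_mid h5 h4 (sub_pos.1 h7) h6
  · filter_upwards [abs_im_sub_lt him] with v hv
    rw [jump, BirkhoffData.powL_exp G j hv, hR0]
    rfl
  · exact differentiableAt_mul_apply (differentiableAt_mul_apply (B := fun _ => L.R 0)
      (differentiableAt_expDiag hlevd) fun p q => differentiableAt_const _)
      (differentiableAt_expDiag_inv hlevd)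
  · rw [← hlev, ← matDeriv_conj_mul_inv hvar hdet]
    congr 1
    refine matDeriv_congr ?_
    filter_upwards [hD.L_frozen, hD.S_frozen] with s hs hs'
    rw [jump, BirkhoffData.powL, hs, BirkhoffData.stokesProduct, hs', hR0]
    rfl

lemma hasIntegrands_stokesLine (ν : Fin (2 * n j)) {t : ℝ} (ht : t ∈ Ioo (0 : ℝ) 1) {w ω : ℂ}
    (hw : G.logPath j (.stokesLine ν) t = w) (hω : G.logPathDeriv j (.stokesLine ν) t = ω) :
    HasIntegrands D s0 G Γ ⟨j, .stokesLine ν⟩ t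
      (((G.localData j).density Ψ (laurent timeExponent (timeCoeff D s0 j)) ((ν : ℕ) + 1) w -
        (G.localData j).density Ψ (laurent timeExponent (timeCoeff D s0 j)) (ν : ℕ) w) * ω) 0 := by
  set L := G.localData j
  have hτ := G.τ_pos j
  have h01 : (0 : ℝ) < 1 - t := by linarith [ht.2]
  have hx : G.τ j * (1 - t) ∈ Ioo 0 (G.τ j) := ⟨mul_pos hτ h01, by nlinarith [ht.1]⟩
  have hre : w.re = Real.log (G.τ j * (1 - t)) := by rw [← hw]; simp [logPath]
  have him : w.im = G.α j ν (G.τ j * (1 - t)) := by rw [← hw]; simp [logPath]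
  have hτw : w.re < L.xτ := hre ▸ Real.log_lt_log hx.1 hx.2
  have hR : w.re < L.xR := hτw.trans (L.xτ_lt_xρ.trans L.xρ_lt_xR)
  have hline : w.im = L.line (ν : ℕ) w.re := by
    rw [(G.line_eq_α j ν hτw).1, hre, Real.exp_log hx.1, him]
  have h3 := (abs_im_sub_lt him).self_of_nhds
  have hS : L.S (ν : ℕ) = (D s0).S j ν := by
    have hN : sectorCount (n j) = 2 * n j := by rw [sectorCount, if_neg (by have := ν.2; omega)]
    change sheetStokes (D s0) j (ν : ℕ) = _
    rw [sheetStokes_of_lt j (by omega) (by have := ν.2; omega), stokesBase,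
      dif_pos (show ((ν : ℕ) : ℤ).toNat < _ from ν.2)]
    rfl
  have hdet := L.det_S (ν : ℕ)
  have hThat := fun p => L.hasDerivAt_That w p
  have hvar : ∀ p, HasDerivAt (fun s => (D s).toral j ((D s0).a j + exp w) p +
      (D s0).L j p * logBranch (G.α j ν (G.τ j * (1 - t))) ((D s0).a j + exp w - (D s).a j))
      (laurent timeExponent (timeCoeff D s0 j) w p) s0 := fun p =>
    ((hasDerivAt_toral_variation j hD w p).fun_add
      (hasDerivAt_logBranch_variation j hD h3 p)).congr_deriv (by rw [laurent_time, add_comm])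
  have hself : (fun p => (D s0).toral j ((D s0).a j + exp w) p +
      (D s0).L j p * logBranch (G.α j ν (G.τ j * (1 - t))) ((D s0).a j + exp w - (D s0).a j)) =
      L.That w := by
    funext p
    rw [BirkhoffData.toral_exp G j, congrFun (G.level_self j h3) p]
    rfl
  set x := -(1 - t)⁻¹ with hxdef
  set σ := L.lineDeriv (ν : ℕ) w.re with hσ
  have hx0 : x < 0 := by rw [hxdef]; simpa using h01
  have hωx : ω = (x : ℂ) * (1 + σ * I) := by rw [← hω, hσ, hre]; rfl
  have hω0 : ω ≠ 0 := fun h => by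
    have := congrArg re h
    rw [hωx, re_ofReal_mul] at this
    simp [hx0.ne] at this
  have hder : HasFDerivAt (fun v : ℂ => v.im - L.line (ν : ℕ) v.re) (imCLM - σ • reCLM) w := by
    have h1 := (L.line_hasDerivAt (ν : ℕ) w.re hτw).hasFDerivAt.comp w reCLM.hasFDerivAt
    refine (imCLM.hasFDerivAt.sub h1).congr_fderiv ?_
    ext v
    simp [hσ, mul_comm]
  have hX : (L.sectorial Ψ ((ν : ℕ) + 1) w)⁻¹ * matDeriv (L.sectorial Ψ ((ν : ℕ) + 1)) w =
      expDiag (L.That w) * ((L.R ((ν : ℕ) + 1))⁻¹ * LocalData.logDeriv Ψ w *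
        L.R ((ν : ℕ) + 1)) * (expDiag (L.That w))⁻¹ - Matrix.diagonal (L.ThatDeriv w) := by
    rw [← adjugate_eq_inv (hΨ.det_sectorial _ hR), hΨ.adjugate_mul_matDeriv_sectorial _ hR,
      expDiag_inv]
    rfl
  have hmono := L.line_strictMono hτw (lt_add_one ((ν : ℕ) : ℤ))
  have hconj := conj_diagonal_apply_self hdet (L.S_triangular (ν : ℕ))
  convert G.hasIntegrands_of j (by simp) ht hw hω hω0
    (h := fun v => v.im - L.line (ν : ℕ) v.re) (by simp [hline]) hder
    (b := -x * (1 + σ ^ 2)) (mul_pos (by linarith) (by positivity)) (fun ξ => by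
      rw [hωx]
      simp only [mul_assoc, _root_.sub_apply, _root_.smul_apply,
        imCLM_apply, reCLM_apply, im_ofReal_mul, re_ofReal_mul, smul_eq_mul]
      simp
      ring)
    (fun p q => hΨ.analyticAt_sectorial ((ν : ℕ) + 1) hR p q)
    (F := fun v => expDiag (L.That v) * L.S (ν : ℕ) * (expDiag (L.That v))⁻¹)
    ?_ ?_ ?_ hX
    (V := Matrix.diagonal (laurent timeExponent (timeCoeff D s0 j) w) -
      expDiag (L.That w) * L.S (ν : ℕ) * (expDiag (L.That w))⁻¹ *
      Matrix.diagonal (laurent timeExponent (timeCoeff D s0 j) w) *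
      (expDiag (L.That w) * L.S (ν : ℕ) * (expDiag (L.That w))⁻¹)⁻¹) ?_
    (matDeriv_conj_mul_inv hThat hdet) using 1
  · rw [trace_malgrange rfl (expDiag_inv_mul _) hdet rfl,
      LocalData.density_succ_sub]
    simp only [hconj, sub_self, sub_zero]
  · rw [trace_theta rfl (expDiag_inv_mul _) hdet rfl]
    simp only [hconj]
    ring
  · filter_upwards [(continuous_re.tendsto w).eventually (gt_mem_nhds hτw),
      L.eventually_lt_line (w := w) (m := (ν : ℕ) + 1) (by rw [hline]; exact hmono)]
      with v h4 h5 h6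
    exact hΨ.eventually_eq_sector h4 (sub_pos.1 h6) h5
  · filter_upwards [abs_im_sub_lt him] with v hv
    rw [jump, BirkhoffData.expThat_exp G j hv, hS]
    rfl
  · exact differentiableAt_mul_apply (differentiableAt_mul_apply (B := fun _ => L.S (ν : ℕ))
      (differentiableAt_expDiag hThat) fun p q => differentiableAt_const _)
      (differentiableAt_expDiag_inv hThat)
  · rw [← hself, ← matDeriv_conj_mul_inv hvar hdet]
    congr 1
    refine matDeriv_congr ?_
    filter_upwards [hD.L_frozen, hD.S_frozen] with s hs hs'
    rw [jump, BirkhoffData.expThat, BirkhoffData.expT, BirkhoffData.powL,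
      Matrix.diagonal_mul_diagonal, hs, hs', hS]
    simp only [← exp_add]
    rfl

end ContourChoice


/-- The integrals along a smooth arc, when the integrands have a primitive. -/
lemma integrable_and_integral_eq_of_primitive {φ1 φ2 w ω : ℝ → ℂ} {g1 g2 K : ℂ → ℂ} {c : ℝ}
    (hwc : ContinuousOn w (Icc 0 1)) (hre : ∀ t ∈ Icc (0 : ℝ) 1, (w t).re < c)
    (hw : ∀ t ∈ Ioo (0 : ℝ) 1, HasDerivAt w (ω t) t) (hω : ContinuousOn ω (Icc 0 1))
    (hg1 : ContinuousOn g1 {w | w.re < c}) (hg2 : ContinuousOn g2 {w | w.re < c})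
    (h₁ : ∀ t ∈ Ioo (0 : ℝ) 1, φ1 t = g1 (w t) * ω t)
    (h₂ : ∀ t ∈ Ioo (0 : ℝ) 1, φ2 t = g2 (w t) * ω t)
    (hK : ∀ w, w.re < c → HasDerivAt K (-g1 w - 1 / 2 * g2 w) w) :
    IntervalIntegrable φ1 volume 0 1 ∧
    IntervalIntegrable φ2 volume 0 1 ∧
    -(∫ t in (0 : ℝ)..1, φ1 t) - 1 / 2 * (∫ t in (0 : ℝ)..1, φ2 t) = K (w 1) - K (w 0) := by
  have hint : ∀ {g : ℂ → ℂ} {φ : ℝ → ℂ}, ContinuousOn g {w | w.re < c} →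
      (∀ t ∈ Ioo (0 : ℝ) 1, φ t = g (w t) * ω t) →
      IntervalIntegrable φ volume 0 1 := fun {g φ} hg h => by
    have h3 : ContinuousOn (fun t => g (w t) * ω t) (uIcc 0 1) := by
      rw [uIcc_of_le zero_le_one]
      exact (hg.comp hwc hre).mul hω
    refine h3.intervalIntegrable.congr_uIoo ?_
    rw [uIoo_of_le zero_le_one]
    exact fun t ht => (h t ht).symm
  have i1 := hint hg1 h₁
  have i2 := hint hg2 h₂
  have i1' : IntervalIntegrable (fun t => -φ1 t) volume 0 1 := i1.neg
  refine ⟨i1, i2, ?_⟩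
  rw [← intervalIntegral.integral_neg, ← intervalIntegral.integral_const_mul,
    ← intervalIntegral.integral_sub i1' (i2.const_mul _)]
  refine intervalIntegral.integral_eq_sub_of_hasDerivAt_of_le zero_le_one
    (f := fun t => K (w t)) ?_ (fun t ht => ?_) (i1'.sub (i2.const_mul _))
  · exact ContinuousOn.comp (t := {w | w.re < c})
      (fun z hz => (hK z hz).continuousAt.continuousWithinAt) hwc hre
  · refine ((hK _ (hre t (Ioo_subset_Icc_self ht))).comp_of_eq t (hw t ht) rfl).congr_deriv ?_
    rw [h₁ t ht, h₂ t ht]; ring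

/-- The difference of the densities on both sides of a line is small at the pole. -/
lemma LocalData.IsExpansion.density_succ_sub_isBigO {r : ℕ} {L : LocalData r} {u Ψ : ℂ → Mat r}
    {Y : FormalMat r} (hΨ : L.IsGlued u Ψ) (hY : L.IsExpansion Ψ Y) {ι : Type*} [Fintype ι]
    (e : ι → ℕ) (t : ι → Fin r → ℂ) (m : ℤ) :
    (fun x => L.density Ψ (laurent e t) (m + 1) (L.linePoint m x) -
      L.density Ψ (laurent e t) m (L.linePoint m x)) =O[atBot] Real.exp := by
  have hlim : ∀ i : ℤ, i = m ∨ i = m + 1 →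
      Tendsto (fun x => (i, L.linePoint m x)) atBot L.sectorFilter := fun i hi =>
    L.tendsto_sectorFilter tendsto_id (.of_forall fun x =>
      ⟨L.line_monotone x (by omega), L.line_monotone x (by omega)⟩)
  have key : ∀ p i, (fun x =>
      ((((L.sectorial Ψ (m + 1) (L.linePoint m x)).adjugate *
        matDeriv (L.sectorial Ψ (m + 1)) (L.linePoint m x)) p p) -
      (((L.sectorial Ψ m (L.linePoint m x)).adjugate *
        matDeriv (L.sectorial Ψ m) (L.linePoint m x)) p p)) *
      (t i p * exp (-(e i * L.linePoint m x)))) =O[atBot] Real.exp := fun p i => by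
    have h1 := (hY.asymp_adjugate_mul_deriv p p (e i + 1)).comp_tendsto
      (hlim (m + 1) (Or.inr rfl))
    have h2 := (hY.asymp_adjugate_mul_deriv p p (e i + 1)).comp_tendsto (hlim m (Or.inl rfl))
    refine (((h1.sub h2).congr_left fun x => by
      simp only [Function.comp_apply, sub_sub_sub_cancel_right]).mul
      (Asymptotics.isBigO_refl _ _)).trans
      (Asymptotics.IsBigO.of_bound ‖t i p‖ (.of_forall fun x => ?_))
    have h3 : exp (L.linePoint m x) ^ (e i + 1) * (t i p * exp (-(e i * L.linePoint m x))) =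
        t i p * exp (L.linePoint m x) := by
      rw [← exp_nat_mul, mul_left_comm, ← exp_add]
      congr 2; push_cast; ring
    simp only [Function.comp_apply]
    rw [h3, norm_mul, norm_exp, Real.norm_eq_abs, Real.abs_exp]
    rfl
  refine (Asymptotics.IsBigO.fun_sum (s := Finset.univ) fun p _ =>
    Asymptotics.IsBigO.fun_sum (s := Finset.univ) fun i _ => key p i).congr' ?_ .rfl
  filter_upwards [eventually_lt_atBot L.xR] with x hx
  rw [hΨ.density_eq m (w := L.linePoint m x) hx, hΨ.density_eq (m + 1) (w := L.linePoint m x) hx,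
    add_sub_add_right_eq_sub, ← Finset.sum_sub_distrib]
  refine Finset.sum_congr rfl fun p _ => ?_
  rw [← sub_mul, laurent, Finset.mul_sum]

lemma sum_localArc {m : ℕ} (f : LocalArc m → ℂ) : ∑ c, f c =
    f .outerStem + f .innerStem + f .connectionCircle + f .formalCircle +
      ∑ h : PLift (0 < m), (f (.neck h.down) + f (.toralCircle h.down)) +
      ∑ ν, f (.stokesLine ν) := by
  let e : (Fin 4 ⊕ (PLift (0 < m) ⊕ PLift (0 < m))) ⊕ Fin (2 * m) ≃ LocalArc m :=
    { toFun := Sum.elim (Sum.elim ![.outerStem, .innerStem, .connectionCircle, .formalCircle]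
        (Sum.elim (fun h => .neck h.down) fun h => .toralCircle h.down)) .stokesLine
      invFun := fun
        | .outerStem => .inl (.inl 0)
        | .innerStem => .inl (.inl 1)
        | .connectionCircle => .inl (.inl 2)
        | .formalCircle => .inl (.inl 3)
        | .neck h => .inl (.inr (.inl ⟨h⟩))
        | .toralCircle h => .inl (.inr (.inr ⟨h⟩))
        | .stokesLine ν => .inr ν
      left_inv := by
        rintro ((i | ⟨h⟩ | ⟨h⟩) | ν)
        · fin_cases i <;> rfl
        all_goals rfl
      right_inv := by rintro (_ | _ | _ | _ | _ | _ | _) <;> rfl }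
  rw [← e.sum_comp, Fintype.sum_sum_type, Fintype.sum_sum_type, Fintype.sum_sum_type,
    Fin.sum_univ_four, Finset.sum_add_distrib]
  rfl

/-- All the data of the modified Malgrange differential exist on the arc `i`, which contributes
`v` to it, up to the factor `2πi`. -/
structure HasContribution {k r : ℕ} {n : Fin k → ℕ} (D : ℂ → BirkhoffData k r n) (s0 : ℂ)
    (G : ContourChoice (D s0)) (Γ : ℂ → Mat r) (i : ContourArc n) (v : ℂ) : Prop where
  minus : ∀ t ∈ Ioo (0 : ℝ) 1, jumpVariation G.path (fun s => G.jump (D s)) s0 i t ≠ 0 →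
    HasMinusValue Γ (G.path i) t (minusValue Γ (G.path i) t) ∧
    HasMinusValue (matDeriv Γ) (G.path i) t (minusValue (matDeriv Γ) (G.path i) t)
  malgrange : IntervalIntegrable (malgrangeIntegrand G.path (fun s => G.jump (D s)) s0 Γ i)
    volume 0 1
  theta : IntervalIntegrable (thetaIntegrand G.path (fun s => G.jump (D s)) s0 i)
    volume 0 1
  value : -(∫ t in (0 : ℝ)..1, malgrangeIntegrand G.path (fun s => G.jump (D s)) s0 Γ i t) -
    1 / 2 * (∫ t in (0 : ℝ)..1, thetaIntegrand G.path (fun s => G.jump (D s)) s0 i t) = v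

namespace ContourChoice

variable {k r : ℕ} {n : Fin k → ℕ} {D : ℂ → BirkhoffData k r n} {s0 : ℂ}
  (hD : IsIsomonodromicAt D s0) (G : ContourChoice (D s0)) {Γ : ℂ → Mat r} (j : Fin k)

lemma hasContribution_of_eventuallyEq {i : ContourArc n}
    (h : ∀ t z, ∀ᶠ s in 𝓝 s0, G.jump (D s) i t z = G.jump (D s0) i t z) :
    HasContribution D s0 G Γ i 0 := by
  have h0 : jumpVariation G.path (fun s => G.jump (D s)) s0 i = 0 := by
    funext t
    rw [jumpVariation, matDeriv_congr (h t _)]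
    ext p q
    simp [matDeriv]
  have h1 : malgrangeIntegrand G.path (fun s => G.jump (D s)) s0 Γ i = 0 := by
    funext t; simp [malgrangeIntegrand, h0]
  have h2 : thetaIntegrand G.path (fun s => G.jump (D s)) s0 i = 0 := by
    funext t; simp [thetaIntegrand, h0]
  refine ⟨fun t _ ht => absurd (by rw [h0]; rfl) ht, ?_, ?_, ?_⟩
  · rw [h1]; exact intervalIntegrable_const
  · rw [h2]; exact intervalIntegrable_const
  · rw [h1, h2]; simp

lemma hasContribution_of_primitive {c : LocalArc (n j)} {g1 g2 K : ℂ → ℂ} {x : ℝ}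
    (hc : ContinuousOn (G.logPath j c) (Icc 0 1))
    (hre : ∀ t ∈ Icc (0 : ℝ) 1, (G.logPath j c t).re < x)
    (hω : ContinuousOn (G.logPathDeriv j c) (Icc 0 1))
    (hg1 : ContinuousOn g1 {w | w.re < x}) (hg2 : ContinuousOn g2 {w | w.re < x})
    (hK : ∀ w, w.re < x → HasDerivAt K (-g1 w - 1 / 2 * g2 w) w)
    (h : ∀ t ∈ Ioo (0 : ℝ) 1, HasIntegrands D s0 G Γ ⟨j, c⟩ t
      (g1 (G.logPath j c t) * G.logPathDeriv j c t)
      (g2 (G.logPath j c t) * G.logPathDeriv j c t)) :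
    HasContribution D s0 G Γ ⟨j, c⟩ (K (G.logPath j c 1) - K (G.logPath j c 0)) := by
  obtain ⟨h1, h2, h3⟩ := integrable_and_integral_eq_of_primitive hc hre
    (fun t ht => G.hasDerivAt_logPath j c ht) hω hg1 hg2 (fun t ht => (h t ht).malgrange)
    (fun t ht => (h t ht).theta) hK
  exact ⟨fun t ht _ => ⟨(h t ht).minus, (h t ht).minus_deriv⟩, h1, h2, h3⟩

end ContourChoice


lemma hasPeriodicPrimitive_laurent {r : ℕ} {ι : Type*} [Fintype ι] {e : ι → ℕ}
    (he : ∀ i, 1 ≤ e i) (t : ι → Fin r → ℂ) (p : Fin r) :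
    HasPeriodicPrimitive fun w => laurent e t w p :=
  HasPeriodicPrimitive.sum _ fun i _ =>
    (HasPeriodicPrimitive.exp_neg_natCast_mul (he i)).const_mul _

namespace ContourChoice

variable {k r : ℕ} {n : Fin k → ℕ} {D : ℂ → BirkhoffData k r n} {s0 : ℂ}
  (hD : IsIsomonodromicAt D s0) (G : ContourChoice (D s0)) {Γ : ℂ → Mat r} (j : Fin k)

lemma level_eq_laurent (w : ℂ) : levelVariation D s0 j w =
    laurent (fun _ : Unit => 1) (fun _ p => -((D s0).L j p * deriv (fun s => (D s).a j) s0)) w := by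
  funext p
  simp [levelVariation, laurent]

lemma toral_eq_laurent_sub (w : ℂ) (p : Fin r) : toralVariation D s0 j w p =
    laurent timeExponent (timeCoeff D s0 j) w p - levelVariation D s0 j w p := by
  rw [laurent_time]; ring

lemma hasPeriodicPrimitive_level (p : Fin r) :
    HasPeriodicPrimitive fun w => levelVariation D s0 j w p := by
  simp only [level_eq_laurent]
  exact hasPeriodicPrimitive_laurent (fun _ => le_rfl) _ p

lemma hasPeriodicPrimitive_toral (p : Fin r) :
    HasPeriodicPrimitive fun w => toralVariation D s0 j w p := by
  convert (hasPeriodicPrimitive_laurent one_le_timeExponent (timeCoeff D s0 j) p).add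
    ((hasPeriodicPrimitive_level (D := D) (s0 := s0) j p).const_mul (-1)) using 2 with w
  rw [toral_eq_laurent_sub]; ring

lemma hasPeriodicPrimitive_ThatDeriv_mul_toral (p : Fin r) :
    HasPeriodicPrimitive fun w =>
      (G.localData j).ThatDeriv w p * toralVariation D s0 j w p := by
  convert ((G.localData j).hasPeriodicPrimitive_ThatDeriv_mul one_le_timeExponent
    (timeCoeff D s0 j) p).add (((G.localData j).hasPeriodicPrimitive_ThatDeriv_mul
      (fun _ => le_rfl) (fun (_ : Unit) p => -((D s0).L j p * deriv (fun s => (D s).a j) s0))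
      p).const_mul (-1)) using 2 with w
  rw [toral_eq_laurent_sub, level_eq_laurent]; ring

lemma differentiable_level (p : Fin r) : Differentiable ℂ fun w => levelVariation D s0 j w p := by
  simp only [level_eq_laurent]
  exact laurent_differentiable _ _ p

lemma differentiable_toral (p : Fin r) : Differentiable ℂ fun w => toralVariation D s0 j w p := by
  simp only [toral_eq_laurent_sub]
  exact (laurent_differentiable _ _ p).sub (differentiable_level j p)

lemma level_add (w : ℂ) (p : Fin r) :
    levelVariation D s0 j (w + 2 * π * I) p = levelVariation D s0 j w p := by
  simp only [level_eq_laurent, laurent_add]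

lemma continuousOn_logPath_circle (x θ : ℝ) : ContinuousOn
    (fun t : ℝ => (Real.log x : ℂ) + (θ + 2 * π * t : ℝ) * I) (Icc 0 1) := by fun_prop

variable {Ψ : ℂ → Mat r}
  (hΨ : (G.localData j).IsGlued (fun w => Γ ((D s0).a j + exp w)) Ψ)

include hΨ

lemma continuousOn_trace_logDeriv {θ : ℂ → Fin r → ℂ} (hθ : ∀ p, Differentiable ℂ fun w => θ w p) :
    ContinuousOn (fun w => (LocalData.logDeriv Ψ w * Matrix.diagonal (θ w)).trace)
      {w | w.re < (G.localData j).xR} :=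
  (hΨ.differentiableOn_density hθ (G.localData j).N).continuousOn.congr fun w _ =>
    (LocalData.IsGlued.density_N θ w).symm

include hD

lemma hasContribution_formalCircle {H : ℂ → ℂ} (hH : ∀ w, w.re < (G.localData j).xR → HasDerivAt H
      (LocalData.logDeriv Ψ w * Matrix.diagonal (levelVariation D s0 j w)).trace w) {w : ℂ}
    (hw : w = Real.log (G.ρ j) + G.θ j * I) :
    HasContribution D s0 G Γ ⟨j, .formalCircle⟩ (H (w + 2 * π * I) - H w) := by
  obtain ⟨P, hP, hPp⟩ := (HasPeriodicPrimitive.sum Finset.univ fun p _ =>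
    (hasPeriodicPrimitive_level (D := D) (s0 := s0) j p).const_mul ((D s0).L j p)).const_mul (-(1 / 2))
  have h0 : G.logPath j .formalCircle 0 = w := by simp [logPath, hw]
  have h1 : G.logPath j .formalCircle 1 = w + 2 * π * I := by simp [logPath, hw]; ring
  have h := G.hasContribution_of_primitive (Γ := Γ) j (c := .formalCircle)
    (g1 := fun w => -(LocalData.logDeriv Ψ w * Matrix.diagonal (levelVariation D s0 j w)).trace)
    (g2 := fun w => ∑ p, (D s0).L j p * levelVariation D s0 j w p)
    (K := fun w => H w + P w) (x := (G.localData j).xR) (continuousOn_logPath_circle _ _)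
    (fun t _ => by
      rw [show (G.logPath j .formalCircle t).re = (G.localData j).xρ by
        simp [logPath, localData]]
      exact (G.localData j).xρ_lt_xR)
    continuousOn_const (G.continuousOn_trace_logDeriv j hΨ (differentiable_level j)).neg
    (continuous_finsetSum _ fun p _ =>
      continuous_const.mul (differentiable_level j p).continuous).continuousOn
    (fun w hw => ((hH w hw).add (hP w)).congr_deriv (by ring))
    (fun t ht => G.hasIntegrands_formalCircle hD j hΨ ht rfl)
  rw [h0, h1, hPp, add_sub_add_right_eq_sub] at h
  exact h

lemma hasContribution_toralCircle (hn : 0 < n j) {F : ℂ → ℂ}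
    (hF : ∀ w, w.re < (G.localData j).xR → HasDerivAt F
      (LocalData.logDeriv Ψ w * Matrix.diagonal (toralVariation D s0 j w)).trace w) {w : ℂ}
    (hw : w = Real.log (G.τ j) + G.θ j * I) :
    HasContribution D s0 G Γ ⟨j, .toralCircle hn⟩ (F (w + 2 * π * I) - F w) := by
  obtain ⟨P, hP, hPp⟩ := ((HasPeriodicPrimitive.sum Finset.univ fun p _ =>
    (hasPeriodicPrimitive_toral (D := D) (s0 := s0) j p).const_mul ((D s0).L j p)).add
    (HasPeriodicPrimitive.sum Finset.univ fun p _ =>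
      G.hasPeriodicPrimitive_ThatDeriv_mul_toral j p)).const_mul (-(1 / 2))
  have h0 : G.logPath j (.toralCircle hn) 0 = w := by simp [logPath, hw]
  have h1 : G.logPath j (.toralCircle hn) 1 = w + 2 * π * I := by simp [logPath, hw]; ring
  have hθ := differentiable_toral (D := D) (s0 := s0) j
  have hLθ : Continuous fun w => ∑ p, (D s0).L j p * toralVariation D s0 j w p :=
    continuous_finsetSum _ fun p _ => continuous_const.mul (hθ p).continuous
  have h := G.hasContribution_of_primitive (Γ := Γ) j (c := .toralCircle hn)
    (g1 := fun w => -(LocalData.logDeriv Ψ w * Matrix.diagonal (toralVariation D s0 j w)).trace +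
      ∑ p, (D s0).L j p * toralVariation D s0 j w p)
    (g2 := fun w => ∑ p, ((G.localData j).ThatDeriv w p - (D s0).L j p) *
      toralVariation D s0 j w p)
    (K := fun w => F w + P w) (x := (G.localData j).xR) (continuousOn_logPath_circle _ _)
    (fun t _ => by
      rw [show (G.logPath j (.toralCircle hn) t).re = (G.localData j).xτ by
        simp [logPath, localData]]
      exact (G.localData j).xτ_lt_xρ.trans (G.localData j).xρ_lt_xR)
    continuousOn_const
    ((G.continuousOn_trace_logDeriv j hΨ hθ).neg.add hLθ.continuousOn)
    (continuous_finsetSum _ fun p _ => Continuous.mul (by unfold LocalData.ThatDeriv; fun_prop)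
      (hθ p).continuous).continuousOn
    (fun w hw => ((hF w hw).add (hP w)).congr_deriv (by
      simp only [sub_mul, Finset.sum_sub_distrib]; ring))
    (fun t ht => G.hasIntegrands_toralCircle hD j hΨ hn ht rfl)
  rw [h0, h1, hPp, add_sub_add_right_eq_sub] at h
  exact h

lemma hasContribution_neck (hn : 0 < n j) {H : ℂ → ℂ}
    (hH : ∀ w, w.re < (G.localData j).xR → HasDerivAt H
      (LocalData.logDeriv Ψ w * Matrix.diagonal (levelVariation D s0 j w)).trace w) {w v : ℂ}
    (hw : w = Real.log (G.τ j) + G.θ j * I) (hv : v = Real.log (G.ρ j) + G.θ j * I) :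
    HasContribution D s0 G Γ ⟨j, .neck hn⟩
      ((H (w + 2 * π * I) - H w) - (H (v + 2 * π * I) - H v)) := by
  have h0 : G.logPath j (.neck hn) 0 = v := by simp [logPath, hv]
  have h1 : G.logPath j (.neck hn) 1 = w := by simp [logPath, hw]
  have hL := differentiable_level (D := D) (s0 := s0) j
  have hθ := fun p => (hL p).continuous
  have hθ' : Continuous fun w => levelVariation D s0 j w := continuous_pi hθ
  have hpos := fun t (ht : t ∈ Icc (0 : ℝ) 1) => radius_pos (G.τ_pos j) (G.τ_lt_ρ j) ht
  have hdef : Continuous (neckDefect D s0 G j) := by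
    unfold neckDefect
    refine Continuous.sub (continuous_finsetSum _ fun p _ => continuous_const.mul (hθ p))
      (continuous_finsetSum _ fun p _ => continuous_const.mul ?_)
    have : Continuous fun w => (G.localData j).R 0 * Matrix.diagonal (levelVariation D s0 j w) *
      ((G.localData j).R 0)⁻¹ := by fun_prop
    exact this.matrix_elem p p
  have hg : ContinuousOn (fun w => (LocalData.logDeriv Ψ w *
      (Matrix.diagonal (levelVariation D s0 j w) - (G.localData j).R 0 *
        Matrix.diagonal (levelVariation D s0 j w) * ((G.localData j).R 0)⁻¹)).trace)
      {w | w.re < (G.localData j).xR} := by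
    refine ((G.continuousOn_trace_logDeriv j hΨ hL).sub
      (hΨ.differentiableOn_density hL 0).continuousOn).congr fun w _ => ?_
    simp only [Pi.sub_apply]
    rw [LocalData.density, Matrix.mul_sub, Matrix.trace_sub, Matrix.mul_assoc (_ * _) _
      (Matrix.diagonal _), Matrix.mul_assoc _ (LocalData.logDeriv Ψ w), Matrix.trace_mul_comm _⁻¹]
    simp only [Matrix.mul_assoc]
  have h := G.hasContribution_of_primitive (Γ := Γ) j (c := .neck hn)
    (g1 := fun w => (LocalData.logDeriv Ψ w * (Matrix.diagonal (levelVariation D s0 j w) -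
      (G.localData j).R 0 * Matrix.diagonal (levelVariation D s0 j w) *
        ((G.localData j).R 0)⁻¹)).trace - neckDefect D s0 G j w)
    (g2 := fun w => 2 * neckDefect D s0 G j w)
    (K := fun w => H (w + 2 * π * I) - H w) (x := (G.localData j).xR)
    (fun t ht => (hasDerivAt_log_radius _ (hpos t ht)).continuousAt.continuousWithinAt)
    (fun t ht => by
      rw [show (G.logPath j (.neck hn) t).re = Real.log (G.ρ j - t * (G.ρ j - G.τ j)) by
        simp [logPath]]
      refine lt_of_le_of_lt ?_ (G.localData j).xρ_lt_xR
      exact Real.log_le_log (hpos t ht) (by nlinarith [ht.1, G.τ_lt_ρ j]))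
    (continuous_ofReal.comp_continuousOn (continuousOn_const.div (by fun_prop)
      fun t ht => (hpos t ht).ne'))
    (hg.sub hdef.continuousOn)
    (continuous_const.mul hdef).continuousOn
    (fun w hw => (LocalData.IsGlued.hasDerivAt_neck hΨ (level_add j) hH hw).congr_deriv (by ring))
    (fun t ht => G.hasIntegrands_neck hD j hΨ hn ht rfl rfl)
  rw [h0, h1] at h
  exact h

end ContourChoice


/-- The integral of a bounded continuous function with a primitive is a limit. -/
lemma integrable_and_tendsto_of_primitive {φ κ : ℝ → ℂ} (hφ : ContinuousOn φ (Ioo 0 1)) {B : ℝ}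
    (hB : ∀ t ∈ Ioo (0 : ℝ) 1, ‖φ t‖ ≤ B) (hκ : ContinuousOn κ (Ico 0 1))
    (hd : ∀ t ∈ Ioo (0 : ℝ) 1, HasDerivAt κ (φ t) t) :
    IntervalIntegrable φ volume 0 1 ∧
      Tendsto (fun t => κ t - κ 0) (𝓝[<] 1) (𝓝 (∫ t in (0 : ℝ)..1, φ t)) := by
  have hint : IntervalIntegrable φ volume 0 1 := by
    rw [intervalIntegrable_iff_integrableOn_Ioo_of_le zero_le_one]
    exact MeasureTheory.IntegrableOn.of_bound (by simp)
      (hφ.aestronglyMeasurable measurableSet_Ioo) B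
      ((MeasureTheory.ae_restrict_iff' measurableSet_Ioo).2 (.of_forall hB))
  refine ⟨hint, ?_⟩
  have hc := intervalIntegral.continuousOn_primitive_interval (μ := volume)
    (f := φ) (a := 0) (b := 1) ((intervalIntegrable_iff' (by simp)).1 hint)
  have h1 : Tendsto (fun t => ∫ s in (0 : ℝ)..t, φ s) (𝓝[<] 1) (𝓝 (∫ t in (0 : ℝ)..1, φ t)) := by
    rw [uIcc_of_le zero_le_one] at hc
    refine (hc 1 (right_mem_Icc.2 zero_le_one)).mono_left ?_
    rw [← nhdsWithin_Ioo_eq_nhdsLT (zero_lt_one (α := ℝ))]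
    exact nhdsWithin_mono _ Ioo_subset_Icc_self
  refine h1.congr' ?_
  filter_upwards [Ioo_mem_nhdsLT (zero_lt_one (α := ℝ))] with t ht
  refine intervalIntegral.integral_eq_sub_of_hasDerivAt_of_le ht.1.le
    (hκ.mono fun s hs => ⟨hs.1, hs.2.trans_lt ht.2⟩)
    (fun s hs => hd s ⟨hs.1, hs.2.trans ht.2⟩) (hint.mono_set ?_)
  rw [uIcc_of_le ht.1.le, uIcc_of_le zero_le_one]
  exact Icc_subset_Icc_right ht.2.le

namespace ContourChoice

variable {k r : ℕ} {n : Fin k → ℕ} {D : ℂ → BirkhoffData k r n} {s0 : ℂ}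
  (hD : IsIsomonodromicAt D s0) (G : ContourChoice (D s0)) {Γ : ℂ → Mat r} (j : Fin k)

lemma continuousOn_logPath_stokesLine (ν : Fin (2 * n j)) :
    ContinuousOn (G.logPath j (.stokesLine ν)) (Ico 0 1) := by
  have hτ := G.τ_pos j
  have h1 : ContinuousOn (fun t => G.α j ν (G.τ j * (1 - t))) (Ico 0 1) :=
    (G.α_smooth j ν).continuousOn.comp (by fun_prop) fun t ht =>
      ⟨mul_nonneg hτ.le (by linarith [ht.2]), by nlinarith [ht.1]⟩
  have h2 : ContinuousOn (fun t => Real.log (G.τ j * (1 - t))) (Ico 0 1) :=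
    ContinuousOn.log (by fun_prop) fun t ht => (mul_pos hτ (by linarith [ht.2])).ne'
  exact (continuous_ofReal.comp_continuousOn h2).add
    ((continuous_ofReal.comp_continuousOn h1).mul continuousOn_const)

lemma continuousOn_logPathDeriv_stokesLine (ν : Fin (2 * n j)) :
    ContinuousOn (G.logPathDeriv j (.stokesLine ν)) (Ioo 0 1) := by
  have hτ := G.τ_pos j
  have h1 : ContinuousOn (fun t => (G.localData j).lineDeriv (ν : ℕ)
      (Real.log (G.τ j * (1 - t)))) (Ioo 0 1) := fun t ht => by
    have hp : 0 < G.τ j * (1 - t) := mul_pos hτ (by linarith [ht.2])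
    refine ContinuousAt.continuousWithinAt (ContinuousAt.comp
      (f := fun t => Real.log (G.τ j * (1 - t))) (g := (G.localData j).lineDeriv (ν : ℕ))
      ((G.localData j).lineDeriv_continuousAt _ _ (Real.log_lt_log hp (by nlinarith [ht.1]))) ?_)
    exact ContinuousAt.log (by fun_prop) hp.ne'
  have h2 : ContinuousOn (fun t : ℝ => -(1 - t)⁻¹) (Ioo 0 1) :=
    (ContinuousOn.inv₀ (by fun_prop) fun t ht => (sub_pos.2 ht.2).ne').neg
  exact (continuous_ofReal.comp_continuousOn h2).mul (continuousOn_const.add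
    ((continuous_ofReal.comp_continuousOn h1).mul continuousOn_const))

lemma exists_norm_logPathDeriv_le (ν : Fin (2 * n j)) : ∃ B, ∀ t ∈ Ioo (0 : ℝ) 1,
    ‖G.logPathDeriv j (.stokesLine ν) t‖ ≤ B * (1 - t)⁻¹ := by
  have hτ := G.τ_pos j
  obtain ⟨B, hB⟩ := isCompact_Icc.exists_bound_of_continuousOn
    ((G.α_smooth j ν).continuousOn_derivWithin (uniqueDiffOn_Icc hτ) le_rfl)
  refine ⟨1 + B * G.τ j, fun t ht => ?_⟩
  have ht1 : 0 < 1 - t := sub_pos.2 ht.2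
  have hp : G.τ j * (1 - t) ∈ Ioo 0 (G.τ j) := ⟨mul_pos hτ ht1, by nlinarith [ht.1]⟩
  have h1 := hB _ (Ioo_subset_Icc_self hp)
  rw [derivWithin_of_mem_nhds (Icc_mem_nhds hp.1 hp.2)] at h1
  rw [logPathDeriv, (G.line_eq_α j ν (Real.log_lt_log hp.1 hp.2)).2, Real.exp_log hp.1, norm_mul,
    norm_real, norm_neg, Real.norm_of_nonneg (inv_pos.2 ht1).le, mul_comm]
  refine mul_le_mul_of_nonneg_right ((norm_add_le _ _).trans ?_) (inv_pos.2 ht1).le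
  rw [norm_one, norm_mul, norm_I, mul_one, norm_real, norm_mul]
  refine add_le_add_right (mul_le_mul h1 ?_ (norm_nonneg _) ((norm_nonneg _).trans h1)) _
  rw [Real.norm_of_nonneg hp.1.le]
  exact hp.2.le

lemma logPath_stokesLine_eq (ν : Fin (2 * n j)) {x : ℝ} (hx : x < Real.log (G.τ j)) :
    G.logPath j (.stokesLine ν) (1 - Real.exp x / G.τ j) = (G.localData j).linePoint (ν : ℕ) x := by
  have hτ := G.τ_pos j
  rw [logPath, sub_sub_cancel, mul_div_cancel₀ _ hτ.ne', Real.log_exp]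
  apply Complex.ext <;> simp [LocalData.linePoint, (G.line_eq_α j ν hx).1]

variable {Ψ : ℂ → Mat r}
  (hΨ : (G.localData j).IsGlued (fun w => Γ ((D s0).a j + exp w)) Ψ)

include hD hΨ

lemma exists_hasContribution_stokesLine {Y : FormalMat r} (hY : (G.localData j).IsExpansion Ψ Y)
    {P : ℤ → ℂ → ℂ} (hP : ∀ m w, w.re < (G.localData j).xR → HasDerivAt (P m)
      ((G.localData j).density Ψ (laurent timeExponent (timeCoeff D s0 j)) m w) w)
    {w : ℂ} (hw : w = Real.log (G.τ j) + G.θ j * I) (ν : Fin (2 * n j)) :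
    ∃ c, HasContribution D s0 G Γ ⟨j, .stokesLine ν⟩ c ∧
      Tendsto (fun x => P ((ν : ℕ) + 1) w - P (ν : ℕ) w -
        (P ((ν : ℕ) + 1) ((G.localData j).linePoint (ν : ℕ) x) -
          P (ν : ℕ) ((G.localData j).linePoint (ν : ℕ) x))) atBot (𝓝 c) := by
  set L := G.localData j
  have hτ := G.τ_pos j
  set v := G.logPath j (.stokesLine ν) with hv
  set δ : ℂ → ℂ := fun w => L.density Ψ (laurent timeExponent (timeCoeff D s0 j)) ((ν : ℕ) + 1) w -
    L.density Ψ (laurent timeExponent (timeCoeff D s0 j)) (ν : ℕ) w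
  have hlaur := laurent_differentiable (timeExponent (m := n j)) (timeCoeff D s0 j)
  have hδc : ContinuousOn δ {w | w.re < L.xR} :=
    (hΨ.differentiableOn_density hlaur _).continuousOn.sub
      (hΨ.differentiableOn_density hlaur _).continuousOn
  have hre : ∀ t ∈ Ico (0 : ℝ) 1, (v t).re < L.xR := fun t ht => by
    rw [show (v t).re = Real.log (G.τ j * (1 - t)) by simp [hv, logPath]]
    refine lt_of_le_of_lt ?_ (L.xτ_lt_xρ.trans L.xρ_lt_xR)
    exact Real.log_le_log (mul_pos hτ (by linarith [ht.2])) (by nlinarith [ht.1])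
  have hvc := G.continuousOn_logPath_stokesLine j ν
  have hsub : Ioo (0 : ℝ) 1 ⊆ Ico 0 1 := Ioo_subset_Ico_self
  have hδv : ContinuousOn (fun t => δ (v t)) (Ico 0 1) := hδc.comp hvc hre
  have hlim : Tendsto (fun x => 1 - Real.exp x / G.τ j) atBot (𝓝[<] 1) := by
    refine tendsto_nhdsWithin_iff.2 ⟨?_, .of_forall fun x => ?_⟩
    · simpa using (Real.tendsto_exp_atBot.div_const (G.τ j)).const_sub 1
    · exact sub_lt_self _ (div_pos (Real.exp_pos x) hτ)
  obtain ⟨A, hA0, hA⟩ : ∃ A, 0 ≤ A ∧ ∀ t ∈ Ioo (0 : ℝ) 1, ‖δ (v t)‖ ≤ A * (1 - t) := by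
    obtain ⟨C, hC0, hC⟩ := (hY.density_succ_sub_isBigO hΨ timeExponent (timeCoeff D s0 j)
      (ν : ℕ)).exists_nonneg
    obtain ⟨X, hX⟩ := eventually_atBot.1 hC.bound
    set y := min X (Real.log (G.τ j) - 1)
    set t0 := 1 - Real.exp y / G.τ j
    have h1 : t0 < 1 := sub_lt_self _ (div_pos (Real.exp_pos y) hτ)
    obtain ⟨E, hE⟩ := isCompact_Icc.exists_bound_of_continuousOn
      (hδv.mono fun t (ht : t ∈ Icc 0 t0) => ⟨ht.1, ht.2.trans_lt h1⟩)
    refine ⟨max (C * G.τ j) (E / (1 - t0)), (by positivity : 0 ≤ C * G.τ j).trans (le_max_left _ _),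
      fun t ht => ?_⟩
    have h2 : 0 < 1 - t := sub_pos.2 ht.2
    rcases le_total t t0 with h | h
    · have h3 := hE t ⟨ht.1.le, h⟩
      refine h3.trans (le_trans ?_ (mul_le_mul_of_nonneg_right (le_max_right _ _) h2.le))
      rw [div_mul_eq_mul_div, le_div_iff₀ (sub_pos.2 h1)]
      exact mul_le_mul_of_nonneg_left (by linarith) ((norm_nonneg _).trans h3)
    · have hp : 0 < G.τ j * (1 - t) := mul_pos hτ h2
      set x := Real.log (G.τ j * (1 - t)) with hx
      have he : Real.exp x = G.τ j * (1 - t) := Real.exp_log hp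
      have h4 : x ≤ y := by
        rw [hx, Real.log_le_iff_le_exp hp, mul_comm, ← le_div_iff₀ hτ]
        linarith
      have h5 := G.logPath_stokesLine_eq j ν (x := x)
        (by linarith [min_le_right X (Real.log (G.τ j) - 1)])
      rw [he, mul_div_cancel_left₀ _ hτ.ne', sub_sub_cancel] at h5
      have h6 := hX x (h4.trans (min_le_left _ _))
      rw [← h5, Real.norm_eq_abs, Real.abs_exp, he, ← mul_assoc] at h6
      exact h6.trans (mul_le_mul_of_nonneg_right (le_max_left _ _) h2.le)
  obtain ⟨B, hB⟩ := G.exists_norm_logPathDeriv_le j ν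
  have hI := fun t ht => G.hasIntegrands_stokesLine hD j hΨ ν (t := t) ht rfl rfl
  have hder : ∀ w, w.re < L.xR → HasDerivAt (fun w => P ((ν : ℕ) + 1) w - P (ν : ℕ) w) (δ w) w :=
    fun w hw => (hP _ w hw).sub (hP _ w hw)
  obtain ⟨h1, h2⟩ := integrable_and_tendsto_of_primitive (B := A * B)
    (φ := fun t => malgrangeIntegrand G.path (fun s => G.jump (D s)) s0 Γ ⟨j, .stokesLine ν⟩ t)
    (κ := fun t => P ((ν : ℕ) + 1) (v t) - P (ν : ℕ) (v t))
    (((hδv.mono hsub).mul (G.continuousOn_logPathDeriv_stokesLine j ν)).congr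
      fun t ht => (hI t ht).malgrange)
    (fun t ht => by
      have h3 : 0 < 1 - t := sub_pos.2 ht.2
      rw [(hI t ht).malgrange, norm_mul]
      refine (mul_le_mul (hA t ht) (hB t ht) (norm_nonneg _) (by positivity)).trans_eq ?_
      field_simp)
    (ContinuousOn.comp (t := {w : ℂ | w.re < L.xR})
      (fun z hz => (hder z hz).continuousAt.continuousWithinAt) hvc hre)
    (fun t ht => by
      rw [(hI t ht).malgrange]
      exact (hder _ (hre t (hsub ht))).comp_of_eq t (G.hasDerivAt_logPath j _ ht) rfl)
  have hz : ∀ t ∈ Ioo (0 : ℝ) 1, thetaIntegrand G.path (fun s => G.jump (D s)) s0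
      ⟨j, .stokesLine ν⟩ t = 0 := fun t ht => (hI t ht).theta
  have hz1 : IntervalIntegrable (thetaIntegrand G.path (fun s => G.jump (D s)) s0
      ⟨j, .stokesLine ν⟩) volume 0 1 := by
    refine (intervalIntegrable_const (c := (0 : ℂ))).congr_uIoo ?_
    rw [uIoo_of_le zero_le_one]
    exact fun t ht => (hz t ht).symm
  have hz2 : (∫ t in (0 : ℝ)..1, thetaIntegrand G.path (fun s => G.jump (D s)) s0
      ⟨j, .stokesLine ν⟩ t) = 0 := by
    rw [intervalIntegral.integral_of_le zero_le_one, MeasureTheory.integral_Ioc_eq_integral_Ioo,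
      MeasureTheory.setIntegral_congr_fun measurableSet_Ioo hz]
    simp
  refine ⟨_, ⟨fun t ht _ => ⟨(hI t ht).minus, (hI t ht).minus_deriv⟩, h1, hz1, by
    rw [hz2, mul_zero, sub_zero]⟩, ?_⟩
  have hv0 : v 0 = w := by
    have := G.α_end j ν
    simp [hv, logPath, hw, this]
  refine (h2.neg.comp hlim).congr' ?_
  filter_upwards [eventually_lt_atBot (Real.log (G.τ j))] with x hx
  simp only [Function.comp_apply]
  rw [hv, G.logPath_stokesLine_eq j ν hx, ← hv, hv0]
  ring

end ContourChoice


namespace ContourChoice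

variable {k r : ℕ} {n : Fin k → ℕ} {D : ℂ → BirkhoffData k r n} {s0 : ℂ}

/-- The contributions of the arcs around one pole. -/
theorem exists_hasContribution (hD : IsIsomonodromicAt D s0) (G : ContourChoice (D s0))
    {Γ : ℂ → Mat r} (j : Fin k) {Ψ : ℂ → Mat r}
    (hΨ : (G.localData j).IsGlued (fun w => Γ ((D s0).a j + exp w)) Ψ) {Y : FormalMat r}
    (hY : (G.localData j).IsExpansion Ψ Y) :
    ∃ v : LocalArc (n j) → ℂ, (∀ c, HasContribution D s0 G Γ ⟨j, c⟩ (v c)) ∧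
      ∑ c, v c = 2 * π * I * LocalData.constantTerm timeExponent (timeCoeff D s0 j)
        (Y.adjugate * formalEuler Y) := by
  set L := G.localData j with hLd
  obtain ⟨P, hP⟩ := hΨ.exists_primitive_density
    (laurent_differentiable (timeExponent (m := n j)) (timeCoeff D s0 j))
  obtain ⟨H', hH'⟩ := hΨ.exists_primitive_density (differentiable_level (D := D) (s0 := s0) j)
  obtain ⟨F', hF'⟩ := hΨ.exists_primitive_density (differentiable_toral (D := D) (s0 := s0) j)
  set H := H' L.N
  set F := F' L.N
  have hH : ∀ w, w.re < L.xR → HasDerivAt H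
      (LocalData.logDeriv Ψ w * Matrix.diagonal (levelVariation D s0 j w)).trace w := fun w hw => by
    rw [← LocalData.IsGlued.density_N (L := L)]; exact hH' _ w hw
  have hF : ∀ w, w.re < L.xR → HasDerivAt F
      (LocalData.logDeriv Ψ w * Matrix.diagonal (toralVariation D s0 j w)).trace w := fun w hw => by
    rw [← LocalData.IsGlued.density_N (L := L)]; exact hF' _ w hw
  obtain ⟨w, hw⟩ : ∃ w : ℂ, w = Real.log (G.τ j) + G.θ j * I := ⟨_, rfl⟩
  obtain ⟨v, hv⟩ : ∃ v : ℂ, v = Real.log (G.ρ j) + G.θ j * I := ⟨_, rfl⟩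
  have hwre : w.re < L.xR := by
    rw [show w.re = L.xτ by simp [hw, hLd, localData]]
    exact L.xτ_lt_xρ.trans L.xρ_lt_xR
  have hvre : v.re < L.xR := by
    rw [show v.re = L.xρ by simp [hv, hLd, localData]]
    exact L.xρ_lt_xR
  choose c hc hlim using G.exists_hasContribution_stokesLine hD j hΨ hY hP hw
  have hS := fun s (h : (D s).S = (D s0).S) => show (D s).stokesProduct j = (D s0).stokesProduct j by
    rw [BirkhoffData.stokesProduct, BirkhoffData.stokesProduct, h]
  refine ⟨fun
    | .outerStem => 0
    | .innerStem => 0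
    | .connectionCircle => 0
    | .formalCircle => H (v + 2 * π * I) - H v
    | .neck _ => (H (w + 2 * π * I) - H w) - (H (v + 2 * π * I) - H v)
    | .toralCircle _ => F (w + 2 * π * I) - F w
    | .stokesLine ν => c ν, fun a => ?_, ?_⟩
  · cases a with
    | outerStem =>
      refine G.hasContribution_of_eventuallyEq fun t z => ?_
      filter_upwards [hD.L_frozen, hD.C_frozen, hD.S_frozen] with s h1 h2 h3
      rw [jump, jump, BirkhoffData.localMonodromy, BirkhoffData.localMonodromy, hS s h3, h1, h2]
    | innerStem =>
      refine G.hasContribution_of_eventuallyEq fun t z => ?_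
      filter_upwards [hD.L_frozen, hD.S_frozen] with s h1 h3
      rw [jump, jump, BirkhoffData.localMonodromy, BirkhoffData.localMonodromy, hS s h3, h1]
    | connectionCircle =>
      refine G.hasContribution_of_eventuallyEq fun t z => ?_
      filter_upwards [hD.C_frozen] with s h2
      rw [jump, jump, h2]
    | formalCircle => exact G.hasContribution_formalCircle hD j hΨ hH hv
    | neck hn => exact G.hasContribution_neck hD j hΨ hn hH hw hv
    | toralCircle hn => exact G.hasContribution_toralCircle hD j hΨ hn hF hw
    | stokesLine ν => exact hc ν
  rw [sum_localArc]
  simp only [zero_add]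
  rcases Nat.eq_zero_or_pos (n j) with hn | hn
  · have hN : L.N = 1 := by
      change sectorCount (n j) = 1
      rw [sectorCount, if_pos hn]
    have hR0 : L.R 0 = 1 := by
      change sectorMatrix (D s0) j 0 = 1
      rw [sectorMatrix_zero, stokesProduct_of_simple_pole j hn]
    have hR1 : L.R 1 = 1 := by
      have := L.R_period
      rwa [hN, Nat.cast_one] at this
    have h := hΨ.sum_contributions hY one_le_timeExponent (timeCoeff D s0 j) hP
      (laurent_time D s0 j) hH hF hwre (c := fun _ => 0) fun m hm => by
        obtain rfl : m = 0 := by omega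
        refine tendsto_const_nhds.congr' ?_
        filter_upwards [eventually_lt_atBot L.xR] with x hx
        have hP0 := hP 0
        simp only [LocalData.density, hR0] at hP0
        have hP1 := hP 1
        simp only [LocalData.density, hR1] at hP1
        have := sub_eq_sub_of_hasDerivAt hP1 hP0 hwre (w' := L.linePoint 0 x) hx
        simp only [Nat.cast_zero, zero_add]
        linear_combination -this
    have hneck := sub_eq_sub_of_hasDerivAt (f := fun w => H (w + 2 * π * I) - H w)
      (g := fun _ => 0) (f' := fun _ => 0) (c := L.xR)
      (fun w hw => (LocalData.IsGlued.hasDerivAt_neck hΨ (level_add j) hH hw).congr_deriv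
        (by simp [hR0])) (fun w _ => hasDerivAt_const w _) hvre hwre
    have hFp : F (w + 2 * π * I) = F w := by
      have : IsEmpty (Fin (n j)) := by rw [hn]; infer_instance
      have := sub_eq_sub_of_hasDerivAt (f := F) (g := fun _ => 0) (f' := fun _ => 0) (c := L.xR)
        (fun w hw => (hF w hw).congr_deriv (by
          rw [show toralVariation D s0 j w = 0 by funext p; simp [toralVariation]]
          simp)) (fun w _ => hasDerivAt_const w _) (w := w + 2 * π * I) (w' := w)
        (by simpa using hwre) hwre
      simpa [sub_eq_zero] using this
    have : IsEmpty (PLift (0 < n j)) := ⟨fun h => by have := h.down; omega⟩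
    have : IsEmpty (Fin (2 * n j)) := by rw [hn, mul_zero]; infer_instance
    rw [← h, Fintype.sum_empty, Fintype.sum_empty, hFp]
    simp only [Finset.sum_const_zero]
    linear_combination hneck
  · have hN : L.N = 2 * n j := by
      change sectorCount (n j) = _
      rw [sectorCount, if_neg hn.ne']
    have h := hΨ.sum_contributions hY one_le_timeExponent (timeCoeff D s0 j) hP
      (laurent_time D s0 j) hH hF hwre (c := fun m => if hm : m < 2 * n j then c ⟨m, hm⟩ else 0)
      fun m hm => by
        rw [hN] at hm
        rw [dif_pos hm]
        exact hlim ⟨m, hm⟩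
    rw [← h, Fintype.sum_subsingleton _ (PLift.up hn), hN, Finset.sum_range]
    simp only [Fin.is_lt, dite_true, Fin.eta]
    ring

end ContourChoice

/-- The formal residue at a pole as a constant term. -/
lemma jmuResidue_eq_constantTerm {k r : ℕ} {n : Fin k → ℕ} (D : ℂ → BirkhoffData k r n) (s0 : ℂ)
    (j : Fin k) {Y : FormalMat r} (hY : Y.det = 1) : jmuResidue D s0 j Y =
      LocalData.constantTerm timeExponent (timeCoeff D s0 j) (Y.adjugate * formalEuler Y) := by
  rw [← coeff_trace_mul_diagonal one_le_timeExponent (timeCoeff D s0 j) hY, jmuResidue]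
  simp only [← thatVariation_eq]

end

theorem proposition4p1 {k r : ℕ} {n : Fin k → ℕ}
    (D : ℂ → BirkhoffData k r n) (s₀ : ℂ) (hD : IsIsomonodromicAt D s₀)
    (G : ContourChoice (D s₀)) (Γ : ℂ → Mat r)
    (hΓ : IsRHSolution G.path (G.jump (D s₀)) Γ) :
    MalgrangeConverges G.path (fun s => G.jump (D s)) s₀ Γ ∧
    (∃ Y : Fin k → FormalMat r, ∀ j,
      HasExpansion Γ ((D s₀).a j) (contourSupport G.path)ᶜ (Y j) ∧
      (D s₀).IsFormalSolution ((D s₀).connectionNear Γ j) (contourSupport G.path)ᶜ j (Y j)) ∧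
    ∀ Y : Fin k → FormalMat r,
      (∀ j, (D s₀).IsFormalSolution ((D s₀).connectionNear Γ j) (contourSupport G.path)ᶜ j (Y j)) →
      modifiedMalgrangeForm G.path (fun s => G.jump (D s)) s₀ Γ = jmuForm D s₀ Y := by
  choose Ψ hΨ using fun j => (hΓ.isJumpSolution j).exists_isGlued
  choose Y₀ hY₀ using fun j => (hΨ j).exists_isExpansion (hΓ.isJumpSolution j)
  choose v hv hsum using fun j => G.exists_hasContribution hD j (hΨ j) (hY₀ j)
  refine ⟨⟨fun i => (hv i.1 i.2).minus, fun i => ⟨(hv i.1 i.2).malgrange, (hv i.1 i.2).theta⟩⟩,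
    ⟨Y₀, fun j => ⟨hΓ.hasExpansion j (hΨ j) (hY₀ j), hΓ.isFormalSolution j (hΨ j) (hY₀ j)⟩⟩,
    fun Y hY => ?_⟩
  have hres : ∀ j, 2 * Real.pi * I * jmuResidue D s₀ j (Y j) = ∑ c, v j c := fun j => by
    rw [jmuResidue_eq_of_isFormalSolution D s₀ j (IsRHSolution.neBot_nhdsWithin_compl G j)
      (hΓ.isFormalSolution j (hΨ j) (hY₀ j)) (hY j),
      jmuResidue_eq_constantTerm D s₀ j ((hY₀ j).det_eq_one (hΨ j)), hsum]
  refine mul_left_cancel₀ two_pi_I_ne_zero ?_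
  rw [jmuForm, Finset.mul_sum, Finset.sum_congr rfl fun j _ => hres j,
    ← Fintype.sum_sigma (f := fun i : ContourArc n => v i.1 i.2),
    ← Finset.sum_congr rfl fun (i : ContourArc n) _ => (hv i.1 i.2).value, modifiedMalgrangeForm,
    malgrangeForm, thetaForm, ← Finset.sum_div, ← Finset.sum_div, Finset.sum_sub_distrib,
    Finset.sum_neg_distrib, ← Finset.mul_sum]
  have := two_pi_I_ne_zero
  field_simp
  ring
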